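/- **Setting.** Let $\nu\ge 1$, $\mathtt m\ge 0$, $\rho>0$, and write $\mathbb N=\{1,2,\dots\}$, $\langle x\rangle=(1+|x|^2)^{1/2}$, with Euclidean norms on $\mathbb R^\nu$ and $\mathbb Z^\nu$. Let $V(\theta,x)$ be real, smooth, $2\pi$-periodic in each $\theta_i$ and in $x$, and even in $x$, with an extension to $\{|\mathrm{Im}\,\theta|<\rho\}$ which is analytic in $\theta$, smooth in $x$, and has $\partial_x^\ell V$ bounded for every $\ell\ge0$; assume $\int_{\mathbb T^\nu}V(\theta,x)\,d\theta=0$ for $x\in[0,\pi]$. Operators act on sine series $\sum_{m\ge1}\varphi_m\sin(mx)$ and are identified with their matrices on the basis $\sin(mx)$; $\overline A$ is the operator whose matrix is the entrywise conjugate; $\mathcal H^r$ is normed by $\|\varphi\|_{\mathcal H^r}^2=\sum_m\langle m\rangle^{2r}|\varphi_m|^2$ and $\|(\varphi,\varphi')\|^2_{\mathcal H^r\times\mathcal H^r}=\|\varphi\|_{\mathcal H^r}^2+\|\varphi'\|_{\mathcal H^r}^2$. Let $B=\sqrt{-\Delta+\mathtt m^2}=\mathrm{diag}(\lambda_j)$,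 $\lambda_j=\sqrt{j^2+\mathtt m^2}$, $\sigma_3=\mathrm{diag}(1,-1)$, and, for $M>0$, $R_M=\{M\le|\omega|\le 2M\}\subset\mathbb R^\nu$, $m_r(A)=|A|/|R_M|$, $$\Omega_0=\Big\{\omega\in R_M:\ |\omega\cdot k|\ge \tfrac{\gamma_0}{\langle k\rangle^{\tau_0}}M\ \ \forall k\in\mathbb Z^\nu\setminus\{0\}\Big\}.$$ For $\omega\in\Omega_0$ let $X(\theta;\omega)=\sum_{k\ne0}\frac{1}{2\mathrm i\,\omega\cdot k}B^{-1/2}\widehat V(k)B^{-1/2}e^{\mathrm ik\cdot\theta}$, and consider the post-Magnus system $$\mathrm i\dot\psi=\big(B\sigma_3+\mathbf V(\omega t;\omega)\big)\psi,\quad \mathbf V=\begin{pmatrix}V^d&V^o\\-\overline{V^o}&-\overline{V^d}\end{pmatrix},\quad V^d=\mathrm i[X,B]+2XBX,\quad V^o=-\mathrm i(XB+BX)+2XBX. \tag{1}$$ For operators $A(\theta)$ put $|A|_{\rho,s}=\sum_{k\in\mathbb Z^\nu}e^{\rho|k|}\big(\sum_{h\ge0}\langle h\rangle^{2s}\sup_{|m-n|=h}|\widehat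 A_{mn}(k)|^2\big)^{1/2}$, and for $\alpha>0$ $$|\mathbf A|^{\alpha,0}_{\rho,s}=|\langle D\rangle^\alpha A^d|_{\rho,s}+|A^d\langle D\rangle^\alpha|_{\rho,s}+\sum_{\sigma\in\{0,\pm\alpha\}}\sum_{\delta\in\{d,o\}}|\langle D\rangle^\sigma A^\delta\langle D\rangle^{-\sigma}|_{\rho,s},$$ where $\langle D\rangle\sin(mx)=\langle m\rangle\sin(mx)$ and $A^d,A^o$ are the first-row blocks of $\mathbf A$. For $\gamma>0$ let $$\eta_0=\frac{M^\alpha}{\gamma}\Big(\sup_{\omega\in\Omega_0}|\mathbf V(\omega)|^{\alpha,0}_{\rho/4,s_0}+\frac{\gamma}{M^\alpha}\sup_{\omega_1\ne\omega_2\in\Omega_0}\frac{|\mathbf V(\omega_1)-\mathbf V(\omega_2)|^{\alpha,0}_{\rho/4,s_0}}{|\omega_1-\omega_2|}\Big),\qquad \Sigma=\sum_{q\ge0}e^{-\frac12(3/2)^q}.$$ Let $\mathcal I^+=\mathbb Z^\nu\times\mathbb N\times\mathbb N$ and $\mathcal I^-=\mathcal I^+\setminus\{(0,a,a):a\in\mathbb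 N\}$, let $$\mathcal U_\alpha=\Big\{\omega\in\Omega_0:\ |\omega\cdot k+\lambda_j\pm\lambda_l|\ge\frac{\widetilde\gamma}{\langle k\rangle^{\widetilde\tau}}\frac{\langle j\pm l\rangle^\alpha}{M^\alpha}\ \ \forall(k,j,l)\in\mathcal I^\pm\Big\},$$ and, for functions $\lambda_j^\infty$ on $R_M$, $$\Omega_{\infty,\alpha}=\Big\{\omega\in\mathcal U_\alpha:\ |\omega\cdot k+\lambda_j^\infty(\omega)\pm\lambda_l^\infty(\omega)|\ge\frac{\gamma}{\langle k\rangle^{\tau}}\frac{\langle j\pm l\rangle^\alpha}{M^\alpha}\ \ \forall(k,j,l)\in\mathcal I^\pm\Big\}.$$ **Theorem (KAM reducibility).** Fix $V,\mathtt m,\rho$ as above, $\alpha\in(0,1)$, $s_0>1/2$, $\tau_0>\nu-1$, $\widetilde\tau\ge2\nu+3$ and $\tau>\nu+1+\alpha+\widetilde\tau/\alpha$. There is $C>0$ such that for every $\gamma>0$ there are $M_*>0$ and $K>0$ such that, for all $\gamma_0\in(0,1)$ and $\widetilde\gamma$ with $\gamma<\widetilde\gamma\le\min\{\gamma_0^{3/2},1/8\}$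 and all $M\ge M_*$, one has $\eta_0\le K M^{-(1-\alpha)}$ and there are real functions $(\lambda_j^\infty)_{j\in\mathbb N}$, defined and Lipschitz on $R_M$, such that: 1. $m_r(R_M\setminus\Omega_{\infty,\alpha})\le C(\gamma+\widetilde\gamma^{1/3}+\gamma_0)$. 2. For each $\omega\in\Omega_{\infty,\alpha}$ there are operators $\mathcal W^\infty(\theta;\omega)$, $\theta\in\mathbb T^\nu$, which for every $r\in[0,s_0]$ are bounded with bounded inverse on $\mathcal H^r\times\mathcal H^r$ and depend continuously on $\theta$ in $\mathcal L(\mathcal H^r\times\mathcal H^r)$, such that $\psi(t)=\mathcal W^\infty(\omega t;\omega)\phi(t)$ conjugates (1) to $$\mathrm i\dot\phi=\mathrm{diag}\{\lambda_j^\infty(\omega):j\in\mathbb N\}\,\sigma_3\,\phi,$$ that is, $\phi$ solves this system if and only if $\psi$ solves (1), where solutions are curves continuous in $\mathcal H^0\times\mathcal H^0$ satisfying the equation tested against each $\sin(mx)$. Moreover, for every $r\in[0,s_0]$ and $\theta\in\mathbb T^\nu$, $$\|\mathcal W^\infty(\theta;\omega)-\mathbf 1\|_{\mathcal L(\mathcal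 H^r\times\mathcal H^r)}\le\sqrt{\eta_0e}\,\Sigma\;e^{\sqrt{\eta_0e}\,\Sigma}.$$ -/

import Mathlib

open scoped ENNReal Topology

noncomputable section

namespace FastKG

/-! Conventions. `ℕ+` indexes the sine basis `sin (m x)`, `m ≥ 1`.  An operator is represented by its
matrix on that basis (row `m`, column `n`: the coefficient of `sin (m x)` in the image of
`sin (n x)`). Angles are `θ : Fin ν → ℝ` and everything depending on them is `2π`-periodic. -/

/-- Frequency space `ℝ^ν` with the Euclidean norm. -/
abbrev Freq (ν : ℕ) : Type := EuclideanSpace ℝ (Fin ν)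

/-- An infinite matrix on the sine basis. -/
abbrev SMat : Type := Matrix ℕ+ ℕ+ ℂ

/-- The bracket `⟨x⟩ = (1 + x²)^{1/2}`. -/
def bracket (x : ℝ) : ℝ := Real.sqrt (1 + x ^ 2)

/-- Euclidean length of `k ∈ ℤ^ν`. -/
def absK {ν : ℕ} (k : Fin ν → ℤ) : ℝ := Real.sqrt (∑ i, (k i : ℝ) ^ 2)

/-- `k · a` for `k ∈ ℤ^ν`, `a ∈ ℝ^ν`. -/
def dotK {ν : ℕ} (k : Fin ν → ℤ) (a : Fin ν → ℝ) : ℝ := ∑ i, (k i : ℝ) * a i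

/-- Entrywise complex conjugate: the matrix of the conjugate operator. -/
def conjMat (A : SMat) : SMat := A.map (starRingEnd ℂ)

/-! ### The driving potential -/

/-- The open complex strip `|Im z| < ρ` (Euclidean length of the imaginary part). -/
def strip (ν : ℕ) (ρ : ℝ) : Set (Fin ν → ℂ) := {z | Real.sqrt (∑ i, (z i).im ^ 2) < ρ}

/-- The potential, identified with its even `2π`-periodic extension in `x`: it is real valued, smooth
in both variables, analytic in the angles in a strip of width `ρ` with every `x`-derivative bounded
there, and has zero mean in the angles. -/
structure IsDriving {ν : ℕ} (ρ : ℝ) (V : (Fin ν → ℝ) → ℝ → ℝ) : Prop where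
  periodic_angle : ∀ (θ : Fin ν → ℝ) (x : ℝ) (k : Fin ν → ℤ),
    V (fun i => θ i + 2 * Real.pi * k i) x = V θ x
  periodic_x : ∀ (θ : Fin ν → ℝ) (x : ℝ), V θ (x + 2 * Real.pi) = V θ x
  even_x : ∀ (θ : Fin ν → ℝ) (x : ℝ), V θ (-x) = V θ x
  smooth : ContDiff ℝ (⊤ : ℕ∞) (fun p : (Fin ν → ℝ) × ℝ => V p.1 p.2)
  analytic : ∃ Vc : (Fin ν → ℂ) → ℝ → ℂ,
    (∀ (θ : Fin ν → ℝ) (x : ℝ), Vc (fun i => (θ i : ℂ)) x = (V θ x : ℂ)) ∧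
    (∀ x : ℝ, DifferentiableOn ℂ (fun z => Vc z x) (strip ν ρ)) ∧
    (∀ z ∈ strip ν ρ, ContDiff ℝ (⊤ : ℕ∞) (Vc z)) ∧
    (∀ l : ℕ, ∃ C : ℝ, ∀ z ∈ strip ν ρ, ∀ x : ℝ, ‖iteratedDeriv l (Vc z) x‖ ≤ C)
  zero_mean : ∀ x ∈ Set.Icc 0 Real.pi,
    ∫ θ in Set.Icc (0 : Fin ν → ℝ) (fun _ => 2 * Real.pi), V θ x = 0

/-- `k`-th Fourier coefficient of a function of the angles. -/
def fourierK {ν : ℕ} (f : (Fin ν → ℝ) → ℂ) (k : Fin ν → ℤ) : ℂ :=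
  ((1 / (2 * Real.pi) ^ ν : ℝ) : ℂ) *
    ∫ θ in Set.Icc (0 : Fin ν → ℝ) (fun _ => 2 * Real.pi),
      f θ * Complex.exp (-Complex.I * (dotK k θ : ℂ))

/-- Matrix of multiplication by `V(θ, ·)` on the sine basis. -/
def potMat {ν : ℕ} (V : (Fin ν → ℝ) → ℝ → ℝ) (θ : Fin ν → ℝ) : SMat := fun m n =>
  ((2 / Real.pi * ∫ x in (0 : ℝ)..Real.pi, V θ x * Real.sin (m * x) * Real.sin (n * x) : ℝ) : ℂ)

/-- Eigenvalues `λ_j = (j² + mass²)^{1/2}` of `B = (-Δ + mass²)^{1/2}` on the sine basis. -/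
def freq0 (mass : ℝ) (j : ℕ+) : ℝ := Real.sqrt ((j : ℝ) ^ 2 + mass ^ 2)

/-! ### The Magnus normal form -/

/-- Fourier coefficients of the Magnus generator:
`X̂(k) = (2 i ω·k)⁻¹ B^{-1/2} V̂(k) B^{-1/2}` for `k ≠ 0`, and `X̂(0) = 0`. -/
def magnusCoeff {ν : ℕ} (mass : ℝ) (V : (Fin ν → ℝ) → ℝ → ℝ) (ω : Freq ν) (k : Fin ν → ℤ) :
    SMat := fun m n =>
  if k = 0 then 0 else
    (1 / (2 * Complex.I * (dotK k ω : ℂ))) *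
      (((freq0 mass m) ^ (-(1 / 2) : ℝ) : ℝ) : ℂ) *
      fourierK (fun θ => potMat V θ m n) k *
      (((freq0 mass n) ^ (-(1 / 2) : ℝ) : ℝ) : ℂ)

/-- The Magnus generator `X(θ; ω) = ∑_k X̂(k) e^{i k·θ}`. -/
def magnusX {ν : ℕ} (mass : ℝ) (V : (Fin ν → ℝ) → ℝ → ℝ) (ω : Freq ν) (θ : Fin ν → ℝ) : SMat :=
  fun m n => ∑' k : Fin ν → ℤ,
    magnusCoeff mass V ω k m n * Complex.exp (Complex.I * (dotK k θ : ℂ))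

/-- The matrix of `X B X`. -/
def magnusXBX {ν : ℕ} (mass : ℝ) (V : (Fin ν → ℝ) → ℝ → ℝ) (ω : Freq ν) (θ : Fin ν → ℝ) : SMat :=
  fun m n => ∑' p : ℕ+,
    magnusX mass V ω θ m p * (freq0 mass p : ℂ) * magnusX mass V ω θ p n

/-- Diagonal block `V^d = i [X, B] + 2 X B X` of the perturbation after the Magnus transform. -/
def magnusVd {ν : ℕ} (mass : ℝ) (V : (Fin ν → ℝ) → ℝ → ℝ) (ω : Freq ν) (θ : Fin ν → ℝ) : SMat :=
  fun m n => Complex.I * (magnusX mass V ω θ m n * (freq0 mass n : ℂ)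
      - (freq0 mass m : ℂ) * magnusX mass V ω θ m n) + 2 * magnusXBX mass V ω θ m n

/-- Off-diagonal block `V^o = -i (X B + B X) + 2 X B X`. -/
def magnusVo {ν : ℕ} (mass : ℝ) (V : (Fin ν → ℝ) → ℝ → ℝ) (ω : Freq ν) (θ : Fin ν → ℝ) : SMat :=
  fun m n => -Complex.I * (magnusX mass V ω θ m n * (freq0 mass n : ℂ)
      + (freq0 mass m : ℂ) * magnusX mass V ω θ m n) + 2 * magnusXBX mass V ω θ m n

/-- `diag(a) σ₃`. -/
def diagSigma3 (a : ℕ+ → ℝ) : Matrix (ℕ+ ⊕ ℕ+) (ℕ+ ⊕ ℕ+) ℂ :=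
  Matrix.fromBlocks (Matrix.diagonal fun j => (a j : ℂ)) 0 0
    (-(Matrix.diagonal fun j => (a j : ℂ)))

/-- The Hamiltonian `B σ₃ + 𝐕(θ; ω)` after the Magnus transform, with
`𝐕 = (V^d, V^o; -conj V^o, -conj V^d)`. -/
def magnusHam {ν : ℕ} (mass : ℝ) (V : (Fin ν → ℝ) → ℝ → ℝ) (ω : Freq ν) (θ : Fin ν → ℝ) :
    Matrix (ℕ+ ⊕ ℕ+) (ℕ+ ⊕ ℕ+) ℂ :=
  diagSigma3 (freq0 mass) +
    Matrix.fromBlocks (magnusVd mass V ω θ) (magnusVo mass V ω θ)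
      (-conjMat (magnusVo mass V ω θ)) (-conjMat (magnusVd mass V ω θ))

/-! ### Norms of operators -/

/-- The `s`-decay norm `(∑_{h ≥ 0} ⟨h⟩^{2s} sup_{|m-n|=h} |A_{mn}|²)^{1/2}`. -/
def decayNorm (s : ℝ) (A : SMat) : ℝ≥0∞ :=
  (∑' h : ℕ, ENNReal.ofReal (bracket h ^ (2 * s)) *
    ⨆ (m : ℕ+) (n : ℕ+) (_ : ((m : ℤ) - (n : ℤ)).natAbs = h), ‖A m n‖ₑ ^ 2) ^ (1 / 2 : ℝ)

/-- `|A|_{ρ,s} = ∑_k e^{ρ|k|} |Â(k)|_s` for an operator depending on the angles. -/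
def analyticNorm {ν : ℕ} (ρ s : ℝ) (A : (Fin ν → ℝ) → SMat) : ℝ≥0∞ :=
  ∑' k : Fin ν → ℤ, ENNReal.ofReal (Real.exp (ρ * absK k)) *
    decayNorm s (fun m n => fourierK (fun θ => A θ m n) k)

/-- The matrix of `⟨D⟩^a A ⟨D⟩^b`. -/
def weightMat (a b : ℝ) (A : SMat) : SMat := fun m n =>
  ((bracket m ^ a : ℝ) : ℂ) * A m n * ((bracket n ^ b : ℝ) : ℂ)

/-- `|A|_{ρ,s}^{α,0}`, for `α > 0`, of the operator matrix `(A^d, A^o; -conj A^o, -conj A^d)`.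
The terms `⟨D⟩^0 A^o`, `A^o ⟨D⟩^0` and `⟨D⟩^0 A^o ⟨D⟩^0` coincide and are counted once. -/
def blockNorm {ν : ℕ} (ρ s α : ℝ) (Ad Ao : (Fin ν → ℝ) → SMat) : ℝ≥0∞ :=
  analyticNorm ρ s (fun θ => weightMat α 0 (Ad θ)) +
  analyticNorm ρ s (fun θ => weightMat 0 α (Ad θ)) +
  (analyticNorm ρ s Ad + analyticNorm ρ s (fun θ => weightMat α (-α) (Ad θ)) +
    analyticNorm ρ s (fun θ => weightMat (-α) α (Ad θ))) +
  (analyticNorm ρ s Ao + analyticNorm ρ s (fun θ => weightMat α (-α) (Ao θ)) +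
    analyticNorm ρ s (fun θ => weightMat (-α) α (Ao θ)))

/-- The Lipschitz norm with weight `w` on `Ω` associated with `|·|_{ρ,s}^{α,0}`. -/
def lipBlockNorm {ν : ℕ} (ρ s α w : ℝ) (Ω : Set (Freq ν))
    (Ad Ao : Freq ν → (Fin ν → ℝ) → SMat) : ℝ≥0∞ :=
  (⨆ ω ∈ Ω, blockNorm ρ s α (Ad ω) (Ao ω)) +
  ENNReal.ofReal w * ⨆ (ω₁ ∈ Ω) (ω₂ ∈ Ω) (_ : ω₁ ≠ ω₂),
    blockNorm ρ s α (Ad ω₁ - Ad ω₂) (Ao ω₁ - Ao ω₂) / ENNReal.ofReal ‖ω₁ - ω₂‖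

/-! ### Sets of frequencies -/

/-- The annulus `R_M`: the closed ball of radius `2M` minus the open ball of radius `M`. -/
def annulus (ν : ℕ) (M : ℝ) : Set (Freq ν) :=
  Metric.closedBall 0 (2 * M) \ Metric.ball 0 M

/-- Measure relative to `R_M`. -/
def relMeas {ν : ℕ} (M : ℝ) (A : Set (Freq ν)) : ℝ≥0∞ :=
  MeasureTheory.volume A / MeasureTheory.volume (annulus ν M)

/-- Diophantine frequencies `Ω₀`. -/
def Omega0 (ν : ℕ) (γ₀ τ₀ M : ℝ) : Set (Freq ν) :=
  {ω ∈ annulus ν M | ∀ k : Fin ν → ℤ, k ≠ 0 →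
    γ₀ / bracket (absK k) ^ τ₀ * M ≤ |dotK k ω|}

/-- Balanced second order Melnikov conditions at `ω` for a list of eigenvalues `a`:
`|ω·k + a_j ± a_l| ≥ g ⟨k⟩^{-t} ⟨j ± l⟩^α M^{-α}`, for all `k, j, l` in the case `+`,
and for all `(k, j, l)` not of the form `(0, j, j)` in the case `-`. -/
def Melnikov {ν : ℕ} (g t α M : ℝ) (a : ℕ+ → ℝ) (ω : Freq ν) : Prop :=
  (∀ (k : Fin ν → ℤ) (j l : ℕ+),
    g / bracket (absK k) ^ t * (bracket ((j : ℝ) + (l : ℝ)) ^ α / M ^ α)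
      ≤ |dotK k ω + a j + a l|) ∧
  (∀ (k : Fin ν → ℤ) (j l : ℕ+), ¬ (k = 0 ∧ j = l) →
    g / bracket (absK k) ^ t * (bracket ((j : ℝ) - (l : ℝ)) ^ α / M ^ α)
      ≤ |dotK k ω + a j - a l|)

/-- The set `U_α`: frequencies in `Ω₀` for which the unperturbed eigenvalues satisfy the Melnikov
conditions with constants `γt, τt`. -/
def UAlpha (ν : ℕ) (mass γ₀ τ₀ γt τt α M : ℝ) : Set (Freq ν) :=
  {ω ∈ Omega0 ν γ₀ τ₀ M | Melnikov γt τt α M (freq0 mass) ω}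

/-- The set `Ω_{∞,α}`: frequencies in `U_α` for which the final eigenvalues `lam j ω` satisfy the
Melnikov conditions with constants `γ, τ`. -/
def OmegaInf (ν : ℕ) (mass γ₀ τ₀ γt τt γ τ α M : ℝ) (lam : ℕ+ → Freq ν → ℝ) : Set (Freq ν) :=
  {ω ∈ UAlpha ν mass γ₀ τ₀ γt τt α M | Melnikov γ τ α M (fun j => lam j ω) ω}

/-- `η₀ = (M^α / γ) |𝐕|`, where `𝐕` is the perturbation after the Magnus transform and the norm is
the Lipschitz norm on `Ω₀` of weight `γ / M^α`, with parameters `ρ/4, s₀, α, 0`. -/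
def eta0 {ν : ℕ} (mass ρ : ℝ) (V : (Fin ν → ℝ) → ℝ → ℝ) (α s₀ γ₀ τ₀ γ M : ℝ) : ℝ≥0∞ :=
  ENNReal.ofReal (M ^ α / γ) *
    lipBlockNorm (ρ / 4) s₀ α (γ / M ^ α) (Omega0 ν γ₀ τ₀ M) (magnusVd mass V) (magnusVo mass V)

/-- `Σ = ∑_{q ≥ 0} exp(-(1/2) (3/2)^q)`. -/
def SigmaConst : ℝ := ∑' q : ℕ, Real.exp (-(1 / 2) * (3 / 2) ^ q)

/-! ### Phase space, solutions, changes of coordinates -/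

/-- The phase space `H⁰ × H⁰`: pairs of square summable sequences of sine coefficients. -/
abbrev State : Type := lp (fun _ : ℕ+ ⊕ ℕ+ => ℂ) 2

/-- The mode `m` of an index of the pair. -/
def mode : ℕ+ ⊕ ℕ+ → ℝ := Sum.elim (fun m => (m : ℝ)) (fun m => (m : ℝ))

/-- Membership in `H^r × H^r`. -/
def MemH (r : ℝ) (φ : State) : Prop := Summable fun i => bracket (mode i) ^ (2 * r) * ‖φ i‖ ^ 2

/-- The norm of `H^r × H^r`. -/
def normH (r : ℝ) (φ : State) : ℝ := Real.sqrt (∑' i, bracket (mode i) ^ (2 * r) * ‖φ i‖ ^ 2)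

/-- For `b ≥ 0`: `T` restricts to an element of `L(H^r × H^r)` of operator norm at most `b`. -/
def OpBound (r : ℝ) (T : State →L[ℂ] State) (b : ℝ) : Prop :=
  ∀ φ : State, MemH r φ → MemH r (T φ) ∧ normH r (T φ) ≤ b * normH r φ

/-- `ψ` is a solution of `i ψ' = H(t) ψ`: it is continuous with values in the phase space and the
equation holds when tested against each element of the sine basis (the weak form of the equation;
it makes sense although `H(t)` is unbounded). -/
def IsSolution (H : ℝ → Matrix (ℕ+ ⊕ ℕ+) (ℕ+ ⊕ ℕ+) ℂ) (ψ : ℝ → State) : Prop :=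
  Continuous ψ ∧ ∀ (t : ℝ) (i : ℕ+ ⊕ ℕ+),
    (Summable fun j => H t i j * ψ t j) ∧
    HasDerivAt (fun u => ψ u i) (-Complex.I * ∑' j, H t i j * ψ t j) t

/-- A quasi-periodic change of coordinates on `H^r × H^r` for all `r ∈ [0, s₀]`: `W(θ)` is
`2π`-periodic in each angle, boundedly invertible on each of these spaces, and depends continuously
on `θ` in each operator norm. -/
structure IsCoordChange {ν : ℕ} (s₀ : ℝ) (W : (Fin ν → ℝ) → State ≃L[ℂ] State) : Prop where
  periodic : ∀ (θ : Fin ν → ℝ) (k : Fin ν → ℤ), W (fun i => θ i + 2 * Real.pi * k i) = W θ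
  bounded : ∀ r ∈ Set.Icc 0 s₀, ∀ θ, ∃ b : ℝ,
    OpBound r (W θ : State →L[ℂ] State) b ∧ OpBound r ((W θ).symm : State →L[ℂ] State) b
  continuous : ∀ r ∈ Set.Icc 0 s₀, ∀ θ₀ : Fin ν → ℝ, ∀ ε > 0, ∀ᶠ θ in 𝓝 θ₀,
    OpBound r ((W θ : State →L[ℂ] State) - (W θ₀ : State →L[ℂ] State)) ε

/-- `ψ(t) = W(ω t) φ(t)` conjugates `i ψ' = H(ω t) ψ` to `i φ' = H' φ`. -/
def Conjugates {ν : ℕ} (ω : Freq ν) (W : (Fin ν → ℝ) → State ≃L[ℂ] State)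
    (H : (Fin ν → ℝ) → Matrix (ℕ+ ⊕ ℕ+) (ℕ+ ⊕ ℕ+) ℂ)
    (H' : Matrix (ℕ+ ⊕ ℕ+) (ℕ+ ⊕ ℕ+) ℂ) : Prop :=
  ∀ φ : ℝ → State,
    IsSolution (fun _ => H') φ ↔
      IsSolution (fun t => H (fun i => ω i * t)) (fun t => W (fun i => ω i * t) (φ t))

end FastKG

end

open scoped ENNReal Topology

noncomputable section

namespace FastKG

/-! ### Schur norms of nonnegative matrices -/

section Schur

variable {J : Type*}

/-- Weighted Schur norm: the largest of the weighted row sums and column sums. -/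
def schur (w M : J → J → ℝ≥0∞) : ℝ≥0∞ :=
  (⨆ x, ∑' y, M x y * w x y) ⊔ (⨆ y, ∑' x, M x y * w x y)

lemma schur_le_iff {w M : J → J → ℝ≥0∞} {c : ℝ≥0∞} :
    schur w M ≤ c ↔ (∀ x, ∑' y, M x y * w x y ≤ c) ∧ ∀ y, ∑' x, M x y * w x y ≤ c := by
  simp [schur]

lemma row_le_schur (w M : J → J → ℝ≥0∞) (x : J) : ∑' y, M x y * w x y ≤ schur w M :=
  (schur_le_iff.1 le_rfl).1 x

lemma col_le_schur (w M : J → J → ℝ≥0∞) (y : J) : ∑' x, M x y * w x y ≤ schur w M :=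
  (schur_le_iff.1 le_rfl).2 y

lemma le_schur (w M : J → J → ℝ≥0∞) (x y : J) : M x y * w x y ≤ schur w M :=
  (ENNReal.le_tsum y).trans (row_le_schur w M x)

lemma schur_le_mul {w w' M M' : J → J → ℝ≥0∞} (c : ℝ≥0∞)
    (h : ∀ x y, M x y * w x y ≤ c * (M' x y * w' x y)) : schur w M ≤ c * schur w' M' := by
  rw [schur_le_iff]
  constructor
  · intro x
    calc ∑' y, M x y * w x y ≤ ∑' y, c * (M' x y * w' x y) := ENNReal.tsum_le_tsum fun y => h x y
      _ = c * ∑' y, M' x y * w' x y := ENNReal.tsum_mul_left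
      _ ≤ _ := by gcongr; exact row_le_schur w' M' x
  · intro y
    calc ∑' x, M x y * w x y ≤ ∑' x, c * (M' x y * w' x y) := ENNReal.tsum_le_tsum fun x => h x y
      _ = c * ∑' x, M' x y * w' x y := ENNReal.tsum_mul_left
      _ ≤ _ := by gcongr; exact col_le_schur w' M' y

lemma schur_mono {w w' M M' : J → J → ℝ≥0∞}
    (h : ∀ x y, M x y * w x y ≤ M' x y * w' x y) : schur w M ≤ schur w' M' := by
  simpa using schur_le_mul 1 (by simpa using h)

lemma schur_mono_weight {w w' : J → J → ℝ≥0∞} (M : J → J → ℝ≥0∞) (h : ∀ x y, w x y ≤ w' x y) :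
    schur w M ≤ schur w' M :=
  schur_mono fun x y => by gcongr; exact h x y

lemma schur_tsum_le {κ : Type*} {w M : J → J → ℝ≥0∞} {N : κ → J → J → ℝ≥0∞}
    (h : ∀ x y, M x y ≤ ∑' n, N n x y) : schur w M ≤ ∑' n, schur w (N n) := by
  rw [schur_le_iff]
  constructor
  · intro x
    calc ∑' y, M x y * w x y ≤ ∑' y, ∑' n, N n x y * w x y := by
          refine ENNReal.tsum_le_tsum fun y => ?_
          rw [ENNReal.tsum_mul_right]; gcongr; exact h x y
      _ = ∑' n, ∑' y, N n x y * w x y := ENNReal.tsum_comm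
      _ ≤ _ := ENNReal.tsum_le_tsum fun n => row_le_schur w (N n) x
  · intro y
    calc ∑' x, M x y * w x y ≤ ∑' x, ∑' n, N n x y * w x y := by
          refine ENNReal.tsum_le_tsum fun x => ?_
          rw [ENNReal.tsum_mul_right]; gcongr; exact h x y
      _ = ∑' n, ∑' x, N n x y * w x y := ENNReal.tsum_comm
      _ ≤ _ := ENNReal.tsum_le_tsum fun n => col_le_schur w (N n) y

lemma schur_add_le {w M A B : J → J → ℝ≥0∞} (h : ∀ x y, M x y ≤ A x y + B x y) :
    schur w M ≤ schur w A + schur w B := by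
  have := schur_tsum_le (κ := Bool) (w := w) (M := M) (N := fun b => cond b A B)
    (by intro x y; simpa [tsum_bool, add_comm] using h x y)
  simpa [tsum_bool, add_comm] using this

lemma schur_mul_le {w₁ w₂ w₃ M A B : J → J → ℝ≥0∞}
    (hM : ∀ x y, M x y ≤ ∑' z, A x z * B z y) (hw : ∀ x y z, w₃ x y ≤ w₁ x z * w₂ z y) :
    schur w₃ M ≤ schur w₁ A * schur w₂ B := by
  have key : ∀ x y, M x y * w₃ x y ≤ ∑' z, (A x z * w₁ x z) * (B z y * w₂ z y) := by
    intro x y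
    calc M x y * w₃ x y ≤ (∑' z, A x z * B z y) * w₃ x y := by gcongr; exact hM x y
      _ = ∑' z, A x z * B z y * w₃ x y := ENNReal.tsum_mul_right.symm
      _ ≤ _ := by
        refine ENNReal.tsum_le_tsum fun z => ?_
        calc A x z * B z y * w₃ x y ≤ A x z * B z y * (w₁ x z * w₂ z y) := by gcongr; exact hw x y z
          _ = _ := by ring
  rw [schur_le_iff]
  constructor
  · intro x
    calc ∑' y, M x y * w₃ x y ≤ ∑' y, ∑' z, (A x z * w₁ x z) * (B z y * w₂ z y) :=
          ENNReal.tsum_le_tsum fun y => key x y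
      _ = ∑' z, ∑' y, (A x z * w₁ x z) * (B z y * w₂ z y) := ENNReal.tsum_comm
      _ = ∑' z, (A x z * w₁ x z) * ∑' y, (B z y * w₂ z y) := by simp_rw [ENNReal.tsum_mul_left]
      _ ≤ ∑' z, (A x z * w₁ x z) * schur w₂ B :=
          ENNReal.tsum_le_tsum fun z => by gcongr; exact row_le_schur w₂ B z
      _ = (∑' z, (A x z * w₁ x z)) * schur w₂ B := ENNReal.tsum_mul_right
      _ ≤ _ := by gcongr; exact row_le_schur w₁ A x
  · intro y
    calc ∑' x, M x y * w₃ x y ≤ ∑' x, ∑' z, (A x z * w₁ x z) * (B z y * w₂ z y) :=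
          ENNReal.tsum_le_tsum fun x => key x y
      _ = ∑' z, ∑' x, (A x z * w₁ x z) * (B z y * w₂ z y) := ENNReal.tsum_comm
      _ = ∑' z, (∑' x, A x z * w₁ x z) * (B z y * w₂ z y) := by simp_rw [ENNReal.tsum_mul_right]
      _ ≤ ∑' z, schur w₁ A * (B z y * w₂ z y) :=
          ENNReal.tsum_le_tsum fun z => by gcongr; exact col_le_schur w₁ A z
      _ = schur w₁ A * ∑' z, (B z y * w₂ z y) := ENNReal.tsum_mul_left
      _ ≤ _ := by gcongr; exact col_le_schur w₂ B y

lemma schur_comm {w M : J → J → ℝ≥0∞} (hw : ∀ x y, w x y = w y x) :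
    schur w (fun x y => M y x) = schur w M := by
  rw [schur, schur, sup_comm]
  simp_rw [hw]

end Schur

lemma ENNReal_cauchy_schwarz {J : Type*} (a f : J → ℝ≥0∞) :
    (∑' y, a y * f y) ^ 2 ≤ (∑' y, a y) * ∑' y, a y * f y ^ 2 := by
  let _ : MeasurableSpace J := ⊤
  have h := ENNReal.lintegral_mul_le_Lp_mul_Lq (MeasureTheory.Measure.count : MeasureTheory.Measure J)
    (Real.HolderConjugate.two_two) (f := fun y => a y ^ (1 / 2 : ℝ))
    (g := fun y => a y ^ (1 / 2 : ℝ) * f y) (Measurable.aemeasurable (fun _ _ => trivial))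
    (Measurable.aemeasurable (fun _ _ => trivial))
  simp only [MeasureTheory.lintegral_count, Pi.mul_apply] at h
  have e1 : ∀ y, a y ^ (1 / 2 : ℝ) * (a y ^ (1 / 2 : ℝ) * f y) = a y * f y := by
    intro y
    rw [← mul_assoc, ← ENNReal.rpow_add_of_nonneg _ _ (by norm_num) (by norm_num)]
    norm_num
  have e2 : ∀ y, (a y ^ (1 / 2 : ℝ)) ^ (2 : ℝ) = a y := by
    intro y; rw [← ENNReal.rpow_mul]; norm_num
  have e3 : ∀ y, (a y ^ (1 / 2 : ℝ) * f y) ^ (2 : ℝ) = a y * f y ^ 2 := by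
    intro y
    rw [ENNReal.mul_rpow_of_nonneg _ _ (by norm_num), e2]; norm_num
  simp only [e1, e2, e3] at h
  calc (∑' y, a y * f y) ^ 2
      ≤ ((∑' y, a y) ^ (1 / 2 : ℝ) * (∑' y, a y * f y ^ 2) ^ (1 / 2 : ℝ)) ^ 2 := by gcongr
    _ = _ := by
      rw [mul_pow, ← ENNReal.rpow_natCast, ← ENNReal.rpow_natCast, ← ENNReal.rpow_mul,
        ← ENNReal.rpow_mul]
      norm_num

/-! ### Bounded operators on `ℓ²` and their matrices -/

section Operators

variable {J : Type*}

/-- Square summable families. -/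
abbrev L2 (J : Type*) : Type _ := lp (fun _ : J => ℂ) 2

/-- Bounded operators on `ℓ²(J)`. -/
abbrev Op (J : Type*) : Type _ := L2 J →L[ℂ] L2 J

open Classical in
/-- The unit vector at `y`. -/
def unitVec (y : J) : L2 J := lp.single 2 y (1 : ℂ)

/-- The matrix entries of an operator. -/
def ent (A : Op J) (x y : J) : ℂ := A (unitVec y) x

/-- Evaluation at a point as a continuous functional. -/
def evalL (x : J) : L2 J →L[ℂ] ℂ :=
  LinearMap.mkContinuous
    { toFun := fun f => f x, map_add' := fun _ _ => rfl, map_smul' := fun _ _ => rfl } 1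
    (fun f => by rw [one_mul]; exact lp.norm_apply_le_norm (by norm_num) f x)

@[simp] lemma evalL_apply (x : J) (f : L2 J) : evalL x f = f x := rfl

lemma enorm_sq_eq_tsum (f : L2 J) : ‖f‖ₑ ^ 2 = ∑' y, ‖f y‖ₑ ^ 2 := by
  have h := lp.hasSum_norm (p := 2) (by norm_num) f
  have h2 : HasSum (fun y => ‖f y‖ ^ 2) (‖f‖ ^ 2) := by simpa using h
  have h3 := ENNReal.ofReal_tsum_of_nonneg (fun y => by positivity) h2.summable
  rw [h2.tsum_eq, ENNReal.ofReal_pow (norm_nonneg _), ofReal_norm] at h3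
  rw [h3]
  congr 1; ext y
  rw [ENNReal.ofReal_pow (norm_nonneg _), ofReal_norm]

lemma memLp_of_tsum {f : J → ℂ} (h : ∑' y, ‖f y‖ₑ ^ 2 ≠ ∞) : Memℓp f 2 := by
  refine memℓp_gen ?_
  have h2 : ∀ y, ‖f y‖ₑ ^ 2 = ((‖f y‖₊ ^ 2 : NNReal) : ℝ≥0∞) := fun y => by
    rw [ENNReal.coe_pow]; rfl
  simp_rw [h2] at h
  have := ENNReal.tsum_coe_ne_top_iff_summable.1 h
  have h3 := NNReal.summable_coe.2 this
  simpa using h3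

@[simp] lemma unitVec_self (y : J) : (unitVec y : L2 J) y = 1 := by
  simp [unitVec]

lemma unitVec_ne {x y : J} (h : x ≠ y) : (unitVec y : L2 J) x = 0 := by
  simp [unitVec, h]

lemma hasSum_unitVec (f : L2 J) : HasSum (fun y => f y • unitVec y) f := by
  classical
  have h := lp.hasSum_single (p := 2) (by norm_num) f
  convert h using 2 with y
  rw [unitVec, ← lp.single_smul, smul_eq_mul, mul_one]

lemma norm_unitVec (y : J) : ‖(unitVec y : L2 J)‖ = 1 := by
  classical
  simp [unitVec, lp.norm_single (p := 2) (E := fun _ : J => ℂ) (by norm_num) y 1]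

lemma norm_ent_le (A : Op J) (x y : J) : ‖ent A x y‖ ≤ ‖A‖ := by
  calc ‖ent A x y‖ ≤ ‖A (unitVec y)‖ := lp.norm_apply_le_norm (by norm_num) _ x
    _ ≤ ‖A‖ * ‖(unitVec y : L2 J)‖ := A.le_opNorm _
    _ = ‖A‖ := by rw [norm_unitVec, mul_one]

lemma hasSum_apply (A : Op J) (f : L2 J) (x : J) :
    HasSum (fun y => ent A x y * f y) (A f x) := by
  have h := ((evalL x).comp A).hasSum (hasSum_unitVec f)
  simpa [ent, mul_comm, Function.comp_def] using h

lemma ent_ext {A B : Op J} (h : ∀ x y, ent A x y = ent B x y) : A = B := by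
  ext f x
  have h1 := hasSum_apply A f x
  simp_rw [h] at h1
  exact h1.unique (hasSum_apply B f x)

lemma hasSum_ent_mul (A B : Op J) (x y : J) :
    HasSum (fun z => ent A x z * ent B z y) (ent (A * B) x y) :=
  hasSum_apply A (B (unitVec y)) x

/-- Taking an entry, as a continuous functional. -/
def entL (x y : J) : Op J →L[ℂ] ℂ :=
  (evalL x).comp (ContinuousLinearMap.apply ℂ (L2 J) (unitVec y))

@[simp] lemma ent_add (A B : Op J) (x y : J) : ent (A + B) x y = ent A x y + ent B x y := rfl
@[simp] lemma ent_sub (A B : Op J) (x y : J) : ent (A - B) x y = ent A x y - ent B x y := rfl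
@[simp] lemma ent_neg (A : Op J) (x y : J) : ent (-A) x y = -ent A x y := rfl
@[simp] lemma ent_smul (c : ℂ) (A : Op J) (x y : J) : ent (c • A) x y = c * ent A x y := rfl
@[simp] lemma ent_zero (x y : J) : ent (0 : Op J) x y = 0 := rfl
@[simp] lemma ent_one_self (x : J) : ent (1 : Op J) x x = 1 := unitVec_self x
lemma ent_one_ne {x y : J} (h : x ≠ y) : ent (1 : Op J) x y = 0 := unitVec_ne h

lemma ent_star (A : Op J) (x y : J) : ent (star A) x y = starRingEnd ℂ (ent A y x) := by
  classical
  have h := ContinuousLinearMap.adjoint_inner_right A (unitVec x) (unitVec y)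
  have e : ∀ (z : J) (f : L2 J), inner ℂ (unitVec z) f = f z := by
    intro z f
    simpa [unitVec] using lp.inner_single_left (𝕜 := ℂ) (G := fun _ : J => ℂ) z 1 f
  rw [e] at h
  rw [ent, ContinuousLinearMap.star_eq_adjoint, h, ← inner_conj_symm, e]
  rfl

/-- Majorant of the matrix of an operator. -/
def entAbs (A : Op J) : J → J → ℝ≥0∞ := fun x y => ‖ent A x y‖ₑ

/-- Boundedness criterion (Schur test) for a matrix. -/
def SchurBdd (a : J → J → ℂ) : Prop := schur 1 (fun x y => ‖a x y‖ₑ) ≠ ∞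

lemma summable_row {a : J → J → ℂ} (h : SchurBdd a) (f : L2 J) (x : J) :
    Summable fun y => a x y * f y := by
  have h1 : ∑' y, ‖a x y * f y‖ₑ ≠ ∞ := by
    refine ne_top_of_le_ne_top (ENNReal.mul_ne_top h (enorm_ne_top (x := f))) ?_
    calc ∑' y, ‖a x y * f y‖ₑ ≤ ∑' y, ‖a x y‖ₑ * (1 : J → J → ℝ≥0∞) x y * ‖f‖ₑ := by
          refine ENNReal.tsum_le_tsum fun y => ?_
          rw [enorm_mul]; simp only [Pi.one_apply, mul_one]
          gcongr
          exact enorm_le_iff_norm_le.2 (lp.norm_apply_le_norm (by norm_num) f y)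
      _ = _ := ENNReal.tsum_mul_right
      _ ≤ _ := by gcongr; exact row_le_schur 1 (fun x y => ‖a x y‖ₑ) x
  have h2 : ∑' y, ((‖a x y * f y‖₊ : NNReal) : ℝ≥0∞) ≠ ∞ := h1
  exact (NNReal.summable_coe.2 (ENNReal.tsum_coe_ne_top_iff_summable.1 h2)).of_norm

lemma schur_test (a : J → J → ℂ) (f : J → ℂ) :
    ∑' x, ‖∑' y, a x y * f y‖ₑ ^ 2 ≤
      (schur 1 (fun x y => ‖a x y‖ₑ)) ^ 2 * ∑' y, ‖f y‖ₑ ^ 2 := by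
  set c := schur 1 (fun x y => ‖a x y‖ₑ)
  calc ∑' x, ‖∑' y, a x y * f y‖ₑ ^ 2 ≤ ∑' x, (∑' y, ‖a x y‖ₑ * ‖f y‖ₑ) ^ 2 := by
        refine ENNReal.tsum_le_tsum fun x => ?_
        gcongr
        refine enorm_tsum_le_tsum_enorm.trans_eq ?_
        simp_rw [enorm_mul]
    _ ≤ ∑' x, (∑' y, ‖a x y‖ₑ) * ∑' y, ‖a x y‖ₑ * ‖f y‖ₑ ^ 2 :=
        ENNReal.tsum_le_tsum fun x => ENNReal_cauchy_schwarz _ _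
    _ ≤ ∑' x, c * ∑' y, ‖a x y‖ₑ * ‖f y‖ₑ ^ 2 := by
        refine ENNReal.tsum_le_tsum fun x => ?_
        gcongr
        simpa using row_le_schur 1 (fun x y => ‖a x y‖ₑ) x
    _ = c * ∑' y, ∑' x, ‖a x y‖ₑ * ‖f y‖ₑ ^ 2 := by
        rw [ENNReal.tsum_mul_left, ENNReal.tsum_comm]
    _ = c * ∑' y, (∑' x, ‖a x y‖ₑ) * ‖f y‖ₑ ^ 2 := by simp_rw [ENNReal.tsum_mul_right]
    _ ≤ c * ∑' y, c * ‖f y‖ₑ ^ 2 := by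
        gcongr with y
        simpa using col_le_schur 1 (fun x y => ‖a x y‖ₑ) y
    _ = _ := by rw [ENNReal.tsum_mul_left, ← mul_assoc, sq]

open Classical in
/-- The operator with a given matrix (zero if the Schur test fails). -/
def ofMat (a : J → J → ℂ) : Op J :=
  if h : SchurBdd a then
    LinearMap.mkContinuous
      { toFun := fun f => ⟨fun x => ∑' y, a x y * f y, memLp_of_tsum (ne_top_of_le_ne_top
          (ENNReal.mul_ne_top (ENNReal.pow_ne_top h) (by
            rw [← enorm_sq_eq_tsum f]; exact ENNReal.pow_ne_top enorm_ne_top))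
          (schur_test a f))⟩
        map_add' := fun f g => by
          ext x
          change ∑' y, a x y * (f y + g y) = ∑' y, a x y * f y + ∑' y, a x y * g y
          simp_rw [mul_add]
          exact (summable_row h f x).tsum_add (summable_row h g x)
        map_smul' := fun c f => by
          ext x
          change ∑' y, a x y * (c * f y) = c * ∑' y, a x y * f y
          rw [← tsum_mul_left]
          congr 1; ext y; ring }
      (schur 1 (fun x y => ‖a x y‖ₑ)).toReal (fun f => by
        set g : L2 J := ⟨fun x => ∑' y, a x y * f y, _⟩ with hg
        change ‖g‖ ≤ _
        have h1 : ‖g‖ₑ ^ 2 ≤ (schur 1 (fun x y => ‖a x y‖ₑ) * ‖f‖ₑ) ^ 2 := by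
          rw [enorm_sq_eq_tsum, mul_pow, enorm_sq_eq_tsum f]
          exact schur_test a f
        have h2 : ‖g‖ₑ ≤ schur 1 (fun x y => ‖a x y‖ₑ) * ‖f‖ₑ := by
          by_contra hlt
          push Not at hlt
          exact absurd h1 (not_le.2 (ENNReal.pow_lt_pow_left (by norm_num) hlt))
        have h3 := ENNReal.toReal_mono (ENNReal.mul_ne_top h enorm_ne_top) h2
        simpa using h3)
  else 0

lemma ofMat_apply {a : J → J → ℂ} (h : SchurBdd a) (f : L2 J) (x : J) :
    ofMat a f x = ∑' y, a x y * f y := by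
  rw [ofMat, dif_pos h]; rfl

lemma ent_ofMat {a : J → J → ℂ} (h : SchurBdd a) (x y : J) : ent (ofMat a) x y = a x y := by
  rw [ent, ofMat_apply h, tsum_eq_single y]
  · simp
  · intro z hz; rw [unitVec_ne hz, mul_zero]

lemma enorm_le_schur (A : Op J) : ‖A‖ₑ ≤ schur 1 (entAbs A) := by
  by_cases h : schur 1 (entAbs A) = ∞
  · rw [h]; exact le_top
  have h' : SchurBdd (ent A) := h
  have e : A = ofMat (ent A) := ent_ext fun x y => (ent_ofMat h' x y).symm
  have h1 : ‖A‖ ≤ (schur 1 (entAbs A)).toReal := by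
    conv_lhs => rw [e, ofMat, dif_pos h']
    exact LinearMap.mkContinuous_norm_le _ ENNReal.toReal_nonneg _
  rw [← ofReal_norm]
  exact ENNReal.ofReal_le_of_le_toReal h1

end Operators

/-! ### Lipschitz norms of parameter dependent quantities -/

section Lipschitz

variable {Θ : Type*} [MetricSpace Θ] {E : Type*} [NormedAddCommGroup E]

/-- Supremum on `Ω`. -/
def supOn (Ω : Set Θ) (f : Θ → E) : ℝ≥0∞ := ⨆ ω ∈ Ω, ‖f ω‖ₑ

/-- Best Lipschitz constant on `Ω`. -/
def lipOn (Ω : Set Θ) (f : Θ → E) : ℝ≥0∞ :=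
  ⨆ (ω₁ ∈ Ω) (ω₂ ∈ Ω), ‖f ω₁ - f ω₂‖ₑ / edist ω₁ ω₂

/-- Weighted Lipschitz norm on `Ω`. -/
def lipN (Ω : Set Θ) (κ : ℝ≥0∞) (f : Θ → E) : ℝ≥0∞ := supOn Ω f + κ * lipOn Ω f

variable {Ω : Set Θ} {κ : ℝ≥0∞}

lemma enorm_le_supOn (f : Θ → E) {ω : Θ} (h : ω ∈ Ω) : ‖f ω‖ₑ ≤ supOn Ω f :=
  le_iSup₂ (f := fun ω (_ : ω ∈ Ω) => ‖f ω‖ₑ) ω h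

lemma supOn_le {f : Θ → E} {c : ℝ≥0∞} (h : ∀ ω ∈ Ω, ‖f ω‖ₑ ≤ c) : supOn Ω f ≤ c := iSup₂_le h

lemma lipOn_le {f : Θ → E} {c : ℝ≥0∞}
    (h : ∀ ω₁ ∈ Ω, ∀ ω₂ ∈ Ω, ‖f ω₁ - f ω₂‖ₑ ≤ c * edist ω₁ ω₂) : lipOn Ω f ≤ c :=
  iSup₂_le fun ω₁ h₁ => iSup₂_le fun ω₂ h₂ => ENNReal.div_le_of_le_mul (h ω₁ h₁ ω₂ h₂)

lemma enorm_sub_le_lipOn (f : Θ → E) {ω₁ ω₂ : Θ} (h₁ : ω₁ ∈ Ω) (h₂ : ω₂ ∈ Ω) :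
    ‖f ω₁ - f ω₂‖ₑ ≤ lipOn Ω f * edist ω₁ ω₂ := by
  rcases eq_or_ne ω₁ ω₂ with rfl | hne
  · simp
  have h : ‖f ω₁ - f ω₂‖ₑ / edist ω₁ ω₂ ≤ lipOn Ω f := by
    unfold lipOn
    exact le_iSup₂_of_le ω₁ h₁ (le_iSup₂_of_le ω₂ h₂ le_rfl)
  exact (ENNReal.div_le_iff_le_mul (Or.inl (by simpa using hne)) (Or.inl (edist_ne_top _ _))).1 h

lemma supOn_le_lipN (f : Θ → E) : supOn Ω f ≤ lipN Ω κ f := le_self_add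

lemma enorm_le_lipN (f : Θ → E) {ω : Θ} (h : ω ∈ Ω) : ‖f ω‖ₑ ≤ lipN Ω κ f :=
  (enorm_le_supOn f h).trans (supOn_le_lipN f)

lemma mul_enorm_sub_le_lipN (f : Θ → E) {ω₁ ω₂ : Θ} (h₁ : ω₁ ∈ Ω) (h₂ : ω₂ ∈ Ω) :
    κ * ‖f ω₁ - f ω₂‖ₑ ≤ lipN Ω κ f * edist ω₁ ω₂ := by
  calc κ * ‖f ω₁ - f ω₂‖ₑ ≤ κ * (lipOn Ω f * edist ω₁ ω₂) := by
        gcongr; exact enorm_sub_le_lipOn f h₁ h₂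
    _ = κ * lipOn Ω f * edist ω₁ ω₂ := by ring
    _ ≤ _ := by gcongr; exact le_add_self

lemma lipN_le {f : Θ → E} {a b : ℝ≥0∞} (ha : ∀ ω ∈ Ω, ‖f ω‖ₑ ≤ a)
    (hb : ∀ ω₁ ∈ Ω, ∀ ω₂ ∈ Ω, ‖f ω₁ - f ω₂‖ₑ ≤ b * edist ω₁ ω₂) :
    lipN Ω κ f ≤ a + κ * b := by
  unfold lipN
  gcongr
  · exact supOn_le ha
  · exact lipOn_le hb

lemma lipN_congr {f g : Θ → E} (h : ∀ ω ∈ Ω, f ω = g ω) : lipN Ω κ f = lipN Ω κ g := by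
  unfold lipN supOn lipOn
  congr 1
  · exact biSup_congr fun ω hω => by rw [h ω hω]
  · congr 1
    exact biSup_congr fun ω₁ h₁ => biSup_congr fun ω₂ h₂ => by rw [h ω₁ h₁, h ω₂ h₂]

lemma lipN_comp_le {F : Type*} [NormedAddCommGroup F] {f : Θ → E} {g : Θ → F}
    (h : ∀ ω ∈ Ω, ‖g ω‖ ≤ ‖f ω‖)
    (h' : ∀ ω₁ ∈ Ω, ∀ ω₂ ∈ Ω, ‖g ω₁ - g ω₂‖ ≤ ‖f ω₁ - f ω₂‖) : lipN Ω κ g ≤ lipN Ω κ f :=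
  lipN_le (fun ω hω => (enorm_le_iff_norm_le.2 (h ω hω)).trans (enorm_le_supOn f hω))
    fun ω₁ h₁ ω₂ h₂ => (enorm_le_iff_norm_le.2 (h' ω₁ h₁ ω₂ h₂)).trans (enorm_sub_le_lipOn f h₁ h₂)

lemma lipN_neg (f : Θ → E) : lipN Ω κ (fun ω => -f ω) = lipN Ω κ f := by
  refine le_antisymm (lipN_comp_le ?_ ?_) (lipN_comp_le ?_ ?_) <;> intros <;>
    simp [neg_add_eq_sub, norm_sub_rev]

lemma lipN_tsum_le {ι : Type*} {f : Θ → ℂ} {g : ι → Θ → ℂ}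
    (h : ∀ ω ∈ Ω, HasSum (fun n => g n ω) (f ω)) : lipN Ω κ f ≤ ∑' n, lipN Ω κ (g n) := by
  have e : ∑' n, lipN Ω κ (g n) = (∑' n, supOn Ω (g n)) + κ * ∑' n, lipOn Ω (g n) := by
    rw [← ENNReal.tsum_mul_left, ← ENNReal.tsum_add]; rfl
  rw [e]
  refine lipN_le (fun ω hω => ?_) fun ω₁ h₁ ω₂ h₂ => ?_
  · rw [← (h ω hω).tsum_eq]
    exact enorm_tsum_le_tsum_enorm.trans (ENNReal.tsum_le_tsum fun n => enorm_le_supOn _ hω)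
  · rw [← ((h ω₁ h₁).sub (h ω₂ h₂)).tsum_eq, ← ENNReal.tsum_mul_right]
    exact enorm_tsum_le_tsum_enorm.trans
      (ENNReal.tsum_le_tsum fun n => enorm_sub_le_lipOn _ h₁ h₂)

lemma lipN_add_le (f g : Θ → E) :
    lipN Ω κ (fun ω => f ω + g ω) ≤ lipN Ω κ f + lipN Ω κ g := by
  have e : lipN Ω κ f + lipN Ω κ g = (supOn Ω f + supOn Ω g) + κ * (lipOn Ω f + lipOn Ω g) := by
    unfold lipN; ring
  rw [e]
  refine lipN_le (fun ω hω => ?_) fun ω₁ h₁ ω₂ h₂ => ?_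
  · exact (enorm_add_le _ _).trans (add_le_add (enorm_le_supOn _ hω) (enorm_le_supOn _ hω))
  · rw [add_sub_add_comm, add_mul]
    exact (enorm_add_le _ _).trans
      (add_le_add (enorm_sub_le_lipOn _ h₁ h₂) (enorm_sub_le_lipOn _ h₁ h₂))

lemma lipN_sub_le (f g : Θ → E) :
    lipN Ω κ (fun ω => f ω - g ω) ≤ lipN Ω κ f + lipN Ω κ g := by
  simpa [sub_eq_add_neg, lipN_neg] using lipN_add_le (Ω := Ω) (κ := κ) f (fun ω => -g ω)

lemma lipN_mul_le (f g : Θ → ℂ) :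
    lipN Ω κ (fun ω => f ω * g ω) ≤ lipN Ω κ f * lipN Ω κ g := by
  have h : lipN Ω κ (fun ω => f ω * g ω) ≤
      supOn Ω f * supOn Ω g + κ * (supOn Ω f * lipOn Ω g + lipOn Ω f * supOn Ω g) := by
    refine lipN_le (fun ω hω => ?_) fun ω₁ h₁ ω₂ h₂ => ?_
    · rw [enorm_mul]; exact mul_le_mul' (enorm_le_supOn f hω) (enorm_le_supOn g hω)
    · have e : f ω₁ * g ω₁ - f ω₂ * g ω₂ = f ω₁ * (g ω₁ - g ω₂) + (f ω₁ - f ω₂) * g ω₂ := by ring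
      rw [e]
      refine (enorm_add_le _ _).trans ?_
      rw [enorm_mul, enorm_mul, add_mul]
      refine add_le_add ?_ ?_
      · rw [mul_assoc]
        exact mul_le_mul' (enorm_le_supOn f h₁) (enorm_sub_le_lipOn g h₁ h₂)
      · rw [mul_right_comm]
        exact mul_le_mul' (enorm_sub_le_lipOn f h₁ h₂) (enorm_le_supOn g h₂)
  refine h.trans ?_
  unfold lipN
  calc _ ≤ supOn Ω f * supOn Ω g + κ * (supOn Ω f * lipOn Ω g + lipOn Ω f * supOn Ω g)
        + κ * lipOn Ω f * (κ * lipOn Ω g) := le_self_add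
    _ = _ := by ring

lemma lipN_const (c : E) : lipN Ω κ (fun _ => c) ≤ ‖c‖ₑ := by
  simpa using lipN_le (Ω := Ω) (κ := κ) (f := fun _ => c) (a := ‖c‖ₑ) (b := 0) (by simp) (by simp)

lemma lipN_const_mul_le (c : ℂ) (f : Θ → ℂ) :
    lipN Ω κ (fun ω => c * f ω) ≤ ‖c‖ₑ * lipN Ω κ f :=
  (lipN_mul_le (fun _ => c) f).trans (by gcongr; exact lipN_const c)

end Lipschitz

/-! ### Parameter dependent operators -/

section Families

variable {Θ : Type*} [MetricSpace Θ] {J : Type*} {Ω : Set Θ} {κ : ℝ≥0∞}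

/-- Majorant of the matrix of a parameter dependent operator. -/
def lipEnt (Ω : Set Θ) (κ : ℝ≥0∞) (A : Θ → Op J) : J → J → ℝ≥0∞ :=
  fun x y => lipN Ω κ fun ω => ent (A ω) x y

/-- Weighted Schur norm of a parameter dependent operator. -/
def famN (Ω : Set Θ) (κ : ℝ≥0∞) (w : J → J → ℝ≥0∞) (A : Θ → Op J) : ℝ≥0∞ :=
  schur w (lipEnt Ω κ A)

lemma famN_mul_le {w₁ w₂ w₃ : J → J → ℝ≥0∞} (A B : Θ → Op J)
    (hw : ∀ x y z, w₃ x y ≤ w₁ x z * w₂ z y) :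
    famN Ω κ w₃ (fun ω => A ω * B ω) ≤ famN Ω κ w₁ A * famN Ω κ w₂ B := by
  refine schur_mul_le (fun x y => ?_) hw
  refine (lipN_tsum_le (g := fun z ω => ent (A ω) x z * ent (B ω) z y)
    fun ω _ => hasSum_ent_mul (A ω) (B ω) x y).trans ?_
  exact ENNReal.tsum_le_tsum fun z => lipN_mul_le _ _

lemma famN_add_le (w : J → J → ℝ≥0∞) (A B : Θ → Op J) :
    famN Ω κ w (fun ω => A ω + B ω) ≤ famN Ω κ w A + famN Ω κ w B :=
  schur_add_le fun _ _ => lipN_add_le _ _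

lemma famN_sub_le (w : J → J → ℝ≥0∞) (A B : Θ → Op J) :
    famN Ω κ w (fun ω => A ω - B ω) ≤ famN Ω κ w A + famN Ω κ w B :=
  schur_add_le fun _ _ => lipN_sub_le _ _

lemma famN_neg (w : J → J → ℝ≥0∞) (A : Θ → Op J) :
    famN Ω κ w (fun ω => -A ω) = famN Ω κ w A := by
  unfold famN; congr 1; ext x y
  exact lipN_neg _

lemma schur_entAbs_le_famN {w : J → J → ℝ≥0∞} (A : Θ → Op J) {ω : Θ} (hω : ω ∈ Ω) :
    schur w (entAbs (A ω)) ≤ famN Ω κ w A :=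
  schur_mono fun x y => by
    gcongr
    exact enorm_le_lipN (fun ω => ent (A ω) x y) hω

lemma enorm_le_famN {w : J → J → ℝ≥0∞} (hw : ∀ x y, 1 ≤ w x y) (A : Θ → Op J) {ω : Θ}
    (hω : ω ∈ Ω) : ‖A ω‖ₑ ≤ famN Ω κ w A :=
  (enorm_le_schur _).trans ((schur_mono_weight _ hw).trans (schur_entAbs_le_famN A hω))

lemma hasSum_inverse_one_sub {G : Op J} (h : ‖G‖ < 1) :
    HasSum (fun n : ℕ => G ^ n) (Ring.inverse (1 - G)) := by
  rw [NormedRing.inverse_one_sub G h]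
  exact (summable_geometric_of_norm_lt_one h).hasSum

lemma famN_inverse_mul_le {w wg : J → J → ℝ≥0∞} (hwg : ∀ x y, 1 ≤ wg x y)
    (hw : ∀ x y z, w x y ≤ wg x z * w z y) {G : Θ → Op J} (hG : famN Ω κ wg G ≤ 1 / 2)
    (T : Θ → Op J) :
    famN Ω κ w (fun ω => Ring.inverse (1 - G ω) * T ω) ≤ 2 * famN Ω κ w T := by
  have hpow : ∀ n : ℕ, famN Ω κ w (fun ω => G ω ^ n * T ω) ≤ (1 / 2) ^ n * famN Ω κ w T := by
    intro n
    induction n with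
    | zero => simp
    | succ n ih =>
      simp_rw [pow_succ' (G _), mul_assoc]
      refine (famN_mul_le G (fun ω => G ω ^ n * T ω) hw).trans ?_
      rw [pow_succ', mul_assoc]
      exact mul_le_mul' hG ih
  have h1 : famN Ω κ w (fun ω => Ring.inverse (1 - G ω) * T ω) ≤
      ∑' n : ℕ, famN Ω κ w (fun ω => G ω ^ n * T ω) := by
    refine schur_tsum_le fun x y => lipN_tsum_le (g := fun n ω => ent (G ω ^ n * T ω) x y)
      fun ω hω => ?_
    have hlt : ‖G ω‖ < 1 := by
      have := (enorm_le_famN (κ := κ) hwg G hω).trans hG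
      rw [← ofReal_norm] at this
      have h2 := (ENNReal.ofReal_le_iff_le_toReal (by simp)).1 this
      norm_num at h2
      linarith
    exact ((hasSum_inverse_one_sub hlt).mul_right (T ω)).mapL (entL x y)
  refine h1.trans ((ENNReal.tsum_le_tsum hpow).trans ?_)
  rw [ENNReal.tsum_mul_right, ENNReal.tsum_geometric]
  simp

lemma famN_mul_inverse_le {w wg : J → J → ℝ≥0∞} (hwg : ∀ x y, 1 ≤ wg x y)
    (hw : ∀ x y z, w x y ≤ w x z * wg z y) {G : Θ → Op J} (hG : famN Ω κ wg G ≤ 1 / 2)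
    (T : Θ → Op J) :
    famN Ω κ w (fun ω => T ω * Ring.inverse (1 - G ω)) ≤ 2 * famN Ω κ w T := by
  have hpow : ∀ n : ℕ, famN Ω κ w (fun ω => T ω * G ω ^ n) ≤ (1 / 2) ^ n * famN Ω κ w T := by
    intro n
    induction n with
    | zero => simp
    | succ n ih =>
      simp_rw [pow_succ (G _), ← mul_assoc]
      refine (famN_mul_le (fun ω => T ω * G ω ^ n) G hw).trans ?_
      rw [pow_succ', mul_assoc, mul_comm (1 / 2 : ℝ≥0∞)]
      exact mul_le_mul' ih hG
  have h1 : famN Ω κ w (fun ω => T ω * Ring.inverse (1 - G ω)) ≤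
      ∑' n : ℕ, famN Ω κ w (fun ω => T ω * G ω ^ n) := by
    refine schur_tsum_le fun x y => lipN_tsum_le (g := fun n ω => ent (T ω * G ω ^ n) x y)
      fun ω hω => ?_
    have hlt : ‖G ω‖ < 1 := by
      have := (enorm_le_famN (κ := κ) hwg G hω).trans hG
      rw [← ofReal_norm] at this
      have h2 := (ENNReal.ofReal_le_iff_le_toReal (by simp)).1 this
      norm_num at h2
      linarith
    exact ((hasSum_inverse_one_sub hlt).mul_left (T ω)).mapL (entL x y)
  refine h1.trans ((ENNReal.tsum_le_tsum hpow).trans ?_)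
  rw [ENNReal.tsum_mul_right, ENNReal.tsum_geometric]
  simp

end Families

section Algebra

variable {J : Type*}

/-! ### Diagonal operators -/

open Classical in
/-- The diagonal operator with bounded entries `s`. -/
def diagOp (s : J → ℂ) : Op J := ofMat fun x y => if x = y then s x else 0

open Classical in
lemma schurBdd_diag {s : J → ℂ} {C : ℝ} (h : ∀ x, ‖s x‖ ≤ C) :
    SchurBdd fun x y : J => if x = y then s x else 0 := by
  refine ne_top_of_le_ne_top (b := ENNReal.ofReal C) (by simp) ?_
  have hs : ∀ x, ‖s x‖ₑ ≤ ENNReal.ofReal C := fun x => by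
    rw [← ofReal_norm]; exact ENNReal.ofReal_le_ofReal (h x)
  rw [schur_le_iff]
  constructor
  · intro x
    rw [tsum_eq_single x (by intro y hy; simp [Ne.symm hy])]
    simpa using hs x
  · intro y
    rw [tsum_eq_single y (by intro x hx; simp [hx])]
    simpa using hs y

lemma ent_diagOp_self {s : J → ℂ} {C : ℝ} (h : ∀ x, ‖s x‖ ≤ C) (x : J) :
    ent (diagOp s) x x = s x := by
  rw [diagOp, ent_ofMat (schurBdd_diag h), if_pos rfl]

lemma ent_diagOp_ne {s : J → ℂ} {C : ℝ} (h : ∀ x, ‖s x‖ ≤ C) {x y : J} (hxy : x ≠ y) :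
    ent (diagOp s) x y = 0 := by
  rw [diagOp, ent_ofMat (schurBdd_diag h), if_neg hxy]

lemma ent_diagOp_mul {s : J → ℂ} {C : ℝ} (h : ∀ x, ‖s x‖ ≤ C) (A : Op J) (x y : J) :
    ent (diagOp s * A) x y = s x * ent A x y := by
  classical
  refine (hasSum_ent_mul (diagOp s) A x y).unique ?_
  convert hasSum_single x ?_ using 1
  · rw [ent_diagOp_self h]
  · intro z hz
    rw [ent_diagOp_ne h hz.symm, zero_mul]

lemma ent_mul_diagOp {s : J → ℂ} {C : ℝ} (h : ∀ x, ‖s x‖ ≤ C) (A : Op J) (x y : J) :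
    ent (A * diagOp s) x y = ent A x y * s y := by
  classical
  refine (hasSum_ent_mul A (diagOp s) x y).unique ?_
  convert hasSum_single y ?_ using 1
  · rw [ent_diagOp_self h]
  · intro z hz
    rw [ent_diagOp_ne h hz, mul_zero]

/-! ### Intertwining relations with unbounded diagonal operators -/

/-- `D A - A D' = B` for (possibly unbounded) diagonal `D, D'`. -/
def Itw (D D' : J → ℂ) (A B : Op J) : Prop := ∀ x y, (D x - D' y) * ent A x y = ent B x y

lemma Itw.mul {D D' D'' : J → ℂ} {A B A' B' : Op J} (h : Itw D D' A B) (h' : Itw D' D'' A' B') :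
    Itw D D'' (A * A') (B * A' + A * B') := by
  intro x y
  have h1 := (hasSum_ent_mul A A' x y).mul_left (D x - D'' y)
  have h2 := (hasSum_ent_mul B A' x y).add (hasSum_ent_mul A B' x y)
  have e : (fun z => (D x - D'' y) * (ent A x z * ent A' z y)) =
      fun z => ent B x z * ent A' z y + ent A x z * ent B' z y := by
    ext z
    rw [← h x z, ← h' z y]; ring
  rw [e] at h1
  exact h1.unique h2

lemma Itw.one (D : J → ℂ) : Itw D D (1 : Op J) 0 := by
  intro x y
  by_cases hxy : x = y
  · subst hxy; simp
  · rw [ent_one_ne hxy]; simp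

lemma Itw.add {D D' : J → ℂ} {A B A' B' : Op J} (h : Itw D D' A B) (h' : Itw D D' A' B') :
    Itw D D' (A + A') (B + B') := by
  intro x y
  rw [ent_add, ent_add, mul_add, h, h']

lemma Itw.pow {D : J → ℂ} {G G' : Op J} (h : Itw D D G G') (n : ℕ) :
    Itw D D (G ^ (n + 1)) (∑ k ∈ Finset.range (n + 1), G ^ k * G' * G ^ (n - k)) := by
  induction n with
  | zero => simpa using h
  | succ n ih =>
    rw [pow_succ]
    convert ih.mul h using 1
    rw [Finset.sum_range_succ _ (n + 1), Finset.sum_mul]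
    congr 1
    · refine Finset.sum_congr rfl fun k hk => ?_
      have : n + 1 - k = (n - k) + 1 := by
        have := Finset.mem_range.1 hk; omega
      rw [this, pow_succ]; simp only [mul_assoc]
    · simp

lemma Itw.inverse_one_sub {D : J → ℂ} {G G' : Op J} (h : Itw D D G G') (hG : ‖G‖ < 1) :
    Itw D D (Ring.inverse (1 - G)) (Ring.inverse (1 - G) * G' * Ring.inverse (1 - G)) := by
  have hs := hasSum_inverse_one_sub hG
  have hn : Summable fun n : ℕ => ‖G ^ n‖ := by
    refine Summable.of_nonneg_of_le (fun _ => norm_nonneg _) (fun n => ?_)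
      ((summable_geometric_of_lt_one (norm_nonneg G) hG).mul_left (max 1 ‖(1 : Op J)‖))
    rcases n with _ | n
    · simp
    · exact (norm_pow_le' G n.succ_pos).trans
        (le_mul_of_one_le_left (by positivity) (le_max_left _ _))
  have hn' : Summable fun n : ℕ => ‖G ^ n * G'‖ :=
    Summable.of_nonneg_of_le (fun _ => norm_nonneg _) (fun n => norm_mul_le _ _)
      (hn.mul_right ‖G'‖)
  have key := tsum_mul_tsum_eq_tsum_sum_range_of_summable_norm hn' hn
  have hsum := (summable_norm_sum_mul_range_of_summable_norm hn' hn).of_norm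
  have e1 : ∑' n : ℕ, G ^ n * G' = Ring.inverse (1 - G) * G' := (hs.mul_right G').tsum_eq
  rw [e1, hs.tsum_eq] at key
  have hB : HasSum (fun n => ∑ k ∈ Finset.range (n + 1), G ^ k * G' * G ^ (n - k))
      (Ring.inverse (1 - G) * G' * Ring.inverse (1 - G)) := by
    rw [key]; exact hsum.hasSum
  have hs1 : HasSum (fun n : ℕ => G ^ (n + 1)) (Ring.inverse (1 - G) - 1) := by
    have := (hasSum_nat_add_iff' (f := fun n : ℕ => G ^ n) 1).2 hs
    simpa using this
  intro x y
  have h1 := (hs1.mapL (entL x y)).mul_left (D x - D y)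
  have h2 := hB.mapL (entL x y)
  have h3 : (D x - D y) * ent (Ring.inverse (1 - G) - 1) x y =
      ent (Ring.inverse (1 - G) * G' * Ring.inverse (1 - G)) x y := by
    have e : (fun n : ℕ => (D x - D y) * entL x y (G ^ (n + 1))) =
        fun n => entL x y (∑ k ∈ Finset.range (n + 1), G ^ k * G' * G ^ (n - k)) :=
      funext fun n => h.pow n x y
    rw [e] at h1
    exact h1.unique h2
  have h4 := Itw.one D x y
  rw [ent_sub, mul_sub, h4] at h3
  simpa using h3

/-! ### The indefinite adjoint -/

/-- Adjoint with respect to the indefinite form given by a sign operator `σ`. -/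
def kstar (σ A : Op J) : Op J := σ * star A * σ

lemma kstar_mul {σ : Op J} (hσ : σ * σ = 1) (A B : Op J) :
    kstar σ (A * B) = kstar σ B * kstar σ A := by
  simp only [kstar, star_mul]
  calc σ * (star B * star A) * σ = σ * star B * 1 * star A * σ := by simp only [mul_assoc, mul_one]
    _ = _ := by rw [← hσ]; simp only [mul_assoc]

lemma kstar_add (σ A B : Op J) : kstar σ (A + B) = kstar σ A + kstar σ B := by
  simp [kstar, mul_add, add_mul]

lemma kstar_sub (σ A B : Op J) : kstar σ (A - B) = kstar σ A - kstar σ B := by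
  simp [kstar, mul_sub, sub_mul]

lemma kstar_one {σ : Op J} (hσ : σ * σ = 1) : kstar σ (1 : Op J) = 1 := by
  simp [kstar, hσ]

lemma continuous_kstar (σ : Op J) : Continuous (kstar σ) := by
  unfold kstar; fun_prop

lemma ent_kstar {s : J → ℂ} {C : ℝ} (h : ∀ x, ‖s x‖ ≤ C) (A : Op J) (x y : J) :
    ent (kstar (diagOp s) A) x y = s x * starRingEnd ℂ (ent A y x) * s y := by
  rw [kstar, ent_mul_diagOp h, ent_diagOp_mul h, ent_star]

lemma Itw.kstar {D D' s : J → ℂ} {C : ℝ} (hs : ∀ x, ‖s x‖ ≤ C)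
    (hD : ∀ x, starRingEnd ℂ (D x) = -D x) (hD' : ∀ x, starRingEnd ℂ (D' x) = -D' x)
    {A B : Op J} (h : Itw D D' A B) : Itw D' D (kstar (diagOp s) A) (kstar (diagOp s) B) := by
  intro x y
  rw [ent_kstar hs, ent_kstar hs, ← h y x, map_mul, map_sub, hD, hD']
  ring

/-! ### Matrices with a symmetry -/

/-- Operators whose matrix is invariant under a relabelling of the index set followed by a
continuous endomorphism of `ℂ`. -/
def symSubring (σ : J ≃ J) (c : ℂ →+* ℂ) (hc : Continuous c) : Subring (Op J) where
  carrier := {A | ∀ x y, ent A (σ x) (σ y) = c (ent A x y)}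
  mul_mem' := by
    intro A B hA hB x y
    have h1 := (σ.hasSum_iff).2 (hasSum_ent_mul A B (σ x) (σ y))
    have h2 := (hasSum_ent_mul A B x y).map c.toAddMonoidHom hc
    have e : (fun z => ent A (σ x) z * ent B z (σ y)) ∘ σ =
        c.toAddMonoidHom ∘ fun z => ent A x z * ent B z y := by
      ext z
      change ent A (σ x) (σ z) * ent B (σ z) (σ y) = c (ent A x z * ent B z y)
      rw [hA x z, hB z y, map_mul]
    rw [e] at h1
    exact h1.unique h2
  one_mem' := by
    intro x y
    by_cases hxy : x = y
    · subst hxy; simp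
    · rw [ent_one_ne hxy, ent_one_ne (σ.injective.ne hxy), map_zero]
  add_mem' := by
    intro A B hA hB x y
    rw [ent_add, hA, hB, ent_add, map_add]
  zero_mem' := by intro x y; simp
  neg_mem' := by
    intro A hA x y
    rw [ent_neg, hA, ent_neg, map_neg]

lemma mem_symSubring {σ : J ≃ J} {c : ℂ →+* ℂ} {hc : Continuous c} {A : Op J} :
    A ∈ symSubring σ c hc ↔ ∀ x y, ent A (σ x) (σ y) = c (ent A x y) := Iff.rfl

lemma isClosed_symSubring (σ : J ≃ J) (c : ℂ →+* ℂ) (hc : Continuous c) :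
    IsClosed (symSubring σ c hc : Set (Op J)) := by
  have : (symSubring σ c hc : Set (Op J)) =
      ⋂ x, ⋂ y, {A | ent A (σ x) (σ y) = c (ent A x y)} := by
    ext A; simp [mem_symSubring]
  rw [this]
  exact isClosed_iInter fun x => isClosed_iInter fun y =>
    isClosed_eq (entL _ _).continuous (hc.comp (entL x y).continuous)

lemma inverse_mem_symSubring {σ : J ≃ J} {c : ℂ →+* ℂ} {hc : Continuous c} {G : Op J}
    (hG : G ∈ symSubring σ c hc) (h : ‖G‖ < 1) : Ring.inverse (1 - G) ∈ symSubring σ c hc :=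
  (isClosed_symSubring σ c hc).mem_of_tendsto (hasSum_inverse_one_sub h).tendsto_sum_nat
    (Filter.Eventually.of_forall fun _ => sum_mem fun i _ => pow_mem hG i)

/-! ### One step of diagonalization -/

/-- The remainder after the change of variables given by the Cayley transform of `G`. -/
def cayleyRem (P Z R G : Op J) : Op J :=
  R + Ring.inverse (1 - -G) *
    (P * G - G * P + (Z * G - G * Z) - G * P * G + G * Z * G) * Ring.inverse (1 - G)

/-- The Cayley transform `(1 - G)⁻¹ (1 + G)`. -/
def cayley (G : Op J) : Op J := Ring.inverse (1 - G) * (1 + G)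

lemma isUnit_one_sub {G : Op J} (h : ‖G‖ < 1) : IsUnit (1 - G) :=
  ⟨Units.oneSub G h, rfl⟩

lemma cayley_itw {D D' z : J → ℂ} {C : ℝ} (hz : ∀ x, ‖z x‖ ≤ C) (hD' : ∀ x, D' x = D x + z x)
    {P R G G' : Op J} (hG : ‖G‖ < 1) (h : Itw D D G G')
    (h2 : G' + G' = diagOp z + R - P) :
    Itw D D' (cayley G)
      (cayley G * cayleyRem P (diagOp z + R) R G - P * cayley G) := by
  have hG' : ‖-G‖ < 1 := by rwa [norm_neg]
  set S := Ring.inverse (1 - G) with hS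
  set T := Ring.inverse (1 - -G) with hT
  set Z := diagOp z + R with hZ
  have S1 : S * (1 - G) = 1 := Ring.inverse_mul_cancel _ (isUnit_one_sub hG)
  have S2 : (1 - G) * S = 1 := Ring.mul_inverse_cancel _ (isUnit_one_sub hG)
  have T1 : T * (1 + G) = 1 := by
    rw [hT, ← sub_neg_eq_add]; exact Ring.inverse_mul_cancel _ (isUnit_one_sub hG')
  have T2 : (1 + G) * T = 1 := by
    rw [hT, ← sub_neg_eq_add]; exact Ring.mul_inverse_cancel _ (isUnit_one_sub hG')
  have hcomm : S * (1 + G) = (1 + G) * S := by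
    calc S * (1 + G) = S * (1 + G) * ((1 - G) * S) := by rw [S2, mul_one]
      _ = S * ((1 + G) * (1 - G)) * S := by simp only [mul_assoc]
      _ = S * ((1 - G) * (1 + G)) * S := by congr 2; noncomm_ring
      _ = S * (1 - G) * ((1 + G) * S) := by simp only [mul_assoc]
      _ = _ := by rw [S1, one_mul]
  have hI : Itw D D (cayley G) (S * G' * S * (1 + G) + S * G') := by
    have h1 : Itw D D (1 + G) G' := by simpa using (Itw.one D).add h
    exact (h.inverse_one_sub hG).mul h1
  have e1 : S * G' * S * (1 + G) + S * G' = S * (Z - P) * S := by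
    calc S * G' * S * (1 + G) + S * G' = S * G' * (S * (1 + G)) + S * G' * ((1 - G) * S) := by
          rw [S2, mul_one, mul_assoc _ S]
      _ = S * (G' + G') * S := by rw [hcomm]; noncomm_ring
      _ = _ := by rw [h2]
  have e2 : diagOp z + cayleyRem P Z R G = T * (Z + P * G - G * P - G * P * G) * S := by
    have : Z = T * ((1 + G) * Z * (1 - G)) * S := by
      calc Z = (T * (1 + G)) * Z * ((1 - G) * S) := by rw [T1, S2, one_mul, mul_one]
        _ = _ := by simp only [mul_assoc]
    calc diagOp z + cayleyRem P Z R G = Z + T *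
          (P * G - G * P + (Z * G - G * Z) - G * P * G + G * Z * G) * S := by
          rw [cayleyRem, ← add_assoc]
      _ = T * ((1 + G) * Z * (1 - G)) * S + T *
          (P * G - G * P + (Z * G - G * Z) - G * P * G + G * Z * G) * S := by rw [← this]
      _ = T * ((1 + G) * Z * (1 - G) +
          (P * G - G * P + (Z * G - G * Z) - G * P * G + G * Z * G)) * S := by
          rw [← add_mul, ← mul_add]
      _ = _ := by congr 2; noncomm_ring
  have e3 : cayley G * (diagOp z + cayleyRem P Z R G) - P * cayley G = S * (Z - P) * S := by
    have a1 : cayley G * (diagOp z + cayleyRem P Z R G) =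
        S * (Z + P * G - G * P - G * P * G) * S := by
      rw [e2, cayley]
      calc S * (1 + G) * (T * (Z + P * G - G * P - G * P * G) * S) =
          S * ((1 + G) * T) * (Z + P * G - G * P - G * P * G) * S := by simp only [mul_assoc]
        _ = _ := by rw [T2, mul_one]
    have a2 : P * cayley G = S * ((1 - G) * P * (1 + G)) * S := by
      rw [cayley, hcomm]
      calc P * ((1 + G) * S) = (S * (1 - G)) * P * (1 + G) * S := by
            rw [S1, one_mul]; simp only [mul_assoc]
        _ = _ := by simp only [mul_assoc]
    rw [a1, a2, ← sub_mul, ← mul_sub]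
    congr 2; noncomm_ring
  intro x y
  have h1 := hI x y
  rw [e1, ← e3] at h1
  have h3 : ent (cayley G * diagOp z) x y = ent (cayley G) x y * z y := ent_mul_diagOp hz _ x y
  rw [mul_add, add_sub_right_comm, ent_add, ent_sub, h3] at h1
  rw [hD', ent_sub]
  linear_combination h1

lemma kstar_cayley_mul {σ : Op J} (hσ : σ * σ = 1) {G : Op J} (hG : ‖G‖ < 1)
    (h : kstar σ G = -G) :
    kstar σ (Ring.inverse (1 - G)) = Ring.inverse (1 - -G) ∧
    kstar σ (Ring.inverse (1 - -G)) = Ring.inverse (1 - G) ∧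
    kstar σ (cayley G) * cayley G = 1 ∧ cayley G * kstar σ (cayley G) = 1 := by
  have hG' : ‖-G‖ < 1 := by rwa [norm_neg]
  set S := Ring.inverse (1 - G) with hS
  set T := Ring.inverse (1 - -G) with hT
  have S1 : S * (1 - G) = 1 := Ring.inverse_mul_cancel _ (isUnit_one_sub hG)
  have S2 : (1 - G) * S = 1 := Ring.mul_inverse_cancel _ (isUnit_one_sub hG)
  have T1 : T * (1 + G) = 1 := by
    rw [hT, ← sub_neg_eq_add]; exact Ring.inverse_mul_cancel _ (isUnit_one_sub hG')
  have T2 : (1 + G) * T = 1 := by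
    rw [hT, ← sub_neg_eq_add]; exact Ring.mul_inverse_cancel _ (isUnit_one_sub hG')
  have k1 : kstar σ (1 - G) = 1 + G := by rw [kstar_sub, kstar_one hσ, h, sub_neg_eq_add]
  have k2 : kstar σ (1 + G) = 1 - G := by rw [kstar_add, kstar_one hσ, h, sub_eq_add_neg]
  have hS' : kstar σ S = T := by
    have : kstar σ S * (1 + G) = 1 := by rw [← k1, ← kstar_mul hσ, S2, kstar_one hσ]
    calc kstar σ S = kstar σ S * ((1 + G) * T) := by rw [T2, mul_one]
      _ = T := by rw [← mul_assoc, this, one_mul]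
  have hT' : kstar σ T = S := by
    have : kstar σ T * (1 - G) = 1 := by rw [← k2, ← kstar_mul hσ, T2, kstar_one hσ]
    calc kstar σ T = kstar σ T * ((1 - G) * S) := by rw [S2, mul_one]
      _ = S := by rw [← mul_assoc, this, one_mul]
  have hk : kstar σ (cayley G) = (1 - G) * T := by
    rw [cayley, kstar_mul hσ, k2, hS']
  refine ⟨hS', hT', ?_, ?_⟩
  · have c1 : T * S = S * T := by
      calc T * S = T * S * ((1 + G) * T) := by rw [T2, mul_one]
        _ = T * S * ((1 + G) * ((1 - G) * S) * T) := by rw [S2, mul_one]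
        _ = T * S * ((1 + G) * (1 - G)) * S * T := by simp only [mul_assoc]
        _ = T * S * ((1 - G) * (1 + G)) * S * T := by
            congr 3; noncomm_ring
        _ = T * (S * (1 - G)) * (1 + G) * S * T := by simp only [mul_assoc]
        _ = _ := by rw [S1, mul_one, T1, one_mul]
    rw [hk, cayley]
    calc (1 - G) * T * (S * (1 + G)) = (1 - G) * (T * S) * (1 + G) := by simp only [mul_assoc]
      _ = ((1 - G) * S) * (T * (1 + G)) := by rw [c1]; simp only [mul_assoc]
      _ = 1 := by rw [S2, T1, one_mul]
  · rw [hk, cayley]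
    calc S * (1 + G) * ((1 - G) * T) = S * ((1 + G) * (1 - G)) * T := by simp only [mul_assoc]
      _ = S * ((1 - G) * (1 + G)) * T := by congr 2; noncomm_ring
      _ = (S * (1 - G)) * ((1 + G) * T) := by simp only [mul_assoc]
      _ = 1 := by rw [S1, T2, one_mul]

lemma kstar_cayleyRem {σ : Op J} (hσ : σ * σ = 1) {P Z R G : Op J} (hG : ‖G‖ < 1)
    (h : kstar σ G = -G) (hP : kstar σ P = -P) (hZ : kstar σ Z = -Z) (hR : kstar σ R = -R) :
    kstar σ (cayleyRem P Z R G) = -cayleyRem P Z R G := by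
  obtain ⟨h1, h2, -, -⟩ := kstar_cayley_mul hσ hG h
  rw [cayleyRem, kstar_add, kstar_mul hσ, kstar_mul hσ, h1, h2, hR]
  simp only [kstar_add, kstar_sub, kstar_mul hσ, h, hP, hZ]
  rw [neg_add, ← mul_assoc, ← neg_mul, ← mul_neg]
  congr 3
  noncomm_ring

end Algebra

/-! ### Brackets and lattice lengths -/

lemma one_le_bracket (x : ℝ) : 1 ≤ bracket x := by
  rw [bracket, Real.one_le_sqrt]; nlinarith [sq_nonneg x]

lemma bracket_pos (x : ℝ) : 0 < bracket x := lt_of_lt_of_le one_pos (one_le_bracket x)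

lemma abs_le_bracket (x : ℝ) : |x| ≤ bracket x := by
  rw [bracket]; apply Real.abs_le_sqrt; linarith

lemma bracket_le_one_add (x : ℝ) : bracket x ≤ 1 + |x| := by
  rw [bracket]; apply Real.sqrt_le_iff.2
  constructor
  · positivity
  · nlinarith [abs_nonneg x, sq_abs x]

lemma bracket_mono {x y : ℝ} (h : |x| ≤ |y|) : bracket x ≤ bracket y := by
  rw [bracket, bracket]
  apply Real.sqrt_le_sqrt
  have := sq_le_sq.2 h
  linarith

lemma bracket_le_add (x y : ℝ) : bracket x ≤ bracket y + |x - y| := by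
  have h1 := abs_le_bracket y
  have h2 : bracket y ^ 2 = 1 + y ^ 2 := Real.sq_sqrt (by positivity)
  rw [bracket]; apply Real.sqrt_le_iff.2
  have h3 := bracket_pos y
  refine ⟨by positivity, ?_⟩
  have h4 : y * (x - y) ≤ bracket y * |x - y| := by
    calc y * (x - y) ≤ |y * (x - y)| := le_abs_self _
      _ = |y| * |x - y| := abs_mul _ _
      _ ≤ _ := by gcongr
  nlinarith [sq_abs (x - y)]

lemma bracket_le_mul (x y : ℝ) : bracket x ≤ bracket y * (1 + |x - y|) := by
  have := bracket_le_add x y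
  nlinarith [one_le_bracket y, abs_nonneg (x - y)]

section Lattice

variable {ν : ℕ}

lemma absK_eq_norm (k : Fin ν → ℤ) :
    absK k = ‖(WithLp.toLp 2 (fun i => (k i : ℝ)) : EuclideanSpace ℝ (Fin ν))‖ := by
  rw [EuclideanSpace.norm_eq, absK]; simp

lemma absK_nonneg (k : Fin ν → ℤ) : 0 ≤ absK k := Real.sqrt_nonneg _

lemma absK_zero : absK (0 : Fin ν → ℤ) = 0 := by simp [absK]

lemma absK_neg (k : Fin ν → ℤ) : absK (-k) = absK k := by simp [absK]

lemma absK_add_le (k l : Fin ν → ℤ) : absK (k + l) ≤ absK k + absK l := by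
  rw [absK_eq_norm, absK_eq_norm, absK_eq_norm]
  refine le_trans (le_of_eq ?_) (norm_add_le _ _)
  congr 1; ext i; simp

lemma absK_sub_le (k l m : Fin ν → ℤ) : absK (k - m) ≤ absK (k - l) + absK (l - m) := by
  have := absK_add_le (k - l) (l - m)
  simpa using this

lemma abs_apply_le_absK (k : Fin ν → ℤ) (i : Fin ν) : |(k i : ℝ)| ≤ absK k := by
  rw [absK]; apply Real.abs_le_sqrt
  exact Finset.single_le_sum (f := fun i => (k i : ℝ) ^ 2) (fun i _ => sq_nonneg _)
    (Finset.mem_univ i)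

lemma one_le_absK {k : Fin ν → ℤ} (hk : k ≠ 0) : 1 ≤ absK k := by
  obtain ⟨i, hi⟩ := Function.ne_iff.1 hk
  refine le_trans ?_ (abs_apply_le_absK k i)
  have : 1 ≤ |k i| := Int.one_le_abs hi
  exact_mod_cast this

lemma dotK_add (k l : Fin ν → ℤ) (a : Fin ν → ℝ) : dotK (k + l) a = dotK k a + dotK l a := by
  simp [dotK, add_mul, Finset.sum_add_distrib]

lemma dotK_neg (k : Fin ν → ℤ) (a : Fin ν → ℝ) : dotK (-k) a = -dotK k a := by
  simp [dotK]

lemma dotK_zero (a : Fin ν → ℝ) : dotK 0 a = 0 := by simp [dotK]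

lemma dotK_sub (k l : Fin ν → ℤ) (a : Fin ν → ℝ) : dotK (k - l) a = dotK k a - dotK l a := by
  rw [sub_eq_add_neg, dotK_add, dotK_neg, sub_eq_add_neg]

lemma abs_dotK_le (k : Fin ν → ℤ) (a : EuclideanSpace ℝ (Fin ν)) :
    |dotK k a| ≤ absK k * ‖a‖ := by
  rw [absK_eq_norm]
  refine le_trans (le_of_eq ?_) (abs_real_inner_le_norm _ a)
  congr 1
  simp [dotK, PiLp.inner_apply, mul_comm]

lemma abs_dotK_sub_le (k : Fin ν → ℤ) (a b : EuclideanSpace ℝ (Fin ν)) :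
    |dotK k a - dotK k b| ≤ absK k * ‖a - b‖ := by
  refine le_trans (le_of_eq ?_) (abs_dotK_le k (a - b))
  congr 1
  simp [dotK, mul_sub]

end Lattice

/-! ### Weights on the extended index set -/

/-- Modes of the pair, together with a frequency vector. -/
abbrev Idx (ν : ℕ) : Type := (ℕ+ ⊕ ℕ+) × (Fin ν → ℤ)

section Weights

variable {ν : ℕ}

lemma one_le_mode (a : ℕ+ ⊕ ℕ+) : 1 ≤ mode a := by
  rcases a with m | m <;> simp only [mode, Sum.elim_inl, Sum.elim_inr] <;>
    exact_mod_cast m.pos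

/-- Off-diagonal weight `e^{ρ|k|} (1 + |h|)^s`. -/
def wE (ρ s : ℝ) (x y : Idx ν) : ℝ :=
  Real.exp (ρ * absK (x.2 - y.2)) * (1 + |mode x.1 - mode y.1|) ^ s

/-- Weight measuring smoothing of order `α`. -/
def wV (α : ℝ) (x y : Idx ν) : ℝ := max (bracket (mode x.1)) (bracket (mode y.1)) ^ α

/-- Weight measuring boundedness after conjugation by powers up to `α`. -/
def wU (α : ℝ) (x y : Idx ν) : ℝ :=
  max (bracket (mode x.1) / bracket (mode y.1)) (bracket (mode y.1) / bracket (mode x.1)) ^ α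

/-- Weight for perturbations: smoothing on the diagonal blocks only. -/
def wP (ρ s α : ℝ) (x y : Idx ν) : ℝ≥0∞ :=
  ENNReal.ofReal (wE ρ s x y * if x.1.isLeft = y.1.isLeft then wV α x y else wU α x y)

/-- Weight for generators: smoothing on all blocks. -/
def wG (ρ s α : ℝ) (x y : Idx ν) : ℝ≥0∞ := ENNReal.ofReal (wE ρ s x y * wV α x y)

lemma absK_sub_comm (k l : Fin ν → ℤ) : absK (k - l) = absK (l - k) := by
  rw [← absK_neg, neg_sub]

lemma wE_comm (ρ s : ℝ) (x y : Idx ν) : wE ρ s x y = wE ρ s y x := by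
  rw [wE, wE, absK_sub_comm, abs_sub_comm]

lemma wV_comm (α : ℝ) (x y : Idx ν) : wV α x y = wV α y x := by rw [wV, wV, max_comm]
lemma wU_comm (α : ℝ) (x y : Idx ν) : wU α x y = wU α y x := by rw [wU, wU, max_comm]

lemma wE_pos (ρ s : ℝ) (x y : Idx ν) : 0 < wE ρ s x y := by unfold wE; positivity

lemma one_le_wE {ρ s : ℝ} (hρ : 0 ≤ ρ) (hs : 0 ≤ s) (x y : Idx ν) : 1 ≤ wE ρ s x y := by
  have h1 : 1 ≤ Real.exp (ρ * absK (x.2 - y.2)) :=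
    Real.one_le_exp (mul_nonneg hρ (absK_nonneg _))
  have h2 : 1 ≤ (1 + |mode x.1 - mode y.1|) ^ s := Real.one_le_rpow (by simp) hs
  calc (1 : ℝ) = 1 * 1 := by ring
    _ ≤ _ := mul_le_mul h1 h2 zero_le_one (by positivity)

lemma wE_self (ρ s : ℝ) (x : Idx ν) : wE ρ s x x = 1 := by simp [wE, absK_zero]

lemma wE_mono {ρ ρ' s : ℝ} (h : ρ' ≤ ρ) (x y : Idx ν) : wE ρ' s x y ≤ wE ρ s x y := by
  unfold wE; gcongr; exact absK_nonneg _

lemma wE_mul {ρ s : ℝ} (hρ : 0 ≤ ρ) (hs : 0 ≤ s) (x y z : Idx ν) :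
    wE ρ s x y ≤ wE ρ s x z * wE ρ s z y := by
  have h1 : Real.exp (ρ * absK (x.2 - y.2)) ≤
      Real.exp (ρ * absK (x.2 - z.2)) * Real.exp (ρ * absK (z.2 - y.2)) := by
    rw [← Real.exp_add, ← mul_add]; gcongr; exact absK_sub_le _ _ _
  have h2 : (1 + |mode x.1 - mode y.1|) ^ s ≤
      (1 + |mode x.1 - mode z.1|) ^ s * (1 + |mode z.1 - mode y.1|) ^ s := by
    rw [← Real.mul_rpow (by positivity) (by positivity)]
    gcongr
    have := abs_sub_le (mode x.1) (mode z.1) (mode y.1)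
    nlinarith [abs_nonneg (mode x.1 - mode z.1), abs_nonneg (mode z.1 - mode y.1)]
  calc wE ρ s x y ≤ _ := mul_le_mul h1 h2 (by positivity) (by positivity)
    _ = _ := by unfold wE; ring

lemma one_le_max_div {a b : ℝ} (ha : 0 < a) (hb : 0 < b) : 1 ≤ max (a / b) (b / a) := by
  rcases le_total a b with h | h
  · exact le_max_of_le_right ((one_le_div ha).2 h)
  · exact le_max_of_le_left ((one_le_div hb).2 h)

lemma one_le_wU {α : ℝ} (hα : 0 ≤ α) (x y : Idx ν) : 1 ≤ wU α x y :=
  Real.one_le_rpow (one_le_max_div (bracket_pos _) (bracket_pos _)) hα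

lemma one_le_wV {α : ℝ} (hα : 0 ≤ α) (x y : Idx ν) : 1 ≤ wV α x y :=
  Real.one_le_rpow (le_max_of_le_left (one_le_bracket _)) hα

lemma wU_le_wV {α : ℝ} (hα : 0 ≤ α) (x y : Idx ν) : wU α x y ≤ wV α x y := by
  unfold wU wV
  refine Real.rpow_le_rpow (le_max_of_le_left (by
    have := bracket_pos (mode x.1); have := bracket_pos (mode y.1); positivity)) ?_ hα
  apply max_le_max
  · exact div_le_self (bracket_pos _).le (one_le_bracket _)
  · exact div_le_self (bracket_pos _).le (one_le_bracket _)

lemma wV_le_wU_mul {α : ℝ} (hα : 0 ≤ α) (x y z : Idx ν) : wV α x y ≤ wU α x z * wV α z y := by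
  unfold wU wV
  have hx := bracket_pos (mode x.1)
  have hy := bracket_pos (mode y.1)
  have hz := bracket_pos (mode z.1)
  set a := bracket (mode x.1)
  set b := bracket (mode y.1)
  set c := bracket (mode z.1)
  have hU := one_le_max_div hx hz
  rw [← Real.mul_rpow (by linarith) (le_max_of_le_left hz.le)]
  refine Real.rpow_le_rpow (le_max_of_le_left hx.le) (max_le ?_ ?_) hα
  · calc a = a / c * c := by field_simp
      _ ≤ _ := mul_le_mul (le_max_left _ _) (le_max_left _ _) hz.le (by linarith)
  · calc b = 1 * b := by ring
      _ ≤ _ := mul_le_mul hU (le_max_right _ _) hy.le (by linarith)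

lemma wG_le_wP_mul {ρ s α : ℝ} (hρ : 0 ≤ ρ) (hs : 0 ≤ s) (hα : 0 ≤ α) (x y z : Idx ν) :
    wG ρ s α x y ≤ wP ρ s α x z * wG ρ s α z y := by
  unfold wG wP
  have hu : wU α x z ≤ if x.1.isLeft = z.1.isLeft then wV α x z else wU α x z := by
    split_ifs
    · exact wU_le_wV hα x z
    · exact le_rfl
  have h0 := one_le_wU hα x z
  rw [← ENNReal.ofReal_mul (mul_nonneg (wE_pos _ _ _ _).le (by linarith))]
  apply ENNReal.ofReal_le_ofReal
  calc wE ρ s x y * wV α x y ≤ (wE ρ s x z * wE ρ s z y) * (wU α x z * wV α z y) :=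
        mul_le_mul (wE_mul hρ hs x y z) (wV_le_wU_mul hα x y z)
          (by linarith [one_le_wV hα x y]) (mul_nonneg (wE_pos _ _ _ _).le (wE_pos _ _ _ _).le)
    _ = wE ρ s x z * wU α x z * (wE ρ s z y * wV α z y) := by ring
    _ ≤ _ := by
      have := wE_pos ρ s x z
      have := wE_pos ρ s z y
      have := one_le_wV hα z y
      gcongr

lemma wP_comm (ρ s α : ℝ) (x y : Idx ν) : wP ρ s α x y = wP ρ s α y x := by
  unfold wP
  rw [wE_comm, wV_comm, wU_comm]
  simp only [eq_comm]

lemma wG_comm (ρ s α : ℝ) (x y : Idx ν) : wG ρ s α x y = wG ρ s α y x := by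
  unfold wG; rw [wE_comm, wV_comm]

lemma wG_le_mul_wP {ρ s α : ℝ} (hρ : 0 ≤ ρ) (hs : 0 ≤ s) (hα : 0 ≤ α) (x y z : Idx ν) :
    wG ρ s α x y ≤ wG ρ s α x z * wP ρ s α z y := by
  rw [wG_comm, mul_comm, wP_comm, wG_comm (x := x)]
  exact wG_le_wP_mul hρ hs hα y x z

lemma wP_le_wG {ρ s α : ℝ} (hα : 0 ≤ α) (x y : Idx ν) : wP ρ s α x y ≤ wG ρ s α x y := by
  unfold wG wP
  apply ENNReal.ofReal_le_ofReal
  have := wE_pos ρ s x y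
  gcongr
  split_ifs
  · exact le_rfl
  · exact wU_le_wV hα x y

lemma wG_le_mul_wG {ρ s α : ℝ} (hρ : 0 ≤ ρ) (hs : 0 ≤ s) (hα : 0 ≤ α) (x y z : Idx ν) :
    wG ρ s α x y ≤ wG ρ s α x z * wG ρ s α z y :=
  (wG_le_mul_wP hρ hs hα x y z).trans (by gcongr; exact wP_le_wG hα z y)

lemma wE_le_wP {ρ s α : ℝ} (hα : 0 ≤ α) (x y : Idx ν) :
    ENNReal.ofReal (wE ρ s x y) ≤ wP ρ s α x y := by
  unfold wP
  apply ENNReal.ofReal_le_ofReal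
  refine le_mul_of_one_le_right (wE_pos _ _ _ _).le ?_
  split_ifs
  · exact one_le_wV hα x y
  · exact one_le_wU hα x y

lemma one_le_wP {ρ s α : ℝ} (hρ : 0 ≤ ρ) (hs : 0 ≤ s) (hα : 0 ≤ α) (x y : Idx ν) :
    1 ≤ wP ρ s α x y :=
  le_trans (by simpa using one_le_wE hρ hs x y) (wE_le_wP hα x y)

lemma one_le_wG {ρ s α : ℝ} (hρ : 0 ≤ ρ) (hs : 0 ≤ s) (hα : 0 ≤ α) (x y : Idx ν) :
    1 ≤ wG ρ s α x y := (one_le_wP hρ hs hα x y).trans (wP_le_wG hα x y)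

lemma wP_mono {ρ ρ' s α : ℝ} (h : ρ' ≤ ρ) (hα : 0 ≤ α) (x y : Idx ν) :
    wP ρ' s α x y ≤ wP ρ s α x y := by
  unfold wP
  apply ENNReal.ofReal_le_ofReal
  have : 0 ≤ if x.1.isLeft = y.1.isLeft then wV α x y else wU α x y := by
    split_ifs
    · linarith [one_le_wV hα x y]
    · linarith [one_le_wU hα x y]
  gcongr
  exact wE_mono h x y

end Weights

/-! ### The truncated reciprocal -/

/-- A Lipschitz function equal to `1/d` for `|d| ≥ δ`. -/
def gcut (δ d : ℝ) : ℝ := d / max |d| δ ^ 2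

lemma gcut_eq {δ d : ℝ} (h : δ ≤ |d|) : gcut δ d = 1 / d := by
  rw [gcut, max_eq_left h, sq_abs]
  by_cases hd : d = 0
  · simp [hd]
  · field_simp

lemma gcut_neg (δ d : ℝ) : gcut δ (-d) = -gcut δ d := by
  rw [gcut, gcut, abs_neg, neg_div]

lemma abs_gcut_le {δ : ℝ} (hδ : 0 < δ) (d : ℝ) : |gcut δ d| ≤ 1 / δ := by
  have hm : δ ≤ max |d| δ := le_max_right _ _
  have hm' : 0 < max |d| δ := by linarith
  rw [gcut, abs_div, abs_of_pos (pow_pos hm' 2)]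
  calc |d| / max |d| δ ^ 2 ≤ max |d| δ / max |d| δ ^ 2 := by gcongr; exact le_max_left _ _
    _ = 1 / max |d| δ := by field_simp
    _ ≤ 1 / δ := by gcongr

lemma abs_gcut_sub_le {δ : ℝ} (hδ : 0 < δ) (d e : ℝ) :
    |gcut δ d - gcut δ e| ≤ 3 / δ ^ 2 * |d - e| := by
  set m := max |d| δ with hm
  set n := max |e| δ with hn
  have hmδ : δ ≤ m := le_max_right _ _
  have hnδ : δ ≤ n := le_max_right _ _
  have hm0 : 0 < m := by linarith
  have hn0 : 0 < n := by linarith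
  have hmn : |n - m| ≤ |d - e| := by
    calc |n - m| ≤ |(|e| - |d|)| := by
          simpa [hm, hn] using abs_max_sub_max_le_abs |e| |d| δ
      _ ≤ |e - d| := abs_abs_sub_abs_le _ _
      _ = |d - e| := abs_sub_comm _ _
  have he : |e| ≤ n := le_max_left _ _
  have e1 : gcut δ d - gcut δ e = (d - e) / m ^ 2 + e * ((n - m) * (n + m)) / (m ^ 2 * n ^ 2) := by
    rw [gcut, gcut, ← hm, ← hn]; field_simp; ring
  have b1 : |(d - e) / m ^ 2| ≤ |d - e| * (1 / δ ^ 2) := by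
    rw [abs_div, abs_of_pos (pow_pos hm0 2), div_eq_mul_one_div]; gcongr
  have b2 : |e * ((n - m) * (n + m)) / (m ^ 2 * n ^ 2)| ≤ |d - e| * (2 / δ ^ 2) := by
    rw [abs_div, abs_mul, abs_mul, abs_of_pos (by positivity : 0 < n + m),
      abs_of_pos (by positivity : 0 < m ^ 2 * n ^ 2)]
    calc |e| * (|n - m| * (n + m)) / (m ^ 2 * n ^ 2)
        ≤ n * (|d - e| * (n + m)) / (m ^ 2 * n ^ 2) := by gcongr
      _ = |d - e| * (1 / (m * m) + 1 / (m * n)) := by field_simp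
      _ ≤ |d - e| * (1 / (δ * δ) + 1 / (δ * δ)) := by gcongr
      _ = _ := by ring
  rw [e1]
  calc _ ≤ _ := abs_add_le _ _
    _ ≤ |d - e| * (1 / δ ^ 2) + |d - e| * (2 / δ ^ 2) := add_le_add b1 b2
    _ = _ := by ring

section Step

variable {ν : ℕ}

/-- Eigenvalues and perturbation, at a stage of the iteration. -/
structure KState (ν : ℕ) where
  /-- The eigenvalues. -/
  μ : ℕ+ ⊕ ℕ+ → Freq ν → ℝ
  /-- The perturbation. -/
  P : Freq ν → Op (Idx ν)

/-- `j - l` inside a block and `j + l` between different blocks. -/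
def modeGap (x y : Idx ν) : ℝ :=
  if x.1.isLeft = y.1.isLeft then mode x.1 - mode y.1 else mode x.1 + mode y.1

/-- Threshold below which small divisors are truncated. -/
def thr (κ τ α : ℝ) (x y : Idx ν) : ℝ :=
  κ / 2 / bracket (absK (x.2 - y.2)) ^ τ * bracket (modeGap x y) ^ α

namespace KState

/-- Small divisors. -/
def sdiv (S : KState ν) (ω : Freq ν) (x y : Idx ν) : ℝ :=
  dotK (x.2 - y.2) ω + S.μ x.1 ω - S.μ y.1 ω

/-- The unbounded diagonal `-i (μ + ω·k)`. -/
def diag (S : KState ν) (ω : Freq ν) (x : Idx ν) : ℂ :=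
  -Complex.I * ((dotK x.2 ω + S.μ x.1 ω : ℝ) : ℂ)

open Classical in
/-- Matrix of the truncated solution of the homological equation. -/
def genMat (S : KState ν) (κ τ α N : ℝ) (ω : Freq ν) (x y : Idx ν) : ℂ :=
  if x ≠ y ∧ absK (x.2 - y.2) ≤ N then
    ent (S.P ω) x y * ((gcut (thr κ τ α x y) (S.sdiv ω x y) : ℝ) / (2 * Complex.I)) else 0

/-- The truncated solution of the homological equation. -/
def gen (S : KState ν) (κ τ α N : ℝ) (ω : Freq ν) : Op (Idx ν) := ofMat (S.genMat κ τ α N ω)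

open Classical in
/-- Matrix of the part of the perturbation with frequencies beyond the cutoff. -/
def restMat (S : KState ν) (N : ℝ) (ω : Freq ν) (x y : Idx ν) : ℂ :=
  if absK (x.2 - y.2) ≤ N then 0 else ent (S.P ω) x y

/-- The part of the perturbation with frequencies beyond the cutoff. -/
def rest (S : KState ν) (N : ℝ) (ω : Freq ν) : Op (Idx ν) := ofMat (S.restMat N ω)

/-- The diagonal of the perturbation. -/
def dg (S : KState ν) (ω : Freq ν) (x : Idx ν) : ℂ := ent (S.P ω) x x

/-- One step of the iteration. -/
def step (S : KState ν) (κ τ α N : ℝ) : KState ν where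
  μ := fun a ω => S.μ a ω - (ent (S.P ω) (a, 0) (a, 0)).im
  P := fun ω => cayleyRem (S.P ω) (diagOp (S.dg ω) + S.rest N ω) (S.rest N ω) (S.gen κ τ α N ω)

variable (S : KState ν) {κ τ α N : ℝ} {ω : Freq ν}

lemma norm_dg_le (x : Idx ν) : ‖S.dg ω x‖ ≤ ‖S.P ω‖ := norm_ent_le _ _ _

lemma rest_bdd (h : SchurBdd (ent (S.P ω))) : SchurBdd (S.restMat N ω) := by
  refine ne_top_of_le_ne_top h (schur_mono fun x y => ?_)
  gcongr
  unfold restMat; split_ifs <;> simp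

lemma ent_rest (h : SchurBdd (ent (S.P ω))) (x y : Idx ν) :
    ent (S.rest N ω) x y = S.restMat N ω x y := ent_ofMat (S.rest_bdd h) x y

lemma thr_pos (hκ : 0 < κ) (x y : Idx ν) : 0 < thr κ τ α x y := by
  unfold thr
  have := bracket_pos (absK (x.2 - y.2))
  have := bracket_pos (modeGap x y)
  positivity

lemma bracket_rpow_le {N τ : ℝ} (hτ : 0 ≤ τ) {k : Fin ν → ℤ} (hk : absK k ≤ N) :
    bracket (absK k) ^ τ ≤ (1 + N) ^ τ := by
  refine Real.rpow_le_rpow (bracket_pos _).le ?_ hτ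
  calc bracket (absK k) ≤ 1 + |absK k| := bracket_le_one_add _
    _ ≤ 1 + N := by rw [abs_of_nonneg (absK_nonneg k)]; linarith

lemma norm_two_I : ‖(2 * Complex.I : ℂ)‖ = 2 := by simp

lemma gen_bdd (hκ : 0 < κ) (hτ : 0 ≤ τ) (hα : 0 ≤ α) (h : SchurBdd (ent (S.P ω))) :
    SchurBdd (S.genMat κ τ α N ω) := by
  refine ne_top_of_le_ne_top (ENNReal.mul_ne_top (a := ENNReal.ofReal ((1 + N) ^ τ / κ))
    ENNReal.ofReal_ne_top h) (schur_le_mul _ fun x y => ?_)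
  rw [← mul_assoc]
  gcongr
  unfold genMat
  split_ifs with hxy
  · have h1 : thr κ τ α x y ≥ κ / 2 / (1 + N) ^ τ := by
      unfold thr
      have h2 := bracket_rpow_le hτ hxy.2
      have h3 : 1 ≤ bracket (modeGap x y) ^ α := Real.one_le_rpow (one_le_bracket _) hα
      have h4 := Real.rpow_pos_of_pos (bracket_pos (absK (x.2 - y.2))) τ
      calc κ / 2 / (1 + N) ^ τ ≤ κ / 2 / bracket (absK (x.2 - y.2)) ^ τ := by gcongr
        _ ≤ _ := le_mul_of_one_le_right (by positivity) h3
    have hN : 0 < 1 + N := by linarith [hxy.2, absK_nonneg (x.2 - y.2)]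
    rw [enorm_mul, mul_comm]
    gcongr
    rw [← ofReal_norm]
    apply ENNReal.ofReal_le_ofReal
    rw [norm_div, norm_two_I, Complex.norm_real, Real.norm_eq_abs]
    calc |gcut (thr κ τ α x y) (S.sdiv ω x y)| / 2 ≤ (1 / thr κ τ α x y) / 2 := by
          gcongr; exact abs_gcut_le (thr_pos hκ x y) _
      _ ≤ (1 / (κ / 2 / (1 + N) ^ τ)) / 2 := by gcongr
      _ = _ := by
        have : (0 : ℝ) < (1 + N) ^ τ := by positivity
        field_simp
  · simp

lemma ent_gen (hκ : 0 < κ) (hτ : 0 ≤ τ) (hα : 0 ≤ α) (h : SchurBdd (ent (S.P ω)))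
    (x y : Idx ν) : ent (S.gen κ τ α N ω) x y = S.genMat κ τ α N ω x y :=
  ent_ofMat (S.gen_bdd hκ hτ hα h) x y

/-- Growth factor of the homological equation. -/
def genConst (κ τ N : ℝ) : ℝ := 13 * ((1 + N) ^ τ) ^ 2 * (1 + N) / κ

variable {Ω : Set (Freq ν)} {ρ ρ' s : ℝ}

lemma schurBdd_of_famN (hρ : 0 ≤ ρ) (hs : 0 ≤ s) (hα : 0 ≤ α) {A : Freq ν → Op (Idx ν)}
    {k : ℝ≥0∞} (hP : famN Ω k (wP ρ s α) A ≠ ∞) (hω : ω ∈ Ω) : SchurBdd (ent (A ω)) :=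
  ne_top_of_le_ne_top hP ((schur_mono_weight _ (one_le_wP hρ hs hα)).trans
    (schur_entAbs_le_famN A hω))

lemma wV_le_gap (hα : 0 ≤ α) {x y : Idx ν} (h : x.1.isLeft ≠ y.1.isLeft) :
    wV α x y ≤ bracket (modeGap x y) ^ α := by
  unfold wV modeGap
  rw [if_neg h]
  have hx := one_le_mode x.1
  have hy := one_le_mode y.1
  refine Real.rpow_le_rpow (le_max_of_le_left (bracket_pos _).le) (max_le ?_ ?_) hα <;>
  · apply bracket_mono
    rw [abs_of_nonneg (by linarith), abs_of_nonneg (by linarith)]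
    linarith

lemma lipN_divisor_le (hκ : 0 < κ) (hτ : 0 ≤ τ) (hα : 0 ≤ α)
    (hμ : ∀ a, ∀ ω₁ ∈ Ω, ∀ ω₂ ∈ Ω, |S.μ a ω₁ - S.μ a ω₂| ≤ ‖ω₁ - ω₂‖) {x y : Idx ν}
    (hxy : absK (x.2 - y.2) ≤ N) :
    lipN Ω (ENNReal.ofReal κ)
      (fun ω => (((gcut (thr κ τ α x y) (S.sdiv ω x y) : ℝ) : ℂ) / (2 * Complex.I))) ≤
      ENNReal.ofReal (genConst κ τ N / bracket (modeGap x y) ^ α) := by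
  set δ := thr κ τ α x y with hδ
  have hδ0 : 0 < δ := thr_pos hκ x y
  set K := absK (x.2 - y.2) with hK
  have hK0 : 0 ≤ K := absK_nonneg _
  have h1 := lipN_le (Ω := Ω) (κ := ENNReal.ofReal κ)
    (f := fun ω => (((gcut δ (S.sdiv ω x y) : ℝ) : ℂ) / (2 * Complex.I)))
    (a := ENNReal.ofReal (1 / δ / 2)) (b := ENNReal.ofReal (3 / δ ^ 2 * (K + 2) / 2))
    (fun ω _ => by
      rw [← ofReal_norm]
      apply ENNReal.ofReal_le_ofReal
      rw [norm_div, norm_two_I, Complex.norm_real, Real.norm_eq_abs]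
      gcongr; exact abs_gcut_le hδ0 _)
    (fun ω₁ h₁ ω₂ h₂ => by
      rw [← ofReal_norm, edist_dist, ← ENNReal.ofReal_mul (by positivity), dist_eq_norm]
      apply ENNReal.ofReal_le_ofReal
      rw [← sub_div, norm_div, norm_two_I, ← Complex.ofReal_sub, Complex.norm_real,
        Real.norm_eq_abs]
      have e1 : |S.sdiv ω₁ x y - S.sdiv ω₂ x y| ≤ (K + 2) * ‖ω₁ - ω₂‖ := by
        have a1 := abs_dotK_sub_le (x.2 - y.2) ω₁ ω₂
        have a2 := hμ x.1 ω₁ h₁ ω₂ h₂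
        have a3 := hμ y.1 ω₁ h₁ ω₂ h₂
        have e : S.sdiv ω₁ x y - S.sdiv ω₂ x y =
          (dotK (x.2 - y.2) ω₁ - dotK (x.2 - y.2) ω₂) + (S.μ x.1 ω₁ - S.μ x.1 ω₂)
            - (S.μ y.1 ω₁ - S.μ y.1 ω₂) := by unfold sdiv; ring
        rw [e]
        calc _ ≤ |dotK (x.2 - y.2) ω₁ - dotK (x.2 - y.2) ω₂| + |S.μ x.1 ω₁ - S.μ x.1 ω₂| +
              |S.μ y.1 ω₁ - S.μ y.1 ω₂| :=
              (abs_sub _ _).trans (add_le_add (abs_add_le _ _) le_rfl)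
          _ ≤ K * ‖ω₁ - ω₂‖ + ‖ω₁ - ω₂‖ + ‖ω₁ - ω₂‖ := by gcongr
          _ = _ := by ring
      calc |gcut δ (S.sdiv ω₁ x y) - gcut δ (S.sdiv ω₂ x y)| / 2
          ≤ (3 / δ ^ 2 * |S.sdiv ω₁ x y - S.sdiv ω₂ x y|) / 2 := by
            gcongr; exact abs_gcut_sub_le hδ0 _ _
        _ ≤ (3 / δ ^ 2 * ((K + 2) * ‖ω₁ - ω₂‖)) / 2 := by gcongr
        _ = _ := by ring)
  refine h1.trans ?_
  rw [← ENNReal.ofReal_mul hκ.le, ← ENNReal.ofReal_add (by positivity) (by positivity)]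
  apply ENNReal.ofReal_le_ofReal
  set b := bracket K ^ τ with hb
  set B := bracket (modeGap x y) ^ α with hB
  have hb1 : 1 ≤ b := Real.one_le_rpow (one_le_bracket _) hτ
  have hB1 : 1 ≤ B := Real.one_le_rpow (one_le_bracket _) hα
  have hbN : b ≤ (1 + N) ^ τ := bracket_rpow_le hτ hxy
  have hδe : δ = κ / 2 / b * B := rfl
  have hb0 : 0 < b := by linarith
  have hB0 : 0 < B := by linarith
  calc 1 / δ / 2 + κ * (3 / δ ^ 2 * (K + 2) / 2)
      = 1 / (κ * B) * (b + 6 * (K + 2) * b ^ 2 / B) := by rw [hδe]; field_simp; ring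
    _ ≤ 1 / (κ * B) * (b ^ 2 + 6 * (K + 2) * b ^ 2) := by
        gcongr
        · nlinarith
        · exact div_le_self (by positivity) hB1
    _ ≤ 1 / (κ * B) * (13 * b ^ 2 * (1 + N)) := by
        gcongr
        nlinarith [sq_nonneg b]
    _ ≤ 1 / (κ * B) * (13 * ((1 + N) ^ τ) ^ 2 * (1 + N)) := by
        have : 0 ≤ 1 + N := by linarith
        gcongr
    _ = _ := by unfold genConst; field_simp

lemma famN_gen_le (hκ : 0 < κ) (hτ : 0 ≤ τ) (hα : 0 ≤ α) (hρ : 0 ≤ ρ) (hs : 0 ≤ s)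
    (hμ : ∀ a, ∀ ω₁ ∈ Ω, ∀ ω₂ ∈ Ω, |S.μ a ω₁ - S.μ a ω₂| ≤ ‖ω₁ - ω₂‖)
    (hP : famN Ω (ENNReal.ofReal κ) (wP ρ s α) S.P ≠ ∞) :
    famN Ω (ENNReal.ofReal κ) (wG ρ s α) (S.gen κ τ α N) ≤
      ENNReal.ofReal (genConst κ τ N) * famN Ω (ENNReal.ofReal κ) (wP ρ s α) S.P := by
  refine schur_le_mul _ fun x y => ?_
  have e : lipEnt Ω (ENNReal.ofReal κ) (S.gen κ τ α N) x y =
      lipN Ω (ENNReal.ofReal κ) (fun ω => S.genMat κ τ α N ω x y) :=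
    lipN_congr fun ω hω => S.ent_gen hκ hτ hα (schurBdd_of_famN hρ hs hα hP hω) x y
  rw [e]
  by_cases hxy : x ≠ y ∧ absK (x.2 - y.2) ≤ N
  · have h1 : lipN Ω (ENNReal.ofReal κ) (fun ω => S.genMat κ τ α N ω x y) ≤
        lipEnt Ω (ENNReal.ofReal κ) S.P x y *
          ENNReal.ofReal (genConst κ τ N / bracket (modeGap x y) ^ α) := by
      unfold genMat
      simp only [if_pos hxy]
      exact (lipN_mul_le _ _).trans (by
        gcongr
        · exact le_rfl
        · exact S.lipN_divisor_le hκ hτ hα hμ hxy.2)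
    have hN : 0 ≤ 1 + N := by linarith [hxy.2, absK_nonneg (x.2 - y.2)]
    have hC : 0 ≤ genConst κ τ N := by unfold genConst; positivity
    have hB1 : 1 ≤ bracket (modeGap x y) ^ α := Real.one_le_rpow (one_le_bracket _) hα
    have h2 : ENNReal.ofReal (genConst κ τ N / bracket (modeGap x y) ^ α) * wG ρ s α x y ≤
        ENNReal.ofReal (genConst κ τ N) * wP ρ s α x y := by
      unfold wG wP
      have hE := wE_pos ρ s x y
      rw [← ENNReal.ofReal_mul (by positivity), ← ENNReal.ofReal_mul hC]
      apply ENNReal.ofReal_le_ofReal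
      have h3 : wV α x y ≤ bracket (modeGap x y) ^ α *
          if x.1.isLeft = y.1.isLeft then wV α x y else wU α x y := by
        have hv := one_le_wV hα x y
        split_ifs with hb
        · nlinarith
        · have := wV_le_gap hα hb
          have := one_le_wU hα x y
          nlinarith
      calc genConst κ τ N / bracket (modeGap x y) ^ α * (wE ρ s x y * wV α x y)
          ≤ genConst κ τ N / bracket (modeGap x y) ^ α * (wE ρ s x y *
            (bracket (modeGap x y) ^ α *
              if x.1.isLeft = y.1.isLeft then wV α x y else wU α x y)) := by gcongr
        _ = _ := by field_simp
    calc lipN Ω (ENNReal.ofReal κ) (fun ω => S.genMat κ τ α N ω x y) * wG ρ s α x y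
        ≤ lipEnt Ω (ENNReal.ofReal κ) S.P x y *
          ENNReal.ofReal (genConst κ τ N / bracket (modeGap x y) ^ α) * wG ρ s α x y := by gcongr
      _ = lipEnt Ω (ENNReal.ofReal κ) S.P x y *
          (ENNReal.ofReal (genConst κ τ N / bracket (modeGap x y) ^ α) * wG ρ s α x y) := by ring
      _ ≤ lipEnt Ω (ENNReal.ofReal κ) S.P x y *
          (ENNReal.ofReal (genConst κ τ N) * wP ρ s α x y) := by gcongr
      _ = _ := by ring
  · unfold genMat
    simp only [if_neg hxy]
    have := lipN_const (Ω := Ω) (κ := ENNReal.ofReal κ) (0 : ℂ)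
    simp only [enorm_zero, nonpos_iff_eq_zero] at this
    rw [this]; simp

lemma lipN_zero {k : ℝ≥0∞} : lipN Ω k (fun _ => (0 : ℂ)) = 0 := by
  simpa using lipN_const (Ω := Ω) (κ := k) (0 : ℂ)

lemma famN_rest_le (hα : 0 ≤ α) (hρ : 0 ≤ ρ) (hs : 0 ≤ s) (hρ' : ρ' ≤ ρ)
    (hP : famN Ω (ENNReal.ofReal κ) (wP ρ s α) S.P ≠ ∞) :
    famN Ω (ENNReal.ofReal κ) (wP ρ' s α) (S.rest N) ≤
      ENNReal.ofReal (Real.exp (-(ρ - ρ') * N)) * famN Ω (ENNReal.ofReal κ) (wP ρ s α) S.P := by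
  refine schur_le_mul _ fun x y => ?_
  have e : lipEnt Ω (ENNReal.ofReal κ) (S.rest N) x y =
      lipN Ω (ENNReal.ofReal κ) (fun ω => S.restMat N ω x y) :=
    lipN_congr fun ω hω => S.ent_rest (schurBdd_of_famN hρ hs hα hP hω) x y
  rw [e]
  unfold restMat
  by_cases hxy : absK (x.2 - y.2) ≤ N
  · simp only [if_pos hxy, lipN_zero]; simp
  · simp only [if_neg hxy]
    have h2 : wP ρ' s α x y ≤ ENNReal.ofReal (Real.exp (-(ρ - ρ') * N)) * wP ρ s α x y := by
      unfold wP
      rw [← ENNReal.ofReal_mul (Real.exp_pos _).le]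
      apply ENNReal.ofReal_le_ofReal
      rw [← mul_assoc]
      have h0 : 0 ≤ if x.1.isLeft = y.1.isLeft then wV α x y else wU α x y := by
        split_ifs
        · linarith [one_le_wV hα x y]
        · linarith [one_le_wU hα x y]
      gcongr
      unfold wE
      rw [← mul_assoc, ← Real.exp_add]
      gcongr
      push Not at hxy
      nlinarith
    calc _ ≤ lipEnt Ω (ENNReal.ofReal κ) S.P x y *
          (ENNReal.ofReal (Real.exp (-(ρ - ρ') * N)) * wP ρ s α x y) := by
          gcongr; exact le_rfl
      _ = _ := by ring

lemma famN_diag_add_rest_le (hα : 0 ≤ α) (hρ : 0 ≤ ρ) (hs : 0 ≤ s) (hN : 0 ≤ N)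
    (hP : famN Ω (ENNReal.ofReal κ) (wP ρ s α) S.P ≠ ∞) :
    famN Ω (ENNReal.ofReal κ) (wP ρ s α) (fun ω => diagOp (S.dg ω) + S.rest N ω) ≤
      famN Ω (ENNReal.ofReal κ) (wP ρ s α) S.P := by
  refine schur_mono fun x y => ?_
  gcongr
  by_cases hxy : x = y
  · subst hxy
    refine le_of_eq (lipN_congr fun ω hω => ?_)
    rw [ent_add, ent_diagOp_self (S.norm_dg_le), S.ent_rest (schurBdd_of_famN hρ hs hα hP hω)]
    simp [restMat, absK_zero, hN, dg]
  · have e : lipEnt Ω (ENNReal.ofReal κ) (fun ω => diagOp (S.dg ω) + S.rest N ω) x y =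
        lipN Ω (ENNReal.ofReal κ) (fun ω => S.restMat N ω x y) :=
      lipN_congr fun ω hω => by
        rw [ent_add, ent_diagOp_ne (S.norm_dg_le) hxy,
          S.ent_rest (schurBdd_of_famN hρ hs hα hP hω), zero_add]
    rw [e]
    unfold restMat
    split_ifs
    · rw [lipN_zero]; exact zero_le
    · exact le_rfl

lemma famN_step_le (hα : 0 ≤ α) (hρ' : 0 ≤ ρ') (hρρ : ρ' ≤ ρ)
    (hs : 0 ≤ s) (hN : 0 ≤ N)
    (hP : famN Ω (ENNReal.ofReal κ) (wP ρ s α) S.P ≠ ∞)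
    (hG : famN Ω (ENNReal.ofReal κ) (wG ρ s α) (S.gen κ τ α N) ≤ 1 / 2) :
    famN Ω (ENNReal.ofReal κ) (wP ρ' s α) (S.step κ τ α N).P ≤
      ENNReal.ofReal (Real.exp (-(ρ - ρ') * N)) * famN Ω (ENNReal.ofReal κ) (wP ρ s α) S.P +
      24 * (famN Ω (ENNReal.ofReal κ) (wP ρ s α) S.P *
        famN Ω (ENNReal.ofReal κ) (wG ρ s α) (S.gen κ τ α N)) := by
  have hρ : 0 ≤ ρ := hρ'.trans hρρ
  set k := ENNReal.ofReal κ with hk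
  set p := famN Ω k (wP ρ s α) S.P with hp
  set g := famN Ω k (wG ρ s α) (S.gen κ τ α N) with hg
  set P := S.P with hPd
  set G := S.gen κ τ α N with hGd
  set Z : Freq ν → Op (Idx ν) := fun ω => diagOp (S.dg ω) + S.rest N ω with hZd
  have hz : famN Ω k (wP ρ s α) Z ≤ p := S.famN_diag_add_rest_le hα hρ hs hN hP
  have m1 := wG_le_wP_mul (ν := ν) hρ hs hα
  have m2 := wG_le_mul_wP (ν := ν) hρ hs hα
  have m3 := wG_le_mul_wG (ν := ν) hρ hs hα
  have hwg := one_le_wG (ν := ν) hρ hs hα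
  have hg1 : g ≤ 1 := hG.trans (by simp)
  have hAG : ∀ A : Freq ν → Op (Idx ν), famN Ω k (wP ρ s α) A ≤ p →
      famN Ω k (wG ρ s α) (fun ω => A ω * G ω) ≤ p * g ∧
      famN Ω k (wG ρ s α) (fun ω => G ω * A ω) ≤ p * g ∧
      famN Ω k (wG ρ s α) (fun ω => G ω * A ω * G ω) ≤ p * g := by
    intro A hA
    have a1 : famN Ω k (wG ρ s α) (fun ω => G ω * A ω) ≤ p * g := by
      rw [mul_comm p]
      exact (famN_mul_le G A m2).trans (mul_le_mul' le_rfl hA)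
    refine ⟨(famN_mul_le A G m1).trans (mul_le_mul' hA le_rfl), a1, ?_⟩
    refine (famN_mul_le (fun ω => G ω * A ω) G m3).trans ?_
    calc _ ≤ p * g * g := by gcongr
      _ ≤ p * g * 1 := by gcongr
      _ = _ := mul_one _
  obtain ⟨p1, p2, p3⟩ := hAG P le_rfl
  obtain ⟨z1, z2, z3⟩ := hAG Z hz
  set T : Freq ν → Op (Idx ν) := fun ω =>
    P ω * G ω - G ω * P ω + (Z ω * G ω - G ω * Z ω) - G ω * P ω * G ω + G ω * Z ω * G ω with hT
  have hTb : famN Ω k (wG ρ s α) T ≤ 6 * (p * g) := by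
    calc famN Ω k (wG ρ s α) T ≤ (((p * g + p * g) + (p * g + p * g)) + p * g) + p * g := by
          refine (famN_add_le _ _ _).trans (add_le_add ?_ z3)
          refine (famN_sub_le _ _ _).trans (add_le_add ?_ p3)
          refine (famN_add_le _ _ _).trans (add_le_add ?_ ?_)
          · exact (famN_sub_le _ _ _).trans (add_le_add p1 p2)
          · exact (famN_sub_le _ _ _).trans (add_le_add z1 z2)
      _ = _ := by ring
  have hGn : famN Ω k (wG ρ s α) (fun ω => -G ω) ≤ 1 / 2 := by rw [famN_neg]; exact hG
  have h1 := famN_inverse_mul_le hwg m3 hGn T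
  have h2 := famN_mul_inverse_le hwg m3 hG (fun ω => Ring.inverse (1 - -G ω) * T ω)
  have h3 : famN Ω k (wP ρ' s α) (fun ω => Ring.inverse (1 - -G ω) * T ω *
      Ring.inverse (1 - G ω)) ≤ 24 * (p * g) := by
    calc _ ≤ famN Ω k (wG ρ s α) (fun ω => Ring.inverse (1 - -G ω) * T ω *
      Ring.inverse (1 - G ω)) := schur_mono_weight _ fun x y =>
            (wP_mono hρρ hα x y).trans (wP_le_wG hα x y)
      _ ≤ 2 * (2 * (6 * (p * g))) := h2.trans (by gcongr; exact h1.trans (by gcongr))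
      _ = _ := by ring
  exact (famN_add_le _ (S.rest N) _).trans
    (add_le_add (S.famN_rest_le hα hρ hs hρρ hP) h3)

end KState

end Step

section Symmetry

variable {ν : ℕ}

/-- Sign of the block. -/
def sgn (x : Idx ν) : ℂ := if x.1.isLeft then 1 else -1

lemma norm_sgn_le (x : Idx ν) : ‖sgn x‖ ≤ 1 := by unfold sgn; split_ifs <;> simp

lemma sgn_mul_sgn (x : Idx ν) : sgn x * sgn x = 1 := by unfold sgn; split_ifs <;> simp

/-- The operator `σ₃`. -/
def sig (ν : ℕ) : Op (Idx ν) := diagOp sgn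

lemma sig_mul_sig : sig ν * sig ν = 1 := by
  refine ent_ext fun x y => ?_
  rw [sig, ent_diagOp_mul norm_sgn_le]
  by_cases h : x = y
  · subst h; rw [ent_diagOp_self norm_sgn_le, sgn_mul_sgn, ent_one_self]
  · rw [ent_diagOp_ne norm_sgn_le h, ent_one_ne h, mul_zero]

/-- Translation of the frequencies. -/
def shiftIdx (a : Fin ν → ℤ) : Idx ν ≃ Idx ν := (Equiv.refl _).prodCongr (Equiv.addRight a)

/-- Exchange of the blocks and reflection of the frequencies. -/
def swapIdx (ν : ℕ) : Idx ν ≃ Idx ν := (Equiv.sumComm ℕ+ ℕ+).prodCongr (Equiv.neg _)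

@[simp] lemma shiftIdx_fst (a : Fin ν → ℤ) (x : Idx ν) : (shiftIdx a x).1 = x.1 := rfl
@[simp] lemma shiftIdx_snd (a : Fin ν → ℤ) (x : Idx ν) : (shiftIdx a x).2 = x.2 + a := rfl
@[simp] lemma swapIdx_fst (x : Idx ν) : (swapIdx ν x).1 = x.1.swap := rfl
@[simp] lemma swapIdx_snd (x : Idx ν) : (swapIdx ν x).2 = -x.2 := rfl

/-- Toeplitz operators in the frequencies. -/
abbrev toepRing (a : Fin ν → ℤ) : Subring (Op (Idx ν)) :=
  symSubring (shiftIdx a) (RingHom.id ℂ) continuous_id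

/-- Operators commuting with complex conjugation and exchange of the blocks. -/
abbrev conjRing (ν : ℕ) : Subring (Op (Idx ν)) :=
  symSubring (swapIdx ν) (starRingEnd ℂ) Complex.continuous_conj

/-- The symmetries of the perturbation. -/
structure OpSym (P : Op (Idx ν)) : Prop where
  skew : kstar (sig ν) P = -P
  toep : ∀ a, P ∈ toepRing a
  conj : P ∈ conjRing ν

lemma OpSym.of_multiplier {P A : Op (Idx ν)} (h : OpSym P) {m : Idx ν → Idx ν → ℂ}
    (hA : ∀ x y, ent A x y = ent P x y * m x y)
    (h1 : ∀ x y, starRingEnd ℂ (m y x) = m x y)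
    (h2 : ∀ a x y, m (shiftIdx a x) (shiftIdx a y) = m x y)
    (h3 : ∀ x y, m (swapIdx ν x) (swapIdx ν y) = starRingEnd ℂ (m x y)) : OpSym A where
  skew := by
    refine ent_ext fun x y => ?_
    have e := congrArg (fun B => ent B x y) h.skew
    simp only [ent_neg, sig, ent_kstar norm_sgn_le] at e
    rw [sig, ent_kstar norm_sgn_le, ent_neg, hA, hA, map_mul, h1, neg_mul_eq_neg_mul, ← e]
    ring
  toep := fun a => by
    rw [mem_symSubring]
    intro x y
    rw [hA, hA, h2, mem_symSubring.1 (h.toep a)]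
    rfl
  conj := by
    rw [mem_symSubring]
    intro x y
    rw [hA, hA, h3, mem_symSubring.1 h.conj, map_mul]

lemma isLeft_swap (a : ℕ+ ⊕ ℕ+) : a.swap.isLeft = !a.isLeft := by cases a <;> rfl

lemma mode_swap (a : ℕ+ ⊕ ℕ+) : mode a.swap = mode a := by cases a <;> rfl

lemma thr_comm (κ τ α : ℝ) (x y : Idx ν) : thr κ τ α y x = thr κ τ α x y := by
  have e : bracket (modeGap y x) = bracket (modeGap x y) := by
    unfold modeGap bracket
    by_cases h : x.1.isLeft = y.1.isLeft
    · rw [if_pos h, if_pos h.symm]; congr 2; ring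
    · rw [if_neg h, if_neg (Ne.symm h)]; congr 2; ring
  rw [thr, thr, e, absK_sub_comm]

lemma thr_shift (κ τ α : ℝ) (a : Fin ν → ℤ) (x y : Idx ν) :
    thr κ τ α (shiftIdx a x) (shiftIdx a y) = thr κ τ α x y := by
  unfold thr modeGap
  rw [shiftIdx_snd, shiftIdx_snd, add_sub_add_right_eq_sub]
  rfl

lemma absK_swap_sub (x y : Idx ν) :
    absK ((swapIdx ν x).2 - (swapIdx ν y).2) = absK (x.2 - y.2) := by
  rw [swapIdx_snd, swapIdx_snd, ← absK_neg]; congr 1; ring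

lemma thr_swap (κ τ α : ℝ) (x y : Idx ν) :
    thr κ τ α (swapIdx ν x) (swapIdx ν y) = thr κ τ α x y := by
  have e : modeGap (swapIdx ν x) (swapIdx ν y) = modeGap x y := by
    have h : ((swapIdx ν x).1.isLeft = (swapIdx ν y).1.isLeft) = (x.1.isLeft = y.1.isLeft) := by
      rw [swapIdx_fst, swapIdx_fst, isLeft_swap, isLeft_swap, Bool.not_inj_iff]
    unfold modeGap
    rw [swapIdx_fst, swapIdx_fst, mode_swap, mode_swap]
    simp only [← swapIdx_fst, h]
  rw [thr, thr, e, absK_swap_sub]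

namespace KState

variable (S : KState ν) {κ τ α N : ℝ} {ω : Freq ν}

/-- The symmetries of a stage of the iteration. -/
structure Sym (S : KState ν) (ω : Freq ν) : Prop where
  op : OpSym (S.P ω)
  odd : ∀ j, S.μ (Sum.inr j) ω = -S.μ (Sum.inl j) ω
  bdd : SchurBdd (ent (S.P ω))

variable {S}

lemma Sym.μ_swap (h : S.Sym ω) (a : ℕ+ ⊕ ℕ+) : S.μ a.swap ω = -S.μ a ω := by
  rcases a with j | j
  · exact h.odd j
  · simp [h.odd j]

lemma sdiv_comm (x y : Idx ν) : S.sdiv ω y x = -S.sdiv ω x y := by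
  unfold sdiv; rw [dotK_sub, dotK_sub]; ring

lemma sdiv_shift (a : Fin ν → ℤ) (x y : Idx ν) :
    S.sdiv ω (shiftIdx a x) (shiftIdx a y) = S.sdiv ω x y := by
  simp [sdiv]

lemma Sym.sdiv_swap (h : S.Sym ω) (x y : Idx ν) :
    S.sdiv ω (swapIdx ν x) (swapIdx ν y) = -S.sdiv ω x y := by
  simp only [sdiv, swapIdx_fst, swapIdx_snd, h.μ_swap, dotK_sub, dotK_neg]
  ring

lemma Sym.gen (h : S.Sym ω) (hκ : 0 < κ) (hτ : 0 ≤ τ) (hα : 0 ≤ α) :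
    OpSym (S.gen κ τ α N ω) := by
  classical
  refine h.op.of_multiplier (m := fun x y => if x ≠ y ∧ absK (x.2 - y.2) ≤ N then
    (((gcut (thr κ τ α x y) (S.sdiv ω x y) : ℝ) : ℂ) / (2 * Complex.I)) else 0) ?_ ?_ ?_ ?_
  · intro x y
    rw [S.ent_gen hκ hτ hα h.bdd]
    unfold genMat
    split_ifs <;> simp
  · intro x y
    rw [thr_comm, sdiv_comm, gcut_neg, absK_sub_comm]
    by_cases hxy : x = y
    · simp [hxy]
    · simp only [ne_eq, hxy, Ne.symm hxy, not_false_eq_true, true_and]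
      split_ifs
      · simp [Complex.conj_ofNat, neg_div, div_neg]
      · simp
  · intro a x y
    simp only [thr_shift, sdiv_shift, shiftIdx_snd, add_sub_add_right_eq_sub,
      (shiftIdx a).injective.ne_iff]
  · intro x y
    simp only [thr_swap, h.sdiv_swap, gcut_neg, absK_swap_sub, (swapIdx ν).injective.ne_iff]
    split_ifs
    · simp [Complex.conj_ofNat, neg_div, div_neg]
    · simp

lemma Sym.rest (h : S.Sym ω) : OpSym (S.rest N ω) := by
  classical
  refine h.op.of_multiplier (m := fun x y => if absK (x.2 - y.2) ≤ N then 0 else 1) ?_ ?_ ?_ ?_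
  · intro x y
    rw [S.ent_rest h.bdd]
    unfold restMat
    split_ifs <;> simp
  · intro x y
    rw [absK_sub_comm]
    split_ifs <;> simp
  · intro a x y
    simp only [shiftIdx_snd, add_sub_add_right_eq_sub]
  · intro x y
    simp only [absK_swap_sub]
    split_ifs <;> simp

lemma Sym.diagOp_dg (h : S.Sym ω) : OpSym (diagOp (S.dg ω)) := by
  classical
  refine h.op.of_multiplier (m := fun x y => if x = y then 1 else 0) ?_ ?_ ?_ ?_
  · intro x y
    by_cases hxy : x = y
    · subst hxy; rw [ent_diagOp_self S.norm_dg_le]; simp [dg]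
    · rw [ent_diagOp_ne S.norm_dg_le hxy]; simp [hxy]
  · intro x y
    by_cases hxy : x = y
    · simp [hxy]
    · simp [hxy, Ne.symm hxy]
  · intro a x y
    simp only [(shiftIdx a).injective.eq_iff]
  · intro x y
    simp only [(swapIdx ν).injective.eq_iff]
    split_ifs <;> simp

lemma cayleyRem_mem {R : Subring (Op (Idx ν))} {P Z Q G : Op (Idx ν)}
    (hi : ∀ A ∈ R, ‖A‖ < 1 → Ring.inverse (1 - A) ∈ R) (hG : ‖G‖ < 1) (h1 : P ∈ R) (h2 : Z ∈ R)
    (h3 : Q ∈ R) (h4 : G ∈ R) : cayleyRem P Z Q G ∈ R := by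
  unfold cayleyRem
  have i1 := hi G h4 hG
  have i2 := hi (-G) (R.neg_mem h4) (by rwa [norm_neg])
  refine R.add_mem h3 (R.mul_mem (R.mul_mem i2 ?_) i1)
  refine R.add_mem (R.sub_mem (R.add_mem ?_ ?_) ?_) ?_
  · exact R.sub_mem (R.mul_mem h1 h4) (R.mul_mem h4 h1)
  · exact R.sub_mem (R.mul_mem h2 h4) (R.mul_mem h4 h2)
  · exact R.mul_mem (R.mul_mem h4 h1) h4
  · exact R.mul_mem (R.mul_mem h4 h2) h4

lemma Sym.step (h : S.Sym ω) (hκ : 0 < κ) (hτ : 0 ≤ τ) (hα : 0 ≤ α)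
    (hG : ‖S.gen κ τ α N ω‖ < 1) (hbdd : SchurBdd (ent ((S.step κ τ α N).P ω))) :
    (S.step κ τ α N).Sym ω where
  op := by
    have g := h.gen (N := N) hκ hτ hα
    have r := h.rest (N := N)
    have d := h.diagOp_dg
    refine ⟨?_, fun a => ?_, ?_⟩
    · refine kstar_cayleyRem sig_mul_sig hG g.skew h.op.skew ?_ r.skew
      rw [kstar_add, d.skew, r.skew, neg_add]
    · exact cayleyRem_mem (fun A hA hA' => inverse_mem_symSubring hA hA') hG (h.op.toep a)
        (Subring.add_mem _ (d.toep a) (r.toep a)) (r.toep a) (g.toep a)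
    · exact cayleyRem_mem (fun A hA hA' => inverse_mem_symSubring hA hA') hG h.op.conj
        (Subring.add_mem _ d.conj r.conj) r.conj g.conj
  odd := fun j => by
    have e := mem_symSubring.1 h.op.conj (Sum.inl j, 0) (Sum.inl j, 0)
    have e2 : swapIdx ν (Sum.inl j, 0) = (Sum.inr j, 0) := by
      ext1 <;> simp
    rw [e2] at e
    simp only [KState.step, e, h.odd]
    simp
    ring
  bdd := hbdd

lemma Sym.dg_eq (h : S.Sym ω) (x : Idx ν) :
    S.dg ω x = Complex.I * ((ent (S.P ω) (x.1, 0) (x.1, 0)).im : ℝ) := by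
  have e := mem_symSubring.1 (h.op.toep x.2) (x.1, 0) (x.1, 0)
  have e2 : shiftIdx x.2 (x.1, 0) = x := by ext1 <;> simp
  rw [e2] at e
  have e3 := congrArg (fun B => ent B (x.1, 0) (x.1, 0)) h.op.skew
  simp only [ent_neg, sig, ent_kstar norm_sgn_le] at e3
  rw [mul_right_comm, sgn_mul_sgn, one_mul] at e3
  have e4 : (ent (S.P ω) (x.1, 0) (x.1, 0)).re = 0 := by
    have := congrArg Complex.re e3
    simp at this
    linarith
  rw [dg, e]
  apply Complex.ext <;> simp [e4]

/-- The homological equation is solved where the divisors are not truncated. -/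
lemma Sym.itw (h : S.Sym ω) (hκ : 0 < κ) (hτ : 0 ≤ τ) (hα : 0 ≤ α) (hN : 0 ≤ N)
    (hG : ‖S.gen κ τ α N ω‖ < 1)
    (hd : ∀ x y, x ≠ y → absK (x.2 - y.2) ≤ N → thr κ τ α x y ≤ |S.sdiv ω x y|) :
    Itw (S.diag ω) ((S.step κ τ α N).diag ω) (cayley (S.gen κ τ α N ω))
      (cayley (S.gen κ τ α N ω) * (S.step κ τ α N).P ω - S.P ω * cayley (S.gen κ τ α N ω)) := by
  refine cayley_itw (z := S.dg ω) (C := ‖S.P ω‖) (S.norm_dg_le)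
    (G' := (1 / 2 : ℂ) • (diagOp (S.dg ω) + S.rest N ω - S.P ω)) ?_ hG ?_ ?_
  · intro x
    rw [h.dg_eq]
    simp only [KState.diag, KState.step]
    push_cast
    ring
  · intro x y
    have e : S.diag ω x - S.diag ω y = -Complex.I * (S.sdiv ω x y : ℂ) := by
      simp only [KState.diag, sdiv, dotK_sub]; push_cast; ring
    rw [e, ent_smul, ent_sub, ent_add, S.ent_rest h.bdd, S.ent_gen hκ hτ hα h.bdd]
    unfold genMat restMat
    by_cases hxy : x = y
    · subst hxy
      rw [ent_diagOp_self S.norm_dg_le]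
      simp [absK_zero, hN, dg]
    · rw [ent_diagOp_ne S.norm_dg_le hxy]
      by_cases hk : absK (x.2 - y.2) ≤ N
      · have h1 := hd x y hxy hk
        have h2 : S.sdiv ω x y ≠ 0 := by
          intro h0
          rw [h0, abs_zero] at h1
          linarith [thr_pos (τ := τ) (α := α) hκ x y]
        rw [gcut_eq h1]
        have h3 : (S.sdiv ω x y : ℂ) ≠ 0 := by exact_mod_cast h2
        simp only [ne_eq, hxy, not_false_eq_true, hk, and_self, if_true]
        push_cast
        field_simp
        ring
      · simp [hk]
  · rw [← add_smul]; norm_num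

end KState

end Symmetry

section Iteration

variable {ν : ℕ}

/-- The iterates. -/
def kseq (S : KState ν) (κ τ α N : ℝ) : ℕ → KState ν
  | 0 => S
  | n + 1 => (kseq S κ τ α N n).step κ τ α (N * 4 ^ n)

/-- Generators of the iteration. -/
def kgen (S : KState ν) (κ τ α N : ℝ) (n : ℕ) : Freq ν → Op (Idx ν) :=
  (kseq S κ τ α N n).gen κ τ α (N * 4 ^ n)

/-- Analyticity widths. -/
def width (ρ : ℝ) (n : ℕ) : ℝ := ρ * (1 + (1 / 2) ^ n)

/-- Smallness conditions for the iteration. -/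
structure KamData (Ω : Set (Freq ν)) (κ τ α s ρ N θ A q : ℝ) (S : KState ν) : Prop where
  hκ : 0 < κ
  hτ : 0 ≤ τ
  hα : 0 ≤ α
  hs : 0 ≤ s
  hρ : 0 < ρ
  hN : 1 ≤ N
  hθ0 : 0 < θ
  hθ : θ ≤ 1 / 2
  hA : ∀ n : ℕ, 13 * ((1 + N * 4 ^ n) ^ τ) ^ 2 * (1 + N * 4 ^ n) * θ ^ n ≤ A * (1 / 4) ^ n
  hexp : Real.exp (-(ρ * N / 2)) ≤ θ / 2
  hq0 : 0 ≤ q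
  hq : 48 * A * q ≤ θ
  hP : famN Ω (ENNReal.ofReal κ) (wP (2 * ρ) s α) S.P ≤ ENNReal.ofReal (κ * q)
  hμ : ∀ a ω₁ ω₂, S.μ a ω₁ = S.μ a ω₂
  hsym : ∀ ω ∈ Ω, S.Sym ω

namespace KamData

variable {Ω : Set (Freq ν)} {κ τ α s ρ N θ A q : ℝ} {S : KState ν}

lemma width_pos (h : KamData Ω κ τ α s ρ N θ A q S) (n : ℕ) : 0 ≤ width ρ n := by
  have := h.hρ; unfold width; positivity

lemma width_ge (h : KamData Ω κ τ α s ρ N θ A q S) (n : ℕ) : ρ ≤ width ρ n := by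
  have := h.hρ
  unfold width
  exact le_mul_of_one_le_right this.le (by simp)

lemma A_ge (h : KamData Ω κ τ α s ρ N θ A q S) : 13 ≤ A := by
  have h1 := h.hA 0
  simp only [pow_zero, mul_one] at h1
  have h2 : 1 ≤ (1 + N) ^ τ := Real.one_le_rpow (by linarith [h.hN]) h.hτ
  nlinarith [h.hN, one_le_pow₀ (n := 2) h2]

lemma Aq_le (h : KamData Ω κ τ α s ρ N θ A q S) : A * q ≤ 1 / 96 := by
  have := h.hq; have := h.hθ; linarith

lemma q_le (h : KamData Ω κ τ α s ρ N θ A q S) : q ≤ 1 / 96 := by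
  have := h.Aq_le; have := h.A_ge; nlinarith [h.hq0]

/-- Estimates for one stage. -/
structure Stage (Ω : Set (Freq ν)) (κ τ α s ρ N θ q : ℝ) (S : KState ν) (n : ℕ) : Prop where
  bound : famN Ω (ENNReal.ofReal κ) (wP (width ρ n) s α) (kseq S κ τ α N n).P ≤
    ENNReal.ofReal (κ * (q * θ ^ n))
  lip : ∀ a, ∀ ω₁ ∈ Ω, ∀ ω₂ ∈ Ω,
    |(kseq S κ τ α N n).μ a ω₁ - (kseq S κ τ α N n).μ a ω₂| ≤ 2 * q * (1 - θ ^ n) * ‖ω₁ - ω₂‖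
  sym : ∀ ω ∈ Ω, (kseq S κ τ α N n).Sym ω

lemma gen_le (h : KamData Ω κ τ α s ρ N θ A q S) {n : ℕ} (hn : Stage Ω κ τ α s ρ N θ q S n) :
    famN Ω (ENNReal.ofReal κ) (wG (width ρ n) s α) (kgen S κ τ α N n) ≤
      ENNReal.ofReal (A * q * (1 / 4) ^ n) := by
  have hκ := h.hκ
  have hlip : ∀ a, ∀ ω₁ ∈ Ω, ∀ ω₂ ∈ Ω,
      |(kseq S κ τ α N n).μ a ω₁ - (kseq S κ τ α N n).μ a ω₂| ≤ ‖ω₁ - ω₂‖ := by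
    intro a ω₁ h₁ ω₂ h₂
    refine (hn.lip a ω₁ h₁ ω₂ h₂).trans (mul_le_of_le_one_left (norm_nonneg _) ?_)
    have := h.q_le
    have := h.hq0
    have := pow_pos h.hθ0 n
    nlinarith
  refine ((kseq S κ τ α N n).famN_gen_le hκ h.hτ h.hα (h.width_pos n) h.hs hlip
    (ne_top_of_le_ne_top ENNReal.ofReal_ne_top hn.bound)).trans ?_
  have hN0 : 0 ≤ 1 + N * 4 ^ n := by have := h.hN; positivity
  calc _ ≤ ENNReal.ofReal (KState.genConst κ τ (N * 4 ^ n)) *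
        ENNReal.ofReal (κ * (q * θ ^ n)) := by gcongr; exact hn.bound
    _ = ENNReal.ofReal (KState.genConst κ τ (N * 4 ^ n) * (κ * (q * θ ^ n))) := by
        have := Real.rpow_nonneg hN0 τ
        refine (ENNReal.ofReal_mul ?_).symm
        unfold KState.genConst
        positivity
    _ ≤ _ := by
        apply ENNReal.ofReal_le_ofReal
        calc KState.genConst κ τ (N * 4 ^ n) * (κ * (q * θ ^ n))
            = (13 * ((1 + N * 4 ^ n) ^ τ) ^ 2 * (1 + N * 4 ^ n) * θ ^ n) * q := by
              unfold KState.genConst; field_simp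
          _ ≤ (A * (1 / 4) ^ n) * q := by
              exact mul_le_mul_of_nonneg_right (h.hA n) h.hq0
          _ = _ := by ring

lemma gen_le_half (h : KamData Ω κ τ α s ρ N θ A q S) {n : ℕ}
    (hn : Stage Ω κ τ α s ρ N θ q S n) :
    famN Ω (ENNReal.ofReal κ) (wG (width ρ n) s α) (kgen S κ τ α N n) ≤ 1 / 2 := by
  refine (h.gen_le hn).trans ?_
  rw [show (1 / 2 : ℝ≥0∞) = ENNReal.ofReal (1 / 2) by
    rw [ENNReal.ofReal_div_of_pos (by norm_num)]; simp]
  apply ENNReal.ofReal_le_ofReal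
  have h1 := h.Aq_le
  have h2 : (1 / 4 : ℝ) ^ n ≤ 1 := pow_le_one₀ (by norm_num) (by norm_num)
  have h3 : 0 ≤ A * q := mul_nonneg (by linarith [h.A_ge]) h.hq0
  nlinarith

lemma norm_gen_lt (h : KamData Ω κ τ α s ρ N θ A q S) {n : ℕ}
    (hn : Stage Ω κ τ α s ρ N θ q S n) {ω : Freq ν} (hω : ω ∈ Ω) :
    ‖kgen S κ τ α N n ω‖ < 1 := by
  have h1 := (enorm_le_famN (κ := ENNReal.ofReal κ)
    (one_le_wG (h.width_pos n) h.hs h.hα) (kgen S κ τ α N n) hω).trans (h.gen_le_half hn)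
  rw [← ofReal_norm] at h1
  have h2 := (ENNReal.ofReal_le_iff_le_toReal (by simp)).1 h1
  norm_num at h2
  linarith

lemma wP_self (ρ s α : ℝ) (x : Idx ν) :
    wP ρ s α x x = ENNReal.ofReal (bracket (mode x.1) ^ α) := by
  simp [wP, wE_self, wV]

/-- The correction of an eigenvalue at one stage. -/
def corr (S : KState ν) (κ τ α N : ℝ) (n : ℕ) (a : ℕ+ ⊕ ℕ+) (ω : Freq ν) : ℝ :=
  (ent ((kseq S κ τ α N n).P ω) (a, 0) (a, 0)).im

lemma lipN_diag_le {n : ℕ}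
    (hn : Stage Ω κ τ α s ρ N θ q S n) (a : ℕ+ ⊕ ℕ+) :
    lipN Ω (ENNReal.ofReal κ) (corr S κ τ α N n a) * ENNReal.ofReal (bracket (mode a) ^ α) ≤
      ENNReal.ofReal (κ * (q * θ ^ n)) := by
  refine le_trans ?_ hn.bound
  have h1 := le_schur (wP (width ρ n) s α)
    (lipEnt Ω (ENNReal.ofReal κ) (kseq S κ τ α N n).P) (a, 0) (a, 0)
  rw [wP_self] at h1
  refine le_trans ?_ h1
  gcongr
  refine lipN_comp_le (fun ω _ => ?_) (fun ω₁ _ ω₂ _ => ?_)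
  · exact Complex.abs_im_le_norm _
  · rw [corr, corr, ← Complex.sub_im]
    exact Complex.abs_im_le_norm _

lemma abs_corr_le (h : KamData Ω κ τ α s ρ N θ A q S) {n : ℕ}
    (hn : Stage Ω κ τ α s ρ N θ q S n) (a : ℕ+ ⊕ ℕ+) {ω : Freq ν} (hω : ω ∈ Ω) :
    |corr S κ τ α N n a ω| * bracket (mode a) ^ α ≤ κ * (q * θ ^ n) := by
  have h0 := h.hκ; have h1 := h.hq0; have h2 := h.hθ0
  have hb := Real.rpow_pos_of_pos (bracket_pos (mode a)) α
  rw [← ENNReal.ofReal_le_ofReal_iff (by positivity), ENNReal.ofReal_mul (abs_nonneg _)]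
  refine le_trans ?_ (lipN_diag_le hn a)
  gcongr
  rw [← Real.norm_eq_abs, ofReal_norm]
  exact enorm_le_lipN _ hω

lemma abs_corr_sub_le (h : KamData Ω κ τ α s ρ N θ A q S) {n : ℕ}
    (hn : Stage Ω κ τ α s ρ N θ q S n) (a : ℕ+ ⊕ ℕ+) {ω₁ ω₂ : Freq ν} (h₁ : ω₁ ∈ Ω)
    (h₂ : ω₂ ∈ Ω) :
    |corr S κ τ α N n a ω₁ - corr S κ τ α N n a ω₂| ≤ q * θ ^ n * ‖ω₁ - ω₂‖ := by
  have h0 := h.hκ; have hq := h.hq0; have hθ := h.hθ0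
  have hb : 1 ≤ bracket (mode a) ^ α := Real.one_le_rpow (one_le_bracket _) h.hα
  have e1 : lipN Ω (ENNReal.ofReal κ) (corr S κ τ α N n a) ≤ ENNReal.ofReal (κ * (q * θ ^ n)) := by
    refine le_trans ?_ (lipN_diag_le hn a)
    refine le_mul_of_one_le_right' ?_
    simpa using hb
  have e2 := (mul_enorm_sub_le_lipN (κ := ENNReal.ofReal κ) (corr S κ τ α N n a) h₁ h₂).trans
    (mul_le_mul_left e1 _)
  rw [← ofReal_norm, edist_dist, dist_eq_norm, ← ENNReal.ofReal_mul h0.le,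
    ← ENNReal.ofReal_mul (by positivity), ENNReal.ofReal_le_ofReal_iff (by positivity),
    Real.norm_eq_abs, mul_assoc] at e2
  exact le_of_mul_le_mul_left e2 h0

lemma exp_width_le (h : KamData Ω κ τ α s ρ N θ A q S) (n : ℕ) :
    Real.exp (-(width ρ n - width ρ (n + 1)) * (N * 4 ^ n)) ≤ θ / 2 := by
  refine le_trans (Real.exp_le_exp.2 ?_) h.hexp
  have e : (width ρ n - width ρ (n + 1)) * (N * 4 ^ n) = ρ * N / 2 * 2 ^ n := by
    unfold width
    rw [pow_succ]
    have : (4 : ℝ) ^ n = 2 ^ n * 2 ^ n := by rw [← mul_pow]; norm_num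
    rw [this, one_div, inv_pow]
    field_simp
    ring
  rw [neg_mul, e]
  have h1 : (1 : ℝ) ≤ 2 ^ n := one_le_pow₀ (by norm_num)
  have := h.hρ; have := h.hN
  have h2 : 0 ≤ ρ * N / 2 := by positivity
  nlinarith

lemma stage (h : KamData Ω κ τ α s ρ N θ A q S) (n : ℕ) : Stage Ω κ τ α s ρ N θ q S n := by
  induction n with
  | zero =>
    refine ⟨?_, ?_, ?_⟩
    · have e : width ρ 0 = 2 * ρ := by unfold width; ring
      simpa [kseq, e] using h.hP
    · intro a ω₁ _ ω₂ _
      simp [kseq, h.hμ a ω₁ ω₂]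
    · exact h.hsym
  | succ n hn =>
    have h0 := h.hκ; have hq := h.hq0; have hθ := h.hθ0; have hN := h.hN
    have hw : width ρ (n + 1) ≤ width ρ n := by
      unfold width
      have := h.hρ
      gcongr ρ * (1 + ?_)
      exact pow_le_pow_of_le_one (by norm_num) (by norm_num) (Nat.le_succ n)
    have hb : famN Ω (ENNReal.ofReal κ) (wP (width ρ (n + 1)) s α) (kseq S κ τ α N (n + 1)).P ≤
        ENNReal.ofReal (κ * (q * θ ^ (n + 1))) := by
      refine ((kseq S κ τ α N n).famN_step_le h.hα (h.width_pos (n + 1)) hw h.hs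
        (by positivity : 0 ≤ N * 4 ^ n) (ne_top_of_le_ne_top ENNReal.ofReal_ne_top hn.bound)
        (h.gen_le_half hn)).trans ?_
      have hA := h.A_ge
      calc _ ≤ ENNReal.ofReal (θ / 2) * ENNReal.ofReal (κ * (q * θ ^ n)) +
            24 * (ENNReal.ofReal (κ * (q * θ ^ n)) * ENNReal.ofReal (A * q * (1 / 4) ^ n)) := by
            gcongr
            · exact h.exp_width_le n
            · exact hn.bound
            · exact hn.bound
            · exact h.gen_le hn
        _ = ENNReal.ofReal (θ / 2 * (κ * (q * θ ^ n)) +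
            24 * ((κ * (q * θ ^ n)) * (A * q * (1 / 4) ^ n))) := by
            rw [ENNReal.ofReal_add (by positivity) (by positivity),
              ENNReal.ofReal_mul (by positivity : 0 ≤ θ / 2),
              ENNReal.ofReal_mul (by norm_num : (0 : ℝ) ≤ 24),
              ENNReal.ofReal_mul (by positivity : 0 ≤ κ * (q * θ ^ n))]
            simp
        _ ≤ _ := by
            apply ENNReal.ofReal_le_ofReal
            have h1 := h.hq
            have h2 : (1 / 4 : ℝ) ^ n ≤ 1 := pow_le_one₀ (by norm_num) (by norm_num)
            have h3 : 0 ≤ A * q := by positivity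
            have h4 : 24 * (A * q * (1 / 4) ^ n) ≤ θ / 2 := by nlinarith
            have h5 : 0 ≤ κ * (q * θ ^ n) := by positivity
            rw [pow_succ]
            nlinarith
    refine ⟨hb, ?_, ?_⟩
    · intro a ω₁ h₁ ω₂ h₂
      have e : (kseq S κ τ α N (n + 1)).μ a ω₁ - (kseq S κ τ α N (n + 1)).μ a ω₂ =
          ((kseq S κ τ α N n).μ a ω₁ - (kseq S κ τ α N n).μ a ω₂) -
          (corr S κ τ α N n a ω₁ - corr S κ τ α N n a ω₂) := by
        simp only [kseq, KState.step, corr]; ring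
      rw [e]
      refine (abs_sub _ _).trans ((add_le_add (hn.lip a ω₁ h₁ ω₂ h₂)
        (h.abs_corr_sub_le hn a h₁ h₂)).trans ?_)
      rw [← add_mul]
      gcongr
      have := h.hθ
      have h5 : 0 ≤ q * θ ^ n := by positivity
      rw [pow_succ]
      nlinarith
    · intro ω hω
      exact (hn.sym ω hω).step h0 h.hτ h.hα (h.norm_gen_lt hn hω)
        (KState.schurBdd_of_famN (h.width_pos (n + 1)) h.hs h.hα
          (ne_top_of_le_ne_top ENNReal.ofReal_ne_top hb) hω)

/-! ### The limiting eigenvalues -/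

/-- The final eigenvalues. -/
def muLim (S : KState ν) (κ τ α N : ℝ) (a : ℕ+ ⊕ ℕ+) (ω : Freq ν) : ℝ :=
  S.μ a ω - ∑' n, corr S κ τ α N n a ω

lemma summable_geo (h : KamData Ω κ τ α s ρ N θ A q S) : Summable fun n : ℕ => θ ^ n :=
  summable_geometric_of_lt_one h.hθ0.le (by linarith [h.hθ])

lemma tsum_geo_le (h : KamData Ω κ τ α s ρ N θ A q S) : ∑' n : ℕ, θ ^ n ≤ 2 := by
  rw [tsum_geometric_of_lt_one h.hθ0.le (by linarith [h.hθ]),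
    inv_le_comm₀ (by linarith [h.hθ]) (by norm_num)]
  linarith [h.hθ]

lemma abs_corr_le' (h : KamData Ω κ τ α s ρ N θ A q S) (n : ℕ) (a : ℕ+ ⊕ ℕ+) {ω : Freq ν}
    (hω : ω ∈ Ω) : |corr S κ τ α N n a ω| ≤ κ * q / bracket (mode a) ^ α * θ ^ n := by
  have h1 := h.abs_corr_le (h.stage n) a hω
  have hb := Real.rpow_pos_of_pos (bracket_pos (mode a)) α
  rw [div_mul_eq_mul_div, le_div_iff₀ hb]
  linarith

lemma summable_corr (h : KamData Ω κ τ α s ρ N θ A q S) (a : ℕ+ ⊕ ℕ+) {ω : Freq ν}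
    (hω : ω ∈ Ω) : Summable fun n => corr S κ τ α N n a ω :=
  Summable.of_norm_bounded (h.summable_geo.mul_left _) fun n => h.abs_corr_le' n a hω

lemma kseq_mu (S : KState ν) (n : ℕ) (a : ℕ+ ⊕ ℕ+) (ω : Freq ν) :
    (kseq S κ τ α N n).μ a ω = S.μ a ω - ∑ i ∈ Finset.range n, corr S κ τ α N i a ω := by
  induction n with
  | zero => simp [kseq]
  | succ n ih =>
    rw [Finset.sum_range_succ, kseq, KState.step]
    simp only [ih, corr]
    ring

lemma tendsto_mu (h : KamData Ω κ τ α s ρ N θ A q S) (a : ℕ+ ⊕ ℕ+) {ω : Freq ν} (hω : ω ∈ Ω) :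
    Filter.Tendsto (fun n => (kseq S κ τ α N n).μ a ω) Filter.atTop
      (𝓝 (muLim S κ τ α N a ω)) := by
  simp_rw [kseq_mu]
  exact (h.summable_corr a hω).hasSum.tendsto_sum_nat.const_sub _

lemma abs_mu_sub_le (h : KamData Ω κ τ α s ρ N θ A q S) (n : ℕ) (a : ℕ+ ⊕ ℕ+) {ω : Freq ν}
    (hω : ω ∈ Ω) : |(kseq S κ τ α N n).μ a ω - muLim S κ τ α N a ω| ≤
      2 * κ * q * θ ^ n / bracket (mode a) ^ α := by
  have hs := h.summable_corr a hω
  have e : (kseq S κ τ α N n).μ a ω - muLim S κ τ α N a ω = ∑' i, corr S κ τ α N (i + n) a ω := by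
    rw [kseq_mu, muLim, ← hs.sum_add_tsum_nat_add n]; ring
  rw [e]
  have hκ := h.hκ; have hq := h.hq0; have hθ := h.hθ0
  have hb := Real.rpow_pos_of_pos (bracket_pos (mode a)) α
  have hg := h.summable_geo.mul_left (κ * q / bracket (mode a) ^ α * θ ^ n)
  calc |∑' i, corr S κ τ α N (i + n) a ω| ≤ ∑' i : ℕ, κ * q / bracket (mode a) ^ α * θ ^ n * θ ^ i :=
        tsum_of_norm_bounded (f := fun i => corr S κ τ α N (i + n) a ω) hg.hasSum fun i => by
          rw [mul_assoc, ← pow_add, add_comm n i]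
          exact h.abs_corr_le' (i + n) a hω
    _ = κ * q / bracket (mode a) ^ α * θ ^ n * ∑' i : ℕ, θ ^ i := tsum_mul_left
    _ ≤ κ * q / bracket (mode a) ^ α * θ ^ n * 2 := by gcongr; exact h.tsum_geo_le
    _ = _ := by ring

lemma muLim_sub_le (h : KamData Ω κ τ α s ρ N θ A q S) (a : ℕ+ ⊕ ℕ+) {ω : Freq ν}
    (hω : ω ∈ Ω) : |muLim S κ τ α N a ω - S.μ a ω| ≤ 2 * κ * q / bracket (mode a) ^ α := by
  have := h.abs_mu_sub_le 0 a hω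
  rw [abs_sub_comm]
  simpa [kseq] using this

lemma muLim_lip (h : KamData Ω κ τ α s ρ N θ A q S) (a : ℕ+ ⊕ ℕ+) {ω₁ ω₂ : Freq ν}
    (h₁ : ω₁ ∈ Ω) (h₂ : ω₂ ∈ Ω) :
    |muLim S κ τ α N a ω₁ - muLim S κ τ α N a ω₂| ≤ 2 * q * ‖ω₁ - ω₂‖ := by
  refine le_of_tendsto (((h.tendsto_mu a h₁).sub (h.tendsto_mu a h₂)).abs)
    (Filter.Eventually.of_forall fun n => ((h.stage n).lip a ω₁ h₁ ω₂ h₂).trans ?_)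
  have := pow_pos h.hθ0 n
  have := h.hq0
  refine mul_le_mul_of_nonneg_right ?_ (norm_nonneg _)
  nlinarith

lemma muLim_odd (h : KamData Ω κ τ α s ρ N θ A q S) (j : ℕ+) {ω : Freq ν} (hω : ω ∈ Ω) :
    muLim S κ τ α N (Sum.inr j) ω = -muLim S κ τ α N (Sum.inl j) ω := by
  refine tendsto_nhds_unique (h.tendsto_mu _ hω) ?_
  have := (h.tendsto_mu (Sum.inl j) hω).neg
  exact this.congr fun n => (((h.stage n).sym ω hω).odd j).symm

/-! ### The limiting conjugation -/

/-- Non-resonance with respect to the final eigenvalues. -/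
def Good (S : KState ν) (κ τ α N : ℝ) (ω : Freq ν) : Prop :=
  ∀ x y : Idx ν, x ≠ y → 2 * thr κ τ α x y ≤
    |dotK (x.2 - y.2) ω + muLim S κ τ α N x.1 ω - muLim S κ τ α N y.1 ω|

lemma thr_le_sdiv (h : KamData Ω κ τ α s ρ N θ A q S) {ω : Freq ν} (hω : ω ∈ Ω)
    (hg : Good S κ τ α N ω) (n : ℕ) {x y : Idx ν} (hxy : x ≠ y)
    (hk : absK (x.2 - y.2) ≤ N * 4 ^ n) :
    thr κ τ α x y ≤ |(kseq S κ τ α N n).sdiv ω x y| := by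
  have hκ := h.hκ; have hq := h.hq0; have hθ := h.hθ0; have hN := h.hN
  have h1 := hg x y hxy
  have hm : ∀ a, |(kseq S κ τ α N n).μ a ω - muLim S κ τ α N a ω| ≤ 2 * κ * q * θ ^ n := fun a =>
    (h.abs_mu_sub_le n a hω).trans (div_le_self (by positivity)
      (Real.one_le_rpow (one_le_bracket _) h.hα))
  have ha := abs_le.1 (hm x.1)
  have hb := abs_le.1 (hm y.1)
  have h2 : 4 * κ * q * θ ^ n ≤ thr κ τ α x y := by
    have hB : 1 ≤ bracket (modeGap x y) ^ α := Real.one_le_rpow (one_le_bracket _) h.hα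
    have hr := KState.bracket_rpow_le h.hτ hk
    have hr0 := Real.rpow_pos_of_pos (bracket_pos (absK (x.2 - y.2))) τ
    set t := (1 + N * 4 ^ n) ^ τ with ht
    have ht1 : 1 ≤ t := Real.one_le_rpow (by
      have : 0 ≤ N * 4 ^ n := by positivity
      linarith) h.hτ
    have hA := h.hA n
    rw [← ht] at hA
    have hA2 : t * θ ^ n ≤ A := by
      have h4 : (1 / 4 : ℝ) ^ n ≤ 1 := pow_le_one₀ (by norm_num) (by norm_num)
      have hA0 := h.A_ge
      have hN1 : 1 ≤ 1 + N * 4 ^ n := by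
        have : 0 ≤ N * 4 ^ n := by positivity
        linarith
      have hp := pow_pos hθ n
      calc t * θ ^ n ≤ 13 * t ^ 2 * (1 + N * 4 ^ n) * θ ^ n := by
            gcongr
            nlinarith
        _ ≤ A * (1 / 4) ^ n := hA
        _ ≤ A := mul_le_of_le_one_right (by linarith) h4
    have hAq := h.Aq_le
    have h8 : 8 * q * θ ^ n * t ≤ 1 := by nlinarith
    calc 4 * κ * q * θ ^ n = κ / 2 * (8 * q * θ ^ n) := by ring
      _ ≤ κ / 2 * (1 / t) := by
        gcongr
        rw [le_div_iff₀ (by linarith)]; exact h8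
      _ = κ / 2 / t := by ring
      _ ≤ κ / 2 / bracket (absK (x.2 - y.2)) ^ τ := by gcongr
      _ ≤ _ := le_mul_of_one_le_right (by positivity) hB
  rcases abs_cases (dotK (x.2 - y.2) ω + muLim S κ τ α N x.1 ω - muLim S κ τ α N y.1 ω) with
    ⟨e, _⟩ | ⟨e, _⟩
  · refine le_trans ?_ (le_abs_self _)
    unfold KState.sdiv
    linarith
  · refine le_trans ?_ (neg_le_abs _)
    unfold KState.sdiv
    linarith

/-- The partial products of the conjugations. -/
def kprod (S : KState ν) (κ τ α N : ℝ) (ω : Freq ν) : ℕ → Op (Idx ν)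
  | 0 => 1
  | n + 1 => kprod S κ τ α N ω n * cayley (kgen S κ τ α N n ω)

/-- The unweighted off-diagonal weight in the extended reals. -/
def wE' (ρ s : ℝ) (x y : Idx ν) : ℝ≥0∞ := ENNReal.ofReal (wE ρ s x y)

lemma wE'_mul {ρ s : ℝ} (hρ : 0 ≤ ρ) (hs : 0 ≤ s) (x y z : Idx ν) :
    wE' ρ s x y ≤ wE' ρ s x z * wE' ρ s z y := by
  unfold wE'
  rw [← ENNReal.ofReal_mul (wE_pos _ _ _ _).le]
  exact ENNReal.ofReal_le_ofReal (wE_mul hρ hs x y z)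

lemma schur_mul_op_le {w₁ w₂ w₃ : Idx ν → Idx ν → ℝ≥0∞} (A B : Op (Idx ν))
    (hw : ∀ x y z, w₃ x y ≤ w₁ x z * w₂ z y) :
    schur w₃ (entAbs (A * B)) ≤ schur w₁ (entAbs A) * schur w₂ (entAbs B) := by
  refine schur_mul_le (fun x y => ?_) hw
  rw [entAbs, ← (hasSum_ent_mul A B x y).tsum_eq]
  refine enorm_tsum_le_tsum_enorm.trans_eq ?_
  simp_rw [enorm_mul]; rfl

lemma schur_add_op_le (w : Idx ν → Idx ν → ℝ≥0∞) (A B : Op (Idx ν)) :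
    schur w (entAbs (A + B)) ≤ schur w (entAbs A) + schur w (entAbs B) :=
  schur_add_le fun _ _ => enorm_add_le _ _

lemma cayley_sub_one {G : Op (Idx ν)} (hG : ‖G‖ < 1) :
    cayley G - 1 = Ring.inverse (1 - G) * G + Ring.inverse (1 - G) * G := by
  have h1 : Ring.inverse (1 - G) * (1 - G) = 1 := Ring.inverse_mul_cancel _ (isUnit_one_sub hG)
  calc cayley G - 1 = cayley G - Ring.inverse (1 - G) * (1 - G) := by rw [h1]
    _ = _ := by rw [cayley]; noncomm_ring

lemma schur_cayley_le (h : KamData Ω κ τ α s ρ N θ A q S) {ω : Freq ν} (hω : ω ∈ Ω) (n : ℕ) :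
    schur (wE' ρ s) (entAbs (cayley (kgen S κ τ α N n ω) - 1)) ≤
      ENNReal.ofReal (4 * (A * q * (1 / 4) ^ n)) := by
  have hn := h.stage n
  rw [cayley_sub_one (h.norm_gen_lt hn hω)]
  have h1 := famN_inverse_mul_le (one_le_wG (h.width_pos n) h.hs h.hα)
    (wG_le_mul_wG (h.width_pos n) h.hs h.hα) (h.gen_le_half hn) (kgen S κ τ α N n)
  have h2 : schur (wE' ρ s) (entAbs (Ring.inverse (1 - kgen S κ τ α N n ω) * kgen S κ τ α N n ω)) ≤
      2 * ENNReal.ofReal (A * q * (1 / 4) ^ n) := by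
    calc _ ≤ schur (wG (width ρ n) s α) (entAbs (Ring.inverse (1 - kgen S κ τ α N n ω) *
          kgen S κ τ α N n ω)) := schur_mono_weight _ fun x y =>
            (ENNReal.ofReal_le_ofReal (wE_mono (h.width_ge n) x y)).trans
              ((wE_le_wP h.hα x y).trans (wP_le_wG h.hα x y))
      _ ≤ _ := schur_entAbs_le_famN (fun ω => Ring.inverse (1 - kgen S κ τ α N n ω) *
          kgen S κ τ α N n ω) hω
      _ ≤ _ := h1.trans (by gcongr; exact h.gen_le hn)
  refine (schur_add_op_le _ _ _).trans ((add_le_add h2 h2).trans_eq ?_)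
  rw [ENNReal.ofReal_mul (by norm_num : (0 : ℝ) ≤ 4)]
  simp only [ENNReal.ofReal_ofNat]
  ring

lemma kprod_succ_sub (ω : Freq ν) (n : ℕ) :
    kprod S κ τ α N ω (n + 1) - kprod S κ τ α N ω n =
      (cayley (kgen S κ τ α N n ω) - 1) +
        (kprod S κ τ α N ω n - 1) * (cayley (kgen S κ τ α N n ω) - 1) := by
  rw [kprod]; noncomm_ring

lemma schur_kprod_le (h : KamData Ω κ τ α s ρ N θ A q S) {ω : Freq ν} (hω : ω ∈ Ω) (n : ℕ) :
    schur (wE' ρ s) (entAbs (kprod S κ τ α N ω n - 1)) ≤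
        ENNReal.ofReal (16 * A * q * (1 - (1 / 4) ^ n)) ∧
    schur (wE' ρ s) (entAbs (kprod S κ τ α N ω (n + 1) - kprod S κ τ α N ω n)) ≤
        ENNReal.ofReal (8 * A * q * (1 / 4) ^ n) := by
  have hA := h.A_ge; have hq := h.hq0; have hAq := h.Aq_le
  have hAq0 : 0 ≤ A * q := by positivity
  have step : ∀ n, schur (wE' ρ s) (entAbs (kprod S κ τ α N ω n - 1)) ≤
        ENNReal.ofReal (16 * A * q * (1 - (1 / 4) ^ n)) →
      schur (wE' ρ s) (entAbs (kprod S κ τ α N ω (n + 1) - kprod S κ τ α N ω n)) ≤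
        ENNReal.ofReal (8 * A * q * (1 / 4) ^ n) := by
    intro n hn
    have hn1 : schur (wE' ρ s) (entAbs (kprod S κ τ α N ω n - 1)) ≤ 1 := by
      refine hn.trans ?_
      rw [← ENNReal.ofReal_one]
      apply ENNReal.ofReal_le_ofReal
      have : 0 < (1 / 4 : ℝ) ^ n := by positivity
      nlinarith
    rw [kprod_succ_sub]
    have hc := h.schur_cayley_le hω n
    calc _ ≤ schur (wE' ρ s) (entAbs (cayley (kgen S κ τ α N n ω) - 1)) +
          schur (wE' ρ s) (entAbs (kprod S κ τ α N ω n - 1)) *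
            schur (wE' ρ s) (entAbs (cayley (kgen S κ τ α N n ω) - 1)) :=
          (schur_add_op_le _ _ _).trans (by
            gcongr; exact schur_mul_op_le _ _ (wE'_mul h.hρ.le h.hs))
      _ ≤ ENNReal.ofReal (4 * (A * q * (1 / 4) ^ n)) +
          1 * ENNReal.ofReal (4 * (A * q * (1 / 4) ^ n)) := by gcongr
      _ = _ := by
          rw [one_mul, ← ENNReal.ofReal_add (by positivity) (by positivity)]
          congr 1; ring
  have main : ∀ n, schur (wE' ρ s) (entAbs (kprod S κ τ α N ω n - 1)) ≤
      ENNReal.ofReal (16 * A * q * (1 - (1 / 4) ^ n)) := by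
    intro n
    induction n with
    | zero =>
      have : schur (wE' ρ s) (entAbs (kprod S κ τ α N ω 0 - 1)) = 0 := by
        simp [kprod, schur, entAbs]
      rw [this]; exact zero_le
    | succ n ih =>
      have e : kprod S κ τ α N ω (n + 1) - 1 =
          (kprod S κ τ α N ω n - 1) + (kprod S κ τ α N ω (n + 1) - kprod S κ τ α N ω n) := by abel
      rw [e]
      refine (schur_add_op_le _ _ _).trans ((add_le_add ih (step n ih)).trans ?_)
      have h4 : (1 / 4 : ℝ) ^ n ≤ 1 := pow_le_one₀ (by norm_num) (by norm_num)
      have h5 : 0 ≤ 1 - (1 / 4 : ℝ) ^ n := by linarith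
      rw [← ENNReal.ofReal_add (by positivity) (by positivity)]
      apply ENNReal.ofReal_le_ofReal
      rw [pow_succ]
      have : 0 ≤ A * q * (1 / 4 : ℝ) ^ n := by positivity
      nlinarith
  exact ⟨main n, step n (main n)⟩

lemma one_le_wE' {ρ s : ℝ} (hρ : 0 ≤ ρ) (hs : 0 ≤ s) (x y : Idx ν) : 1 ≤ wE' ρ s x y := by
  simpa [wE'] using one_le_wE hρ hs x y

/-- The conclusion of the iteration at a fixed frequency. -/
structure Limit (S : KState ν) (κ τ α N : ℝ) (ω : Freq ν) (W : Op (Idx ν)) : Prop where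
  left_inv : kstar (sig ν) W * W = 1
  right_inv : W * kstar (sig ν) W = 1
  toep : ∀ a, W ∈ toepRing a
  itw : ∀ x y, (S.diag ω x - (-Complex.I * ((dotK y.2 ω + muLim S κ τ α N y.1 ω : ℝ) : ℂ))) *
    ent W x y = -ent (S.P ω * W) x y

lemma exists_limit (h : KamData Ω κ τ α s ρ N θ A q S) {ω : Freq ν} (hω : ω ∈ Ω)
    (hg : Good S κ τ α N ω) :
    ∃ W : Op (Idx ν), Limit S κ τ α N ω W ∧
      schur (wE' ρ s) (entAbs (W - 1)) ≤ ENNReal.ofReal (16 * A * q) := by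
  have hA := h.A_ge; have hq := h.hq0
  have hAq0 : 0 ≤ A * q := by positivity
  have hnorm : ∀ n, ‖kprod S κ τ α N ω (n + 1) - kprod S κ τ α N ω n‖ ≤
      8 * A * q * (1 / 4) ^ n := by
    intro n
    have h1 := (enorm_le_schur (kprod S κ τ α N ω (n + 1) - kprod S κ τ α N ω n)).trans
      ((schur_mono_weight _ (one_le_wE' h.hρ.le h.hs)).trans (h.schur_kprod_le hω n).2)
    rw [← ofReal_norm, ENNReal.ofReal_le_ofReal_iff (by positivity)] at h1
    exact h1
  have hcau : CauchySeq (kprod S κ τ α N ω) := by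
    refine cauchySeq_of_le_geometric (1 / 4) (8 * A * q) (by norm_num) fun n => ?_
    rw [dist_comm, dist_eq_norm]
    exact hnorm n
  obtain ⟨W, hW⟩ := cauchySeq_tendsto_of_complete hcau
  have hstar : ∀ n, kstar (sig ν) (cayley (kgen S κ τ α N n ω)) * cayley (kgen S κ τ α N n ω) = 1 ∧
      cayley (kgen S κ τ α N n ω) * kstar (sig ν) (cayley (kgen S κ τ α N n ω)) = 1 := fun n =>
    (kstar_cayley_mul sig_mul_sig (h.norm_gen_lt (h.stage n) hω)
      (((h.stage n).sym ω hω).gen h.hκ h.hτ h.hα).skew).2.2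
  have hl : ∀ n, kstar (sig ν) (kprod S κ τ α N ω n) * kprod S κ τ α N ω n = 1 := by
    intro n
    induction n with
    | zero => simp [kprod, kstar_one sig_mul_sig]
    | succ n ih =>
      rw [kprod, kstar_mul sig_mul_sig, mul_assoc, ← mul_assoc _ (kprod S κ τ α N ω n), ih, one_mul,
        (hstar n).1]
  have hr : ∀ n, kprod S κ τ α N ω n * kstar (sig ν) (kprod S κ τ α N ω n) = 1 := by
    intro n
    induction n with
    | zero => simp [kprod, kstar_one sig_mul_sig]
    | succ n ih =>
      rw [kprod, kstar_mul sig_mul_sig, mul_assoc, ← mul_assoc (cayley _), (hstar n).2, one_mul, ih]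
  have ht : ∀ n a, kprod S κ τ α N ω n ∈ toepRing a := by
    intro n a
    induction n with
    | zero => exact Subring.one_mem _
    | succ n ih =>
      have hgen := (((h.stage n).sym ω hω).gen (N := N * 4 ^ n) h.hκ h.hτ h.hα).toep a
      exact Subring.mul_mem _ ih (Subring.mul_mem _
        (inverse_mem_symSubring hgen (h.norm_gen_lt (h.stage n) hω))
        (Subring.add_mem _ (Subring.one_mem _) hgen))
  have hitw : ∀ n, Itw (S.diag ω) ((kseq S κ τ α N n).diag ω) (kprod S κ τ α N ω n)
      (kprod S κ τ α N ω n * (kseq S κ τ α N n).P ω - S.P ω * kprod S κ τ α N ω n) := by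
    intro n
    induction n with
    | zero =>
      have := Itw.one (S.diag ω)
      simpa [kprod, kseq] using this
    | succ n ih =>
      have hstep := ((h.stage n).sym ω hω).itw (N := N * 4 ^ n) h.hκ h.hτ h.hα
        (by have := h.hN; positivity) (h.norm_gen_lt (h.stage n) hω)
        (fun x y hxy hk => h.thr_le_sdiv hω hg n hxy hk)
      have := ih.mul hstep
      have e : ∀ A B C D E F : Op (Idx ν), (A * B - C * A) * D + A * (D * E - B * D) =
          A * D * E - C * (A * D) := by intros; noncomm_ring
      rw [e] at this
      · exact this
      · exact 0
  have hP0 : Filter.Tendsto (fun n => (kseq S κ τ α N n).P ω) Filter.atTop (𝓝 0) := by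
    refine squeeze_zero_norm (a := fun n => κ * q * θ ^ n) (fun n => ?_) ?_
    · have h1 := (enorm_le_famN (κ := ENNReal.ofReal κ)
        (one_le_wP (h.width_pos n) h.hs h.hα) (kseq S κ τ α N n).P hω).trans (h.stage n).bound
      have hκ := h.hκ; have hθ := h.hθ0
      rw [← ofReal_norm, ENNReal.ofReal_le_ofReal_iff (by positivity)] at h1
      linarith
    · have := (tendsto_pow_atTop_nhds_zero_of_lt_one h.hθ0.le (by linarith [h.hθ])).const_mul (κ * q)
      simpa using this
  refine ⟨W, ⟨?_, ?_, fun a => ?_, fun x y => ?_⟩, ?_⟩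
  · exact tendsto_nhds_unique ((((continuous_kstar (sig ν)).tendsto W).comp hW).mul hW)
      (tendsto_const_nhds.congr fun n => (hl n).symm)
  · exact tendsto_nhds_unique (hW.mul (((continuous_kstar (sig ν)).tendsto W).comp hW))
      (tendsto_const_nhds.congr fun n => (hr n).symm)
  · exact (isClosed_symSubring _ _ _).mem_of_tendsto hW (Filter.Eventually.of_forall fun n => ht n a)
  · have l1 : Filter.Tendsto (fun n => (S.diag ω x - (kseq S κ τ α N n).diag ω y) *
        ent (kprod S κ τ α N ω n) x y) Filter.atTop
        (𝓝 ((S.diag ω x - (-Complex.I * ((dotK y.2 ω + muLim S κ τ α N y.1 ω : ℝ) : ℂ))) *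
          ent W x y)) := by
      refine Filter.Tendsto.mul (Filter.Tendsto.const_sub _ (Filter.Tendsto.const_mul _ ?_))
        (((entL x y).continuous.tendsto W).comp hW)
      exact (Complex.continuous_ofReal.tendsto _).comp ((h.tendsto_mu y.1 hω).const_add _)
    have l2 : Filter.Tendsto (fun n => ent (kprod S κ τ α N ω n * (kseq S κ τ α N n).P ω -
        S.P ω * kprod S κ τ α N ω n) x y) Filter.atTop (𝓝 (ent (W * 0 - S.P ω * W) x y)) :=
      ((entL x y).continuous.tendsto _).comp ((hW.mul hP0).sub (hW.const_mul _))
    have := tendsto_nhds_unique l1 (l2.congr fun n => (hitw n x y).symm)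
    rw [this]
    simp
  · have hsum : HasSum (fun n => kprod S κ τ α N ω (n + 1) - kprod S κ τ α N ω n) (W - 1) := by
      have hsm : Summable fun n => kprod S κ τ α N ω (n + 1) - kprod S κ τ α N ω n :=
        Summable.of_norm_bounded ((summable_geometric_of_lt_one (by norm_num)
          (by norm_num : (1 / 4 : ℝ) < 1)).mul_left _) hnorm
      rw [hsm.hasSum_iff_tendsto_nat]
      simp_rw [Finset.sum_range_sub]
      exact hW.sub_const 1
    calc schur (wE' ρ s) (entAbs (W - 1)) ≤ ∑' n, schur (wE' ρ s)
          (entAbs (kprod S κ τ α N ω (n + 1) - kprod S κ τ α N ω n)) := by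
          refine schur_tsum_le fun x y => ?_
          change ‖entL x y (W - 1)‖ₑ ≤ _
          rw [← (hsum.mapL (entL x y)).tsum_eq]
          exact enorm_tsum_le_tsum_enorm
      _ ≤ ∑' n : ℕ, ENNReal.ofReal (8 * A * q * (1 / 4) ^ n) :=
          ENNReal.tsum_le_tsum fun n => (h.schur_kprod_le hω n).2
      _ = ENNReal.ofReal (∑' n : ℕ, 8 * A * q * (1 / 4) ^ n) := by
          rw [ENNReal.ofReal_tsum_of_nonneg (fun n => by positivity)]
          exact (summable_geometric_of_lt_one (by norm_num)
            (by norm_num : (1 / 4 : ℝ) < 1)).mul_left _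
      _ ≤ _ := by
          apply ENNReal.ofReal_le_ofReal
          rw [tsum_mul_left, tsum_geometric_of_lt_one (by norm_num) (by norm_num)]
          nlinarith

end KamData

end Iteration

section Evaluation

variable {ν : ℕ}

/-- The character `e^{i k·θ}`. -/
def chr (k : Fin ν → ℤ) (θ : Fin ν → ℝ) : ℂ := Complex.exp (Complex.I * (dotK k θ : ℂ))

lemma norm_chr (k : Fin ν → ℤ) (θ : Fin ν → ℝ) : ‖chr k θ‖ = 1 := by
  rw [chr, mul_comm, Complex.norm_exp_ofReal_mul_I]

lemma enorm_chr (k : Fin ν → ℤ) (θ : Fin ν → ℝ) : ‖chr k θ‖ₑ = 1 := by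
  rw [← ofReal_norm, norm_chr, ENNReal.ofReal_one]

lemma chr_add (k l : Fin ν → ℤ) (θ : Fin ν → ℝ) : chr (k + l) θ = chr k θ * chr l θ := by
  rw [chr, chr, chr, ← Complex.exp_add, dotK_add]; push_cast; ring_nf

lemma chr_zero (θ : Fin ν → ℝ) : chr 0 θ = 1 := by simp [chr, dotK_zero]

lemma chr_periodic (k : Fin ν → ℤ) (θ : Fin ν → ℝ) (l : Fin ν → ℤ) :
    chr k (fun i => θ i + 2 * Real.pi * l i) = chr k θ := by
  have e : dotK k (fun i => θ i + 2 * Real.pi * l i) =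
      dotK k θ + 2 * Real.pi * ((∑ i, k i * l i : ℤ) : ℝ) := by
    simp only [dotK, mul_add, Finset.sum_add_distrib]
    push_cast
    rw [Finset.mul_sum]
    congr 1
    exact Finset.sum_congr rfl fun i _ => by ring
  rw [chr, chr, e]
  push_cast
  rw [mul_add, Complex.exp_add]
  have := Complex.exp_int_mul_two_pi_mul_I (∑ i, k i * l i)
  push_cast at this
  rw [show Complex.I * (2 * (Real.pi : ℂ) * ∑ i, (k i : ℂ) * (l i : ℂ)) =
    (∑ i, (k i : ℂ) * (l i : ℂ)) * (2 * Real.pi * Complex.I) by ring, this, mul_one]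

lemma abs_dotK_le_sum (k : Fin ν → ℤ) (η : Fin ν → ℝ) : |dotK k η| ≤ absK k * ∑ i, |η i| := by
  unfold dotK
  refine (Finset.abs_sum_le_sum_abs _ _).trans ?_
  rw [Finset.mul_sum]
  refine Finset.sum_le_sum fun i _ => ?_
  rw [abs_mul]
  gcongr
  exact abs_apply_le_absK k i

lemma norm_chr_sub_le (k : Fin ν → ℤ) (θ θ' : Fin ν → ℝ) :
    ‖chr k θ - chr k θ'‖ ≤ absK k * ∑ i, |θ i - θ' i| := by
  have e : chr k θ - chr k θ' = chr k θ' * (Complex.exp (Complex.I * (dotK k (θ - θ') : ℝ)) - 1) := by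
    rw [mul_sub, mul_one]
    congr 1
    rw [chr, chr, ← Complex.exp_add]
    congr 1
    simp only [dotK, Pi.sub_apply, mul_sub, Finset.sum_sub_distrib]
    push_cast; ring
  rw [e, norm_mul, norm_chr, one_mul]
  exact (Real.norm_exp_I_mul_ofReal_sub_one_le).trans (abs_dotK_le_sum k _)

lemma tsum_prod_enn {α β : Type*} (f : α × β → ℝ≥0∞) :
    ∑' p, f p = ∑' a, ∑' b, f (a, b) := ENNReal.tsum_prod (f := fun a b => f (a, b))

/-- The index set of the pair. -/
abbrev Pr : Type := ℕ+ ⊕ ℕ+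

/-- Matrix at the angle `θ` of a Toeplitz operator. -/
def evalM (θ : Fin ν → ℝ) (A : Op (Idx ν)) (a b : Pr) : ℂ :=
  ∑' k : Fin ν → ℤ, ent A (a, k) (b, 0) * chr k θ

/-- Majorant of `evalM`, with an exponential weight. -/
def coefAbs (ρ : ℝ) (A : Op (Idx ν)) (a b : Pr) : ℝ≥0∞ :=
  ∑' k : Fin ν → ℤ, ‖ent A (a, k) (b, 0)‖ₑ * ENNReal.ofReal (Real.exp (ρ * absK k))

/-- Off-diagonal weight on the pair. -/
def wI (s : ℝ) (a b : Pr) : ℝ≥0∞ := ENNReal.ofReal ((1 + |mode a - mode b|) ^ s)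

/-- Toeplitz operators. -/
def IsToep (A : Op (Idx ν)) : Prop := ∀ a, A ∈ toepRing a

lemma IsToep.ent_eq {A : Op (Idx ν)} (h : IsToep A) (a b : Pr) (k l : Fin ν → ℤ) :
    ent A (a, k) (b, l) = ent A (a, k - l) (b, 0) := by
  have := mem_symSubring.1 (h l) (a, k - l) (b, 0)
  have e1 : shiftIdx l (a, k - l) = (a, k) := by ext1 <;> simp
  have e2 : shiftIdx l (b, 0) = (b, l) := by ext1 <;> simp
  rw [e1, e2] at this
  exact this

lemma schur_coefAbs_le {A : Op (Idx ν)} (h : IsToep A) (ρ s : ℝ) :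
    schur (wI s) (coefAbs ρ A) ≤ schur (KamData.wE' ρ s) (entAbs A) := by
  have hw : ∀ (a b : Pr) (k l : Fin ν → ℤ), KamData.wE' ρ s (a, k) (b, l) =
      ENNReal.ofReal (Real.exp (ρ * absK (k - l))) * wI s a b := by
    intro a b k l
    rw [KamData.wE', wE, wI, ENNReal.ofReal_mul (Real.exp_pos _).le]
  rw [schur_le_iff]
  constructor
  · intro a
    refine le_trans (le_of_eq ?_) (row_le_schur (KamData.wE' ρ s) (entAbs A) (a, 0))
    rw [tsum_prod_enn]
    refine tsum_congr fun b => ?_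
    rw [coefAbs, ← ENNReal.tsum_mul_right, ← (Equiv.neg (Fin ν → ℤ)).tsum_eq]
    refine tsum_congr fun k => ?_
    rw [hw, entAbs, h.ent_eq a b 0 k, Equiv.neg_apply, zero_sub, absK_neg]
    ring
  · intro b
    refine le_trans (le_of_eq ?_) (col_le_schur (KamData.wE' ρ s) (entAbs A) (b, 0))
    rw [tsum_prod_enn]
    refine tsum_congr fun a => ?_
    rw [coefAbs, ← ENNReal.tsum_mul_right]
    refine tsum_congr fun k => ?_
    rw [hw, entAbs, sub_zero]
    ring

lemma one_le_wI {s : ℝ} (hs : 0 ≤ s) (a b : Pr) : 1 ≤ wI s a b := by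
  rw [wI, ENNReal.one_le_ofReal]
  exact Real.one_le_rpow (by simp) hs

lemma enorm_evalM_le {ρ : ℝ} (hρ : 0 ≤ ρ) (θ : Fin ν → ℝ) (A : Op (Idx ν)) (a b : Pr) :
    ‖evalM θ A a b‖ₑ ≤ coefAbs ρ A a b := by
  refine enorm_tsum_le_tsum_enorm.trans (ENNReal.tsum_le_tsum fun k => ?_)
  rw [enorm_mul, enorm_chr]
  gcongr
  rw [ENNReal.one_le_ofReal]
  exact Real.one_le_exp (mul_nonneg hρ (absK_nonneg _))

/-- Finite weighted norm and Toeplitz structure. -/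
structure Nice (ρ s : ℝ) (A : Op (Idx ν)) : Prop where
  toep : IsToep A
  fin : schur (KamData.wE' ρ s) (entAbs A) ≠ ∞

namespace Nice

variable {ρ s : ℝ} {A B : Op (Idx ν)}

lemma coefAbs_ne_top (hs : 0 ≤ s) (h : Nice ρ s A) (a b : Pr) : coefAbs ρ A a b ≠ ∞ := by
  refine ne_top_of_le_ne_top h.fin ((?_ : coefAbs ρ A a b ≤ _).trans
    ((le_schur (wI s) (coefAbs ρ A) a b).trans (schur_coefAbs_le h.toep ρ s)))
  exact le_mul_of_one_le_right' (one_le_wI hs a b)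

lemma summable_of_enorm {ι : Type*} {f : ι → ℂ} (h : ∑' i, ‖f i‖ₑ ≠ ∞) :
    Summable fun i => ‖f i‖ := by
  have h2 : ∑' i, ((‖f i‖₊ : NNReal) : ℝ≥0∞) ≠ ∞ := h
  exact NNReal.summable_coe.2 (ENNReal.tsum_coe_ne_top_iff_summable.1 h2)

lemma summable_coef_exp (hs : 0 ≤ s) (h : Nice ρ s A) (a b : Pr) :
    Summable fun k : Fin ν → ℤ => ‖ent A (a, k) (b, 0)‖ * Real.exp (ρ * absK k) := by
  have h1 := h.coefAbs_ne_top hs a b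
  have h2 := summable_of_enorm (f := fun k : Fin ν → ℤ =>
    ent A (a, k) (b, 0) * (Real.exp (ρ * absK k) : ℝ)) (by
      refine ne_top_of_le_ne_top h1 (le_of_eq (tsum_congr fun k => ?_))
      rw [enorm_mul]
      congr 1
      rw [← ofReal_norm, Complex.norm_real, Real.norm_eq_abs, abs_of_pos (Real.exp_pos _)])
  refine h2.congr fun k => ?_
  rw [norm_mul, Complex.norm_real, Real.norm_eq_abs, abs_of_pos (Real.exp_pos _)]

lemma summable_coef (hρ : 0 ≤ ρ) (hs : 0 ≤ s) (h : Nice ρ s A) (a b : Pr) :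
    Summable fun k : Fin ν → ℤ => ‖ent A (a, k) (b, 0)‖ :=
  Summable.of_nonneg_of_le (fun _ => norm_nonneg _) (fun k => le_mul_of_one_le_right
    (norm_nonneg _) (Real.one_le_exp (mul_nonneg hρ (absK_nonneg k)))) (h.summable_coef_exp hs a b)

lemma summable_eval (hρ : 0 ≤ ρ) (hs : 0 ≤ s) (h : Nice ρ s A) (θ : Fin ν → ℝ) (a b : Pr) :
    Summable fun k : Fin ν → ℤ => ent A (a, k) (b, 0) * chr k θ :=
  (((h.summable_coef hρ hs a b).congr fun k => by rw [norm_mul, norm_chr, mul_one]) :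
    Summable fun k : Fin ν → ℤ => ‖ent A (a, k) (b, 0) * chr k θ‖).of_norm

lemma evalM_sub (hρ : 0 ≤ ρ) (hs : 0 ≤ s) (hA : Nice ρ s A) (hB : Nice ρ s B) (θ : Fin ν → ℝ)
    (a b : Pr) : evalM θ (A - B) a b = evalM θ A a b - evalM θ B a b := by
  rw [evalM, evalM, evalM, ← (hA.summable_eval hρ hs θ a b).tsum_sub (hB.summable_eval hρ hs θ a b)]
  exact tsum_congr fun k => by rw [ent_sub, sub_mul]

lemma schurBdd_evalM (hρ : 0 ≤ ρ) (hs : 0 ≤ s) (h : Nice ρ s A) (θ : Fin ν → ℝ) :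
    SchurBdd (evalM θ A) := by
  refine ne_top_of_le_ne_top h.fin (le_trans ?_ (schur_coefAbs_le h.toep ρ s))
  refine schur_mono fun a b => mul_le_mul' (enorm_evalM_le hρ θ A a b) (one_le_wI hs a b)

lemma mul (hρ : 0 ≤ ρ) (hs : 0 ≤ s) (hA : Nice ρ s A) (hB : Nice ρ s B) : Nice ρ s (A * B) where
  toep := fun a => Subring.mul_mem _ (hA.toep a) (hB.toep a)
  fin := ne_top_of_le_ne_top (ENNReal.mul_ne_top hA.fin hB.fin)
    (KamData.schur_mul_op_le A B (KamData.wE'_mul hρ hs))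

lemma one : Nice ρ s (1 : Op (Idx ν)) where
  toep := fun _ => Subring.one_mem _
  fin := by
    classical
    refine ne_top_of_le_ne_top ENNReal.one_ne_top (schur_le_iff.2 ⟨fun x => ?_, fun x => ?_⟩)
    · rw [tsum_eq_single x]
      · simp [entAbs, KamData.wE', wE_self]
      · intro y hy; simp [entAbs, ent_one_ne (Ne.symm hy)]
    · rw [tsum_eq_single x]
      · simp [entAbs, KamData.wE', wE_self]
      · intro y hy; simp [entAbs, ent_one_ne hy]

lemma of_sub_one {b : ℝ≥0∞} (hb : b ≠ ∞) (ht : IsToep A)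
    (h : schur (KamData.wE' ρ s) (entAbs (A - 1)) ≤ b) : Nice ρ s A where
  toep := ht
  fin := by
    have e : A = (A - 1) + 1 := by abel
    rw [e]
    exact ne_top_of_le_ne_top (ENNReal.add_ne_top.2 ⟨ne_top_of_le_ne_top hb h, one.fin⟩)
      (KamData.schur_add_op_le _ _ _)

lemma kstar (h : Nice ρ s A) : Nice ρ s (kstar (sig ν) A) where
  toep := fun a => by
    rw [mem_symSubring]
    intro x y
    rw [sig, ent_kstar norm_sgn_le, ent_kstar norm_sgn_le, mem_symSubring.1 (h.toep a)]
    rfl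
  fin := by
    have hn : ∀ x : Idx ν, ‖sgn x‖ₑ = 1 := fun x => by
      unfold sgn; split_ifs <;> simp
    have e : entAbs (FastKG.kstar (sig ν) A) = fun x y => entAbs A y x := by
      ext x y
      rw [entAbs, sig, ent_kstar norm_sgn_le, enorm_mul, enorm_mul, hn, hn, one_mul, mul_one, entAbs]
      rw [← ofReal_norm, ← ofReal_norm, RCLike.norm_conj]
    rw [e, schur_comm (fun x y => by rw [KamData.wE', KamData.wE', wE_comm])]
    exact h.fin

/-- Evaluation at an angle is multiplicative. -/
lemma evalM_mul (hρ : 0 ≤ ρ) (hs : 0 ≤ s) (hA : Nice ρ s A) (hB : Nice ρ s B) (θ : Fin ν → ℝ)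
    (a b : Pr) : HasSum (fun c => evalM θ A a c * evalM θ B c b) (evalM θ (A * B) a b) := by
  set F : Pr × (Fin ν → ℤ) × (Fin ν → ℤ) → ℂ := fun p =>
    (ent A (a, p.2.1) (p.1, 0) * chr p.2.1 θ) * (ent B (p.1, p.2.2) (b, 0) * chr p.2.2 θ) with hF
  have hFs : Summable F := by
    refine (summable_of_enorm (f := F) ?_).of_norm
    rw [tsum_prod_enn]
    have : ∀ c, ∑' q : (Fin ν → ℤ) × (Fin ν → ℤ), ‖F (c, q)‖ₑ ≤
        (schur (KamData.wE' ρ s) (entAbs A)) * coefAbs ρ B c b := by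
      intro c
      rw [tsum_prod_enn]
      calc ∑' (k : Fin ν → ℤ) (l : Fin ν → ℤ), ‖F (c, k, l)‖ₑ
          = ∑' k : Fin ν → ℤ, ‖ent A (a, k) (c, 0)‖ₑ * ∑' l : Fin ν → ℤ, ‖ent B (c, l) (b, 0)‖ₑ := by
            refine tsum_congr fun k => ?_
            rw [← ENNReal.tsum_mul_left]
            refine tsum_congr fun l => ?_
            simp only [hF, enorm_mul, enorm_chr, mul_one]
        _ = (∑' k : Fin ν → ℤ, ‖ent A (a, k) (c, 0)‖ₑ) *
            ∑' l : Fin ν → ℤ, ‖ent B (c, l) (b, 0)‖ₑ := ENNReal.tsum_mul_right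
        _ ≤ coefAbs ρ A a c * coefAbs ρ B c b := by
            have h1 : ∀ k : Fin ν → ℤ, 1 ≤ ENNReal.ofReal (Real.exp (ρ * absK k)) := fun k => by
              rw [ENNReal.one_le_ofReal]
              exact Real.one_le_exp (mul_nonneg hρ (absK_nonneg _))
            exact mul_le_mul' (ENNReal.tsum_le_tsum fun k => le_mul_of_one_le_right' (h1 k))
              (ENNReal.tsum_le_tsum fun k => le_mul_of_one_le_right' (h1 k))
        _ ≤ _ := by
            gcongr
            refine le_trans ?_ ((le_schur (wI s) (coefAbs ρ A) a c).trans
              (schur_coefAbs_le hA.toep ρ s))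
            exact le_mul_of_one_le_right' (one_le_wI hs a c)
    refine ne_top_of_le_ne_top ?_ (ENNReal.tsum_le_tsum this)
    rw [ENNReal.tsum_mul_left]
    refine ENNReal.mul_ne_top hA.fin (ne_top_of_le_ne_top hB.fin ?_)
    refine le_trans ?_ ((col_le_schur (wI s) (coefAbs ρ B) b).trans (schur_coefAbs_le hB.toep ρ s))
    exact ENNReal.tsum_le_tsum fun c => le_mul_of_one_le_right' (one_le_wI hs c b)
  have h1 : HasSum (fun c => evalM θ A a c * evalM θ B c b) (∑' p, F p) := by
    refine hFs.hasSum.prod_fiberwise fun c => ?_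
    have hc := hFs.prod_factor c
    have := (hA.summable_eval hρ hs θ a c).hasSum.mul (hB.summable_eval hρ hs θ c b).hasSum hc
    exact this
  let e : (Fin ν → ℤ) × Idx ν ≃ Pr × (Fin ν → ℤ) × (Fin ν → ℤ) :=
    { toFun := fun p => (p.2.1, p.1 - p.2.2, p.2.2)
      invFun := fun p => (p.2.1 + p.2.2, p.1, p.2.2)
      left_inv := fun p => by simp
      right_inv := fun p => by simp }
  have hG := (e.hasSum_iff).2 hFs.hasSum
  have h2 : HasSum (fun k => ent (A * B) (a, k) (b, 0) * chr k θ) (∑' p, F p) := by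
    refine hG.prod_fiberwise fun k => ?_
    have := (hasSum_ent_mul A B (a, k) (b, 0)).mul_right (chr k θ)
    have e2 : (fun c => (F ∘ e) (k, c)) =
        fun z => ent A (a, k) z * ent B z (b, 0) * chr k θ := by
      ext z
      obtain ⟨c, l⟩ := z
      change (ent A (a, k - l) (c, 0) * chr (k - l) θ) * (ent B (c, l) (b, 0) * chr l θ) = _
      rw [hA.toep.ent_eq a c k l]
      have : chr k θ = chr (k - l) θ * chr l θ := by rw [← chr_add, sub_add_cancel]
      rw [this]; ring
    rw [e2]
    exact this
  rw [evalM, h2.tsum_eq]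
  exact h1

end Nice

end Evaluation

section OpBounds

/-- The square of the norm of `H^r × H^r` in the extended reals. -/
def enormH (r : ℝ) (φ : Pr → ℂ) : ℝ≥0∞ :=
  ∑' i, ‖((bracket (mode i) ^ r : ℝ) : ℂ) * φ i‖ₑ ^ 2

lemma enormH_term (r : ℝ) (φ : Pr → ℂ) (i : Pr) :
    ‖((bracket (mode i) ^ r : ℝ) : ℂ) * φ i‖ₑ ^ 2 =
      ENNReal.ofReal (bracket (mode i) ^ (2 * r) * ‖φ i‖ ^ 2) := by
  have hb := bracket_pos (mode i)
  rw [← ofReal_norm, ← ENNReal.ofReal_pow (norm_nonneg _), norm_mul, Complex.norm_real,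
    Real.norm_eq_abs, abs_of_pos (Real.rpow_pos_of_pos hb r), mul_pow, ← Real.rpow_natCast,
    ← Real.rpow_mul hb.le, mul_comm r]
  norm_num

lemma memH_iff (r : ℝ) (φ : State) : MemH r φ ↔ enormH r φ ≠ ∞ := by
  have h0 : ∀ i, 0 ≤ bracket (mode i) ^ (2 * r) * ‖φ i‖ ^ 2 := fun i => by
    have := bracket_pos (mode i); positivity
  unfold MemH enormH
  simp_rw [enormH_term]
  constructor
  · intro h
    rw [← ENNReal.ofReal_tsum_of_nonneg h0 h]
    exact ENNReal.ofReal_ne_top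
  · intro h
    refine (ENNReal.summable_toReal h).congr fun i => ENNReal.toReal_ofReal (h0 i)

lemma ofReal_normH_sq {r : ℝ} {φ : State} (h : MemH r φ) :
    ENNReal.ofReal (normH r φ ^ 2) = enormH r φ := by
  have h0 : ∀ i, 0 ≤ bracket (mode i) ^ (2 * r) * ‖φ i‖ ^ 2 := fun i => by
    have := bracket_pos (mode i); positivity
  unfold normH enormH
  simp_rw [enormH_term]
  rw [Real.sq_sqrt (tsum_nonneg h0), ENNReal.ofReal_tsum_of_nonneg h0 h]

lemma normH_nonneg (r : ℝ) (φ : State) : 0 ≤ normH r φ := Real.sqrt_nonneg _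

lemma bracket_rpow_div_le {r s : ℝ} (hr : 0 ≤ r) (hrs : r ≤ s) (a b : Pr) :
    bracket (mode a) ^ r * (bracket (mode b) ^ r)⁻¹ ≤ (1 + |mode a - mode b|) ^ s := by
  have ha := bracket_pos (mode a)
  have hb := bracket_pos (mode b)
  have hb' := Real.rpow_pos_of_pos hb r
  rw [← div_eq_mul_inv, div_le_iff₀ hb']
  calc bracket (mode a) ^ r ≤ (bracket (mode b) * (1 + |mode a - mode b|)) ^ r :=
        Real.rpow_le_rpow ha.le (bracket_le_mul _ _) hr
    _ = bracket (mode b) ^ r * (1 + |mode a - mode b|) ^ r :=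
        Real.mul_rpow hb.le (by positivity)
    _ ≤ bracket (mode b) ^ r * (1 + |mode a - mode b|) ^ s := by
        gcongr
        simp
    _ = _ := mul_comm _ _

lemma opBound_of_schur {r s b : ℝ} (hr : 0 ≤ r) (hrs : r ≤ s) (hb : 0 ≤ b) (T : Op Pr)
    (h : schur (wI s) (entAbs T) ≤ ENNReal.ofReal b) : OpBound r T b := by
  intro φ hφ
  set a : Pr → Pr → ℂ := fun i j => ((bracket (mode i) ^ r : ℝ) : ℂ) * ent T i j *
    (((bracket (mode j) ^ r)⁻¹ : ℝ) : ℂ) with ha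
  set f : Pr → ℂ := fun i => ((bracket (mode i) ^ r : ℝ) : ℂ) * φ i with hf
  have hpos : ∀ i : Pr, 0 < bracket (mode i) ^ r := fun i =>
    Real.rpow_pos_of_pos (bracket_pos _) r
  have h1 : schur 1 (fun i j => ‖a i j‖ₑ) ≤ ENNReal.ofReal b := by
    refine le_trans (schur_mono fun i j => ?_) h
    simp only [Pi.one_apply, mul_one, ha, entAbs, wI]
    rw [← ofReal_norm, ← ofReal_norm, ← ENNReal.ofReal_mul (norm_nonneg _)]
    apply ENNReal.ofReal_le_ofReal
    rw [norm_mul, norm_mul, Complex.norm_real, Complex.norm_real, Real.norm_eq_abs,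
      Real.norm_eq_abs, abs_of_pos (hpos i), abs_of_pos (inv_pos.2 (hpos j))]
    calc _ = ‖ent T i j‖ * (bracket (mode i) ^ r * (bracket (mode j) ^ r)⁻¹) := by ring
      _ ≤ _ := by gcongr; exact bracket_rpow_div_le hr hrs i j
  have h2 : ∀ i, ∑' j, a i j * f j = ((bracket (mode i) ^ r : ℝ) : ℂ) * T φ i := by
    intro i
    rw [← (hasSum_apply T φ i).tsum_eq, ← tsum_mul_left]
    refine tsum_congr fun j => ?_
    have : ((bracket (mode j) ^ r : ℝ) : ℂ) ≠ 0 := by exact_mod_cast (hpos j).ne'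
    simp only [ha, hf]
    push_cast
    field_simp
  have h3 := schur_test a f
  simp_rw [h2] at h3
  have h4 : enormH r (T φ) ≤ ENNReal.ofReal b ^ 2 * enormH r φ :=
    h3.trans (by gcongr; exact le_rfl)
  have h5 : MemH r (T φ) := (memH_iff r _).2 (ne_top_of_le_ne_top
    (ENNReal.mul_ne_top (by simp) ((memH_iff r φ).1 hφ)) h4)
  refine ⟨h5, ?_⟩
  rw [← ofReal_normH_sq h5, ← ofReal_normH_sq hφ, ← ENNReal.ofReal_pow hb,
    ← ENNReal.ofReal_mul (by positivity), ENNReal.ofReal_le_ofReal_iff (by positivity),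
    ← mul_pow] at h4
  exact le_of_sq_le_sq h4 (mul_nonneg hb (normH_nonneg _ _))

end OpBounds

section Coordinates

variable {ν : ℕ} {ρ s : ℝ}

/-- The operator at the angle `θ` of a Toeplitz operator. -/
def evalOp (θ : Fin ν → ℝ) (A : Op (Idx ν)) : Op Pr := ofMat (evalM θ A)

lemma Nice.ent_evalOp {A : Op (Idx ν)} (hρ : 0 ≤ ρ) (hs : 0 ≤ s) (h : Nice ρ s A)
    (θ : Fin ν → ℝ) (a b : Pr) : ent (evalOp θ A) a b = evalM θ A a b :=
  ent_ofMat (h.schurBdd_evalM hρ hs θ) a b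

lemma Nice.evalOp_mul {A B : Op (Idx ν)} (hρ : 0 ≤ ρ) (hs : 0 ≤ s) (hA : Nice ρ s A)
    (hB : Nice ρ s B) (θ : Fin ν → ℝ) : evalOp θ (A * B) = evalOp θ A * evalOp θ B := by
  refine ent_ext fun a b => ?_
  rw [(hA.mul hρ hs hB).ent_evalOp hρ hs]
  refine (hA.evalM_mul hρ hs hB θ a b).unique ?_
  have := hasSum_ent_mul (evalOp θ A) (evalOp θ B) a b
  simpa only [hA.ent_evalOp hρ hs, hB.ent_evalOp hρ hs] using this

lemma evalOp_one (hρ : 0 ≤ ρ) (hs : 0 ≤ s) (θ : Fin ν → ℝ) : evalOp θ (1 : Op (Idx ν)) = 1 := by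
  refine ent_ext fun a b => ?_
  rw [(Nice.one (ρ := ρ) (s := s)).ent_evalOp hρ hs, evalM, tsum_eq_single 0]
  · rw [chr_zero, mul_one]
    by_cases hab : a = b
    · subst hab; rw [ent_one_self, ent_one_self]
    · rw [ent_one_ne hab, ent_one_ne (by simp [hab])]
  · intro k hk
    rw [ent_one_ne (by simp [hk]), zero_mul]

lemma evalM_periodic (A : Op (Idx ν)) (θ : Fin ν → ℝ) (k : Fin ν → ℤ) :
    evalM (fun i => θ i + 2 * Real.pi * k i) A = evalM θ A := by
  ext a b
  exact tsum_congr fun l => by rw [chr_periodic]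

lemma Nice.schur_evalOp_sub_le {A : Op (Idx ν)} (hρ : 0 < ρ) (hs : 0 ≤ s) (h : Nice ρ s A)
    (θ θ' : Fin ν → ℝ) : schur (wI s) (entAbs (evalOp θ A - evalOp θ' A)) ≤
      ENNReal.ofReal ((∑ i, |θ i - θ' i|) / ρ) * schur (KamData.wE' ρ s) (entAbs A) := by
  refine le_trans ?_ (mul_le_mul' le_rfl (schur_coefAbs_le h.toep ρ s))
  refine schur_le_mul _ fun a b => ?_
  rw [← mul_assoc]
  gcongr
  rw [entAbs, ent_sub, h.ent_evalOp hρ.le hs, h.ent_evalOp hρ.le hs, evalM, evalM,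
    ← (h.summable_eval hρ.le hs θ a b).tsum_sub (h.summable_eval hρ.le hs θ' a b), coefAbs,
    ← ENNReal.tsum_mul_left]
  refine enorm_tsum_le_tsum_enorm.trans (ENNReal.tsum_le_tsum fun k => ?_)
  rw [← mul_sub, enorm_mul, mul_left_comm]
  gcongr
  rw [← ofReal_norm, ← ENNReal.ofReal_mul (by positivity)]
  apply ENNReal.ofReal_le_ofReal
  refine (norm_chr_sub_le k θ θ').trans ?_
  have h1 : ρ * absK k ≤ Real.exp (ρ * absK k) := by
    linarith [Real.add_one_le_exp (ρ * absK k)]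
  have h2 : 0 ≤ ∑ i, |θ i - θ' i| := Finset.sum_nonneg fun i _ => abs_nonneg _
  calc absK k * ∑ i, |θ i - θ' i| = (∑ i, |θ i - θ' i|) / ρ * (ρ * absK k) := by field_simp
    _ ≤ _ := by gcongr

lemma Nice.eventually_schur_le {A : Op (Idx ν)} (hρ : 0 < ρ) (hs : 0 ≤ s) (h : Nice ρ s A)
    (θ₀ : Fin ν → ℝ) {ε : ℝ} (hε : 0 < ε) :
    ∀ᶠ θ in 𝓝 θ₀, schur (wI s) (entAbs (evalOp θ A - evalOp θ₀ A)) ≤ ENNReal.ofReal ε := by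
  set K := (schur (KamData.wE' ρ s) (entAbs A)).toReal with hK
  have hK0 : 0 ≤ K := ENNReal.toReal_nonneg
  have hc : Continuous fun θ : Fin ν → ℝ => (∑ i, |θ i - θ₀ i|) / ρ * K := by fun_prop
  have hlt : (fun θ : Fin ν → ℝ => (∑ i, |θ i - θ₀ i|) / ρ * K) θ₀ < ε := by simpa using hε
  filter_upwards [(hc.tendsto θ₀).eventually (eventually_lt_nhds hlt)] with θ hθ
  refine (h.schur_evalOp_sub_le hρ hs θ θ₀).trans ?_
  rw [← ENNReal.ofReal_toReal h.fin, ← hK, ← ENNReal.ofReal_mul (by positivity)]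
  exact ENNReal.ofReal_le_ofReal hθ.le

lemma Nice.schur_evalOp_le {A : Op (Idx ν)} (hρ : 0 ≤ ρ) (hs : 0 ≤ s) (h : Nice ρ s A)
    (θ : Fin ν → ℝ) : schur (wI s) (entAbs (evalOp θ A)) ≤
      schur (KamData.wE' ρ s) (entAbs A) := by
  refine le_trans (schur_mono fun a b => ?_) (schur_coefAbs_le h.toep ρ s)
  gcongr
  rw [entAbs, h.ent_evalOp hρ hs]
  exact enorm_evalM_le hρ θ A a b

lemma Nice.continuous_evalOp {A : Op (Idx ν)} (hρ : 0 < ρ) (hs : 0 ≤ s) (h : Nice ρ s A) :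
    Continuous fun θ => evalOp θ A := by
  rw [continuous_iff_continuousAt]
  intro θ₀
  rw [ContinuousAt, Metric.tendsto_nhds]
  intro ε hε
  filter_upwards [h.eventually_schur_le hρ hs θ₀ (half_pos hε)] with θ hθ
  have h1 := (enorm_le_schur _).trans ((schur_mono_weight _ (one_le_wI hs)).trans hθ)
  rw [← ofReal_norm, ENNReal.ofReal_le_ofReal_iff (by positivity)] at h1
  rw [dist_eq_norm]
  linarith

/-- The change of coordinates at the angle `θ` given by a pair of inverse Toeplitz operators. -/
def coordChange (A B : Op (Idx ν)) (h : ∀ θ, evalOp θ B * evalOp θ A = 1)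
    (h' : ∀ θ, evalOp θ A * evalOp θ B = 1) (θ : Fin ν → ℝ) : State ≃L[ℂ] State :=
  ContinuousLinearEquiv.equivOfInverse (evalOp θ A) (evalOp θ B)
    (fun φ => congrArg (fun T : Op Pr => T φ) (h θ))
    (fun φ => congrArg (fun T : Op Pr => T φ) (h' θ))

lemma isCoordChange {A B : Op (Idx ν)} (hρ : 0 < ρ) (hs : 0 ≤ s) (hA : Nice ρ s A)
    (hB : Nice ρ s B) (h : ∀ θ, evalOp θ B * evalOp θ A = 1)
    (h' : ∀ θ, evalOp θ A * evalOp θ B = 1) {s₀ : ℝ} (hs₀ : s₀ ≤ s) :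
    IsCoordChange s₀ (coordChange A B h h') where
  periodic := fun θ k => by
    refine DFunLike.ext _ _ fun φ => ?_
    change evalOp _ A φ = evalOp θ A φ
    rw [evalOp, evalOp, evalM_periodic]
  bounded := fun r hr θ => by
    set a := (schur (KamData.wE' ρ s) (entAbs A)).toReal
    set b := (schur (KamData.wE' ρ s) (entAbs B)).toReal
    refine ⟨max a b, ?_, ?_⟩
    · refine opBound_of_schur hr.1 (hr.2.trans hs₀) (le_max_of_le_left ENNReal.toReal_nonneg)
        (evalOp θ A) ((hA.schur_evalOp_le hρ.le hs θ).trans ?_)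
      rw [ENNReal.le_ofReal_iff_toReal_le hA.fin (le_max_of_le_left ENNReal.toReal_nonneg)]
      exact le_max_left _ _
    · refine opBound_of_schur hr.1 (hr.2.trans hs₀) (le_max_of_le_left ENNReal.toReal_nonneg)
        (evalOp θ B) ((hB.schur_evalOp_le hρ.le hs θ).trans ?_)
      rw [ENNReal.le_ofReal_iff_toReal_le hB.fin (le_max_of_le_left ENNReal.toReal_nonneg)]
      exact le_max_right _ _
  continuous := fun r hr θ₀ ε hε => by
    filter_upwards [hA.eventually_schur_le hρ hs θ₀ hε] with θ hθ
    exact opBound_of_schur hr.1 (hr.2.trans hs₀) hε.le (evalOp θ A - evalOp θ₀ A) hθ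

/-! ### Time derivatives -/

lemma hasDerivAt_chr (k : Fin ν → ℤ) (ω : Freq ν) (t : ℝ) :
    HasDerivAt (fun t : ℝ => chr k fun i => ω i * t)
      (Complex.I * (dotK k ω : ℂ) * chr k fun i => ω i * t) t := by
  have e : ∀ t : ℝ, chr k (fun i => ω i * t) =
      Complex.exp ((t : ℂ) * (Complex.I * (dotK k ω : ℂ))) := by
    intro t
    rw [chr]; congr 1
    simp only [dotK]
    push_cast
    rw [Finset.mul_sum, Finset.mul_sum, Finset.mul_sum]
    exact Finset.sum_congr rfl fun i _ => by ring
  simp_rw [e]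
  have h1 : HasDerivAt (fun t : ℝ => (t : ℂ) * (Complex.I * (dotK k ω : ℂ)))
      (1 * (Complex.I * (dotK k ω : ℂ))) t := (HasDerivAt.ofReal_comp (hasDerivAt_id t)).mul_const _
  have h2 := h1.cexp
  rw [one_mul] at h2
  convert h2 using 1
  ring

lemma Nice.hasDerivAt_evalM {A : Op (Idx ν)} (hρ : 0 < ρ) (hs : 0 ≤ s) (h : Nice ρ s A)
    (ω : Freq ν) (a b : Pr) (t : ℝ) :
    (Summable fun k => ent A (a, k) (b, 0) *
      (Complex.I * (dotK k ω : ℂ) * chr k fun i => ω i * t)) ∧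
    HasDerivAt (fun t : ℝ => evalM (fun i => ω i * t) A a b)
      (∑' k, ent A (a, k) (b, 0) * (Complex.I * (dotK k ω : ℂ) * chr k fun i => ω i * t)) t := by
  have hsum := (h.summable_coef_exp hs a b).mul_left (‖ω‖ / ρ)
  have hbd : ∀ (k : Fin ν → ℤ) (t : ℝ), ‖ent A (a, k) (b, 0) *
      (Complex.I * (dotK k ω : ℂ) * chr k fun i => ω i * t)‖ ≤
      ‖ω‖ / ρ * (‖ent A (a, k) (b, 0)‖ * Real.exp (ρ * absK k)) := by
    intro k t
    rw [norm_mul, norm_mul, norm_mul, norm_chr, Complex.norm_I, one_mul, mul_one, Complex.norm_real,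
      Real.norm_eq_abs]
    have h1 : ρ * absK k ≤ Real.exp (ρ * absK k) := by
      linarith [Real.add_one_le_exp (ρ * absK k)]
    calc ‖ent A (a, k) (b, 0)‖ * |dotK k ω| ≤ ‖ent A (a, k) (b, 0)‖ * (absK k * ‖ω‖) := by
          gcongr; exact abs_dotK_le k ω
      _ = ‖ω‖ / ρ * (‖ent A (a, k) (b, 0)‖ * (ρ * absK k)) := by field_simp
      _ ≤ _ := by gcongr
  refine ⟨Summable.of_norm_bounded hsum fun k => hbd k t, ?_⟩
  exact hasDerivAt_tsum hsum (fun k t => (hasDerivAt_chr k ω t).const_mul _) (fun k t => hbd k t)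
    (h.summable_eval hρ.le hs (fun i => ω i * 0) a b) t

end Coordinates

section WeakSolutions

lemma summable_of_majorant {M : Pr → Pr → ℝ≥0∞} (hM : schur 1 M ≠ ∞) (i : Pr) :
    Summable fun j => (M i j).toReal :=
  ENNReal.summable_toReal (ne_top_of_le_ne_top hM (by simpa using row_le_schur 1 M i))

lemma majorant_ne_top {M : Pr → Pr → ℝ≥0∞} (hM : schur 1 M ≠ ∞) (i j : Pr) : M i j ≠ ∞ :=
  ne_top_of_le_ne_top hM (by simpa using le_schur 1 M i j)

/-- A family of operators whose entries intertwine two Hamiltonians maps solutions to solutions. -/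
lemma IsSolution.map {H₁ H₂ : ℝ → Matrix Pr Pr ℂ} {μ₁ μ₂ : Pr → ℝ} {B₁ B₂ A : ℝ → Op Pr}
    {M₁ M₂ M : Pr → Pr → ℝ≥0∞}
    (hH₁ : ∀ t i j, H₁ t i j = (Matrix.diagonal fun i => (μ₁ i : ℂ)) i j + ent (B₁ t) i j)
    (hH₂ : ∀ t i j, H₂ t i j = (Matrix.diagonal fun i => (μ₂ i : ℂ)) i j + ent (B₂ t) i j)
    (hM₁ : schur 1 M₁ ≠ ∞) (hM₂ : schur 1 M₂ ≠ ∞) (hM : schur 1 M ≠ ∞)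
    (hB₁ : ∀ t i j, ‖ent (B₁ t) i j‖ₑ ≤ M₁ i j) (hB₂ : ∀ t i j, ‖ent (B₂ t) i j‖ₑ ≤ M₂ i j)
    (hA : ∀ t i j, ‖ent (A t) i j‖ₑ ≤ M i j) (hcont : Continuous A)
    (hderiv : ∀ t i j, HasDerivAt (fun u => ent (A u) i j)
      (-Complex.I * (((μ₂ i - μ₁ j : ℝ) : ℂ) * ent (A t) i j + ent (B₂ t * A t) i j -
        ent (A t * B₁ t) i j)) t)
    {ψ : ℝ → State} (hψ : IsSolution H₁ ψ) : IsSolution H₂ fun t => A t (ψ t) := by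
  have hdiag : ∀ (μ : Pr → ℝ) (f : State) (i : Pr),
      HasSum (fun j => (Matrix.diagonal fun i => (μ i : ℂ)) i j * f j) ((μ i : ℂ) * f i) := by
    intro μ f i
    have := hasSum_single (f := fun j => (Matrix.diagonal fun i => (μ i : ℂ)) i j * f j) i
      (fun j hj => by simp [Matrix.diagonal_apply_ne _ hj.symm])
    simpa using this
  have hHs : ∀ {H : ℝ → Matrix Pr Pr ℂ} {μ : Pr → ℝ} {B : ℝ → Op Pr},
      (∀ t i j, H t i j = (Matrix.diagonal fun i => (μ i : ℂ)) i j + ent (B t) i j) →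
      ∀ t i (f : State), HasSum (fun j => H t i j * f j) ((μ i : ℂ) * f i + B t f i) := by
    intro H μ B hH t i f
    simp_rw [hH, add_mul]
    exact (hdiag μ f i).add (hasSum_apply (B t) f i)
  refine ⟨hcont.clm_apply hψ.1, fun t₀ i => ⟨(hHs hH₂ t₀ i _).summable, ?_⟩⟩
  rw [(hHs hH₂ t₀ i _).tsum_eq]
  have hψd : ∀ t j, HasDerivAt (fun u => ψ u j)
      (-Complex.I * ((μ₁ j : ℂ) * ψ t j + B₁ t (ψ t) j)) t := fun t j => by
    have := (hψ.2 t j).2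
    rwa [(hHs hH₁ t j _).tsum_eq] at this
  obtain ⟨R, hR⟩ := (isCompact_Icc (a := t₀ - 1) (b := t₀ + 1)).exists_bound_of_continuousOn
    hψ.1.continuousOn
  have hR0 : 0 ≤ R := (norm_nonneg _).trans (hR t₀ ⟨by linarith, by linarith⟩)
  set M₃ : Pr → Pr → ℝ≥0∞ := fun i j => ∑' k, M₂ i k * M k j with hM₃
  set M₄ : Pr → Pr → ℝ≥0∞ := fun i j => ∑' k, M i k * M₁ k j with hM₄
  have hM₃f : schur 1 M₃ ≠ ∞ := ne_top_of_le_ne_top (ENNReal.mul_ne_top hM₂ hM)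
    (schur_mul_le (fun _ _ => le_rfl) fun _ _ _ => by simp)
  have hM₄f : schur 1 M₄ ≠ ∞ := ne_top_of_le_ne_top (ENNReal.mul_ne_top hM hM₁)
    (schur_mul_le (fun _ _ => le_rfl) fun _ _ _ => by simp)
  have hprod : ∀ (S T : Op Pr) (i j : Pr) (U V : Pr → Pr → ℝ≥0∞), (∀ i j, ‖ent S i j‖ₑ ≤ U i j) →
      (∀ i j, ‖ent T i j‖ₑ ≤ V i j) → ‖ent (S * T) i j‖ₑ ≤ ∑' k, U i k * V k j := by
    intro S T i j U V hU hV
    rw [← (hasSum_ent_mul S T i j).tsum_eq]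
    refine enorm_tsum_le_tsum_enorm.trans (ENNReal.tsum_le_tsum fun k => ?_)
    rw [enorm_mul]
    exact mul_le_mul' (hU i k) (hV k j)
  have hreal : ∀ {z : ℂ} {m : ℝ≥0∞}, m ≠ ∞ → ‖z‖ₑ ≤ m → ‖z‖ ≤ m.toReal := by
    intro z m hm h
    have := ENNReal.toReal_mono hm h
    simpa using this
  set b₁ := (schur 1 M₁).toReal with hb₁
  have hB₁n : ∀ t, ‖B₁ t‖ ≤ b₁ := by
    intro t
    have h1 : ‖B₁ t‖ₑ ≤ schur 1 M₁ := (enorm_le_schur _).trans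
      (schur_mono fun i j => by gcongr; exact hB₁ t i j)
    have := ENNReal.toReal_mono hM₁ h1
    simpa using this
  set u : Pr → ℝ := fun j => (|μ₂ i| * (M i j).toReal + (M₃ i j).toReal + (M₄ i j).toReal +
    (M i j).toReal * b₁) * R with hu
  have hus : Summable u := by
    refine Summable.mul_right R ?_
    exact ((((summable_of_majorant hM i).mul_left _).add (summable_of_majorant hM₃f i)).add
      (summable_of_majorant hM₄f i)).add ((summable_of_majorant hM i).mul_right _)
  set g' : Pr → ℝ → ℂ := fun j t => -Complex.I * ((μ₂ i : ℂ) * (ent (A t) i j * ψ t j) +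
    ent (B₂ t * A t) i j * ψ t j - ent (A t * B₁ t) i j * ψ t j +
    ent (A t) i j * B₁ t (ψ t) j) with hg'
  have hgd : ∀ j, ∀ t, HasDerivAt (fun v => ent (A v) i j * ψ v j) (g' j t) t := by
    intro j t
    have := (hderiv t i j).mul (hψd t j)
    refine this.congr_deriv ?_
    simp only [hg']
    push_cast
    ring
  have hgb : ∀ j, ∀ t ∈ Set.Ioo (t₀ - 1) (t₀ + 1), ‖g' j t‖ ≤ u j := by
    intro j t ht
    have hRt : ‖ψ t‖ ≤ R := hR t ⟨ht.1.le, ht.2.le⟩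
    have hψj : ‖ψ t j‖ ≤ R := (lp.norm_apply_le_norm (by norm_num) _ j).trans hRt
    have hBj : ‖B₁ t (ψ t) j‖ ≤ b₁ * R := by
      refine (lp.norm_apply_le_norm (by norm_num) _ j).trans ?_
      refine ((B₁ t).le_opNorm _).trans ?_
      exact mul_le_mul (hB₁n t) hRt (norm_nonneg _) ENNReal.toReal_nonneg
    have a1 := hreal (majorant_ne_top hM i j) (hA t i j)
    have a2 := hreal (majorant_ne_top hM₃f i j) (hprod (B₂ t) (A t) i j M₂ M (hB₂ t) (hA t))
    have a3 := hreal (majorant_ne_top hM₄f i j) (hprod (A t) (B₁ t) i j M M₁ (hA t) (hB₁ t))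
    have n1 : ‖(μ₂ i : ℂ) * (ent (A t) i j * ψ t j)‖ ≤ |μ₂ i| * ((M i j).toReal * R) := by
      rw [norm_mul, norm_mul, Complex.norm_real, Real.norm_eq_abs]; gcongr
    have n2 : ‖ent (B₂ t * A t) i j * ψ t j‖ ≤ (M₃ i j).toReal * R := by
      rw [norm_mul]; gcongr
    have n3 : ‖ent (A t * B₁ t) i j * ψ t j‖ ≤ (M₄ i j).toReal * R := by
      rw [norm_mul]; gcongr
    have n4 : ‖ent (A t) i j * B₁ t (ψ t) j‖ ≤ (M i j).toReal * (b₁ * R) := by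
      rw [norm_mul]; gcongr
    calc ‖g' j t‖ = ‖(μ₂ i : ℂ) * (ent (A t) i j * ψ t j) +
          ent (B₂ t * A t) i j * ψ t j - ent (A t * B₁ t) i j * ψ t j +
          ent (A t) i j * B₁ t (ψ t) j‖ := by simp [hg']
      _ ≤ ‖(μ₂ i : ℂ) * (ent (A t) i j * ψ t j)‖ + ‖ent (B₂ t * A t) i j * ψ t j‖ +
          ‖ent (A t * B₁ t) i j * ψ t j‖ + ‖ent (A t) i j * B₁ t (ψ t) j‖ :=
          (norm_add_le _ _).trans (by
            gcongr
            exact (norm_sub_le _ _).trans (by gcongr; exact norm_add_le _ _))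
      _ ≤ |μ₂ i| * ((M i j).toReal * R) + (M₃ i j).toReal * R + (M₄ i j).toReal * R +
          (M i j).toReal * (b₁ * R) := by gcongr
      _ = u j := by simp only [hu]; ring
  have hmem : t₀ ∈ Set.Ioo (t₀ - 1) (t₀ + 1) := ⟨by linarith, by linarith⟩
  have hmain := hasDerivAt_tsum_of_isPreconnected hus isOpen_Ioo isPreconnected_Ioo
    (fun j t _ => hgd j t) hgb hmem (hasSum_apply (A t₀) (ψ t₀) i).summable hmem
  have e1 : (fun t => ∑' j, ent (A t) i j * ψ t j) = fun t => A t (ψ t) i := by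
    ext t; exact (hasSum_apply (A t) (ψ t) i).tsum_eq
  have e2 : HasSum (fun j => g' j t₀) (-Complex.I * ((μ₂ i : ℂ) * A t₀ (ψ t₀) i +
      B₂ t₀ (A t₀ (ψ t₀)) i)) := by
    have h1 := (hasSum_apply (A t₀) (ψ t₀) i).mul_left (μ₂ i : ℂ)
    have h2 := hasSum_apply (B₂ t₀ * A t₀) (ψ t₀) i
    have h3 := hasSum_apply (A t₀ * B₁ t₀) (ψ t₀) i
    have h4 := hasSum_apply (A t₀) (B₁ t₀ (ψ t₀)) i
    have := (((h1.add h2).sub h3).add h4).mul_left (-Complex.I)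
    have e : (A t₀ * B₁ t₀) (ψ t₀) i = A t₀ (B₁ t₀ (ψ t₀)) i := rfl
    rw [e, sub_add_cancel] at this
    exact this
  rw [e1, e2.tsum_eq] at hmain
  exact hmain

end WeakSolutions

section Transfer

variable {ν : ℕ} {ρ s : ℝ}

lemma Nice.hasDerivAt_evalOp {A C : Op (Idx ν)} (hρ : 0 < ρ) (hs : 0 ≤ s) (hA : Nice ρ s A)
    (hC : Nice ρ s C) {ω : Freq ν} {a b : Pr} {c : ℝ} {e : ℂ}
    (h : ∀ k, Complex.I * (dotK k ω : ℂ) * ent A (a, k) (b, 0) =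
      e * ent C (a, k) (b, 0) - Complex.I * (c : ℂ) * ent A (a, k) (b, 0)) (t : ℝ) :
    HasDerivAt (fun u : ℝ => ent (evalOp (fun i => ω i * u) A) a b)
      (e * ent (evalOp (fun i => ω i * t) C) a b -
        Complex.I * (c : ℂ) * ent (evalOp (fun i => ω i * t) A) a b) t := by
  simp_rw [hA.ent_evalOp hρ.le hs, hC.ent_evalOp hρ.le hs]
  refine (hA.hasDerivAt_evalM hρ hs ω a b t).2.congr_deriv ?_
  have h1 := (hC.summable_eval hρ.le hs (fun i => ω i * t) a b).mul_left e
  have h2 := (hA.summable_eval hρ.le hs (fun i => ω i * t) a b).mul_left (Complex.I * (c : ℂ))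
  rw [evalM, evalM, ← tsum_mul_left, ← tsum_mul_left, ← h1.tsum_sub h2]
  refine tsum_congr fun k => ?_
  calc _ = (Complex.I * (dotK k ω : ℂ) * ent A (a, k) (b, 0)) * chr k (fun i => ω i * t) := by ring
    _ = _ := by rw [h]; ring

lemma evalOp_smul_ent {A : Op (Idx ν)} (θ : Fin ν → ℝ) (c : ℂ) (i j : Pr) :
    ent (c • evalOp θ A) i j = c * ent (evalOp θ A) i j := by
  simp [ent]

/-- An operator in the extended space which removes the perturbation provides a change of
coordinates conjugating the quasi-periodic system to the diagonal one. -/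
theorem exists_coordChange {S : KState ν} {κ τ α N b s₀ : ℝ} {ω : Freq ν} {W : Op (Idx ν)}
    (hρ : 0 < ρ) (hs : 0 ≤ s) (hs₀ : s₀ ≤ s) (hb : 0 ≤ b)
    (hL : KamData.Limit S κ τ α N ω W) (hP : Nice ρ s (S.P ω))
    (hsk : kstar (sig ν) (S.P ω) = -S.P ω)
    (hW : schur (KamData.wE' ρ s) (entAbs (W - 1)) ≤ ENNReal.ofReal b)
    {H : (Fin ν → ℝ) → Matrix Pr Pr ℂ}
    (hH : ∀ θ i j, H θ i j = (Matrix.diagonal fun a => (S.μ a ω : ℂ)) i j +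
      Complex.I * evalM θ (S.P ω) i j)
    {lam : ℕ+ → ℝ} (hl : ∀ j, KamData.muLim S κ τ α N (Sum.inl j) ω = lam j)
    (hr : ∀ j, KamData.muLim S κ τ α N (Sum.inr j) ω = -lam j) :
    ∃ Wf : (Fin ν → ℝ) → State ≃L[ℂ] State, IsCoordChange s₀ Wf ∧
      Conjugates ω Wf H (diagSigma3 lam) ∧
      ∀ r ∈ Set.Icc 0 s₀, ∀ θ : Fin ν → ℝ,
        OpBound r ((Wf θ : State →L[ℂ] State) - ContinuousLinearMap.id ℂ State) b := by
  set P := S.P ω with hPdef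
  set μ' : Pr → ℝ := fun a => KamData.muLim S κ τ α N a ω with hμ'
  have hWn : Nice ρ s W := Nice.of_sub_one ENNReal.ofReal_ne_top hL.toep hW
  set Z := kstar (sig ν) W with hZ
  have hZn : Nice ρ s Z := hWn.kstar
  have hZW : ∀ θ, evalOp θ Z * evalOp θ W = 1 := fun θ => by
    rw [← hZn.evalOp_mul hρ.le hs hWn, hL.left_inv, evalOp_one hρ.le hs]
  have hWZ : ∀ θ, evalOp θ W * evalOp θ Z = 1 := fun θ => by
    rw [← hWn.evalOp_mul hρ.le hs hZn, hL.right_inv, evalOp_one hρ.le hs]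
  refine ⟨coordChange W Z hZW hWZ, isCoordChange hρ hs hWn hZn hZW hWZ hs₀, ?_, ?_⟩
  · have hdiag : ∀ i j, diagSigma3 lam i j = (Matrix.diagonal fun a => (μ' a : ℂ)) i j := by
      rintro (i | i) (j | j)
      · by_cases hij : i = j
        · subst hij; simp [diagSigma3, hμ', hl]
        · simp [diagSigma3, hij]
      · simp [diagSigma3]
      · simp [diagSigma3]
      · by_cases hij : i = j
        · subst hij; simp [diagSigma3, hμ', hr]
        · simp [diagSigma3, hij]
    have hcl : ∀ t : ℝ, Continuous fun t : ℝ => (fun i => ω i * t : Fin ν → ℝ) := fun _ => by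
      fun_prop
    have hD : ∀ x : Idx ν, starRingEnd ℂ (S.diag ω x) = -S.diag ω x := fun x => by
      simp only [KState.diag, map_mul, map_neg, Complex.conj_I, Complex.conj_ofReal]; ring
    have hD' : ∀ y : Idx ν, starRingEnd ℂ (-Complex.I * ((dotK y.2 ω + μ' y.1 : ℝ) : ℂ)) =
        -(-Complex.I * ((dotK y.2 ω + μ' y.1 : ℝ) : ℂ)) := fun x => by
      simp only [map_mul, map_neg, Complex.conj_I, Complex.conj_ofReal]; ring
    have hitw : Itw (S.diag ω) (fun y : Idx ν => -Complex.I * ((dotK y.2 ω + μ' y.1 : ℝ) : ℂ)) W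
        (-(P * W)) := fun x y => by rw [ent_neg]; exact hL.itw x y
    have hitwZ : Itw (fun y : Idx ν => -Complex.I * ((dotK y.2 ω + μ' y.1 : ℝ) : ℂ)) (S.diag ω) Z
        (Z * P) := by
      have h := Itw.kstar norm_sgn_le hD hD' hitw
      have e : kstar (diagOp sgn) (-(P * W)) = Z * P := by
        have h1 : kstar (sig ν) (P * W + -(P * W)) =
            kstar (sig ν) (P * W) + kstar (sig ν) (-(P * W)) := kstar_add _ _ _
        have h2 : kstar (sig ν) (P * W) = -(Z * P) := by
          rw [kstar_mul sig_mul_sig, hsk, mul_neg]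
        have h3 : kstar (sig ν) (0 : Op (Idx ν)) = 0 := by simp [kstar]
        rw [add_neg_cancel, h3, h2] at h1
        exact (neg_add_eq_zero.1 h1.symm).symm
      rwa [e] at h
    have hfin : ∀ {A : Op (Idx ν)}, Nice ρ s A → schur 1 (coefAbs ρ A) ≠ ∞ := fun {A} hA =>
      ne_top_of_le_ne_top hA.fin ((schur_mono_weight _ fun a b => one_le_wI hs a b).trans
        (schur_coefAbs_le hA.toep ρ s))
    have hmaj : ∀ {A : Op (Idx ν)}, Nice ρ s A → ∀ (θ : Fin ν → ℝ) (i j : Pr),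
        ‖ent (evalOp θ A) i j‖ₑ ≤ coefAbs ρ A i j := fun {A} hA θ i j => by
      rw [hA.ent_evalOp hρ.le hs]; exact enorm_evalM_le hρ.le θ A i j
    have hmajI : ∀ (θ : Fin ν → ℝ) (i j : Pr),
        ‖ent (Complex.I • evalOp θ P) i j‖ₑ ≤ coefAbs ρ P i j := fun θ i j => by
      rw [evalOp_smul_ent, enorm_mul]
      have hI : ‖Complex.I‖ₑ = 1 := by rw [← ofReal_norm, Complex.norm_I, ENNReal.ofReal_one]
      rw [hI, one_mul]
      exact hmaj hP θ i j
    have h0 : schur 1 (fun _ _ : Pr => (0 : ℝ≥0∞)) ≠ ∞ := by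
      refine ne_top_of_le_ne_top ENNReal.zero_ne_top (schur_le_iff.2 ⟨fun _ => ?_, fun _ => ?_⟩) <;>
        simp
    have hH₁ : ∀ (t : ℝ) i j, diagSigma3 lam i j =
        (Matrix.diagonal fun a => (μ' a : ℂ)) i j + ent ((fun _ => 0 : ℝ → Op Pr) t) i j :=
      fun t i j => by rw [ent_zero, add_zero, hdiag]
    have hH₂ : ∀ (t : ℝ) i j, H (fun i => ω i * t) i j =
        (Matrix.diagonal fun a => (S.μ a ω : ℂ)) i j +
          ent (Complex.I • evalOp (fun i => ω i * t) P) i j := fun t i j => by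
      rw [hH, evalOp_smul_ent, hP.ent_evalOp hρ.le hs]
    intro φ
    constructor
    · intro hφ
      refine IsSolution.map (A := fun t : ℝ => evalOp (fun i => ω i * t) W) hH₁ hH₂ h0 (hfin hP)
        (hfin hWn) (fun t i j => by simp [ent_zero]) (fun t => hmajI _) (fun t => hmaj hWn _)
        ((hWn.continuous_evalOp hρ hs).comp (hcl 0)) (fun t i j => ?_) hφ
      have hd := hWn.hasDerivAt_evalOp hρ hs (hP.mul hρ.le hs hWn) (ω := ω) (a := i) (b := j)
        (c := S.μ i ω - μ' j) (e := 1) (fun k => by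
          have h1 := hL.itw (i, k) (j, 0)
          simp only [KState.diag, dotK_zero] at h1
          have h2 : ent (P * W) (i, k) (j, 0) = -(-ent (P * W) (i, k) (j, 0)) := by ring
          rw [h2, ← h1]
          simp only [hμ']
          push_cast
          ring) t
      refine hd.congr_deriv ?_
      rw [hP.evalOp_mul hρ.le hs hWn, smul_mul_assoc, mul_zero, ent_zero]
      have : ent (Complex.I • (evalOp (fun i => ω i * t) P * evalOp (fun i => ω i * t) W)) i j =
        Complex.I * ent (evalOp (fun i => ω i * t) P * evalOp (fun i => ω i * t) W) i j := by
        simp [ent]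
      rw [this]
      linear_combination (ent (evalOp (fun i => ω i * t) P * evalOp (fun i => ω i * t) W) i j) *
        Complex.I_mul_I
    · intro hψ
      have h := IsSolution.map (A := fun t : ℝ => evalOp (fun i => ω i * t) Z) hH₂ hH₁ (hfin hP) h0
        (hfin hZn) (fun t => hmajI _) (fun t i j => by simp [ent_zero]) (fun t => hmaj hZn _)
        ((hZn.continuous_evalOp hρ hs).comp (hcl 0)) (fun t i j => ?_) hψ
      · have e : (fun t : ℝ => evalOp (fun i => ω i * t) Z
            (coordChange W Z hZW hWZ (fun i => ω i * t) (φ t))) = φ := by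
          ext1 t
          exact congrArg (fun T : Op Pr => T (φ t)) (hZW fun i => ω i * t)
        rwa [e] at h
      have hd := hZn.hasDerivAt_evalOp hρ hs ((hZn.mul hρ.le hs hP)) (ω := ω) (a := i) (b := j)
        (c := μ' i - S.μ j ω) (e := -1) (fun k => by
          have h1 := hitwZ (i, k) (j, 0)
          simp only [KState.diag, dotK_zero] at h1
          rw [← h1]
          push_cast
          ring) t
      refine hd.congr_deriv ?_
      rw [hZn.evalOp_mul hρ.le hs hP, mul_smul_comm, zero_mul, ent_zero]
      have : ent (Complex.I • (evalOp (fun i => ω i * t) Z * evalOp (fun i => ω i * t) P)) i j =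
        Complex.I * ent (evalOp (fun i => ω i * t) Z * evalOp (fun i => ω i * t) P) i j := by
        simp [ent]
      rw [this]
      linear_combination -(ent (evalOp (fun i => ω i * t) Z * evalOp (fun i => ω i * t) P) i j) *
        Complex.I_mul_I
  · intro r hr' θ
    refine opBound_of_schur hr'.1 (hr'.2.trans hs₀) hb
      ((coordChange W Z hZW hWZ θ : State →L[ℂ] State) - ContinuousLinearMap.id ℂ State) ?_
    have h1n : Nice ρ s (W - 1) :=
      ⟨fun a => Subring.sub_mem _ (hWn.toep a) (Subring.one_mem _),
        ne_top_of_le_ne_top ENNReal.ofReal_ne_top hW⟩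
    refine le_trans (le_of_eq ?_) ((h1n.schur_evalOp_le hρ.le hs θ).trans hW)
    congr 1
    ext a b
    have e1 : ((coordChange W Z hZW hWZ θ : State →L[ℂ] State) - ContinuousLinearMap.id ℂ State) =
      evalOp θ W - evalOp θ 1 := by rw [evalOp_one hρ.le hs]; rfl
    rw [e1, entAbs, entAbs, ent_sub, hWn.ent_evalOp hρ.le hs, h1n.ent_evalOp hρ.le hs,
      (Nice.one (ρ := ρ) (s := s)).ent_evalOp hρ.le hs, hWn.evalM_sub hρ.le hs Nice.one]

end Transfer

section FourierBox

open MeasureTheory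
open scoped Pointwise

variable {ν : ℕ}

/-- The period box of the angles. -/
abbrev box (ν : ℕ) : Set (Fin ν → ℝ) := Set.Icc (0 : Fin ν → ℝ) (fun _ => 2 * Real.pi)

lemma two_pi_isUnit : ∀ _ : Fin ν, IsUnit (2 * Real.pi) := fun _ => by
  simp [Real.pi_ne_zero]

lemma isCompact_box : IsCompact (box ν) := isCompact_Icc

lemma integral_box_add {f : (Fin ν → ℝ) → ℂ}
    (hf : ∀ (θ : Fin ν → ℝ) (k : Fin ν → ℤ), f (fun i => θ i + 2 * Real.pi * k i) = f θ)
    (η : Fin ν → ℝ) : ∫ θ in box ν, f (θ + η) = ∫ θ in box ν, f θ := by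
  set b := (Pi.basisFun ℝ (Fin ν)).isUnitSMul (two_pi_isUnit (ν := ν)) with hb
  set D := ZSpan.fundamentalDomain b with hD
  have hpi : (0 : ℝ) < 2 * Real.pi := by positivity
  have hDeq : D = Set.univ.pi fun _ : Fin ν => Set.Ico (0 : ℝ) (2 * Real.pi) := by
    ext x
    simp only [hD, ZSpan.mem_fundamentalDomain, Set.mem_pi, Set.mem_univ, true_imp_iff, Set.mem_Ico]
    refine forall_congr' fun i => ?_
    have e : b.repr x i = (2 * Real.pi)⁻¹ * x i := by
      rw [hb, Module.Basis.repr_isUnitSMul, Units.smul_def, Units.val_inv_eq_inv_val,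
        IsUnit.unit_spec]
      simp
    rw [e, inv_mul_eq_div, le_div_iff₀ hpi, div_lt_iff₀ hpi]
    simp
  have hae : D =ᵐ[volume] box ν := by
    rw [hDeq]
    exact Measure.univ_pi_Ico_ae_eq_Icc
  have h1 := ZSpan.isAddFundamentalDomain' b volume
  have h2 : IsAddFundamentalDomain (Submodule.span ℤ (Set.range b)).toAddSubgroup (η +ᵥ D) volume :=
    h1.vadd_of_comm η
  have hper : ∀ (g : (Submodule.span ℤ (Set.range b)).toAddSubgroup) (x : Fin ν → ℝ), f (g +ᵥ x) = f x := by
    intro g x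
    obtain ⟨c, hc⟩ := (Submodule.mem_span_range_iff_exists_fun ℤ).1 g.2
    rw [← hf x c]
    congr 1
    ext i
    have : (g : Fin ν → ℝ) i = 2 * Real.pi * c i := by
      rw [← hc, Finset.sum_apply, Finset.sum_eq_single i]
      · simp [hb, Module.Basis.isUnitSMul_apply]; ring
      · intro j _ hj
        simp [hb, Module.Basis.isUnitSMul_apply, Pi.single_eq_of_ne hj.symm]
      · simp
    rw [← this, add_comm]; rfl
  have : Countable (Submodule.span ℤ (Set.range b)).toAddSubgroup :=
    inferInstanceAs (Countable (Submodule.span ℤ (Set.range b)))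
  have h3 := h1.setIntegral_eq h2 hper
  have h4 := (measurePreserving_add_right volume η).setIntegral_preimage_emb
    (measurableEmbedding_addRight η) f (η +ᵥ D)
  have h5 : (fun x => x + η) ⁻¹' (η +ᵥ D) = D := by
    ext x
    simp [Set.mem_vadd_set, add_comm]
  rw [h5] at h4
  rw [← setIntegral_congr_set hae, ← setIntegral_congr_set hae, h4, ← h3]

lemma continuous_chr (k : Fin ν → ℤ) : Continuous (chr k) := by
  unfold chr dotK
  fun_prop

lemma chr_eq_prod (k : Fin ν → ℤ) (θ : Fin ν → ℝ) :
    chr k θ = ∏ i, Complex.exp (Complex.I * (k i : ℂ) * (θ i : ℂ)) := by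
  rw [chr, ← Complex.exp_sum, dotK]
  push_cast
  rw [Finset.mul_sum]
  congr 1
  exact Finset.sum_congr rfl fun i _ => by ring

lemma integral_chr (k : Fin ν → ℤ) :
    ∫ θ in box ν, chr k θ = if k = 0 then (((2 * Real.pi) ^ ν : ℝ) : ℂ) else 0 := by
  have hbox : box ν = Set.univ.pi fun _ : Fin ν => Set.Icc (0 : ℝ) (2 * Real.pi) := by
    rw [Set.pi_univ_Icc]; rfl
  simp_rw [chr_eq_prod]
  rw [hbox, volume_pi, Measure.restrict_pi_pi,
    integral_fintype_prod_eq_prod (𝕜 := ℂ)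
      (f := fun i (x : ℝ) => Complex.exp (Complex.I * (k i : ℂ) * (x : ℂ)))]
  have hone : ∀ j : ℤ, ∫ x in Set.Icc (0 : ℝ) (2 * Real.pi), Complex.exp (Complex.I * (j : ℂ) * x) =
      if j = 0 then ((2 * Real.pi : ℝ) : ℂ) else 0 := by
    intro j
    rw [integral_Icc_eq_integral_Ioc, ← intervalIntegral.integral_of_le (by positivity)]
    split_ifs with hj
    · simp [hj]
    · rw [integral_exp_mul_complex (by simp [hj])]
      have : Complex.exp (Complex.I * (j : ℂ) * ((2 * Real.pi : ℝ) : ℂ)) = 1 := by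
        rw [show Complex.I * (j : ℂ) * ((2 * Real.pi : ℝ) : ℂ) = j * (2 * Real.pi * Complex.I) by
          push_cast; ring]
        exact Complex.exp_int_mul_two_pi_mul_I j
      rw [this]; simp
  simp_rw [hone]
  split_ifs with h
  · subst h; simp
  · obtain ⟨i, hi⟩ := Function.ne_iff.1 h
    exact Finset.prod_eq_zero (Finset.mem_univ i) (by simpa using hi)

lemma fourierK_eq (f : (Fin ν → ℝ) → ℂ) (k : Fin ν → ℤ) :
    fourierK f k = ((1 / (2 * Real.pi) ^ ν : ℝ) : ℂ) * ∫ θ in box ν, f θ * chr (-k) θ := by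
  unfold fourierK chr
  simp_rw [dotK_neg]
  push_cast
  simp

lemma volume_box : volume (box ν) = ENNReal.ofReal ((2 * Real.pi) ^ ν) := by
  rw [Real.volume_Icc_pi]
  simp [ENNReal.ofReal_pow Real.pi_pos.le, ENNReal.ofReal_mul, mul_pow]

lemma volume_box_real : (volume : Measure (Fin ν → ℝ)).real (box ν) = (2 * Real.pi) ^ ν := by
  rw [Measure.real, volume_box, ENNReal.toReal_ofReal (by positivity)]

/-- The Fourier coefficients of an absolutely convergent series. -/
lemma fourierK_tsum {a : (Fin ν → ℤ) → ℂ} (ha : Summable fun k => ‖a k‖) (l : Fin ν → ℤ) :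
    fourierK (fun θ => ∑' k, a k * chr k θ) l = a l := by
  rw [fourierK_eq]
  simp_rw [← tsum_mul_right, mul_assoc, ← chr_add]
  have hc : ∀ k, Continuous fun θ => a k * chr (k + -l) θ := fun k =>
    continuous_const.mul (continuous_chr _)
  have h1 : ∀ k, Integrable (fun θ => a k * chr (k + -l) θ) (volume.restrict (box ν)) := fun k =>
    (hc k).continuousOn.integrableOn_compact isCompact_box
  have h2 := hasSum_integral_of_summable_integral_norm h1 (by
    simp_rw [norm_mul, norm_chr, mul_one]
    simpa using ha.mul_left _)
  rw [← h2.tsum_eq]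
  simp_rw [integral_const_mul, integral_chr]
  rw [tsum_eq_single l]
  · have : ((2 * Real.pi) ^ ν : ℝ) ≠ 0 := by positivity
    have h' : (((2 * Real.pi) ^ ν : ℝ) : ℂ) ≠ 0 := by exact_mod_cast this
    simp only [add_neg_cancel, if_true]
    push_cast at h' ⊢
    field_simp
  · intro k hk
    rw [if_neg (by rw [← sub_eq_add_neg]; exact sub_ne_zero.2 hk), mul_zero]

lemma norm_fourierK_le {f : (Fin ν → ℝ) → ℂ} {C : ℝ} (h : ∀ θ, ‖f θ‖ ≤ C) (k : Fin ν → ℤ) :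
    ‖fourierK f k‖ ≤ C := by
  rw [fourierK_eq, norm_mul, Complex.norm_real, Real.norm_of_nonneg (by positivity)]
  have h1 := norm_setIntegral_le_of_norm_le_const (f := fun θ => f θ * chr (-k) θ) (C := C)
    (s := box ν) (μ := volume) (isCompact_box.measure_lt_top) (fun θ _ => by
      rw [norm_mul, norm_chr, mul_one]; exact h θ)
  rw [volume_box_real] at h1
  have h2 : (0 : ℝ) < (2 * Real.pi) ^ ν := by positivity
  rw [one_div, inv_mul_le_iff₀ h2, mul_comm]
  exact h1

/-- The point `θ + w y` of complexified angle space. -/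
def cpt (θ y : Fin ν → ℝ) (w : ℂ) : Fin ν → ℂ := fun i => (θ i : ℂ) + w * (y i : ℂ)

lemma cpt_mem_strip {ρ : ℝ} {y : Fin ν → ℝ} (hy : ∑ i, y i ^ 2 = 1) (θ : Fin ν → ℝ) {w : ℂ}
    (hw : |w.im| < ρ) : cpt θ y w ∈ strip ν ρ := by
  have e : ∀ i, (cpt θ y w i).im = w.im * y i := fun i => by simp [cpt]
  simp only [strip, Set.mem_ofPred_eq, e, mul_pow, ← Finset.mul_sum, hy, mul_one]
  rwa [Real.sqrt_sq_eq_abs]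

/-- Integrand of the Fourier coefficient on a shifted contour. -/
def shiftedIntegrand (F : (Fin ν → ℂ) → ℂ) (k : Fin ν → ℤ) (y : Fin ν → ℝ) (w : ℂ)
    (θ : Fin ν → ℝ) : ℂ :=
  F (cpt θ y w) * Complex.exp (-Complex.I * ((dotK k θ : ℂ) + w * (dotK k y : ℂ)))

/-- Exponential decay of the Fourier coefficients of a function analytic and bounded in a strip. -/
lemma norm_fourierK_le_of_strip {ρ σ C : ℝ} (hσ : 0 ≤ σ) (hσρ : σ < ρ)
    {F : (Fin ν → ℂ) → ℂ} {f : (Fin ν → ℝ) → ℂ} (hF : DifferentiableOn ℂ F (strip ν ρ))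
    (hC : ∀ z ∈ strip ν ρ, ‖F z‖ ≤ C) (hFf : ∀ θ : Fin ν → ℝ, F (fun i => (θ i : ℂ)) = f θ)
    (hf : ∀ (θ : Fin ν → ℝ) (k : Fin ν → ℤ), f (fun i => θ i + 2 * Real.pi * k i) = f θ)
    (k : Fin ν → ℤ) : ‖fourierK f k‖ ≤ C * Real.exp (-(σ * absK k)) := by
  have hρ : 0 < ρ := hσ.trans_lt hσρ
  have hreal : ∀ θ : Fin ν → ℝ, (fun i => (θ i : ℂ)) ∈ strip ν ρ := fun θ => by
    simp [strip, hρ]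
  rcases eq_or_ne k 0 with rfl | hk
  · rw [absK_zero, mul_zero, neg_zero, Real.exp_zero, mul_one]
    exact norm_fourierK_le (fun θ => by rw [← hFf]; exact hC _ (hreal θ)) 0
  have hC0 : 0 ≤ C := (norm_nonneg _).trans (hC _ (hreal 0))
  have hK : 0 < absK k := lt_of_lt_of_le one_pos (one_le_absK hk)
  set y : Fin ν → ℝ := fun i => (k i : ℝ) / absK k with hy
  have hKsq : absK k ^ 2 = ∑ i, (k i : ℝ) ^ 2 := Real.sq_sqrt (by positivity)
  have hy1 : ∑ i, y i ^ 2 = 1 := by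
    simp only [hy, div_pow, ← Finset.sum_div, ← hKsq]
    exact div_self (by positivity)
  have hky : dotK k y = absK k := by
    simp only [dotK, hy, mul_div_assoc', ← Finset.sum_div, ← pow_two, ← hKsq]
    field_simp
  set U : Set ℂ := {w | |w.im| < ρ} with hU
  have hUo : IsOpen U := isOpen_lt (by fun_prop) continuous_const
  have hUc : Convex ℝ U := by
    have : U = Complex.im ⁻¹' (Set.Ioo (-ρ) ρ) := by ext w; simp [hU, abs_lt]
    rw [this]
    exact (convex_Ioo _ _).linear_preimage Complex.imLm
  set G := shiftedIntegrand F k y with hG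
  have hcpt : ∀ θ : Fin ν → ℝ, Differentiable ℂ (cpt θ y) := fun θ => by unfold cpt; fun_prop
  have hGd : ∀ θ, DifferentiableOn ℂ (fun w => G w θ) U := by
    intro θ
    refine DifferentiableOn.mul (hF.comp (hcpt θ).differentiableOn
      fun w hw => cpt_mem_strip hy1 θ hw) (Differentiable.differentiableOn (by fun_prop))
  have hGc : ∀ w ∈ U, Continuous (G w) := by
    intro w hw
    refine Continuous.mul (hF.continuousOn.comp_continuous (by unfold cpt; fun_prop)
      fun θ => cpt_mem_strip hy1 θ hw) ?_
    unfold dotK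
    fun_prop
  have hGn : ∀ w ∈ U, ∀ θ, ‖G w θ‖ ≤ C * Real.exp (w.im * absK k) := by
    intro w hw θ
    rw [hG, shiftedIntegrand, norm_mul, Complex.norm_exp]
    have : (-Complex.I * ((dotK k θ : ℂ) + w * (dotK k y : ℂ))).re = w.im * absK k := by
      simp [hky]
    rw [this]
    gcongr
    exact hC _ (cpt_mem_strip hy1 θ hw)
  have hGb : ∀ w ∈ U, ∀ θ, ‖G w θ‖ ≤ C * Real.exp (ρ * absK k) := by
    intro w hw θ
    refine (hGn w hw θ).trans ?_
    gcongr
    exact (le_abs_self _).trans (le_of_lt hw)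
  have hint : ∀ w ∈ U, Integrable (G w) (volume.restrict (box ν)) := fun w hw =>
    (hGc w hw).continuousOn.integrableOn_compact isCompact_box
  set I : ℂ → ℂ := fun w => ∫ θ in box ν, G w θ with hI
  have hId : DifferentiableOn ℂ I U := by
    intro w hw
    obtain ⟨ε, hε, hball⟩ := Metric.isOpen_iff.1 hUo w hw
    have hd : ∀ v ∈ Metric.ball w (ε / 2), ∀ θ, HasDerivAt (fun w => G w θ)
        (deriv (fun w => G w θ) v) v := fun v hv θ =>
      ((hGd θ).differentiableAt (hUo.mem_nhds (hball (Metric.ball_subset_ball (by linarith) hv)))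
        ).hasDerivAt
    have hbd : ∀ v ∈ Metric.ball w (ε / 2), ∀ θ, ‖deriv (fun w => G w θ) v‖ ≤
        C * Real.exp (ρ * absK k) / (ε / 4) := by
      intro v hv θ
      have hsub : Metric.closedBall v (ε / 4) ⊆ U := by
        refine subset_trans (fun z hz => ?_) hball
        rw [Metric.mem_ball] at hv ⊢
        rw [Metric.mem_closedBall] at hz
        linarith [dist_triangle z v w]
      refine Complex.norm_deriv_le_of_forall_mem_sphere_norm_le (by linarith) ?_ ?_
      · exact ((hGd θ).mono hsub).diffContOnCl_ball (subset_refl _)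
      · exact fun z hz => hGb z (hsub (Metric.sphere_subset_closedBall hz)) θ
    have hmeas : AEStronglyMeasurable (fun θ => deriv (fun w => G w θ) w)
        (volume.restrict (box ν)) := by
      obtain ⟨u, hu0, hu⟩ : ∃ u : ℕ → ℂ, (∀ n, u n ≠ 0 ∧ w + u n ∈ U) ∧
          Filter.Tendsto u Filter.atTop (𝓝 0) := by
        refine ⟨fun n => ((ε / 2 / (n + 1) : ℝ) : ℂ), fun n => ⟨?_, hball ?_⟩, ?_⟩
        · have : ε / 2 / ((n : ℝ) + 1) ≠ 0 := by positivity
          exact Complex.ofReal_ne_zero.2 this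
        · rw [Metric.mem_ball, dist_eq_norm, add_sub_cancel_left, Complex.norm_real,
            Real.norm_of_nonneg (by positivity)]
          have : ε / 2 / ((n : ℝ) + 1) ≤ ε / 2 := div_le_self (by positivity) (by simp)
          linarith
        · have h1 : Filter.Tendsto (fun n : ℕ => ε / 2 / ((n : ℝ) + 1)) Filter.atTop (𝓝 0) := by
            have := (tendsto_one_div_add_atTop_nhds_zero_nat (𝕜 := ℝ)).const_mul (ε / 2)
            simpa [div_eq_mul_inv] using this
          exact (Complex.continuous_ofReal.tendsto' 0 0 (by simp)).comp h1
      refine aestronglyMeasurable_of_tendsto_ae Filter.atTop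
        (f := fun n θ => (u n)⁻¹ • (G (w + u n) θ - G w θ)) (fun n => ?_)
        (Filter.Eventually.of_forall fun θ => ?_)
      · have h1 : Continuous fun θ => G (w + u n) θ - G w θ := (hGc _ (hu0 n).2).sub (hGc w hw)
        have h2 : Continuous fun θ => (u n)⁻¹ • (G (w + u n) θ - G w θ) := by
          simp only [smul_eq_mul]
          exact continuous_const.mul h1
        exact h2.aestronglyMeasurable
      · have h1 := (hd w (Metric.mem_ball_self (by linarith)) θ).tendsto_slope_zero
        refine h1.comp (tendsto_nhdsWithin_iff.2 ⟨hu, Filter.Eventually.of_forall fun n =>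
          (hu0 n).1⟩)
    have := hasDerivAt_integral_of_dominated_loc_of_deriv_le (μ := volume.restrict (box ν))
      (F := G) (F' := fun w θ => deriv (fun w => G w θ) w)
      (bound := fun _ => C * Real.exp (ρ * absK k) / (ε / 4)) (x₀ := w)
      (Metric.ball_mem_nhds w (by linarith : 0 < ε / 2))
      (Filter.eventually_of_mem (hUo.mem_nhds hw) fun v hv => (hGc v hv).aestronglyMeasurable)
      (hint w hw) hmeas (Filter.Eventually.of_forall fun θ v hv => hbd v hv θ)
      (by
        have : IsFiniteMeasure (volume.restrict (box ν)) :=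
          ⟨by simpa using isCompact_box.measure_lt_top⟩
        exact integrable_const _)
      (Filter.Eventually.of_forall fun θ v hv => hd v hv θ)
    exact this.2.differentiableAt.differentiableWithinAt
  have hIreal : ∀ u : ℝ, I u = I 0 := by
    intro u
    set g : (Fin ν → ℝ) → ℂ := fun θ => f θ * chr (-k) θ with hg
    have e : ∀ u : ℝ, ∀ θ, G u θ = g (θ + fun i => u * y i) := by
      intro u θ
      have e1 : cpt θ y u = fun i => (((θ + fun i => u * y i) i : ℝ) : ℂ) := by
        ext i; simp [cpt]
      simp only [hG, shiftedIntegrand, hg, e1, hFf, chr]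
      congr 2
      have : dotK (-k) (θ + fun i => u * y i) = -(dotK k θ + u * dotK k y) := by
        simp only [dotK, Pi.neg_apply, Pi.add_apply, Finset.mul_sum, ← Finset.sum_add_distrib,
          ← Finset.sum_neg_distrib]
        refine Finset.sum_congr rfl fun i _ => ?_
        push_cast; ring
      rw [this]; push_cast; ring
    have hgp : ∀ (θ : Fin ν → ℝ) (l : Fin ν → ℤ), g (fun i => θ i + 2 * Real.pi * l i) = g θ :=
      fun θ l => by simp only [hg]; rw [hf, chr_periodic]
    have h0 : I 0 = ∫ θ in box ν, g θ := by
      have := e 0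
      simp only [hI]
      refine integral_congr_ae (Filter.Eventually.of_forall fun θ => ?_)
      have e2 := e 0 θ
      simp only [Complex.ofReal_zero, zero_mul] at e2
      rw [e2]
      congr 1
      ext i; simp
    rw [h0, ← integral_box_add hgp fun i => u * y i]
    exact integral_congr_ae (Filter.Eventually.of_forall fun θ => e u θ)
  have h0U : (0 : ℂ) ∈ U := by simp [hU, hρ]
  have hconst : Set.EqOn I (fun _ => I 0) U := by
    refine (hId.analyticOnNhd hUo).eqOn_of_preconnected_of_frequently_eq analyticOnNhd_const
      hUc.isPreconnected h0U ?_
    have hu : Filter.Tendsto (fun n : ℕ => ((1 / ((n : ℝ) + 1) : ℝ) : ℂ)) Filter.atTop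
        (𝓝[≠] 0) := by
      refine tendsto_nhdsWithin_iff.2 ⟨?_, Filter.Eventually.of_forall fun n => ?_⟩
      · exact (Complex.continuous_ofReal.tendsto' 0 0 (by simp)).comp
          tendsto_one_div_add_atTop_nhds_zero_nat
      · have : 1 / ((n : ℝ) + 1) ≠ 0 := by positivity
        exact Complex.ofReal_ne_zero.2 this
    exact hu.frequently (Filter.Eventually.of_forall fun n => hIreal _).frequently
  have hmem : (-(σ : ℂ) * Complex.I) ∈ U := by
    simp [hU, abs_of_nonneg hσ, hσρ]
  have hfour : fourierK f k = ((1 / (2 * Real.pi) ^ ν : ℝ) : ℂ) * I (-(σ : ℂ) * Complex.I) := by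
    rw [hconst hmem, fourierK_eq]
    congr 1
    refine integral_congr_ae (Filter.Eventually.of_forall fun θ => ?_)
    have e1 : cpt θ y 0 = fun i => (θ i : ℂ) := by ext i; simp [cpt]
    simp only [hG, shiftedIntegrand, e1, zero_mul, add_zero, hFf, chr, dotK_neg]
    push_cast
    simp
  rw [hfour, norm_mul, Complex.norm_real, Real.norm_of_nonneg (by positivity)]
  have h1 := norm_setIntegral_le_of_norm_le_const (f := G (-(σ : ℂ) * Complex.I))
    (C := C * Real.exp (-(σ * absK k))) (s := box ν) (μ := volume)
    (isCompact_box.measure_lt_top) (fun θ _ => by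
      refine (hGn _ hmem θ).trans (le_of_eq ?_)
      simp)
  rw [volume_box_real] at h1
  have h2 : (0 : ℝ) < (2 * Real.pi) ^ ν := by positivity
  rw [one_div, inv_mul_le_iff₀ h2, mul_comm ((2 * Real.pi) ^ ν)]
  exact h1

end FourierBox

section Differences

open MeasureTheory

/-- Iterated forward difference. -/
def dif (h : ℝ) (p : ℕ) (f : ℝ → ℂ) : ℝ → ℂ := (fwdDiff h)^[p] f

lemma dif_succ (h : ℝ) (p : ℕ) (f : ℝ → ℂ) : dif h (p + 1) f = dif h p (fwdDiff h f) :=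
  Function.iterate_succ_apply _ _ _

lemma dif_eq_sum (h : ℝ) (p : ℕ) (f : ℝ → ℂ) (x : ℝ) :
    dif h p f x = ∑ j ∈ Finset.range (p + 1), ((-1) ^ (p - j) * (p.choose j : ℂ)) * f (x + j * h) := by
  rw [dif, fwdDiff_iter_eq_sum_shift]
  refine Finset.sum_congr rfl fun j _ => ?_
  simp

lemma norm_dif_le (h : ℝ) (p : ℕ) {f : ℝ → ℂ} (hf : ContDiff ℝ (⊤ : ℕ∞) f) {C : ℝ}
    (hC : ∀ x, ‖iteratedDeriv p f x‖ ≤ C) (x : ℝ) : ‖dif h p f x‖ ≤ |h| ^ p * C := by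
  induction p generalizing f C x with
  | zero => simpa [dif] using hC x
  | succ p ih =>
    have hsh : ContDiff ℝ (⊤ : ℕ∞) fun x => f (x + h) := hf.comp (contDiff_id.add contDiff_const)
    have hg : ContDiff ℝ (⊤ : ℕ∞) (fwdDiff h f) := hsh.sub hf
    rw [dif_succ, pow_succ, mul_assoc]
    refine ih hg (C := |h| * C) (fun y => ?_) x
    have e : iteratedDeriv p (fwdDiff h f) y =
        iteratedDeriv p f (y + h) - iteratedDeriv p f y := by
      have h1 := iteratedDeriv_fun_sub (n := p) (x := y) (f := fun x => f (x + h)) (g := f)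
        (hsh.contDiffAt.of_le (by exact_mod_cast le_top))
        (hf.contDiffAt.of_le (by exact_mod_cast le_top))
      rw [iteratedDeriv_comp_add_const] at h1
      exact h1
    rw [e, mul_comm]
    have hd : Differentiable ℝ (iteratedDeriv p f) :=
      hf.differentiable_iteratedDeriv p (by exact_mod_cast WithTop.coe_lt_top _)
    have := convex_univ.norm_image_sub_le_of_norm_deriv_le (f := iteratedDeriv p f) (C := C)
      (x := y) (y := y + h) (fun z _ => hd z) (fun z _ => by
        rw [← iteratedDeriv_succ]; exact hC z) (Set.mem_univ _) (Set.mem_univ _)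
    simpa using this

/-- The integral of a periodic function against an exponential. -/
def xcoef (v : ℝ → ℂ) (j : ℤ) : ℂ :=
  ∫ x in (0 : ℝ)..2 * Real.pi, v x * Complex.exp (-Complex.I * j * x)

lemma xcoef_fwdDiff {v : ℝ → ℂ} (hv : Continuous v) (hper : Function.Periodic v (2 * Real.pi))
    {j : ℤ} (hj : j ≠ 0) : xcoef (fwdDiff (Real.pi / j) v) j = -2 * xcoef v j := by
  have hjr : (j : ℂ) ≠ 0 := by exact_mod_cast hj
  set g : ℝ → ℂ := fun x => v x * Complex.exp (-Complex.I * j * x) with hg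
  have hgc : Continuous g := by fun_prop
  have hgp : Function.Periodic g (2 * Real.pi) := by
    intro x
    simp only [hg]
    rw [hper x]
    congr 1
    rw [show -Complex.I * j * ((x + 2 * Real.pi : ℝ) : ℂ) = -Complex.I * j * x +
      ((-j : ℤ) : ℂ) * (2 * Real.pi * Complex.I) by push_cast; ring, Complex.exp_add,
      Complex.exp_int_mul_two_pi_mul_I, mul_one]
  have e : ∀ x : ℝ, fwdDiff (Real.pi / j) v x * Complex.exp (-Complex.I * j * x) =
      -g (x + Real.pi / j) - g x := by
    intro x
    simp only [hg, fwdDiff]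
    have : Complex.exp (-Complex.I * j * ((x + Real.pi / j : ℝ) : ℂ)) =
        -Complex.exp (-Complex.I * j * x) := by
      rw [show -Complex.I * j * ((x + Real.pi / j : ℝ) : ℂ) = -Complex.I * j * x +
        -(Real.pi * Complex.I) by push_cast; field_simp; ring, Complex.exp_add, Complex.exp_neg,
        Complex.exp_pi_mul_I]
      norm_num
    rw [this]; ring
  have hshift : ∫ x in (0 : ℝ)..2 * Real.pi, g (x + Real.pi / j) = xcoef v j := by
    rw [intervalIntegral.integral_comp_add_right]
    have := hgp.intervalIntegral_add_eq (Real.pi / j) 0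
    rw [zero_add] at this
    rw [zero_add, add_comm (2 * Real.pi)]
    exact this
  have hg1 : Continuous fun x : ℝ => -g (x + Real.pi / j) := by fun_prop
  rw [xcoef]
  simp_rw [e]
  rw [intervalIntegral.integral_sub (hg1.intervalIntegrable _ _) (hgc.intervalIntegrable _ _),
    intervalIntegral.integral_neg, hshift]
  change -xcoef v j - xcoef v j = _
  ring

lemma xcoef_dif {v : ℝ → ℂ} (hv : Continuous v) (hper : Function.Periodic v (2 * Real.pi))
    {j : ℤ} (hj : j ≠ 0) (p : ℕ) : xcoef (dif (Real.pi / j) p v) j = (-2) ^ p * xcoef v j := by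
  induction p generalizing v with
  | zero => simp [dif]
  | succ p ih =>
    rw [dif_succ, ih, xcoef_fwdDiff hv hper hj, pow_succ, mul_assoc]
    · exact (by unfold fwdDiff; fun_prop)
    · intro x
      simp only [fwdDiff]
      rw [hper x, show x + 2 * Real.pi + Real.pi / j = x + Real.pi / j + 2 * Real.pi by ring, hper]

lemma norm_xcoef_le {v : ℝ → ℂ} {C : ℝ} (hC : ∀ x, ‖v x‖ ≤ C) (j : ℤ) :
    ‖xcoef v j‖ ≤ C * (2 * Real.pi) := by
  have h := intervalIntegral.norm_integral_le_of_norm_le_const (a := 0) (b := 2 * Real.pi)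
    (f := fun x : ℝ => v x * Complex.exp (-Complex.I * j * x)) (C := C) (fun x _ => by
      rw [norm_mul]
      have : ‖Complex.exp (-Complex.I * j * x)‖ = 1 := by
        rw [show -Complex.I * j * x = ((-j * x : ℝ) : ℂ) * Complex.I by push_cast; ring,
          Complex.norm_exp_ofReal_mul_I]
      rw [this, mul_one]; exact hC x)
  rwa [sub_zero, abs_of_pos (by positivity)] at h

lemma norm_xcoef_mul_pow_le {v : ℝ → ℂ} (hv : Continuous v)
    (hper : Function.Periodic v (2 * Real.pi)) {j : ℤ} {p : ℕ} {B : ℝ}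
    (hB : ∀ h x, ‖dif h p v x‖ ≤ |h| ^ p * B) (hp : p ≠ 0) :
    ‖xcoef v j‖ * |(j : ℝ)| ^ p ≤ (2 * Real.pi) * Real.pi ^ p * B := by
  have hB0 : 0 ≤ B := by
    have := (norm_nonneg _).trans (hB 1 0)
    simpa using this
  rcases eq_or_ne j 0 with rfl | hj
  · simp [hp]; positivity
  have hjr : (0 : ℝ) < |(j : ℝ)| := by positivity
  have h1 := norm_xcoef_le (hB (Real.pi / j)) j
  rw [xcoef_dif hv hper hj, norm_mul, norm_pow, norm_neg, abs_div, abs_of_pos Real.pi_pos,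
    div_pow] at h1
  have h2 : (1 : ℝ) ≤ ‖(2 : ℂ)‖ ^ p := one_le_pow₀ (by simp)
  calc ‖xcoef v j‖ * |(j : ℝ)| ^ p ≤ ‖(2 : ℂ)‖ ^ p * ‖xcoef v j‖ * |(j : ℝ)| ^ p := by
        gcongr; exact le_mul_of_one_le_left (norm_nonneg _) h2
    _ ≤ Real.pi ^ p / |(j : ℝ)| ^ p * B * (2 * Real.pi) * |(j : ℝ)| ^ p := by gcongr
    _ = _ := by field_simp

/-- Sine matrix elements of an even periodic function. -/
lemma sine_element {v : ℝ → ℂ} (hv : Continuous v) (hper : Function.Periodic v (2 * Real.pi))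
    (heven : ∀ x, v (-x) = v x) (m n : ℤ) :
    ∫ x in (0 : ℝ)..Real.pi, v x * (Real.sin (m * x) : ℂ) * (Real.sin (n * x) : ℂ) =
      (1 / 8 : ℂ) * (xcoef v (m - n) + xcoef v (n - m) - xcoef v (m + n) - xcoef v (-(m + n))) := by
  set g : ℝ → ℂ := fun x => v x * (Real.sin (m * x) : ℂ) * (Real.sin (n * x) : ℂ) with hg
  have hgc : Continuous g := by fun_prop
  have hgp : Function.Periodic g (2 * Real.pi) := by
    intro x
    simp only [hg]
    have : ∀ j : ℤ, Real.sin (j * (x + 2 * Real.pi)) = Real.sin (j * x) := fun j => by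
      rw [mul_add, Real.sin_add_int_mul_two_pi]
    rw [hper x, this, this]
  have hge : ∀ x, g (-x) = g x := fun x => by
    simp only [hg]
    rw [heven]
    simp
  have h1 : ∫ x in (-Real.pi)..0, g x = ∫ x in (0 : ℝ)..Real.pi, g x := by
    have := intervalIntegral.integral_comp_neg (a := 0) (b := Real.pi) g
    rw [neg_zero] at this
    rw [← this]
    simp_rw [hge]
  have h2 : ∫ x in (0 : ℝ)..2 * Real.pi, g x = 2 * ∫ x in (0 : ℝ)..Real.pi, g x := by
    have := hgp.intervalIntegral_add_eq 0 (-Real.pi)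
    rw [zero_add, show -Real.pi + 2 * Real.pi = Real.pi by ring] at this
    rw [this, ← intervalIntegral.integral_add_adjacent_intervals (b := 0)
      (hgc.intervalIntegrable _ _) (hgc.intervalIntegrable _ _), h1]
    ring
  have h3 : ∫ x in (0 : ℝ)..Real.pi, g x = (1 / 2 : ℂ) * ∫ x in (0 : ℝ)..2 * Real.pi, g x := by
    rw [h2]; ring
  have hE : ∀ j : ℤ, Continuous fun x : ℝ => v x * Complex.exp (-Complex.I * j * x) := fun j => by
    fun_prop
  have hI : ∀ j : ℤ, IntervalIntegrable (fun x : ℝ => v x * Complex.exp (-Complex.I * j * x))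
      volume 0 (2 * Real.pi) := fun j => (hE j).intervalIntegrable _ _
  rw [h3, xcoef, xcoef, xcoef, xcoef, ← intervalIntegral.integral_add (hI _) (hI _),
    ← intervalIntegral.integral_sub ((hI _).add (hI _)) (hI _),
    ← intervalIntegral.integral_sub (((hI _).add (hI _)).sub (hI _)) (hI _),
    ← intervalIntegral.integral_const_mul, ← intervalIntegral.integral_const_mul]
  refine intervalIntegral.integral_congr fun x _ => ?_
  simp only [hg]
  have hs : ∀ j : ℤ, ((Real.sin (j * x) : ℝ) : ℂ) =
      (Complex.exp (-Complex.I * j * x) - Complex.exp (Complex.I * j * x)) * Complex.I / 2 := by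
    intro j
    rw [Complex.ofReal_sin, Complex.sin]
    push_cast
    rw [show -((j : ℂ) * (x : ℂ)) * Complex.I = -Complex.I * j * x by ring,
      show ((j : ℂ) * (x : ℂ)) * Complex.I = Complex.I * j * x by ring]
  rw [hs, hs]
  have ex : ∀ a b : ℂ, Complex.exp (a + b) = Complex.exp a * Complex.exp b := Complex.exp_add
  push_cast
  rw [show -Complex.I * ((m : ℂ) - n) * x = -Complex.I * m * x + Complex.I * n * x by ring,
    show -Complex.I * ((n : ℂ) - m) * x = -Complex.I * n * x + Complex.I * m * x by ring,
    show -Complex.I * ((m : ℂ) + n) * x = -Complex.I * m * x + -Complex.I * n * x by ring,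
    show -Complex.I * (-((m : ℂ) + n)) * x = Complex.I * m * x + Complex.I * n * x by ring,
    ex, ex, ex, ex]
  linear_combination (v x * (Complex.exp (-Complex.I * m * x) - Complex.exp (Complex.I * m * x)) *
    (Complex.exp (-Complex.I * n * x) - Complex.exp (Complex.I * n * x)) / 8) * Complex.I_mul_I

end Differences

section Potential

open MeasureTheory

variable {ν : ℕ}

lemma conj_fourierK (f : (Fin ν → ℝ) → ℂ) (k : Fin ν → ℤ) :
    starRingEnd ℂ (fourierK f k) = fourierK (fun θ => starRingEnd ℂ (f θ)) (-k) := by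
  rw [fourierK_eq, fourierK_eq, map_mul, Complex.conj_ofReal, ← integral_conj]
  congr 2
  ext θ
  rw [map_mul, neg_neg]
  congr 1
  rw [chr, chr, ← Complex.exp_conj, dotK_neg]
  simp

lemma fourierK_finset_sum {ι : Type*} (s : Finset ι) (c : ι → ℂ) {f : ι → (Fin ν → ℝ) → ℂ}
    (hf : ∀ i ∈ s, Continuous (f i)) (k : Fin ν → ℤ) :
    fourierK (fun θ => ∑ i ∈ s, c i * f i θ) k = ∑ i ∈ s, c i * fourierK (f i) k := by
  simp_rw [fourierK_eq, Finset.sum_mul, mul_assoc]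
  rw [integral_finsetSum]
  · rw [Finset.mul_sum]
    refine Finset.sum_congr rfl fun i _ => ?_
    rw [integral_const_mul]
    ring
  · intro i hi
    exact ((continuous_const.mul ((hf i hi).mul (continuous_chr _))).continuousOn
      ).integrableOn_compact isCompact_box

/-- Fourier coefficient in the angles of the potential. -/
def potCoef (V : (Fin ν → ℝ) → ℝ → ℝ) (k : Fin ν → ℤ) (x : ℝ) : ℂ :=
  fourierK (fun θ => (V θ x : ℂ)) k

/-- Fourier coefficient in the angles of the matrix of the potential. -/
def potEnt (V : (Fin ν → ℝ) → ℝ → ℝ) (k : Fin ν → ℤ) (m n : ℕ+) : ℂ :=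
  fourierK (fun θ => potMat V θ m n) k

lemma potEnt_neg (V : (Fin ν → ℝ) → ℝ → ℝ) (k : Fin ν → ℤ) (m n : ℕ+) :
    potEnt V (-k) m n = starRingEnd ℂ (potEnt V k m n) := by
  rw [potEnt, potEnt, conj_fourierK]
  congr 1
  ext θ
  rw [potMat, Complex.conj_ofReal]

lemma potEnt_symm (V : (Fin ν → ℝ) → ℝ → ℝ) (k : Fin ν → ℤ) (m n : ℕ+) :
    potEnt V k m n = potEnt V k n m := by
  rw [potEnt, potEnt]
  congr 1
  ext θ
  simp only [potMat]
  congr 3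
  ext x
  ring

namespace IsDriving

variable {ρ : ℝ} {V : (Fin ν → ℝ) → ℝ → ℝ}

lemma cont (hV : IsDriving ρ V) : Continuous fun p : (Fin ν → ℝ) × ℝ => V p.1 p.2 := hV.smooth.continuous

lemma continuous_potCoef (hV : IsDriving ρ V) (k : Fin ν → ℤ) : Continuous (potCoef V k) := by
  have h := hV.cont
  unfold potCoef
  simp_rw [fourierK_eq]
  refine continuous_const.mul ?_
  have hc : Continuous (fun p : ℝ × (Fin ν → ℝ) => (V p.2 p.1 : ℂ) * chr (-k) p.2) := by
    refine Continuous.mul (Complex.continuous_ofReal.comp (h.comp continuous_swap))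
      ((continuous_chr _).comp continuous_snd)
  exact continuous_parametric_integral_of_continuous hc isCompact_box

lemma periodic_potCoef (hV : IsDriving ρ V) (k : Fin ν → ℤ) : Function.Periodic (potCoef V k) (2 * Real.pi) :=
  fun x => by simp only [potCoef, hV.periodic_x]

lemma even_potCoef (hV : IsDriving ρ V) (k : Fin ν → ℤ) (x : ℝ) : potCoef V k (-x) = potCoef V k x := by
  simp only [potCoef, hV.even_x]

lemma potCoef_zero (hV : IsDriving ρ V) {x : ℝ} (hx : x ∈ Set.Icc 0 Real.pi) : potCoef V 0 x = 0 := by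
  have h := hV.zero_mean x hx
  rw [potCoef, fourierK_eq]
  simp_rw [neg_zero, chr_zero, mul_one]
  have e : ∫ θ in box ν, ((V θ x : ℝ) : ℂ) = ((∫ θ in box ν, V θ x : ℝ) : ℂ) := integral_ofReal
  rw [e, h]
  simp

lemma dif_potCoef_le (hV : IsDriving ρ V) {σ : ℝ} (hσ : 0 ≤ σ) (hσρ : σ < ρ) (p : ℕ) :
    ∃ C : ℝ, 0 ≤ C ∧ ∀ (k : Fin ν → ℤ) (h x : ℝ),
      ‖dif h p (potCoef V k) x‖ ≤ |h| ^ p * (C * Real.exp (-(σ * absK k))) := by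
  obtain ⟨Vc, h1, h2, h3, h4⟩ := hV.analytic
  obtain ⟨C, hC⟩ := h4 p
  have h0 : (0 : Fin ν → ℂ) ∈ strip ν ρ := by simp [strip, hσ.trans_lt hσρ]
  refine ⟨C, (norm_nonneg _).trans (hC 0 h0 0), fun k h x => ?_⟩
  have hVx : ∀ y : ℝ, Continuous fun θ : Fin ν → ℝ => (V θ y : ℂ) := fun y =>
    Complex.continuous_ofReal.comp (hV.cont.comp (continuous_id.prodMk continuous_const))
  have e : dif h p (potCoef V k) x = fourierK (fun θ => dif h p (fun y => (V θ y : ℂ)) x) k := by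
    simp_rw [dif_eq_sum]
    rw [fourierK_finset_sum _ _ fun j _ => hVx _]
    rfl
  rw [e, ← mul_assoc]
  refine norm_fourierK_le_of_strip (F := fun z => dif h p (Vc z) x) hσ hσρ ?_ ?_ ?_ ?_ k
  · simp_rw [dif_eq_sum]
    exact DifferentiableOn.fun_sum fun j _ => (h2 _).const_mul _
  · exact fun z hz => norm_dif_le h p (h3 z hz) (hC z hz) x
  · intro θ
    congr 1
    ext y
    exact h1 θ y
  · intro θ l
    simp_rw [hV.periodic_angle]

lemma potEnt_eq (hV : IsDriving ρ V) (k : Fin ν → ℤ) (m n : ℕ+) : potEnt V k m n =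
    ((2 / Real.pi : ℝ) : ℂ) * ∫ x in (0 : ℝ)..Real.pi,
      potCoef V k x * (Real.sin (m * x) : ℂ) * (Real.sin (n * x) : ℂ) := by
  set g : ℝ → (Fin ν → ℝ) → ℂ := fun x θ =>
    (V θ x : ℂ) * (Real.sin (m * x) : ℂ) * (Real.sin (n * x) : ℂ) * chr (-k) θ with hg
  have hgc : Continuous (Function.uncurry g) := by
    have h1 : Continuous fun p : ℝ × (Fin ν → ℝ) => (V p.2 p.1 : ℂ) :=
      Complex.continuous_ofReal.comp (hV.cont.comp continuous_swap)
    have h2 : Continuous fun p : ℝ × (Fin ν → ℝ) => chr (-k) p.2 :=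
      (continuous_chr _).comp continuous_snd
    have h3 : ∀ j : ℕ+, Continuous fun p : ℝ × (Fin ν → ℝ) => ((Real.sin (j * p.1) : ℝ) : ℂ) :=
      fun j => by fun_prop
    exact ((h1.mul (h3 m)).mul (h3 n)).mul h2
  have hgi : Integrable (Function.uncurry g)
      ((volume.restrict (Set.uIoc 0 Real.pi)).prod (volume.restrict (box ν))) := by
    rw [Measure.prod_restrict]
    have h1 : IntegrableOn (Function.uncurry g) (Set.Icc 0 Real.pi ×ˢ box ν) (volume.prod volume) :=
      hgc.continuousOn.integrableOn_compact (isCompact_Icc.prod isCompact_box)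
    refine h1.mono_set (Set.prod_mono ?_ le_rfl)
    rw [Set.uIoc_of_le Real.pi_pos.le]
    exact Set.Ioc_subset_Icc_self
  have hsw := intervalIntegral_integral_swap hgi
  rw [potEnt, fourierK_eq]
  have e1 : ∀ θ, potMat V θ m n * chr (-k) θ =
      ((2 / Real.pi : ℝ) : ℂ) * ∫ x in (0 : ℝ)..Real.pi, g x θ := by
    intro θ
    rw [potMat, intervalIntegral.integral_mul_const]
    push_cast
    rw [← intervalIntegral.integral_ofReal]
    push_cast
    ring
  have e2 : ∀ x, potCoef V k x * (Real.sin (m * x) : ℂ) * (Real.sin (n * x) : ℂ) =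
      ((1 / (2 * Real.pi) ^ ν : ℝ) : ℂ) * ∫ θ in box ν, g x θ := by
    intro x
    rw [potCoef, fourierK_eq, mul_assoc, mul_assoc, ← integral_mul_const]
    congr 2
    ext θ
    simp only [hg]; ring
  simp_rw [e1, e2]
  rw [integral_const_mul, intervalIntegral.integral_const_mul, hsw]
  ring

lemma potEnt_zero (hV : IsDriving ρ V) (m n : ℕ+) : potEnt V 0 m n = 0 := by
  rw [hV.potEnt_eq, intervalIntegral.integral_congr (g := fun _ => 0)]
  · simp
  · intro x hx
    rw [Set.uIcc_of_le Real.pi_pos.le] at hx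
    simp only [hV.potCoef_zero hx, zero_mul]

/-- Decay of the matrix elements of the potential. -/
lemma potEnt_decay (hV : IsDriving ρ V) {σ : ℝ} (hσ : 0 ≤ σ) (hσρ : σ < ρ) (p : ℕ) :
    ∃ C : ℝ, 0 < C ∧ ∀ (k : Fin ν → ℤ) (m n : ℕ+),
      ‖potEnt V k m n‖ * (1 + |(m : ℝ) - n|) ^ p ≤ C * Real.exp (-(σ * absK k)) := by
  obtain ⟨C₀, hC₀, h0⟩ := hV.dif_potCoef_le hσ hσρ 0
  obtain ⟨C₁, hC₁, h1⟩ := hV.dif_potCoef_le hσ hσρ (p + 1)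
  set D := 2 ^ p * (2 * Real.pi) * (C₀ + Real.pi ^ (p + 1) * C₁) with hD
  have hD0 : 0 ≤ D := by positivity
  have hx : ∀ (k : Fin ν → ℤ) (j : ℤ), ‖xcoef (potCoef V k) j‖ * (1 + |(j : ℝ)|) ^ p ≤
      D * Real.exp (-(σ * absK k)) := by
    intro k j
    have a0 := norm_xcoef_le (v := potCoef V k) (fun x => by simpa [dif] using h0 k 0 x) j
    have a1 := norm_xcoef_mul_pow_le (hV.continuous_potCoef k) (hV.periodic_potCoef k) (j := j)
      (h1 k) p.succ_ne_zero
    have hp : (1 + |(j : ℝ)|) ^ p ≤ 2 ^ p * (1 + |(j : ℝ)| ^ (p + 1)) := by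
      rcases eq_or_ne j 0 with rfl | hj
      · simp; exact one_le_pow₀ (by norm_num)
      · have hj1 : (1 : ℝ) ≤ |(j : ℝ)| := by
          exact_mod_cast Int.one_le_abs hj
        calc (1 + |(j : ℝ)|) ^ p ≤ (2 * |(j : ℝ)|) ^ p := by gcongr; linarith
          _ = 2 ^ p * |(j : ℝ)| ^ p := mul_pow _ _ _
          _ ≤ 2 ^ p * (1 + |(j : ℝ)| ^ (p + 1)) := by
            gcongr
            have : |(j : ℝ)| ^ p ≤ |(j : ℝ)| ^ (p + 1) := pow_le_pow_right₀ hj1 (Nat.le_succ p)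
            linarith
    calc _ ≤ ‖xcoef (potCoef V k) j‖ * (2 ^ p * (1 + |(j : ℝ)| ^ (p + 1))) := by gcongr
      _ = 2 ^ p * (‖xcoef (potCoef V k) j‖ + ‖xcoef (potCoef V k) j‖ * |(j : ℝ)| ^ (p + 1)) := by
        ring
      _ ≤ 2 ^ p * (C₀ * Real.exp (-(σ * absK k)) * (2 * Real.pi) +
          2 * Real.pi * Real.pi ^ (p + 1) * (C₁ * Real.exp (-(σ * absK k)))) := by gcongr
      _ = _ := by rw [hD]; ring
  refine ⟨D + 1, by positivity, fun k m n => ?_⟩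
  have he := hV.potEnt_eq k m n
  have hs := sine_element (hV.continuous_potCoef k) (hV.periodic_potCoef k) (hV.even_potCoef k) m n
  simp only [Int.cast_natCast] at hs
  rw [he, hs]
  have hb : ∀ j : ℤ, |(m : ℝ) - n| ≤ |(j : ℝ)| → ‖xcoef (potCoef V k) j‖ *
      (1 + |(m : ℝ) - n|) ^ p ≤ D * Real.exp (-(σ * absK k)) := fun j hj =>
    le_trans (by gcongr) (hx k j)
  have hm : (0 : ℝ) < m := by exact_mod_cast m.pos
  have hn : (0 : ℝ) < n := by exact_mod_cast n.pos
  have hmn : |(m : ℝ) - n| ≤ |(m : ℝ) + n| := by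
    rw [abs_le]
    have := le_abs_self ((m : ℝ) + n)
    constructor <;> linarith
  have b1 := hb (m - n) (by push_cast; exact le_rfl)
  have b2 := hb (n - m) (by push_cast; rw [abs_sub_comm])
  have b3 := hb (m + n) (by push_cast; exact hmn)
  have b4 := hb (-(m + n)) (by push_cast; rw [abs_neg]; exact hmn)
  have hpi : 2 / Real.pi ≤ 1 := by
    rw [div_le_one Real.pi_pos]; linarith [Real.pi_gt_three]
  set x1 := xcoef (potCoef V k) (m - n)
  set x2 := xcoef (potCoef V k) (n - m)
  set x3 := xcoef (potCoef V k) (m + n)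
  set x4 := xcoef (potCoef V k) (-(m + n))
  set w := (1 + |(m : ℝ) - n|) ^ p with hw
  have hw0 : 0 ≤ w := by positivity
  have hexp := Real.exp_pos (-(σ * absK k))
  have hnorm : ‖x1 + x2 - x3 - x4‖ ≤ ‖x1‖ + ‖x2‖ + ‖x3‖ + ‖x4‖ :=
    (norm_sub_le _ _).trans (by
      gcongr
      exact (norm_sub_le _ _).trans (by gcongr; exact norm_add_le _ _))
  rw [norm_mul, norm_mul, Complex.norm_real, Real.norm_of_nonneg (by positivity)]
  have h18 : ‖(1 / 8 : ℂ)‖ = 1 / 8 := by norm_num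
  rw [h18]
  calc 2 / Real.pi * (1 / 8 * ‖x1 + x2 - x3 - x4‖) * w
      ≤ 1 * (1 / 8 * (‖x1‖ + ‖x2‖ + ‖x3‖ + ‖x4‖)) * w := by gcongr
    _ = 1 / 8 * (‖x1‖ * w + ‖x2‖ * w + ‖x3‖ * w + ‖x4‖ * w) := by ring
    _ ≤ (D + 1) * Real.exp (-(σ * absK k)) := by nlinarith

end IsDriving

end Potential

section Kernel

variable {ν : ℕ}

lemma summable_bracket_rpow {r : ℝ} (hr : (ν : ℝ) < r) :
    Summable fun k : Fin ν → ℤ => (bracket (absK k) ^ r)⁻¹ := by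
  set b := (EuclideanSpace.basisFun (Fin ν) ℝ).toBasis with hb
  set L := Submodule.span ℤ (Set.range b) with hL
  have hrank : Module.finrank ℤ L = ν := by
    rw [ZLattice.rank ℝ L]; simp
  have h1 := ZLattice.summable_norm_rpow L (-r) (by rw [hrank]; linarith)
  set F : (Fin ν → ℤ) → L := fun k => ⟨∑ i, k i • b i,
    sum_mem fun i _ => Submodule.smul_mem _ _ (Submodule.subset_span ⟨i, rfl⟩)⟩ with hF
  have hFv : ∀ k, ((F k : L) : EuclideanSpace ℝ (Fin ν)) =
      WithLp.toLp 2 (fun i => (k i : ℝ)) := by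
    intro k
    ext j
    simp only [hF, hb]
    simp [Finset.sum_apply, Pi.single_apply]
  have hFn : ∀ k, ‖F k‖ = absK k := fun k => by
    rw [absK_eq_norm, ← hFv k]; rfl
  have hinj : Function.Injective F := by
    intro k l h
    have := congrArg (fun z : L => (z : EuclideanSpace ℝ (Fin ν))) h
    simp only [hFv] at this
    ext i
    have := congrArg (fun v : EuclideanSpace ℝ (Fin ν) => v i) this
    simpa using this
  have h2 := h1.comp_injective hinj
  have h3 : Summable fun k : Fin ν → ℤ => absK k ^ (-r) := h2.congr fun k => by
    simp only [Function.comp, hFn]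
  refine Summable.of_norm_bounded_eventually h3 ?_
  rw [Filter.eventually_cofinite]
  refine (Set.finite_singleton (0 : Fin ν → ℤ)).subset fun k hk => ?_
  by_contra hk0
  apply hk
  have hpos := one_le_absK (k := k) hk0
  have hr0 : 0 ≤ r := (Nat.cast_nonneg ν).trans hr.le
  have hb := bracket_pos (absK k)
  rw [Real.norm_of_nonneg (by positivity), Real.rpow_neg (absK_nonneg k)]
  gcongr
  exact (le_abs_self _).trans (abs_le_bracket _)

lemma exists_bracket_rpow_le_exp (r : ℝ) {ε : ℝ} (hε : 0 < ε) :
    ∃ C : ℝ, 0 < C ∧ ∀ t : ℝ, 0 ≤ t → bracket t ^ r ≤ C * Real.exp (ε * t) := by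
  obtain ⟨n, hn⟩ := exists_nat_ge (max r 1)
  have hn1 : (1 : ℝ) ≤ n := (le_max_right _ _).trans hn
  set c := min 1 (ε / n) with hc
  have hc0 : 0 < c := lt_min one_pos (by positivity)
  refine ⟨(c ^ n)⁻¹, by positivity, fun t ht => ?_⟩
  rw [inv_mul_eq_div, le_div_iff₀ (by positivity)]
  have hb := one_le_bracket t
  calc bracket t ^ r * c ^ n ≤ bracket t ^ (n : ℝ) * c ^ n := by
        gcongr
        · exact (le_max_left _ _).trans hn
    _ = (bracket t * c) ^ n := by rw [Real.rpow_natCast, mul_pow]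
    _ ≤ (1 + ε / n * t) ^ n := by
        gcongr
        have h1 := bracket_le_one_add t
        rw [abs_of_nonneg ht] at h1
        calc bracket t * c ≤ (1 + t) * c := by gcongr
          _ = c + c * t := by ring
          _ ≤ 1 + ε / n * t := by
            gcongr
            · exact min_le_left _ _
            · exact min_le_right _ _
    _ ≤ (Real.exp (ε / n * t)) ^ n := by
        gcongr
        linarith [Real.add_one_le_exp (ε / n * t)]
    _ = Real.exp (ε * t) := by
        rw [← Real.exp_nat_mul]
        congr 1
        field_simp

lemma summable_exp_absK {δ : ℝ} (hδ : 0 < δ) :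
    Summable fun k : Fin ν → ℤ => Real.exp (-(δ * absK k)) := by
  obtain ⟨C, hC, h⟩ := exists_bracket_rpow_le_exp ((ν : ℝ) + 1) hδ
  refine Summable.of_nonneg_of_le (fun _ => (Real.exp_pos _).le) (fun k => ?_)
    ((summable_bracket_rpow (ν := ν) (r := (ν : ℝ) + 1) (by linarith)).mul_left C)
  have hb := bracket_pos (absK k)
  have := h (absK k) (absK_nonneg k)
  rw [Real.exp_neg, ← div_eq_mul_inv, inv_eq_one_div, div_le_div_iff₀ (Real.exp_pos _)
    (by positivity), one_mul]
  exact this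

/-- Sum of the exponential kernel over the frequencies. -/
def expSum (ν : ℕ) (δ : ℝ) : ℝ≥0∞ :=
  ∑' k : Fin ν → ℤ, ENNReal.ofReal (Real.exp (-(δ * absK k)))

lemma expSum_ne_top {δ : ℝ} (hδ : 0 < δ) : expSum ν δ ≠ ∞ := by
  rw [expSum, ← ENNReal.ofReal_tsum_of_nonneg (fun _ => (Real.exp_pos _).le) (summable_exp_absK hδ)]
  exact ENNReal.ofReal_ne_top

/-- Sum of the quadratic kernel over the integers. -/
def sqSum : ℝ≥0∞ := ∑' h : ℤ, ENNReal.ofReal (((1 + |(h : ℝ)|) ^ 2)⁻¹)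

lemma sqSum_ne_top : sqSum ≠ ∞ := by
  have h1 : Summable fun h : ℤ => ((1 + |(h : ℝ)|) ^ 2)⁻¹ := by
    have h2 : Summable fun h : ℤ => (2 : ℝ) * (1 / (h : ℝ) ^ 2) :=
      ((Real.summable_one_div_int_pow (p := 2)).2 (by norm_num)).mul_left 2
    refine Summable.of_norm_bounded_eventually h2 ?_
    rw [Filter.eventually_cofinite]
    refine (Set.finite_singleton (0 : ℤ)).subset fun h hh => ?_
    by_contra h0
    apply hh
    have h0' : (h : ℝ) ≠ 0 := by exact_mod_cast h0
    have : 0 < (h : ℝ) ^ 2 := by positivity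
    rw [Real.norm_of_nonneg (by positivity), ← sq_abs (h : ℝ), mul_one_div,
      inv_eq_one_div, div_le_div_iff₀ (by positivity) (by rw [sq_abs]; positivity)]
    nlinarith [abs_nonneg (h : ℝ)]
  rw [sqSum, ← ENNReal.ofReal_tsum_of_nonneg (fun _ => by positivity) h1]
  exact ENNReal.ofReal_ne_top

/-- Schur norm of the reference kernel. -/
def kerSum (ν : ℕ) (δ : ℝ) : ℝ≥0∞ := 2 * sqSum * expSum ν δ

lemma kerSum_ne_top {δ : ℝ} (hδ : 0 < δ) : kerSum ν δ ≠ ∞ :=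
  ENNReal.mul_ne_top (ENNReal.mul_ne_top (by norm_num) sqSum_ne_top) (expSum_ne_top hδ)

/-- The mode of an index of the pair, as a positive integer. -/
def idx : Pr → ℕ+ := Sum.elim id id

lemma mode_eq (a : Pr) : mode a = (idx a : ℝ) := by rcases a with a | a <;> rfl

lemma tsum_mode_le (a : Pr) :
    ∑' b : Pr, ENNReal.ofReal (((1 + |mode a - mode b|) ^ 2)⁻¹) ≤ 2 * sqSum := by
  rw [ENNReal.summable.tsum_sum ENNReal.summable]
  have h : ∀ e : ℕ+ → Pr, (∀ n, mode (e n) = n) →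
      ∑' n : ℕ+, ENNReal.ofReal (((1 + |mode a - mode (e n)|) ^ 2)⁻¹) ≤ sqSum := by
    intro e he
    have h1 := ENNReal.tsum_comp_le_tsum_of_injective (f := fun n : ℕ+ => ((idx a : ℤ) - (n : ℤ)))
      (fun n n' h => by simpa using h)
      fun h : ℤ => ENNReal.ofReal (((1 + |(h : ℝ)|) ^ 2)⁻¹)
    refine le_trans (le_of_eq (tsum_congr fun n => ?_)) h1
    rw [he, mode_eq]
    push_cast
    rfl
  rw [two_mul]
  exact add_le_add (h Sum.inl fun _ => rfl) (h Sum.inr fun _ => rfl)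

/-- The reference kernel. -/
def ker (δ : ℝ) (x y : Idx ν) : ℝ≥0∞ :=
  ENNReal.ofReal (Real.exp (-(δ * absK (x.2 - y.2)))) *
    ENNReal.ofReal (((1 + |mode x.1 - mode y.1|) ^ 2)⁻¹)

lemma ker_comm (δ : ℝ) (x y : Idx ν) : ker δ x y = ker δ y x := by
  rw [ker, ker, absK_sub_comm, abs_sub_comm]

lemma schur_le_kerSum {w M : Idx ν → Idx ν → ℝ≥0∞} {B : ℝ≥0∞} {δ : ℝ}
    (h : ∀ x y, M x y * w x y ≤ B * ker δ x y) : schur w M ≤ B * kerSum ν δ := by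
  have hrow : ∀ x : Idx ν, ∑' y, ker δ x y ≤ kerSum ν δ := by
    intro x
    rw [tsum_prod_enn]
    simp only [ker]
    simp_rw [ENNReal.tsum_mul_right]
    have e : ∑' k : Fin ν → ℤ, ENNReal.ofReal (Real.exp (-(δ * absK (x.2 - k)))) = expSum ν δ :=
      (Equiv.subLeft x.2).tsum_eq fun k => ENNReal.ofReal (Real.exp (-(δ * absK k)))
    rw [e, ENNReal.tsum_mul_left, mul_comm, kerSum]
    gcongr
    exact tsum_mode_le x.1
  rw [schur_le_iff]
  constructor
  · intro x
    calc _ ≤ ∑' y, B * ker δ x y := ENNReal.tsum_le_tsum fun y => h x y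
      _ ≤ _ := by rw [ENNReal.tsum_mul_left]; gcongr; exact hrow x
  · intro y
    calc _ ≤ ∑' x, B * ker δ x y := ENNReal.tsum_le_tsum fun x => h x y
      _ ≤ _ := by
        rw [ENNReal.tsum_mul_left]; gcongr
        simp_rw [ker_comm δ _ y]
        exact hrow y

end Kernel

section Generator

variable {ν : ℕ} {ρ : ℝ} {V : (Fin ν → ℝ) → ℝ → ℝ} {γ₀ τ₀ M : ℝ}

/-- Entries of the generator without the factors `B^{-1/2}`. -/
def tEnt (V : (Fin ν → ℝ) → ℝ → ℝ) (ω : Freq ν) (x y : Idx ν) : ℂ :=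
  1 / (2 * Complex.I * (dotK (x.2 - y.2) ω : ℂ)) * potEnt V (x.2 - y.2) (idx x.1) (idx y.1)

/-- The generator without the factors `B^{-1/2}`, acting on both components. -/
def tOp (V : (Fin ν → ℝ) → ℝ → ℝ) (ω : Freq ν) : Op (Idx ν) := ofMat (tEnt V ω)

/-- Small divisor estimate for the generator. -/
lemma lipN_divisor_le {κ : ℝ} (hγ₀ : 0 < γ₀) (hM : 0 < M) (hκ : 0 ≤ κ) {k : Fin ν → ℤ}
    (hk : k ≠ 0) (z : ℂ) :
    lipN (Omega0 ν γ₀ τ₀ M) (ENNReal.ofReal κ)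
      (fun ω => 1 / (2 * Complex.I * (dotK k ω : ℂ)) * z) ≤
    ENNReal.ofReal ((bracket (absK k) ^ τ₀ / (γ₀ * M) +
      κ * (absK k * (bracket (absK k) ^ τ₀ / (γ₀ * M)) ^ 2)) * ‖z‖) := by
  set D := bracket (absK k) ^ τ₀ / (γ₀ * M) with hD
  have hb := bracket_pos (absK k)
  have hD0 : 0 < D := by positivity
  have hdiv : ∀ ω ∈ Omega0 ν γ₀ τ₀ M, 0 < |dotK k ω| ∧ 1 / |dotK k ω| ≤ D := by
    intro ω hω
    have h := hω.2 k hk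
    have h0 : 0 < γ₀ / bracket (absK k) ^ τ₀ * M := by positivity
    refine ⟨h0.trans_le h, ?_⟩
    calc 1 / |dotK k ω| ≤ 1 / (γ₀ / bracket (absK k) ^ τ₀ * M) := by gcongr
      _ = D := by rw [hD]; field_simp
  have hK := absK_nonneg k
  rw [ENNReal.ofReal_mul (by positivity), ENNReal.ofReal_add (by positivity) (by positivity),
    add_mul, ENNReal.ofReal_mul hκ, mul_assoc (ENNReal.ofReal κ)]
  refine lipN_le (fun ω hω => ?_) fun ω₁ h₁ ω₂ h₂ => ?_
  · obtain ⟨h0, h1⟩ := hdiv ω hω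
    rw [enorm_mul, ← ofReal_norm, ← ofReal_norm]
    gcongr
    rw [norm_div, norm_mul, norm_mul, Complex.norm_I, Complex.norm_real, Real.norm_eq_abs]
    refine le_trans ?_ h1
    simp only [norm_one, Complex.norm_ofNat, mul_one]
    gcongr
    linarith
  · obtain ⟨p1, q1⟩ := hdiv ω₁ h₁
    obtain ⟨p2, q2⟩ := hdiv ω₂ h₂
    rw [← sub_mul, enorm_mul, ← ofReal_norm, ← ofReal_norm z, edist_dist, dist_eq_norm,
      mul_right_comm (ENNReal.ofReal _)]
    refine mul_le_mul' ?_ le_rfl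
    rw [← ENNReal.ofReal_mul (by positivity)]
    apply ENNReal.ofReal_le_ofReal
    set a := dotK k ω₁
    set b := dotK k ω₂
    have ha : (a : ℂ) ≠ 0 := by
      have := abs_pos.1 p1
      exact_mod_cast this
    have hb' : (b : ℂ) ≠ 0 := by
      have := abs_pos.1 p2
      exact_mod_cast this
    have e : 1 / (2 * Complex.I * (a : ℂ)) - 1 / (2 * Complex.I * (b : ℂ)) =
        ((b - a : ℝ) : ℂ) / (2 * Complex.I * ((a * b : ℝ) : ℂ)) := by
      push_cast
      field_simp
    rw [e, norm_div, norm_mul, norm_mul, Complex.norm_I, Complex.norm_real, Complex.norm_real,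
      Real.norm_eq_abs, Real.norm_eq_abs, abs_mul]
    simp only [Complex.norm_ofNat, mul_one]
    have hab : |b - a| ≤ absK k * ‖ω₁ - ω₂‖ := by
      rw [abs_sub_comm]; exact abs_dotK_sub_le k ω₁ ω₂
    calc |b - a| / (2 * (|a| * |b|)) ≤ absK k * ‖ω₁ - ω₂‖ / (1 * (|a| * |b|)) := by
          gcongr; norm_num
      _ = absK k * ((1 / |a|) * (1 / |b|)) * ‖ω₁ - ω₂‖ := by field_simp
      _ ≤ absK k * (D * D) * ‖ω₁ - ω₂‖ := by gcongr
      _ = _ := by ring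

/-- Bound for the generator. -/
lemma exists_lipN_tEnt_le (hV : IsDriving ρ V) {ρ' s : ℝ} (hρ' : 0 ≤ ρ') (hρρ : ρ' < ρ)
    (hτ₀ : 0 ≤ τ₀) :
    ∃ C : ℝ, 0 < C ∧ ∀ γ γ₀ κ M : ℝ, 0 < γ → γ ≤ γ₀ → γ₀ ≤ 1 → 0 < κ → κ ≤ γ → 1 ≤ M →
      schur (fun x y => ENNReal.ofReal (wE ρ' s x y)) (fun x y =>
        lipN (Omega0 ν γ₀ τ₀ M) (ENNReal.ofReal κ) fun ω => tEnt V ω x y) ≤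
      ENNReal.ofReal (C / (γ * M)) := by
  set ε := (ρ - ρ') / 3 with hε
  have hε0 : 0 < ε := by rw [hε]; linarith
  set p := ⌈s⌉₊ + 2 with hp
  obtain ⟨C₁, hC₁, h1⟩ := hV.potEnt_decay (σ := ρ' + 2 * ε) (by positivity) (by rw [hε]; linarith) p
  obtain ⟨C₂, hC₂, h2⟩ := exists_bracket_rpow_le_exp (2 * τ₀ + 1) hε0
  set S := (kerSum ν ε).toReal with hS
  refine ⟨2 * C₁ * C₂ * S + 1, by positivity, fun γ γ₀ κ M hγ hγγ hγ₀ hκ hκγ hM => ?_⟩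
  have hγ₀p : 0 < γ₀ := hγ.trans_le hγγ
  have hM0 : 0 < M := by linarith
  have hkey : ∀ x y : Idx ν, (lipN (Omega0 ν γ₀ τ₀ M) (ENNReal.ofReal κ) fun ω => tEnt V ω x y) *
      ENNReal.ofReal (wE ρ' s x y) ≤ ENNReal.ofReal (2 * C₁ * C₂ / (γ * M)) * ker ε x y := by
    intro x y
    set k := x.2 - y.2 with hk
    set h := |mode x.1 - mode y.1| with hh
    have hh0 : 0 ≤ h := abs_nonneg _
    rcases eq_or_ne k 0 with hk0 | hk0
    · have : (fun ω => tEnt V ω x y) = fun _ => (0 : ℂ) := by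
        ext ω
        simp only [tEnt]
        rw [← hk, hk0, hV.potEnt_zero, mul_zero]
      rw [this]
      have h0 : lipN (Omega0 ν γ₀ τ₀ M) (ENNReal.ofReal κ) (fun _ => (0 : ℂ)) ≤ 0 := by
        simpa using lipN_const (Ω := Omega0 ν γ₀ τ₀ M) (κ := ENNReal.ofReal κ) (0 : ℂ)
      rw [nonpos_iff_eq_zero.1 h0, zero_mul]
      exact zero_le
    · have hb := one_le_bracket (absK k)
      have hb0 := bracket_pos (absK k)
      have hK := absK_nonneg k
      have hKb : absK k ≤ bracket (absK k) := (le_abs_self _).trans (abs_le_bracket _)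
      set z := potEnt V k (idx x.1) (idx y.1) with hz
      have hl := lipN_divisor_le (τ₀ := τ₀) hγ₀p hM0 hκ.le hk0 z
      have hdec := h1 k (idx x.1) (idx y.1)
      rw [← mode_eq, ← mode_eq, ← hh, ← hz] at hdec
      refine (mul_le_mul' hl le_rfl).trans ?_
      rw [ker, ← ENNReal.ofReal_mul (by positivity), ← ENNReal.ofReal_mul (by positivity),
        ← ENNReal.ofReal_mul (by positivity)]
      apply ENNReal.ofReal_le_ofReal
      rw [← hh, ← hk]
      have hfac : bracket (absK k) ^ τ₀ / (γ₀ * M) +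
          κ * (absK k * (bracket (absK k) ^ τ₀ / (γ₀ * M)) ^ 2) ≤
          2 * bracket (absK k) ^ (2 * τ₀ + 1) / (γ * M) := by
        have e1 : bracket (absK k) ^ (2 * τ₀ + 1) =
            (bracket (absK k) ^ τ₀) ^ 2 * bracket (absK k) := by
          rw [Real.rpow_add_one hb0.ne', ← Real.rpow_natCast, ← Real.rpow_mul hb0.le]
          norm_num [mul_comm]
        set B := bracket (absK k) with hB
        set b := B ^ τ₀ with hbdef
        have hb1 : 1 ≤ b := Real.one_le_rpow hb hτ₀
        have t1 : b / (γ₀ * M) ≤ b ^ 2 * B / (γ * M) := by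
          gcongr
          calc b = b * 1 * 1 := by ring
            _ ≤ b * b * B := by gcongr
            _ = b ^ 2 * B := by ring
        have t2 : κ * (absK k * (b / (γ₀ * M)) ^ 2) ≤ b ^ 2 * B / (γ * M) := by
          have : κ / (γ₀ * M) ≤ 1 := by
            rw [div_le_one (by positivity)]
            calc κ ≤ γ := hκγ
              _ ≤ γ₀ * 1 := by linarith
              _ ≤ γ₀ * M := by gcongr
          calc κ * (absK k * (b / (γ₀ * M)) ^ 2) =
                (κ / (γ₀ * M)) * (b ^ 2 * absK k / (γ₀ * M)) := by field_simp
            _ ≤ 1 * (b ^ 2 * B / (γ * M)) := by gcongr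
            _ = _ := one_mul _
        rw [e1]
        calc _ ≤ b ^ 2 * B / (γ * M) + b ^ 2 * B / (γ * M) := add_le_add t1 t2
          _ = _ := by ring
      have hpw : (1 + h) ^ s ≤ (1 + h) ^ p * ((1 + h) ^ 2)⁻¹ := by
        rw [hp, pow_add, mul_inv_cancel_right₀ (by positivity), ← Real.rpow_natCast]
        exact Real.rpow_le_rpow_of_exponent_le (by linarith) (Nat.le_ceil s)
      have hexp : Real.exp (-((ρ' + 2 * ε) * absK k)) * Real.exp (ε * absK k) *
          Real.exp (ρ' * absK k) = Real.exp (-(ε * absK k)) := by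
        rw [← Real.exp_add, ← Real.exp_add]; congr 1; ring
      calc _ ≤ 2 * (C₂ * Real.exp (ε * absK k)) / (γ * M) * ‖z‖ *
            (Real.exp (ρ' * absK k) * ((1 + h) ^ p * ((1 + h) ^ 2)⁻¹)) := by
            rw [wE, ← hk, ← hh]
            gcongr
            exact hfac.trans (by gcongr; exact h2 _ hK)
        _ = 2 * C₂ / (γ * M) * Real.exp (ε * absK k) * Real.exp (ρ' * absK k) *
            (‖z‖ * (1 + h) ^ p) * ((1 + h) ^ 2)⁻¹ := by ring
        _ ≤ 2 * C₂ / (γ * M) * Real.exp (ε * absK k) * Real.exp (ρ' * absK k) *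
            (C₁ * Real.exp (-((ρ' + 2 * ε) * absK k))) * ((1 + h) ^ 2)⁻¹ := by gcongr
        _ = 2 * C₁ * C₂ / (γ * M) * ((Real.exp (-((ρ' + 2 * ε) * absK k)) *
            Real.exp (ε * absK k) * Real.exp (ρ' * absK k)) * ((1 + h) ^ 2)⁻¹) := by ring
        _ = _ := by rw [hexp]
  refine (schur_le_kerSum hkey).trans ?_
  rw [← ENNReal.ofReal_toReal (kerSum_ne_top (ν := ν) hε0), ← ENNReal.ofReal_mul (by positivity), ← hS]
  apply ENNReal.ofReal_le_ofReal
  rw [div_mul_eq_mul_div]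
  gcongr
  linarith

end Generator

section Perturbation

variable {ν : ℕ} {V : (Fin ν → ℝ) → ℝ → ℝ} {mass : ℝ}

/-- The diagonal entries of `B^{-1/2}`. -/
def cB (mass : ℝ) (a : Pr) : ℝ := freq0 mass (idx a) ^ (-(1 / 2) : ℝ)

/-- The multipliers `λ_n - λ_m` on the diagonal blocks and `-(λ_n + λ_m)` on the others. -/
def aE (mass : ℝ) (a b : Pr) : ℝ :=
  if a.isLeft = b.isLeft then freq0 mass (idx b) - freq0 mass (idx a)
  else -(freq0 mass (idx b) + freq0 mass (idx a))

/-- Entries, in the extended space, of `-i` times the perturbation. -/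
def pEnt (mass : ℝ) (V : (Fin ν → ℝ) → ℝ → ℝ) (ω : Freq ν) (x y : Idx ν) : ℂ :=
  (cB mass x.1 * cB mass y.1 : ℝ) * ((aE mass x.1 y.1 : ℂ) * ent (tOp V ω) x y -
    Complex.I * sgn x * ent (tOp V ω * tOp V ω) x y)

/-- `-i` times the perturbation in the extended space. -/
def pOp (mass : ℝ) (V : (Fin ν → ℝ) → ℝ → ℝ) (ω : Freq ν) : Op (Idx ν) := ofMat (pEnt mass V ω)

/-- Weight of an entry, without off-diagonal decay. -/
def bw (α : ℝ) (x y : Idx ν) : ℝ := if x.1.isLeft = y.1.isLeft then wV α x y else wU α x y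

lemma freq0_ge (mass : ℝ) (j : ℕ+) : (j : ℝ) ≤ freq0 mass j := by
  rw [freq0]
  exact Real.le_sqrt_of_sq_le (by nlinarith [sq_nonneg mass])

lemma one_le_coe (j : ℕ+) : (1 : ℝ) ≤ (j : ℝ) := by exact_mod_cast j.pos

lemma one_le_freq0 (mass : ℝ) (j : ℕ+) : 1 ≤ freq0 mass j := (one_le_coe j).trans (freq0_ge mass j)

lemma abs_freq0_sub_le (mass : ℝ) (j l : ℕ+) :
    |freq0 mass j - freq0 mass l| ≤ |(j : ℝ) - l| := by
  have hj := one_le_freq0 mass j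
  have hl := one_le_freq0 mass l
  have hj' := freq0_ge mass j
  have hl' := freq0_ge mass l
  have ej : freq0 mass j ^ 2 = (j : ℝ) ^ 2 + mass ^ 2 := Real.sq_sqrt (by positivity)
  have el : freq0 mass l ^ 2 = (l : ℝ) ^ 2 + mass ^ 2 := Real.sq_sqrt (by positivity)
  have h1 : (freq0 mass j - freq0 mass l) * (freq0 mass j + freq0 mass l) =
      ((j : ℝ) - l) * (j + l) := by nlinarith
  have hs : 0 < freq0 mass j + freq0 mass l := by linarith
  have hjl : (0 : ℝ) < j + l := by linarith [one_le_coe j, one_le_coe l]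
  have h2 : |freq0 mass j - freq0 mass l| * (freq0 mass j + freq0 mass l) =
      |(j : ℝ) - l| * (j + l) := by
    have e := congrArg abs h1
    rwa [abs_mul, abs_mul, abs_of_pos hs, abs_of_pos hjl] at e
  by_contra hcon
  push Not at hcon
  have := mul_lt_mul hcon (show (j : ℝ) + l ≤ freq0 mass j + freq0 mass l by linarith) hjl
    (abs_nonneg _)
  linarith

lemma cB_pos (mass : ℝ) (a : Pr) : 0 < cB mass a :=
  Real.rpow_pos_of_pos (by linarith [one_le_freq0 mass (idx a)]) _

lemma cB_sq_mul (mass : ℝ) (a : Pr) : cB mass a * freq0 mass (idx a) * cB mass a = 1 := by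
  have h := one_le_freq0 mass (idx a)
  have hp : 0 < freq0 mass (idx a) := by linarith
  rw [mul_right_comm, cB, ← Real.rpow_add hp]
  norm_num
  rw [Real.rpow_neg_one, inv_mul_cancel₀ hp.ne']

lemma cB_le_one (mass : ℝ) (a : Pr) : cB mass a ≤ 1 :=
  Real.rpow_le_one_of_one_le_of_nonpos (one_le_freq0 mass _) (by norm_num)

lemma one_le_one_add (x y : Idx ν) : 1 ≤ 1 + |mode x.1 - mode y.1| := by simp

lemma bracket_le_two_mul (a : Pr) : bracket (mode a) ≤ 2 * freq0 mass (idx a) := by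
  have h1 := bracket_le_one_add (mode a)
  have h2 := one_le_mode a
  rw [abs_of_pos (by linarith)] at h1
  have h3 := freq0_ge mass (idx a)
  rw [← mode_eq] at h3
  linarith

lemma cB_mul_le {a b : Pr} {u : ℝ} (hu : u ≤ 2 * freq0 mass (idx a) * (1 + |mode a - mode b|))
    (hu' : u ≤ 2 * freq0 mass (idx b) * (1 + |mode a - mode b|)) :
    cB mass a * cB mass b * u ≤ 2 * (1 + |mode a - mode b|) := by
  have ha := cB_pos mass a
  have hb := cB_pos mass b
  have h1 := cB_sq_mul mass a
  have h2 := cB_sq_mul mass b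
  have hh : 0 ≤ |mode a - mode b| := abs_nonneg _
  rcases le_total (cB mass a) (cB mass b) with h | h
  · calc cB mass a * cB mass b * u ≤ cB mass a * cB mass b *
          (2 * freq0 mass (idx b) * (1 + |mode a - mode b|)) := by gcongr
      _ ≤ cB mass b * cB mass b * (2 * freq0 mass (idx b) * (1 + |mode a - mode b|)) := by
        have := one_le_freq0 mass (idx b)
        gcongr
      _ = 2 * (1 + |mode a - mode b|) * (cB mass b * freq0 mass (idx b) * cB mass b) := by ring
      _ = _ := by rw [h2, mul_one]
  · calc cB mass a * cB mass b * u ≤ cB mass a * cB mass b *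
          (2 * freq0 mass (idx a) * (1 + |mode a - mode b|)) := by gcongr
      _ ≤ cB mass a * cB mass a * (2 * freq0 mass (idx a) * (1 + |mode a - mode b|)) := by
        have := one_le_freq0 mass (idx a)
        gcongr
      _ = 2 * (1 + |mode a - mode b|) * (cB mass a * freq0 mass (idx a) * cB mass a) := by ring
      _ = _ := by rw [h1, mul_one]

lemma freq0_le_mul (a b : Pr) :
    freq0 mass (idx a) ≤ freq0 mass (idx b) * (1 + |mode a - mode b|) := by
  have h := abs_freq0_sub_le mass (idx a) (idx b)
  rw [← mode_eq, ← mode_eq] at h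
  have h1 := one_le_freq0 mass (idx b)
  have h2 := le_abs_self (freq0 mass (idx a) - freq0 mass (idx b))
  nlinarith [abs_nonneg (mode a - mode b)]

lemma cB_mul_wV_le {α : ℝ} (hα : α ≤ 1) (x y : Idx ν) :
    cB mass x.1 * cB mass y.1 * wV α x y ≤ 2 * (1 + |mode x.1 - mode y.1|) := by
  have hx := bracket_le_two_mul (mass := mass) x.1
  have hy := bracket_le_two_mul (mass := mass) y.1
  have hxy := freq0_le_mul (mass := mass) x.1 y.1
  have hyx := freq0_le_mul (mass := mass) y.1 x.1
  rw [abs_sub_comm] at hyx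
  have hh : 0 ≤ |mode x.1 - mode y.1| := abs_nonneg _
  have f1 := one_le_freq0 mass (idx x.1)
  have f2 := one_le_freq0 mass (idx y.1)
  have h1 : wV α x y ≤ max (bracket (mode x.1)) (bracket (mode y.1)) := by
    have := Real.rpow_le_rpow_of_exponent_le (le_max_of_le_left (one_le_bracket (mode x.1)) :
      1 ≤ max (bracket (mode x.1)) (bracket (mode y.1))) hα
    rwa [Real.rpow_one] at this
  refine cB_mul_le (h1.trans (max_le ?_ ?_)) (h1.trans (max_le ?_ ?_)) <;> nlinarith

lemma wU_le {α : ℝ} (hα : α ≤ 1) (x y : Idx ν) : wU α x y ≤ 1 + |mode x.1 - mode y.1| := by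
  have h1 := bracket_le_mul (mode x.1) (mode y.1)
  have h2 := bracket_le_mul (mode y.1) (mode x.1)
  rw [abs_sub_comm] at h2
  have p1 := bracket_pos (mode x.1)
  have p2 := bracket_pos (mode y.1)
  have h := Real.rpow_le_rpow_of_exponent_le (one_le_max_div p1 p2) hα
  rw [Real.rpow_one] at h
  refine h.trans (max_le ?_ ?_)
  · rw [div_le_iff₀ p2, mul_comm]; exact h1
  · rw [div_le_iff₀ p1, mul_comm]; exact h2

lemma wU_nonneg (α : ℝ) (x y : Idx ν) : 0 ≤ wU α x y := by
  have p1 := bracket_pos (mode x.1)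
  have p2 := bracket_pos (mode y.1)
  unfold wU; positivity

lemma bw_nonneg (α : ℝ) (x y : Idx ν) : 0 ≤ bw α x y := by
  have p1 := bracket_pos (mode x.1)
  have p2 := bracket_pos (mode y.1)
  unfold bw wV wU
  split_ifs <;> positivity

lemma wP_eq (ρ s α : ℝ) (x y : Idx ν) : wP ρ s α x y = ENNReal.ofReal (wE ρ s x y * bw α x y) := rfl

lemma cB_mul_bw_le {α : ℝ} (hα : α ≤ 1) (x y : Idx ν) :
    cB mass x.1 * cB mass y.1 * bw α x y ≤ 2 * (1 + |mode x.1 - mode y.1|) ^ 2 := by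
  have h1 := one_le_one_add x y
  have hx := cB_pos mass x.1
  have hy := cB_pos mass y.1
  unfold bw
  split_ifs
  · exact (cB_mul_wV_le hα x y).trans (by nlinarith)
  · calc cB mass x.1 * cB mass y.1 * wU α x y ≤ 1 * 1 * wU α x y := by
          have := wU_nonneg α x y
          gcongr
          · exact cB_le_one mass _
          · exact cB_le_one mass _
      _ ≤ _ := by nlinarith [wU_le hα x y]

lemma cB_mul_aE_mul_bw_le {α : ℝ} (hα : α ≤ 1) (x y : Idx ν) :
    cB mass x.1 * cB mass y.1 * |aE mass x.1 y.1| * bw α x y ≤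
      2 * (1 + |mode x.1 - mode y.1|) ^ 2 := by
  have h1 := one_le_one_add x y
  have hx := cB_pos mass x.1
  have hy := cB_pos mass y.1
  have f1 := one_le_freq0 mass (idx x.1)
  have f2 := one_le_freq0 mass (idx y.1)
  unfold bw aE
  split_ifs with h
  · have h2 := abs_freq0_sub_le mass (idx y.1) (idx x.1)
    rw [← mode_eq, ← mode_eq, abs_sub_comm (mode y.1)] at h2
    have h3 := cB_mul_wV_le (mass := mass) hα x y
    have h4 : 0 ≤ wV α x y := by
      have p1 := bracket_pos (mode x.1)
      unfold wV; positivity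
    calc _ = (cB mass x.1 * cB mass y.1 * wV α x y) *
          |freq0 mass (idx y.1) - freq0 mass (idx x.1)| := by ring
      _ ≤ 2 * (1 + |mode x.1 - mode y.1|) * |mode x.1 - mode y.1| := by gcongr
      _ ≤ _ := by nlinarith
  · rw [abs_neg, abs_of_pos (by linarith)]
    have hxy := freq0_le_mul (mass := mass) x.1 y.1
    have hyx := freq0_le_mul (mass := mass) y.1 x.1
    rw [abs_sub_comm] at hyx
    have h3 : cB mass x.1 * cB mass y.1 * (freq0 mass (idx y.1) + freq0 mass (idx x.1)) ≤
        2 * (1 + |mode x.1 - mode y.1|) := by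
      apply cB_mul_le <;> nlinarith
    have h4 := wU_le hα x y
    have h5 := wU_nonneg α x y
    calc _ ≤ 2 * (1 + |mode x.1 - mode y.1|) * (1 + |mode x.1 - mode y.1|) := by
          gcongr
      _ = _ := by ring

/-! ### Bounds -/

section Bounds

variable {Ω : Set (Freq ν)} {κ : ℝ≥0∞} {ρ s α : ℝ} {t : ℝ≥0∞}

/-- A bound for the generator, uniform over the frequencies. -/
def GenBound (Ω : Set (Freq ν)) (κ : ℝ≥0∞) (ρ s : ℝ) (V : (Fin ν → ℝ) → ℝ → ℝ) (t : ℝ≥0∞) : Prop :=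
  schur (KamData.wE' ρ s) (fun x y => lipN Ω κ fun ω => tEnt V ω x y) ≤ t

namespace GenBound

lemma schurBdd (h : GenBound Ω κ ρ s V t) (ht : t ≠ ∞) (hρ : 0 ≤ ρ) (hs : 0 ≤ s) {ω : Freq ν}
    (hω : ω ∈ Ω) : SchurBdd (tEnt V ω) := by
  refine ne_top_of_le_ne_top ht (le_trans ?_ h)
  refine schur_mono fun x y => mul_le_mul' (enorm_le_lipN (fun ω => tEnt V ω x y) hω) ?_
  exact KamData.one_le_wE' hρ hs x y

lemma ent_tOp (h : GenBound Ω κ ρ s V t) (ht : t ≠ ∞) (hρ : 0 ≤ ρ) (hs : 0 ≤ s) {ω : Freq ν}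
    (hω : ω ∈ Ω) (x y : Idx ν) : ent (tOp V ω) x y = tEnt V ω x y :=
  ent_ofMat (h.schurBdd ht hρ hs hω) x y

lemma famN_tOp (h : GenBound Ω κ ρ s V t) (ht : t ≠ ∞) (hρ : 0 ≤ ρ) (hs : 0 ≤ s) :
    famN Ω κ (KamData.wE' ρ s) (tOp V) ≤ t := by
  refine le_trans (le_of_eq ?_) h
  unfold famN lipEnt
  congr 1
  ext x y
  exact lipN_congr fun ω hω => h.ent_tOp ht hρ hs hω x y

lemma famN_sq (h : GenBound Ω κ ρ s V t) (ht : t ≠ ∞) (hρ : 0 ≤ ρ) (hs : 0 ≤ s) :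
    famN Ω κ (KamData.wE' ρ s) (fun ω => tOp V ω * tOp V ω) ≤ t * t :=
  (famN_mul_le _ _ (KamData.wE'_mul hρ hs)).trans
    (mul_le_mul' (h.famN_tOp ht hρ hs) (h.famN_tOp ht hρ hs))

lemma lipN_pEnt_mul_le (hα : α ≤ 1) (x y : Idx ν) :
    (lipN Ω κ fun ω => pEnt mass V ω x y) * ENNReal.ofReal (bw α x y) ≤
      ENNReal.ofReal (2 * (1 + |mode x.1 - mode y.1|) ^ 2) *
        (lipEnt Ω κ (tOp V) x y + lipEnt Ω κ (fun ω => tOp V ω * tOp V ω) x y) := by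
  have hx := cB_pos mass x.1
  have hy := cB_pos mass y.1
  have hsg : ‖Complex.I * sgn x‖ ≤ 1 := by
    rw [norm_mul, Complex.norm_I, one_mul]; exact norm_sgn_le x
  have e : (fun ω => pEnt mass V ω x y) = fun ω =>
      (((cB mass x.1 * cB mass y.1 : ℝ) : ℂ) * (aE mass x.1 y.1 : ℂ)) * ent (tOp V ω) x y -
      (((cB mass x.1 * cB mass y.1 : ℝ) : ℂ) * (Complex.I * sgn x)) *
        ent (tOp V ω * tOp V ω) x y := by
    ext ω; rw [pEnt]; ring
  have h1 : (lipN Ω κ fun ω => pEnt mass V ω x y) ≤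
      ENNReal.ofReal (cB mass x.1 * cB mass y.1 * |aE mass x.1 y.1|) * lipEnt Ω κ (tOp V) x y +
      ENNReal.ofReal (cB mass x.1 * cB mass y.1) *
        lipEnt Ω κ (fun ω => tOp V ω * tOp V ω) x y := by
    rw [e]
    refine (lipN_sub_le _ _).trans (add_le_add ?_ ?_)
    · refine (lipN_const_mul_le _ _).trans (mul_le_mul' (le_of_eq ?_) le_rfl)
      rw [← ofReal_norm, norm_mul, Complex.norm_real, Complex.norm_real, Real.norm_eq_abs,
        Real.norm_eq_abs, abs_of_pos (by positivity)]
    · refine (lipN_const_mul_le _ _).trans (mul_le_mul' ?_ le_rfl)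
      rw [← ofReal_norm, norm_mul, Complex.norm_real, Real.norm_eq_abs, abs_of_pos (by positivity)]
      exact ENNReal.ofReal_le_ofReal (mul_le_of_le_one_right (by positivity) hsg)
  refine (mul_le_mul' h1 le_rfl).trans ?_
  rw [add_mul, mul_add, mul_right_comm, mul_right_comm (ENNReal.ofReal (cB mass x.1 * cB mass y.1)),
    ← ENNReal.ofReal_mul (by positivity), ← ENNReal.ofReal_mul (by positivity)]
  exact add_le_add
    (mul_le_mul' (ENNReal.ofReal_le_ofReal (cB_mul_aE_mul_bw_le hα x y)) le_rfl)
    (mul_le_mul' (ENNReal.ofReal_le_ofReal (cB_mul_bw_le hα x y)) le_rfl)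

lemma schur_pEnt_le (h : GenBound Ω κ ρ (s + 2) V t) (ht : t ≠ ∞) (hρ : 0 ≤ ρ) (hs : 0 ≤ s)
    (hα : α ≤ 1) : schur (wP ρ s α) (fun x y => lipN Ω κ fun ω => pEnt mass V ω x y) ≤
      2 * (t + t * t) := by
  have hs2 : 0 ≤ s + 2 := by linarith
  have h1 : schur (wP ρ s α) (fun x y => lipN Ω κ fun ω => pEnt mass V ω x y) ≤
      2 * schur (KamData.wE' ρ (s + 2)) (fun x y => lipEnt Ω κ (tOp V) x y +
        lipEnt Ω κ (fun ω => tOp V ω * tOp V ω) x y) := by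
    refine schur_le_mul 2 fun x y => ?_
    have hw := wE_pos ρ s x y
    rw [wP_eq, mul_comm (wE ρ s x y), ENNReal.ofReal_mul (bw_nonneg α x y), ← mul_assoc]
    refine (mul_le_mul' (lipN_pEnt_mul_le hα x y) le_rfl).trans (le_of_eq ?_)
    have : KamData.wE' ρ (s + 2) x y =
        ENNReal.ofReal ((1 + |mode x.1 - mode y.1|) ^ 2) * ENNReal.ofReal (wE ρ s x y) := by
      rw [← ENNReal.ofReal_mul (by positivity), KamData.wE', wE, wE, Real.rpow_add (by positivity)]
      congr 1
      norm_num
      ring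
    rw [this, ENNReal.ofReal_mul (by norm_num)]
    norm_num
    ring
  refine h1.trans ?_
  gcongr
  refine (schur_add_le fun _ _ => le_rfl).trans (add_le_add (h.famN_tOp ht hρ hs2)
    (h.famN_sq ht hρ hs2))

lemma schurBdd_pEnt (h : GenBound Ω κ ρ (s + 2) V t) (ht : t ≠ ∞) (hρ : 0 ≤ ρ) (hs : 0 ≤ s)
    {ω : Freq ν} (hω : ω ∈ Ω) : SchurBdd (pEnt mass V ω) := by
  refine ne_top_of_le_ne_top (b := 2 * (t + t * t)) (by finiteness)
    (le_trans ?_ (h.schur_pEnt_le (mass := mass) ht hρ hs zero_le_one))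
  exact schur_mono fun x y => mul_le_mul' (enorm_le_lipN (fun ω => pEnt mass V ω x y) hω)
    (one_le_wP hρ hs le_rfl x y)

lemma ent_pOp (h : GenBound Ω κ ρ (s + 2) V t) (ht : t ≠ ∞) (hρ : 0 ≤ ρ) (hs : 0 ≤ s)
    {ω : Freq ν} (hω : ω ∈ Ω) (x y : Idx ν) : ent (pOp mass V ω) x y = pEnt mass V ω x y :=
  ent_ofMat (h.schurBdd_pEnt ht hρ hs hω) x y

lemma lipEnt_pOp (h : GenBound Ω κ ρ (s + 2) V t) (ht : t ≠ ∞) (hρ : 0 ≤ ρ) (hs : 0 ≤ s)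
    (x y : Idx ν) : lipEnt Ω κ (pOp mass V) x y = lipN Ω κ fun ω => pEnt mass V ω x y :=
  lipN_congr fun _ hω => h.ent_pOp ht hρ hs hω x y

lemma famN_pOp_le (h : GenBound Ω κ ρ (s + 2) V t) (ht : t ≠ ∞) (hρ : 0 ≤ ρ) (hs : 0 ≤ s)
    (hα : α ≤ 1) : famN Ω κ (wP ρ s α) (pOp mass V) ≤ 2 * (t + t * t) := by
  refine le_trans (le_of_eq ?_) (h.schur_pEnt_le (mass := mass) ht hρ hs hα)
  unfold famN
  congr 1
  ext x y
  exact h.lipEnt_pOp ht hρ hs x y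

/-! ### Symmetries -/

lemma tOp_toep (h : GenBound Ω κ ρ s V t) (ht : t ≠ ∞) (hρ : 0 ≤ ρ) (hs : 0 ≤ s) {ω : Freq ν}
    (hω : ω ∈ Ω) : IsToep (tOp V ω) := fun a => by
  rw [mem_symSubring]
  intro x y
  simp [h.ent_tOp ht hρ hs hω, tEnt]

lemma tOp_conj (h : GenBound Ω κ ρ s V t) (ht : t ≠ ∞) (hρ : 0 ≤ ρ) (hs : 0 ≤ s) {ω : Freq ν}
    (hω : ω ∈ Ω) : tOp V ω ∈ conjRing ν := by
  rw [mem_symSubring]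
  intro x y
  have e : ∀ a : Pr, idx a.swap = idx a := fun a => by rcases a with a | a <;> rfl
  rw [h.ent_tOp ht hρ hs hω, h.ent_tOp ht hρ hs hω, tEnt, tEnt]
  simp only [swapIdx_fst, swapIdx_snd, e]
  rw [show -x.2 - -y.2 = -(x.2 - y.2) by abel, potEnt_neg, dotK_neg]
  have c2 : starRingEnd ℂ 2 = 2 := Complex.conj_ofNat 2
  simp [c2]

lemma star_tOp (h : GenBound Ω κ ρ s V t) (ht : t ≠ ∞) (hρ : 0 ≤ ρ) (hs : 0 ≤ s) {ω : Freq ν}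
    (hω : ω ∈ Ω) : star (tOp V ω) = tOp V ω := by
  refine ent_ext fun x y => ?_
  rw [ent_star, h.ent_tOp ht hρ hs hω, h.ent_tOp ht hρ hs hω, tEnt, tEnt,
    show y.2 - x.2 = -(x.2 - y.2) by abel, potEnt_neg, dotK_neg, potEnt_symm]
  have c2 : starRingEnd ℂ 2 = 2 := Complex.conj_ofNat 2
  simp [c2]

lemma opSym (h : GenBound Ω κ ρ (s + 2) V t) (ht : t ≠ ∞) (hρ : 0 ≤ ρ) (hs : 0 ≤ s) {ω : Freq ν}
    (hω : ω ∈ Ω) : OpSym (pOp mass V ω) := by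
  have hs2 : 0 ≤ s + 2 := by linarith
  have hT := h.tOp_toep ht hρ hs2 hω
  have hC := h.tOp_conj ht hρ hs2 hω
  have hS := h.star_tOp ht hρ hs2 hω
  have hT2 : ∀ a, tOp V ω * tOp V ω ∈ toepRing a := fun a => Subring.mul_mem _ (hT a) (hT a)
  have hC2 : tOp V ω * tOp V ω ∈ conjRing ν := Subring.mul_mem _ hC hC
  have hS2 : star (tOp V ω * tOp V ω) = tOp V ω * tOp V ω := by rw [star_mul, hS]
  refine ⟨?_, fun a => ?_, ?_⟩
  · refine ent_ext fun x y => ?_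
    rw [sig, ent_kstar norm_sgn_le, ent_neg, h.ent_pOp ht hρ hs hω, h.ent_pOp ht hρ hs hω, pEnt,
      pEnt]
    have e1 : starRingEnd ℂ (ent (tOp V ω) y x) = ent (tOp V ω) x y := by rw [← ent_star, hS]
    have e2 : starRingEnd ℂ (ent (tOp V ω * tOp V ω) y x) = ent (tOp V ω * tOp V ω) x y := by
      rw [← ent_star, hS2]
    have e3 : starRingEnd ℂ (sgn y) = sgn y := by unfold sgn; split_ifs <;> simp
    simp only [map_mul, map_sub, Complex.conj_ofReal, Complex.conj_I, e1, e2, e3]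
    have e4 : sgn x * (aE mass y.1 x.1 : ℂ) * sgn y = -(aE mass x.1 y.1 : ℂ) := by
      obtain ⟨a, k⟩ := x
      obtain ⟨b, l⟩ := y
      rcases a with a | a <;> rcases b with b | b <;> simp [aE, sgn] <;> ring
    have e5 : sgn y * sgn y = 1 := sgn_mul_sgn y
    rw [mul_comm (cB mass y.1)]
    linear_combination ((cB mass x.1 * cB mass y.1 : ℝ) : ℂ) * (ent (tOp V ω) x y * e4 +
      Complex.I * sgn x * ent (tOp V ω * tOp V ω) x y * e5)
  · rw [mem_symSubring]
    intro x y
    rw [h.ent_pOp ht hρ hs hω, h.ent_pOp ht hρ hs hω, pEnt, pEnt, mem_symSubring.1 (hT a),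
      mem_symSubring.1 (hT2 a)]
    rfl
  · rw [mem_symSubring]
    intro x y
    rw [h.ent_pOp ht hρ hs hω, h.ent_pOp ht hρ hs hω, pEnt, pEnt, mem_symSubring.1 hC,
      mem_symSubring.1 hC2]
    have e : ∀ a : Pr, idx a.swap = idx a := fun a => by rcases a with a | a <;> rfl
    have e3 : sgn (swapIdx ν x) = -sgn x := by
      obtain ⟨a, k⟩ := x
      rcases a with a | a <;> simp [sgn]
    have e3' : starRingEnd ℂ (sgn x) = sgn x := by unfold sgn; split_ifs <;> simp
    have e4 : aE mass (swapIdx ν x).1 (swapIdx ν y).1 = aE mass x.1 y.1 := by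
      obtain ⟨a, k⟩ := x
      obtain ⟨b, l⟩ := y
      rcases a with a | a <;> rcases b with b | b <;> simp [aE, idx]
    rw [e3, e4]
    simp only [cB, swapIdx_fst, e, map_mul, map_sub, Complex.conj_ofReal, Complex.conj_I, e3']
    ring

end GenBound

end Bounds

end Perturbation

section Magnus

variable {ν : ℕ} {V : (Fin ν → ℝ) → ℝ → ℝ} {mass : ℝ} {Ω : Set (Freq ν)} {κ : ℝ≥0∞} {ρ s : ℝ}
  {t : ℝ≥0∞}

namespace GenBound

lemma nice_tOp (h : GenBound Ω κ ρ s V t) (ht : t ≠ ∞) (hρ : 0 ≤ ρ) (hs : 0 ≤ s) {ω : Freq ν}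
    (hω : ω ∈ Ω) : Nice ρ s (tOp V ω) where
  toep := h.tOp_toep ht hρ hs hω
  fin := ne_top_of_le_ne_top ht ((schur_entAbs_le_famN _ hω).trans (h.famN_tOp ht hρ hs))

lemma nice_pOp (h : GenBound Ω κ ρ (s + 2) V t) (ht : t ≠ ∞) (hρ : 0 ≤ ρ) (hs : 0 ≤ s)
    {ω : Freq ν} (hω : ω ∈ Ω) : Nice ρ s (pOp mass V ω) where
  toep := (h.opSym ht hρ hs hω).toep
  fin := by
    refine ne_top_of_le_ne_top (b := 2 * (t + t * t)) (by finiteness)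
      (((schur_mono_weight _ fun x y => ?_).trans (schur_entAbs_le_famN (κ := κ) _ hω)).trans
        (h.famN_pOp_le (mass := mass) ht hρ hs zero_le_one))
    exact wE_le_wP le_rfl x y

lemma magnusX_eq (h : GenBound Ω κ ρ s V t) (ht : t ≠ ∞) (hρ : 0 ≤ ρ) (hs : 0 ≤ s)
    {ω : Freq ν} (hω : ω ∈ Ω) (hV0 : ∀ m n, potEnt V 0 m n = 0) (θ : Fin ν → ℝ) (a b : Pr) :
    magnusX mass V ω θ (idx a) (idx b) =
      (cB mass a * cB mass b : ℝ) * evalM θ (tOp V ω) a b := by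
  rw [magnusX, evalM, ← tsum_mul_left]
  refine tsum_congr fun k => ?_
  rw [h.ent_tOp ht hρ hs hω, tEnt, magnusCoeff, sub_zero]
  simp only
  split_ifs with hk
  · rw [hk, hV0]; simp
  · rw [chr, cB, cB, potEnt]; push_cast; ring

lemma conj_evalM_tOp (h : GenBound Ω κ ρ s V t) (ht : t ≠ ∞) (hρ : 0 ≤ ρ) (hs : 0 ≤ s)
    {ω : Freq ν} (hω : ω ∈ Ω) (θ : Fin ν → ℝ) (a b : Pr) :
    starRingEnd ℂ (evalM θ (tOp V ω) a b) = evalM θ (tOp V ω) a b := by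
  rw [evalM, Complex.conj_tsum, ← (Equiv.neg (Fin ν → ℤ)).tsum_eq]
  refine tsum_congr fun k => ?_
  rw [map_mul, Equiv.neg_apply]
  congr 1
  · rw [h.ent_tOp ht hρ hs hω, h.ent_tOp ht hρ hs hω, tEnt, tEnt, sub_zero, sub_zero, potEnt_neg,
      dotK_neg]
    have c2 : starRingEnd ℂ 2 = 2 := Complex.conj_ofNat 2
    simp [c2]
  · rw [chr, chr, ← Complex.exp_conj, dotK_neg]
    simp

lemma evalM_tOp_idx (h : GenBound Ω κ ρ s V t) (ht : t ≠ ∞) (hρ : 0 ≤ ρ) (hs : 0 ≤ s)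
    {ω : Freq ν} (hω : ω ∈ Ω) (θ : Fin ν → ℝ) {a b a' b' : Pr} (ha : idx a = idx a') (hb : idx b = idx b') :
    evalM θ (tOp V ω) a b = evalM θ (tOp V ω) a' b' := by
  refine tsum_congr fun k => ?_
  rw [h.ent_tOp ht hρ hs hω, h.ent_tOp ht hρ hs hω, tEnt, tEnt, ha, hb]

lemma magnusXBX_eq (h : GenBound Ω κ ρ s V t) (ht : t ≠ ∞) (hρ : 0 ≤ ρ) (hs : 0 ≤ s)
    {ω : Freq ν} (hω : ω ∈ Ω) (hV0 : ∀ m n, potEnt V 0 m n = 0) (θ : Fin ν → ℝ) (a b : Pr) :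
    2 * magnusXBX mass V ω θ (idx a) (idx b) =
      (cB mass a * cB mass b : ℝ) * evalM θ (tOp V ω * tOp V ω) a b := by
  have hn := h.nice_tOp ht hρ hs hω
  have h1 := hn.evalM_mul hρ hs hn θ a b
  have hl : Summable ((fun c => evalM θ (tOp V ω) a c * evalM θ (tOp V ω) c b) ∘ Sum.inl) :=
    h1.summable.comp_injective Sum.inl_injective
  have hr : Summable ((fun c => evalM θ (tOp V ω) a c * evalM θ (tOp V ω) c b) ∘ Sum.inr) :=
    h1.summable.comp_injective Sum.inr_injective
  rw [← h1.tsum_eq, Summable.tsum_sum hl hr]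
  have e : ∀ p : ℕ+, evalM θ (tOp V ω) a (Sum.inr p) * evalM θ (tOp V ω) (Sum.inr p) b =
      evalM θ (tOp V ω) a (Sum.inl p) * evalM θ (tOp V ω) (Sum.inl p) b := fun p => by
    rw [h.evalM_tOp_idx ht hρ hs hω θ (a := a) (b := Sum.inr p) (a' := a) (b' := Sum.inl p) rfl rfl,
      h.evalM_tOp_idx ht hρ hs hω θ (a := Sum.inr p) (b := b) (a' := Sum.inl p) (b' := b) rfl rfl]
  simp_rw [e]
  rw [← two_mul, mul_left_comm]
  congr 1
  rw [magnusXBX, ← tsum_mul_left]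
  refine tsum_congr fun p => ?_
  have e1 := h.magnusX_eq (mass := mass) ht hρ hs hω hV0 θ a (Sum.inl p)
  have e2 := h.magnusX_eq (mass := mass) ht hρ hs hω hV0 θ (Sum.inl p) b
  have e3 := cB_sq_mul mass (Sum.inl p)
  have hp : idx (Sum.inl p) = p := rfl
  rw [hp] at e1 e2 e3
  have e4 : (cB mass (Sum.inl p) : ℂ) * (freq0 mass p : ℂ) * (cB mass (Sum.inl p) : ℂ) = 1 := by
    exact_mod_cast e3
  rw [e1, e2]
  push_cast
  linear_combination ((cB mass a : ℂ) * (cB mass b : ℂ) * evalM θ (tOp V ω) a (Sum.inl p) *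
    evalM θ (tOp V ω) (Sum.inl p) b) * e4

lemma conj_magnusX (h : GenBound Ω κ ρ s V t) (ht : t ≠ ∞) (hρ : 0 ≤ ρ) (hs : 0 ≤ s)
    {ω : Freq ν} (hω : ω ∈ Ω) (hV0 : ∀ m n, potEnt V 0 m n = 0) (θ : Fin ν → ℝ) (m n : ℕ+) :
    starRingEnd ℂ (magnusX mass V ω θ m n) = magnusX mass V ω θ m n := by
  have e := h.magnusX_eq (mass := mass) ht hρ hs hω hV0 θ (Sum.inl m) (Sum.inl n)
  change magnusX mass V ω θ m n = _ at e
  rw [e, map_mul, Complex.conj_ofReal, h.conj_evalM_tOp ht hρ hs hω]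

lemma conj_magnusXBX (h : GenBound Ω κ ρ s V t) (ht : t ≠ ∞) (hρ : 0 ≤ ρ) (hs : 0 ≤ s)
    {ω : Freq ν} (hω : ω ∈ Ω) (hV0 : ∀ m n, potEnt V 0 m n = 0) (θ : Fin ν → ℝ) (m n : ℕ+) :
    starRingEnd ℂ (magnusXBX mass V ω θ m n) = magnusXBX mass V ω θ m n := by
  rw [magnusXBX, Complex.conj_tsum]
  refine tsum_congr fun p => ?_
  rw [map_mul, map_mul, Complex.conj_ofReal, h.conj_magnusX ht hρ hs hω hV0,
    h.conj_magnusX ht hρ hs hω hV0]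

lemma evalM_pOp (h : GenBound Ω κ ρ (s + 2) V t) (ht : t ≠ ∞) (hρ : 0 ≤ ρ)
    (hs : 0 ≤ s) {ω : Freq ν} (hω : ω ∈ Ω) (θ : Fin ν → ℝ) (a b : Pr) : evalM θ (pOp mass V ω) a b =
    (cB mass a * cB mass b : ℝ) * ((aE mass a b : ℂ) * evalM θ (tOp V ω) a b -
      Complex.I * (if a.isLeft then 1 else -1) * evalM θ (tOp V ω * tOp V ω) a b) := by
  have hs2 : 0 ≤ s + 2 := by linarith
  have hn := h.nice_tOp ht hρ hs2 hω
  have h1 := (hn.summable_eval hρ hs2 θ a b).mul_left (aE mass a b : ℂ)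
  have h2 := ((hn.mul hρ hs2 hn).summable_eval hρ hs2 θ a b).mul_left
    (Complex.I * (if a.isLeft then 1 else -1))
  rw [evalM, evalM, evalM, ← tsum_mul_left, ← tsum_mul_left, ← h1.tsum_sub h2, ← tsum_mul_left]
  refine tsum_congr fun k => ?_
  rw [h.ent_pOp ht hρ hs hω, pEnt, sgn]
  ring

lemma magnusVd_eq (h : GenBound Ω κ ρ (s + 2) V t) (ht : t ≠ ∞) (hρ : 0 ≤ ρ)
    (hs : 0 ≤ s) {ω : Freq ν} (hω : ω ∈ Ω) (hV0 : ∀ m n, potEnt V 0 m n = 0) (θ : Fin ν → ℝ) (m n : ℕ+) :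
    magnusVd mass V ω θ m n = Complex.I * evalM θ (pOp mass V ω) (Sum.inl m) (Sum.inl n) := by
  have hs2 : 0 ≤ s + 2 := by linarith
  have e1 := h.magnusX_eq (mass := mass) ht hρ hs2 hω hV0 θ (Sum.inl m) (Sum.inl n)
  have e2 := h.magnusXBX_eq (mass := mass) ht hρ hs2 hω hV0 θ (Sum.inl m) (Sum.inl n)
  change magnusX mass V ω θ m n = _ at e1
  change 2 * magnusXBX mass V ω θ m n = _ at e2
  rw [magnusVd, e1, e2, h.evalM_pOp ht hρ hs hω]
  simp only [aE, Sum.isLeft_inl, if_true, idx, Sum.elim_inl, id]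
  push_cast
  linear_combination ((cB mass (Sum.inl m) : ℂ) * (cB mass (Sum.inl n) : ℂ) *
    evalM θ (tOp V ω * tOp V ω) (Sum.inl m) (Sum.inl n)) * Complex.I_mul_I

lemma magnusVo_eq (h : GenBound Ω κ ρ (s + 2) V t) (ht : t ≠ ∞) (hρ : 0 ≤ ρ)
    (hs : 0 ≤ s) {ω : Freq ν} (hω : ω ∈ Ω) (hV0 : ∀ m n, potEnt V 0 m n = 0) (θ : Fin ν → ℝ) (m n : ℕ+) :
    magnusVo mass V ω θ m n = Complex.I * evalM θ (pOp mass V ω) (Sum.inl m) (Sum.inr n) := by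
  have hs2 : 0 ≤ s + 2 := by linarith
  have e1 := h.magnusX_eq (mass := mass) ht hρ hs2 hω hV0 θ (Sum.inl m) (Sum.inr n)
  have e2 := h.magnusXBX_eq (mass := mass) ht hρ hs2 hω hV0 θ (Sum.inl m) (Sum.inr n)
  change magnusX mass V ω θ m n = _ at e1
  change 2 * magnusXBX mass V ω θ m n = _ at e2
  rw [magnusVo, e1, e2, h.evalM_pOp ht hρ hs hω]
  simp only [aE, Sum.isLeft_inl, Sum.isLeft_inr, if_true, idx, Sum.elim_inl, Sum.elim_inr, id,
    Bool.true_eq_false, if_false]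
  push_cast
  linear_combination ((cB mass (Sum.inl m) : ℂ) * (cB mass (Sum.inr n) : ℂ) *
    evalM θ (tOp V ω * tOp V ω) (Sum.inl m) (Sum.inr n)) * Complex.I_mul_I

lemma neg_conj_magnusVd_eq (h : GenBound Ω κ ρ (s + 2) V t) (ht : t ≠ ∞) (hρ : 0 ≤ ρ)
    (hs : 0 ≤ s) {ω : Freq ν} (hω : ω ∈ Ω) (hV0 : ∀ m n, potEnt V 0 m n = 0) (θ : Fin ν → ℝ) (m n : ℕ+) :
    -starRingEnd ℂ (magnusVd mass V ω θ m n) =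
      Complex.I * evalM θ (pOp mass V ω) (Sum.inr m) (Sum.inr n) := by
  have hs2 : 0 ≤ s + 2 := by linarith
  have e1 := h.magnusX_eq (mass := mass) ht hρ hs2 hω hV0 θ (Sum.inr m) (Sum.inr n)
  have e2 := h.magnusXBX_eq (mass := mass) ht hρ hs2 hω hV0 θ (Sum.inr m) (Sum.inr n)
  change magnusX mass V ω θ m n = _ at e1
  change 2 * magnusXBX mass V ω θ m n = _ at e2
  have c2 : starRingEnd ℂ 2 = 2 := Complex.conj_ofNat 2
  rw [magnusVd]
  simp only [map_add, map_mul, map_sub, Complex.conj_I, Complex.conj_ofReal, c2,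
    h.conj_magnusX ht hρ hs2 hω hV0, h.conj_magnusXBX ht hρ hs2 hω hV0]
  rw [e1, e2, h.evalM_pOp ht hρ hs hω]
  simp only [aE, Sum.isLeft_inr, if_true, idx, Sum.elim_inr, id, Bool.false_eq_true, if_false]
  push_cast
  linear_combination -((cB mass (Sum.inr m) : ℂ) * (cB mass (Sum.inr n) : ℂ) *
    evalM θ (tOp V ω * tOp V ω) (Sum.inr m) (Sum.inr n)) * Complex.I_mul_I

lemma neg_conj_magnusVo_eq (h : GenBound Ω κ ρ (s + 2) V t) (ht : t ≠ ∞) (hρ : 0 ≤ ρ)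
    (hs : 0 ≤ s) {ω : Freq ν} (hω : ω ∈ Ω) (hV0 : ∀ m n, potEnt V 0 m n = 0) (θ : Fin ν → ℝ) (m n : ℕ+) :
    -starRingEnd ℂ (magnusVo mass V ω θ m n) =
      Complex.I * evalM θ (pOp mass V ω) (Sum.inr m) (Sum.inl n) := by
  have hs2 : 0 ≤ s + 2 := by linarith
  have e1 := h.magnusX_eq (mass := mass) ht hρ hs2 hω hV0 θ (Sum.inr m) (Sum.inl n)
  have e2 := h.magnusXBX_eq (mass := mass) ht hρ hs2 hω hV0 θ (Sum.inr m) (Sum.inl n)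
  change magnusX mass V ω θ m n = _ at e1
  change 2 * magnusXBX mass V ω θ m n = _ at e2
  have c2 : starRingEnd ℂ 2 = 2 := Complex.conj_ofNat 2
  rw [magnusVo]
  simp only [map_add, map_mul, map_neg, Complex.conj_I, Complex.conj_ofReal, c2,
    h.conj_magnusX ht hρ hs2 hω hV0, h.conj_magnusXBX ht hρ hs2 hω hV0]
  rw [e1, e2, h.evalM_pOp ht hρ hs hω]
  simp only [aE, Sum.isLeft_inl, Sum.isLeft_inr, idx, Sum.elim_inl, Sum.elim_inr, id,
    Bool.false_eq_true, if_false]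
  push_cast
  linear_combination -((cB mass (Sum.inr m) : ℂ) * (cB mass (Sum.inl n) : ℂ) *
    evalM θ (tOp V ω * tOp V ω) (Sum.inr m) (Sum.inl n)) * Complex.I_mul_I

/-- The unperturbed eigenvalues with signs. -/
def _root_.FastKG.mu0 (mass : ℝ) : Pr → ℝ := Sum.elim (freq0 mass) fun j => -freq0 mass j

lemma magnusHam_eq (h : GenBound Ω κ ρ (s + 2) V t) (ht : t ≠ ∞) (hρ : 0 ≤ ρ)
    (hs : 0 ≤ s) {ω : Freq ν} (hω : ω ∈ Ω) (hV0 : ∀ m n, potEnt V 0 m n = 0) (θ : Fin ν → ℝ) (i j : Pr) :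
    magnusHam mass V ω θ i j = (Matrix.diagonal fun a => (mu0 mass a : ℂ)) i j +
      Complex.I * evalM θ (pOp mass V ω) i j := by
  rcases i with i | i <;> rcases j with j | j
  · rw [← h.magnusVd_eq ht hρ hs hω hV0]
    by_cases hij : i = j
    · subst hij; simp [magnusHam, diagSigma3, mu0]
    · simp [magnusHam, diagSigma3, hij]
  · rw [← h.magnusVo_eq ht hρ hs hω hV0]
    simp [magnusHam, diagSigma3]
  · rw [← h.neg_conj_magnusVo_eq ht hρ hs hω hV0]
    simp [magnusHam, diagSigma3, conjMat]
  · rw [← h.neg_conj_magnusVd_eq ht hρ hs hω hV0]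
    by_cases hij : i = j
    · subst hij; simp [magnusHam, diagSigma3, mu0, conjMat]
    · simp [magnusHam, diagSigma3, hij, conjMat]

end GenBound

end Magnus

section BlockNorms

variable {ν : ℕ}

lemma enorm_le_decayNorm {s : ℝ} (hs : 0 ≤ s) (A : SMat) (m n : ℕ+) : ‖A m n‖ₑ ≤ decayNorm s A := by
  set h := ((m : ℤ) - (n : ℤ)).natAbs with hh
  have h1 : ‖A m n‖ₑ ^ 2 ≤ ENNReal.ofReal (bracket h ^ (2 * s)) *
      ⨆ (m : ℕ+) (n : ℕ+) (_ : ((m : ℤ) - (n : ℤ)).natAbs = h), ‖A m n‖ₑ ^ 2 := by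
    rw [← one_mul (‖A m n‖ₑ ^ 2)]
    refine mul_le_mul' ?_ ?_
    · rw [← ENNReal.ofReal_one]
      exact ENNReal.ofReal_le_ofReal (Real.one_le_rpow (one_le_bracket _) (by positivity))
    · exact le_iSup₂_of_le m n (le_iSup_of_le hh.symm le_rfl)
  have h2 := ENNReal.rpow_le_rpow (h1.trans (ENNReal.le_tsum (f := fun h : ℕ =>
    ENNReal.ofReal (bracket h ^ (2 * s)) *
    ⨆ (m : ℕ+) (n : ℕ+) (_ : ((m : ℤ) - (n : ℤ)).natAbs = h), ‖A m n‖ₑ ^ 2) h))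
    (show (0 : ℝ) ≤ 1 / 2 by norm_num)
  rwa [← ENNReal.rpow_natCast, ← ENNReal.rpow_mul, show ((2 : ℕ) : ℝ) * (1 / 2) = 1 by norm_num,
    ENNReal.rpow_one] at h2

lemma decayNorm_le {s : ℝ} (hs : 0 ≤ s) {A : SMat} {β : ℝ≥0∞}
    (h : ∀ m n : ℕ+, ‖A m n‖ₑ * ENNReal.ofReal ((1 + |(m : ℝ) - n|) ^ (s + 1)) ≤ β) :
    decayNorm s A ≤ β * sqSum ^ (1 / 2 : ℝ) := by
  have h1 : ∀ j : ℕ, ENNReal.ofReal (bracket j ^ (2 * s)) *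
      (⨆ (m : ℕ+) (n : ℕ+) (_ : ((m : ℤ) - (n : ℤ)).natAbs = j), ‖A m n‖ₑ ^ 2) ≤
      β ^ 2 * ENNReal.ofReal (((1 + |((j : ℤ) : ℝ)|) ^ 2)⁻¹) := by
    intro j
    have hj : (0 : ℝ) < 1 + j := by positivity
    have hs1 : (⨆ (m : ℕ+) (n : ℕ+) (_ : ((m : ℤ) - (n : ℤ)).natAbs = j), ‖A m n‖ₑ ^ 2) ≤
        (β * ENNReal.ofReal (((1 + (j : ℝ)) ^ (s + 1))⁻¹)) ^ 2 := by
      refine iSup₂_le fun m n => iSup_le fun hmn => ?_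
      gcongr
      have e : |(m : ℝ) - n| = j := by
        have := congrArg (fun z : ℕ => (z : ℝ)) hmn
        simpa [Nat.cast_natAbs] using this
      have h2 := h m n
      rw [e] at h2
      have hp : 0 < (1 + (j : ℝ)) ^ (s + 1) := by positivity
      calc ‖A m n‖ₑ = ‖A m n‖ₑ * (ENNReal.ofReal ((1 + (j : ℝ)) ^ (s + 1)) *
            ENNReal.ofReal (((1 + (j : ℝ)) ^ (s + 1))⁻¹)) := by
            rw [← ENNReal.ofReal_mul hp.le, mul_inv_cancel₀ hp.ne']; simp
        _ ≤ _ := by rw [← mul_assoc]; gcongr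
    refine (mul_le_mul' le_rfl hs1).trans ?_
    rw [mul_pow, ← ENNReal.ofReal_pow (by positivity), mul_left_comm,
      ← ENNReal.ofReal_mul (Real.rpow_nonneg (bracket_pos _).le _)]
    gcongr
    have hb : bracket j ≤ 1 + j := by
      have := bracket_le_one_add (j : ℝ)
      rwa [abs_of_nonneg (by positivity)] at this
    have e2 : |((j : ℤ) : ℝ)| = j := by simp
    have hb0 := bracket_pos (j : ℝ)
    rw [e2]
    calc bracket j ^ (2 * s) * (((1 + (j : ℝ)) ^ (s + 1))⁻¹) ^ 2 ≤
          (1 + (j : ℝ)) ^ (2 * s) * (((1 + (j : ℝ)) ^ (s + 1))⁻¹) ^ 2 := by gcongr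
      _ = _ := by
        rw [← Real.rpow_neg hj.le, ← Real.rpow_natCast, ← Real.rpow_mul hj.le, ← Real.rpow_add hj,
          ← Real.rpow_natCast, ← Real.rpow_neg hj.le]
        congr 1
        push_cast
        ring
  have h2 : (∑' j : ℕ, ENNReal.ofReal (bracket j ^ (2 * s)) *
      ⨆ (m : ℕ+) (n : ℕ+) (_ : ((m : ℤ) - (n : ℤ)).natAbs = j), ‖A m n‖ₑ ^ 2) ≤ β ^ 2 * sqSum := by
    refine (ENNReal.tsum_le_tsum h1).trans ?_
    rw [ENNReal.tsum_mul_left]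
    gcongr
    exact ENNReal.tsum_comp_le_tsum_of_injective Nat.cast_injective
      fun h : ℤ => ENNReal.ofReal (((1 + |(h : ℝ)|) ^ 2)⁻¹)
  refine (ENNReal.rpow_le_rpow h2 (by norm_num)).trans (le_of_eq ?_)
  rw [ENNReal.mul_rpow_of_nonneg _ _ (by norm_num), ← ENNReal.rpow_natCast, ← ENNReal.rpow_mul,
    show ((2 : ℕ) : ℝ) * (1 / 2) = 1 by norm_num, ENNReal.rpow_one]

/-- `c k` is the `k`-th Fourier coefficient of `A`, entrywise. -/
def HasCoef (A : (Fin ν → ℝ) → SMat) (c : (Fin ν → ℤ) → SMat) : Prop :=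
  ∀ k m n, fourierK (fun θ => A θ m n) k = c k m n

lemma fourierK_mul (a b : ℂ) (f : (Fin ν → ℝ) → ℂ) (k : Fin ν → ℤ) :
    fourierK (fun θ => a * f θ * b) k = a * fourierK f k * b := by
  have e : (fun θ => a * f θ * b * Complex.exp (-Complex.I * (dotK k θ : ℂ))) =
      fun θ => (a * b) * (f θ * Complex.exp (-Complex.I * (dotK k θ : ℂ))) := by ext θ; ring
  rw [fourierK, e, MeasureTheory.integral_const_mul, fourierK]
  ring

variable {A Ad Ao : (Fin ν → ℝ) → SMat} {c cd co : (Fin ν → ℤ) → SMat} {ρ s α δ : ℝ} {β : ℝ≥0∞}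

lemma HasCoef.weightMat (h : HasCoef A c) (a b : ℝ) :
    HasCoef (fun θ => weightMat a b (A θ)) fun k => weightMat a b (c k) := fun k m n => by
  simp only [FastKG.weightMat]
  rw [fourierK_mul, h k m n]

lemma enorm_weightMat (a b : ℝ) (B : SMat) (m n : ℕ+) : ‖weightMat a b B m n‖ₑ =
    ‖B m n‖ₑ * ENNReal.ofReal (bracket m ^ a * bracket n ^ b) := by
  have h1 := Real.rpow_nonneg (bracket_pos (m : ℝ)).le a
  have h2 := Real.rpow_nonneg (bracket_pos (n : ℝ)).le b
  rw [weightMat, enorm_mul, enorm_mul, ENNReal.ofReal_mul h1, ← ofReal_norm (((_ : ℝ)) : ℂ),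
    ← ofReal_norm (((bracket n ^ b : ℝ)) : ℂ), Complex.norm_real, Complex.norm_real,
    Real.norm_of_nonneg h1, Real.norm_of_nonneg h2]
  ring

lemma HasCoef.enorm_le_analyticNorm (h : HasCoef A c) (hρ : 0 ≤ ρ) (hs : 0 ≤ s) (k : Fin ν → ℤ)
    (m n : ℕ+) : ‖c k m n‖ₑ ≤ analyticNorm ρ s A := by
  have h1 : ‖c k m n‖ₑ ≤ ENNReal.ofReal (Real.exp (ρ * absK k)) *
      decayNorm s (fun m n => fourierK (fun θ => A θ m n) k) := by
    rw [← one_mul ‖c k m n‖ₑ]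
    refine mul_le_mul' ?_ ?_
    · rw [← ENNReal.ofReal_one]
      exact ENNReal.ofReal_le_ofReal (Real.one_le_exp (mul_nonneg hρ (absK_nonneg k)))
    · rw [← h k m n]
      exact enorm_le_decayNorm hs (fun m n => fourierK (fun θ => A θ m n) k) m n
  exact h1.trans (ENNReal.le_tsum (f := fun k : Fin ν → ℤ => ENNReal.ofReal (Real.exp (ρ * absK k)) *
    decayNorm s (fun m n => fourierK (fun θ => A θ m n) k)) k)

lemma HasCoef.analyticNorm_le (h : HasCoef A c) (hs : 0 ≤ s)
    (hb : ∀ k m n, ‖c k m n‖ₑ * ENNReal.ofReal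
      (Real.exp ((ρ + δ) * absK k) * (1 + |(m : ℝ) - n|) ^ (s + 1)) ≤ β) :
    analyticNorm ρ s A ≤ β * (expSum ν δ * sqSum ^ (1 / 2 : ℝ)) := by
  have h1 : ∀ k, ENNReal.ofReal (Real.exp (ρ * absK k)) *
      decayNorm s (fun m n => fourierK (fun θ => A θ m n) k) ≤
      β * (ENNReal.ofReal (Real.exp (-(δ * absK k))) * sqSum ^ (1 / 2 : ℝ)) := by
    intro k
    have h2 : decayNorm s (fun m n => fourierK (fun θ => A θ m n) k) ≤
        β * ENNReal.ofReal (Real.exp (-((ρ + δ) * absK k))) * sqSum ^ (1 / 2 : ℝ) := by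
      refine decayNorm_le hs fun m n => ?_
      rw [h k m n]
      have h3 := hb k m n
      have e : (1 + |(m : ℝ) - n|) ^ (s + 1) = Real.exp ((ρ + δ) * absK k) *
          (1 + |(m : ℝ) - n|) ^ (s + 1) * Real.exp (-((ρ + δ) * absK k)) := by
        rw [mul_right_comm, ← Real.exp_add]; simp
      rw [e, ENNReal.ofReal_mul (by positivity), ← mul_assoc]
      gcongr
    refine (mul_le_mul' le_rfl h2).trans (le_of_eq ?_)
    have e : ENNReal.ofReal (Real.exp (-(δ * absK k))) = ENNReal.ofReal (Real.exp (ρ * absK k)) *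
        ENNReal.ofReal (Real.exp (-((ρ + δ) * absK k))) := by
      rw [← ENNReal.ofReal_mul (Real.exp_pos _).le, ← Real.exp_add]
      congr 2; ring
    rw [e]; ring
  refine (ENNReal.tsum_le_tsum h1).trans (le_of_eq ?_)
  rw [ENNReal.tsum_mul_left, ENNReal.tsum_mul_right, expSum]

lemma HasCoef.analyticNorm_weightMat_le (h : HasCoef A c) (hs : 0 ≤ s) (x : ℕ+ → Pr)
    (hx : ∀ n, mode (x n) = n) {a b : ℝ}
    (hab : ∀ (k : Fin ν → ℤ) (m n : ℕ+),
      bracket m ^ a * bracket n ^ b ≤ bw α ((Sum.inl m, k) : Idx ν) (x n, 0))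
    (hb : ∀ k m n, ‖c k m n‖ₑ * wP (ρ + δ) (s + 1) α (Sum.inl m, k) (x n, 0) ≤ β) :
    analyticNorm ρ s (fun θ => FastKG.weightMat a b (A θ)) ≤
      β * (expSum ν δ * sqSum ^ (1 / 2 : ℝ)) := by
  refine (h.weightMat a b).analyticNorm_le hs fun k m n => ?_
  refine le_trans ?_ (hb k m n)
  rw [enorm_weightMat, mul_assoc]
  have p1 := Real.rpow_nonneg (bracket_pos (m : ℝ)).le a
  have p2 := Real.rpow_nonneg (bracket_pos (n : ℝ)).le b
  gcongr
  rw [← ENNReal.ofReal_mul (by positivity), wP_eq, mul_comm]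
  apply ENNReal.ofReal_le_ofReal
  rw [wE, hx, sub_zero]
  exact mul_le_mul_of_nonneg_left (hab k m n) (by positivity)

lemma weightMat_zero_zero (B : SMat) : weightMat 0 0 B = B := by
  ext m n; simp [weightMat]

lemma bw_inl (k : Fin ν → ℤ) (m n : ℕ+) : bw α ((Sum.inl m, k) : Idx ν) (Sum.inl n, 0) =
    max (bracket m) (bracket n) ^ α := by
  simp [bw, wV, mode]

lemma bw_inr (k : Fin ν → ℤ) (m n : ℕ+) : bw α ((Sum.inl m, k) : Idx ν) (Sum.inr n, 0) =
    max (bracket (m : ℝ) / bracket n) (bracket (n : ℝ) / bracket m) ^ α := by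
  simp [bw, wU, mode]

lemma rpow_mul_rpow_neg_eq {a b : ℝ} (ha : 0 < a) (hb : 0 < b) (α : ℝ) :
    a ^ α * b ^ (-α) = (a / b) ^ α := by
  rw [Real.rpow_neg hb.le, Real.div_rpow ha.le hb.le, div_eq_mul_inv]

lemma blockNorm_le (hd : HasCoef Ad cd) (ho : HasCoef Ao co) (hs : 0 ≤ s) (hα : 0 ≤ α)
    (h : ∀ k m n, ‖cd k m n‖ₑ * wP (ρ + δ) (s + 1) α (Sum.inl m, k) (Sum.inl n, 0) ≤ β)
    (h' : ∀ k m n, ‖co k m n‖ₑ * wP (ρ + δ) (s + 1) α (Sum.inl m, k) (Sum.inr n, 0) ≤ β) :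
    blockNorm ρ s α Ad Ao ≤ 8 * (β * (expSum ν δ * sqSum ^ (1 / 2 : ℝ))) := by
  have key : ∀ a b : ℝ, (∀ m n : ℕ+, bracket m ^ a * bracket n ^ b ≤
      max (bracket m) (bracket n) ^ α) → analyticNorm ρ s (fun θ => weightMat a b (Ad θ)) ≤
      β * (expSum ν δ * sqSum ^ (1 / 2 : ℝ)) := fun a b hab =>
    hd.analyticNorm_weightMat_le hs Sum.inl (fun _ => rfl)
      (fun k m n => by rw [bw_inl]; exact hab m n) h
  have key' : ∀ a b : ℝ, (∀ m n : ℕ+, bracket m ^ a * bracket n ^ b ≤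
      max (bracket (m : ℝ) / bracket n) (bracket (n : ℝ) / bracket m) ^ α) →
      analyticNorm ρ s (fun θ => weightMat a b (Ao θ)) ≤
      β * (expSum ν δ * sqSum ^ (1 / 2 : ℝ)) := fun a b hab =>
    ho.analyticNorm_weightMat_le hs Sum.inr (fun _ => rfl)
      (fun k m n => by rw [bw_inr]; exact hab m n) h'
  have p : ∀ m : ℕ+, 0 < bracket (m : ℝ) := fun m => bracket_pos _
  have q : ∀ m : ℕ+, 1 ≤ bracket (m : ℝ) := fun m => one_le_bracket _
  have hn : ∀ m : ℕ+, bracket (m : ℝ) ^ (-α) ≤ 1 := fun m =>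
    Real.rpow_le_one_of_one_le_of_nonpos (q m) (by linarith)
  have b1 : ∀ m n : ℕ+, bracket (m : ℝ) ^ α ≤ max (bracket (m : ℝ)) (bracket n) ^ α := fun m n =>
    Real.rpow_le_rpow (p m).le (le_max_left _ _) hα
  have b2 : ∀ m n : ℕ+, bracket (n : ℝ) ^ α ≤ max (bracket (m : ℝ)) (bracket n) ^ α := fun m n =>
    Real.rpow_le_rpow (p n).le (le_max_right _ _) hα
  have r1 : ∀ m n : ℕ+, 1 ≤ max (bracket (m : ℝ)) (bracket n) ^ α := fun m n =>
    Real.one_le_rpow ((q m).trans (le_max_left _ _)) hα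
  have i1 := key α 0 fun m n => by rw [Real.rpow_zero, mul_one]; exact b1 m n
  have i2 := key 0 α fun m n => by rw [Real.rpow_zero, one_mul]; exact b2 m n
  have i3 := key 0 0 fun m n => by rw [Real.rpow_zero, Real.rpow_zero, one_mul]; exact r1 m n
  have i4 := key α (-α) fun m n =>
    (mul_le_of_le_one_right (Real.rpow_nonneg (p m).le _) (hn n)).trans (b1 m n)
  have i5 := key (-α) α fun m n =>
    (mul_le_of_le_one_left (Real.rpow_nonneg (p n).le _) (hn m)).trans (b2 m n)
  have j3 := key' 0 0 fun m n => by
    rw [Real.rpow_zero, Real.rpow_zero, one_mul]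
    exact Real.one_le_rpow (one_le_max_div (p m) (p n)) hα
  have j4 := key' α (-α) fun m n => by
    rw [rpow_mul_rpow_neg_eq (p m) (p n)]
    exact Real.rpow_le_rpow (div_pos (p m) (p n)).le (le_max_left _ _) hα
  have j5 := key' (-α) α fun m n => by
    rw [mul_comm, rpow_mul_rpow_neg_eq (p n) (p m)]
    exact Real.rpow_le_rpow (div_pos (p n) (p m)).le (le_max_right _ _) hα
  simp only [weightMat_zero_zero] at i3 j3
  refine (add_le_add (add_le_add (add_le_add i1 i2) (add_le_add (add_le_add i3 i4) i5))
    (add_le_add (add_le_add j3 j4) j5)).trans (le_of_eq ?_)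
  ring

lemma enorm_mul_bw_le_blockNorm (hd : HasCoef Ad cd) (hρ : 0 ≤ ρ) (hs : 0 ≤ s)
    (k : Fin ν → ℤ) (m n : ℕ+) :
    ‖cd k m n‖ₑ * ENNReal.ofReal (bw α ((Sum.inl m, k) : Idx ν) (Sum.inl n, 0)) ≤
      blockNorm ρ s α Ad Ao := by
  rw [bw_inl]
  rcases le_total (bracket (m : ℝ)) (bracket n) with h | h
  · rw [max_eq_right h]
    have := (hd.weightMat 0 α).enorm_le_analyticNorm hρ hs k m n
    rw [enorm_weightMat, Real.rpow_zero, one_mul] at this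
    refine this.trans ?_
    unfold blockNorm
    exact le_add_self.trans (le_self_add.trans le_self_add)
  · rw [max_eq_left h]
    have := (hd.weightMat α 0).enorm_le_analyticNorm hρ hs k m n
    rw [enorm_weightMat, Real.rpow_zero, mul_one] at this
    refine this.trans ?_
    unfold blockNorm
    exact le_self_add.trans (le_self_add.trans le_self_add)

lemma enorm_mul_bw_le_blockNorm' (ho : HasCoef Ao co) (hρ : 0 ≤ ρ) (hs : 0 ≤ s)
    (k : Fin ν → ℤ) (m n : ℕ+) :
    ‖co k m n‖ₑ * ENNReal.ofReal (bw α ((Sum.inl m, k) : Idx ν) (Sum.inr n, 0)) ≤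
      blockNorm ρ s α Ad Ao := by
  have p : ∀ m : ℕ+, 0 < bracket (m : ℝ) := fun m => bracket_pos _
  rw [bw_inr]
  rcases le_total (bracket (m : ℝ) / bracket n) (bracket (n : ℝ) / bracket m) with h | h
  · rw [max_eq_right h, ← rpow_mul_rpow_neg_eq (p n) (p m), mul_comm (bracket (n : ℝ) ^ α),
      ← enorm_weightMat]
    refine ((ho.weightMat (-α) α).enorm_le_analyticNorm hρ hs k m n).trans ?_
    unfold blockNorm
    exact le_add_self.trans le_add_self
  · rw [max_eq_left h, ← rpow_mul_rpow_neg_eq (p m) (p n), ← enorm_weightMat]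
    refine ((ho.weightMat α (-α)).enorm_le_analyticNorm hρ hs k m n).trans ?_
    unfold blockNorm
    exact (le_add_self.trans le_self_add).trans le_add_self

end BlockNorms

section LipBlock

variable {ν : ℕ} {V : (Fin ν → ℝ) → ℝ → ℝ} {mass : ℝ} {Ω : Set (Freq ν)} {κ : ℝ≥0∞} {ρ s : ℝ}
  {t : ℝ≥0∞}

lemma lipN_mul_le_add {Θ E : Type*} [MetricSpace Θ] [NormedAddCommGroup E] {Ω : Set Θ} {f : Θ → E}
    {c a b : ℝ≥0∞} (ha : ∀ ω ∈ Ω, ‖f ω‖ₑ * c ≤ a)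
    (hb : ∀ ω₁ ∈ Ω, ∀ ω₂ ∈ Ω, ω₁ ≠ ω₂ → ‖f ω₁ - f ω₂‖ₑ * c / edist ω₁ ω₂ ≤ b) :
    lipN Ω κ f * c ≤ a + κ * b := by
  rw [lipN, add_mul, mul_assoc, supOn, lipOn]
  simp only [ENNReal.iSup_mul]
  gcongr
  · exact iSup₂_le ha
  · refine iSup₂_le fun ω₁ h₁ => iSup₂_le fun ω₂ h₂ => ?_
    rcases eq_or_ne ω₁ ω₂ with rfl | hne
    · simp
    · rw [ENNReal.mul_comm_div, ← mul_div_assoc]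
      exact hb ω₁ h₁ ω₂ h₂ hne

namespace GenBound

lemma hasCoef_of_evalM (h : GenBound Ω κ ρ (s + 2) V t) (ht : t ≠ ∞) (hρ : 0 ≤ ρ) (hs : 0 ≤ s)
    {ω : Freq ν} (hω : ω ∈ Ω) {A : (Fin ν → ℝ) → SMat} (b : ℕ+ → Pr)
    (hA : ∀ θ m n, A θ m n = Complex.I * evalM θ (pOp mass V ω) (Sum.inl m) (b n)) :
    HasCoef A fun k m n => Complex.I * ent (pOp mass V ω) (Sum.inl m, k) (b n, 0) := by
  intro k m n
  have hn := h.nice_pOp (mass := mass) ht hρ hs hω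
  have e : (fun θ => A θ m n) = fun θ => ∑' l : Fin ν → ℤ,
      (Complex.I * ent (pOp mass V ω) (Sum.inl m, l) (b n, 0)) * chr l θ := by
    ext θ
    rw [hA, evalM, ← tsum_mul_left]
    exact tsum_congr fun l => by ring
  rw [e, fourierK_tsum]
  simpa using hn.summable_coef hρ hs (Sum.inl m) (b n)

lemma hasCoef_sub_of_evalM (h : GenBound Ω κ ρ (s + 2) V t) (ht : t ≠ ∞) (hρ : 0 ≤ ρ) (hs : 0 ≤ s)
    {ω₁ ω₂ : Freq ν} (h₁ : ω₁ ∈ Ω) (h₂ : ω₂ ∈ Ω) {A : Freq ν → (Fin ν → ℝ) → SMat} (b : ℕ+ → Pr)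
    (hA : ∀ ω ∈ Ω, ∀ θ m n, A ω θ m n = Complex.I * evalM θ (pOp mass V ω) (Sum.inl m) (b n)) :
    HasCoef (A ω₁ - A ω₂) fun k m n => Complex.I * (ent (pOp mass V ω₁) (Sum.inl m, k) (b n, 0) -
      ent (pOp mass V ω₂) (Sum.inl m, k) (b n, 0)) := by
  intro k m n
  have n1 := h.nice_pOp (mass := mass) ht hρ hs h₁
  have n2 := h.nice_pOp (mass := mass) ht hρ hs h₂
  have e : (fun θ => (A ω₁ - A ω₂) θ m n) = fun θ => ∑' l : Fin ν → ℤ,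
      (Complex.I * (ent (pOp mass V ω₁) (Sum.inl m, l) (b n, 0) -
      ent (pOp mass V ω₂) (Sum.inl m, l) (b n, 0))) * chr l θ := by
    ext θ
    rw [Pi.sub_apply, Matrix.sub_apply, hA _ h₁, hA _ h₂, ← mul_sub, evalM, evalM,
      ← (n1.summable_eval hρ hs θ _ _).tsum_sub (n2.summable_eval hρ hs θ _ _), ← tsum_mul_left]
    exact tsum_congr fun l => by ring
  rw [e, fourierK_tsum]
  have hsub := (n1.summable_coef hρ hs (Sum.inl m) (b n)).add
    (n2.summable_coef hρ hs (Sum.inl m) (b n))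
  refine hsub.of_nonneg_of_le (fun _ => norm_nonneg _) fun l => ?_
  rw [norm_mul, Complex.norm_I, one_mul]
  exact norm_sub_le _ _

section Bounds

variable {ρ₁ s₁ α w δ : ℝ}

lemma lipBlockNorm_le (h : GenBound Ω κ ρ (s + 2) V t) (ht : t ≠ ∞) (hρ : 0 ≤ ρ) (hs : 0 ≤ s)
    (hV : ∀ m n, potEnt V 0 m n = 0) (hs₁ : 0 ≤ s₁) (hα : 0 ≤ α) (hw : 0 < w) :
    lipBlockNorm ρ₁ s₁ α w Ω (magnusVd mass V) (magnusVo mass V) ≤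
      16 * (famN Ω (ENNReal.ofReal w) (wP (ρ₁ + δ) (s₁ + 1) α) (pOp mass V) *
        (expSum ν δ * sqSum ^ (1 / 2 : ℝ))) := by
  set F := famN Ω (ENNReal.ofReal w) (wP (ρ₁ + δ) (s₁ + 1) α) (pOp mass V) with hF
  set E := expSum ν δ * sqSum ^ (1 / 2 : ℝ)
  have hd : ∀ ω ∈ Ω, ∀ θ m n, magnusVd mass V ω θ m n =
      Complex.I * evalM θ (pOp mass V ω) (Sum.inl m) (Sum.inl n) :=
    fun ω hω θ m n => h.magnusVd_eq ht hρ hs hω hV θ m n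
  have ho : ∀ ω ∈ Ω, ∀ θ m n, magnusVo mass V ω θ m n =
      Complex.I * evalM θ (pOp mass V ω) (Sum.inl m) (Sum.inr n) :=
    fun ω hω θ m n => h.magnusVo_eq ht hρ hs hω hV θ m n
  have hI : ∀ z : ℂ, ‖Complex.I * z‖ₑ = ‖z‖ₑ := fun z => by
    rw [← ofReal_norm, norm_mul, Complex.norm_I, one_mul, ofReal_norm]
  have hw0 : ENNReal.ofReal w ≠ 0 := by simpa using hw
  have hwt : ENNReal.ofReal w ≠ ∞ := ENNReal.ofReal_ne_top
  have b1 : ∀ ω ∈ Ω, ∀ x y : Idx ν, ‖Complex.I * ent (pOp mass V ω) x y‖ₑ *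
      wP (ρ₁ + δ) (s₁ + 1) α x y ≤ F := fun ω hω x y => by
    rw [hI]
    exact (mul_le_mul' (enorm_le_lipN (κ := ENNReal.ofReal w)
      (fun ω => ent (pOp mass V ω) x y) hω) le_rfl).trans (le_schur _ _ x y)
  have b2 : ∀ ω₁ ∈ Ω, ∀ ω₂ ∈ Ω, ∀ x y : Idx ν, ‖Complex.I * (ent (pOp mass V ω₁) x y -
      ent (pOp mass V ω₂) x y)‖ₑ * wP (ρ₁ + δ) (s₁ + 1) α x y ≤
      F / ENNReal.ofReal w * edist ω₁ ω₂ := fun ω₁ h₁ ω₂ h₂ x y => by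
    rw [hI, ENNReal.mul_comm_div, ← mul_div_assoc,
      ENNReal.le_div_iff_mul_le (Or.inl hw0) (Or.inl hwt)]
    calc _ = ENNReal.ofReal w * ‖ent (pOp mass V ω₁) x y - ent (pOp mass V ω₂) x y‖ₑ *
          wP (ρ₁ + δ) (s₁ + 1) α x y := by ring
      _ ≤ lipEnt Ω (ENNReal.ofReal w) (pOp mass V) x y * edist ω₁ ω₂ *
          wP (ρ₁ + δ) (s₁ + 1) α x y := mul_le_mul' (mul_enorm_sub_le_lipN
            (fun ω => ent (pOp mass V ω) x y) h₁ h₂) le_rfl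
      _ = lipEnt Ω (ENNReal.ofReal w) (pOp mass V) x y * wP (ρ₁ + δ) (s₁ + 1) α x y *
          edist ω₁ ω₂ := by ring
      _ ≤ _ := mul_le_mul' (le_schur _ _ x y) le_rfl
  have c1 : (⨆ ω ∈ Ω, blockNorm ρ₁ s₁ α (magnusVd mass V ω) (magnusVo mass V ω)) ≤ 8 * (F * E) :=
    iSup₂_le fun ω hω => blockNorm_le (h.hasCoef_of_evalM ht hρ hs hω Sum.inl (hd ω hω))
      (h.hasCoef_of_evalM ht hρ hs hω Sum.inr (ho ω hω)) hs₁ hα (fun k m n => b1 ω hω _ _)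
      fun k m n => b1 ω hω _ _
  have c2 : (⨆ (ω₁ ∈ Ω) (ω₂ ∈ Ω) (_ : ω₁ ≠ ω₂), blockNorm ρ₁ s₁ α
      (magnusVd mass V ω₁ - magnusVd mass V ω₂) (magnusVo mass V ω₁ - magnusVo mass V ω₂) /
      ENNReal.ofReal ‖ω₁ - ω₂‖) ≤ 8 * (F / ENNReal.ofReal w * E) := by
    refine iSup₂_le fun ω₁ h₁ => iSup₂_le fun ω₂ h₂ => iSup_le fun hne => ?_
    refine ENNReal.div_le_of_le_mul ((blockNorm_le (δ := δ)
      (h.hasCoef_sub_of_evalM ht hρ hs h₁ h₂ Sum.inl hd)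
      (h.hasCoef_sub_of_evalM ht hρ hs h₁ h₂ Sum.inr ho) hs₁ hα
      (fun k m n => b2 ω₁ h₁ ω₂ h₂ _ _) fun k m n => b2 ω₁ h₁ ω₂ h₂ _ _).trans (le_of_eq ?_))
    rw [edist_dist, dist_eq_norm]
    ring
  refine (add_le_add c1 (mul_le_mul' le_rfl c2)).trans (le_of_eq ?_)
  rw [show ENNReal.ofReal w * (8 * (F / ENNReal.ofReal w * E)) =
    8 * (ENNReal.ofReal w * (F / ENNReal.ofReal w) * E) by ring, ENNReal.mul_div_cancel hw0 hwt]
  ring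

lemma lipEnt_mul_bw_le (h : GenBound Ω κ ρ (s + 2) V t) (ht : t ≠ ∞) (hρ : 0 ≤ ρ) (hs : 0 ≤ s)
    (hV : ∀ m n, potEnt V 0 m n = 0) (hρ₁ : 0 ≤ ρ₁) (hs₁ : 0 ≤ s₁) (x y : Idx ν) :
    lipEnt Ω (ENNReal.ofReal w) (pOp mass V) x y * ENNReal.ofReal (bw α x y) ≤
      lipBlockNorm ρ₁ s₁ α w Ω (magnusVd mass V) (magnusVo mass V) := by
  have hd : ∀ ω ∈ Ω, ∀ θ m n, magnusVd mass V ω θ m n =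
      Complex.I * evalM θ (pOp mass V ω) (Sum.inl m) (Sum.inl n) :=
    fun ω hω θ m n => h.magnusVd_eq ht hρ hs hω hV θ m n
  have ho : ∀ ω ∈ Ω, ∀ θ m n, magnusVo mass V ω θ m n =
      Complex.I * evalM θ (pOp mass V ω) (Sum.inl m) (Sum.inr n) :=
    fun ω hω θ m n => h.magnusVo_eq ht hρ hs hω hV θ m n
  have hI : ∀ z : ℂ, ‖Complex.I * z‖ₑ = ‖z‖ₑ := fun z => by
    rw [← ofReal_norm, norm_mul, Complex.norm_I, one_mul, ofReal_norm]
  have left : ∀ (m : ℕ+) (k : Fin ν → ℤ) (b : Pr),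
      lipEnt Ω (ENNReal.ofReal w) (pOp mass V) (Sum.inl m, k) (b, 0) *
        ENNReal.ofReal (bw α ((Sum.inl m, k) : Idx ν) (b, 0)) ≤
      lipBlockNorm ρ₁ s₁ α w Ω (magnusVd mass V) (magnusVo mass V) := by
    intro m k b
    refine lipN_mul_le_add (fun ω hω => ?_) fun ω₁ h₁ ω₂ h₂ hne => ?_
    · refine le_trans ?_ (le_iSup₂ (f := fun ω (_ : ω ∈ Ω) =>
        blockNorm ρ₁ s₁ α (magnusVd mass V ω) (magnusVo mass V ω)) ω hω)
      rw [← hI]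
      rcases b with n | n
      · exact enorm_mul_bw_le_blockNorm (h.hasCoef_of_evalM ht hρ hs hω Sum.inl (hd ω hω))
          hρ₁ hs₁ k m n
      · exact enorm_mul_bw_le_blockNorm' (h.hasCoef_of_evalM ht hρ hs hω Sum.inr (ho ω hω))
          hρ₁ hs₁ k m n
    · refine le_trans ?_ (le_iSup₂_of_le ω₁ h₁ (le_iSup₂_of_le ω₂ h₂ (le_iSup_of_le hne le_rfl)))
      rw [← hI, edist_dist, dist_eq_norm]
      refine ENNReal.div_le_div_right ?_ _
      rcases b with n | n
      · exact enorm_mul_bw_le_blockNorm (h.hasCoef_sub_of_evalM ht hρ hs h₁ h₂ Sum.inl hd)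
          hρ₁ hs₁ k m n
      · exact enorm_mul_bw_le_blockNorm' (h.hasCoef_sub_of_evalM ht hρ hs h₁ h₂ Sum.inr ho)
          hρ₁ hs₁ k m n
  have shift : ∀ (m : ℕ+) (k : Fin ν → ℤ) (y : Idx ν),
      lipEnt Ω (ENNReal.ofReal w) (pOp mass V) (Sum.inl m, k) y *
        ENNReal.ofReal (bw α ((Sum.inl m, k) : Idx ν) y) ≤
      lipBlockNorm ρ₁ s₁ α w Ω (magnusVd mass V) (magnusVo mass V) := by
    intro m k y
    obtain ⟨b, l⟩ := y
    have e : lipEnt Ω (ENNReal.ofReal w) (pOp mass V) (Sum.inl m, k) (b, l) =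
        lipEnt Ω (ENNReal.ofReal w) (pOp mass V) (Sum.inl m, k - l) (b, 0) :=
      lipN_congr fun ω hω => IsToep.ent_eq (h.opSym ht hρ hs hω).toep _ _ _ _
    rw [e]
    exact left m (k - l) b
  obtain ⟨a, k⟩ := x
  rcases a with m | m
  · exact shift m k y
  · have e : lipEnt Ω (ENNReal.ofReal w) (pOp mass V) (Sum.inr m, k) y ≤
        lipEnt Ω (ENNReal.ofReal w) (pOp mass V) (Sum.inl m, -k) (swapIdx ν y) := by
      have e1 : ∀ ω ∈ Ω, ent (pOp mass V ω) (Sum.inl m, -k) (swapIdx ν y) =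
          starRingEnd ℂ (ent (pOp mass V ω) (Sum.inr m, k) y) := fun ω hω =>
        mem_symSubring.1 (h.opSym ht hρ hs hω).conj (Sum.inr m, k) y
      refine lipN_comp_le (fun ω hω => ?_) fun ω₁ h₁ ω₂ h₂ => ?_
      · rw [e1 ω hω, RCLike.norm_conj]
      · rw [e1 _ h₁, e1 _ h₂, ← map_sub, RCLike.norm_conj]
    have e2 : bw α ((Sum.inr m, k) : Idx ν) y = bw α ((Sum.inl m, -k) : Idx ν) (swapIdx ν y) := by
      obtain ⟨b, l⟩ := y
      rcases b with b | b <;> simp [bw, wV, wU, mode]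
    rw [e2]
    exact (mul_le_mul' e le_rfl).trans (shift m (-k) _)

/-- Interpolation between a norm without decay and one with strong decay. -/
lemma famN_pOp_interpolate {ℓ : ℝ≥0∞}
    (hℓ : ∀ x y : Idx ν, lipEnt Ω κ (pOp mass V) x y * ENNReal.ofReal (bw α x y) ≤ ℓ) :
    famN Ω κ (wP ρ s α) (pOp mass V) ≤
      (ℓ * famN Ω κ (wP (4 * ρ) (2 * s + 4) α) (pOp mass V)) ^ (1 / 2 : ℝ) * kerSum ν ρ := by
  refine schur_le_kerSum fun x y => ?_
  set E := lipEnt Ω κ (pOp mass V) x y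
  set b := ENNReal.ofReal (bw α x y)
  have h1 := hℓ x y
  have h2 : E * b * ENNReal.ofReal (wE (4 * ρ) (2 * s + 4) x y) ≤
      famN Ω κ (wP (4 * ρ) (2 * s + 4) α) (pOp mass V) := by
    refine le_trans (le_of_eq ?_) (le_schur _ _ x y)
    rw [wP_eq, mul_comm (wE _ _ x y), ENNReal.ofReal_mul (bw_nonneg α x y), mul_assoc]
  have h3 := ENNReal.rpow_le_rpow (mul_le_mul' h1 h2) (show (0 : ℝ) ≤ 1 / 2 by norm_num)
  have hh : 0 < 1 + |mode x.1 - mode y.1| := by positivity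
  have e1 : wE (4 * ρ) (2 * s + 4) x y = (wE (2 * ρ) (s + 2) x y) ^ 2 := by
    rw [wE, wE, mul_pow, ← Real.exp_nat_mul, ← Real.rpow_natCast (_ ^ _), ← Real.rpow_mul hh.le]
    congr 2
    · push_cast; ring
    · push_cast; ring
  have hw := (wE_pos (2 * ρ) (s + 2) x y).le
  rw [e1, ENNReal.ofReal_pow hw, show E * b * (E * b * ENNReal.ofReal (wE (2 * ρ) (s + 2) x y) ^ 2) =
    (E * b * ENNReal.ofReal (wE (2 * ρ) (s + 2) x y)) ^ 2 by ring, ← ENNReal.rpow_natCast,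
    ← ENNReal.rpow_mul, show ((2 : ℕ) : ℝ) * (1 / 2) = 1 by norm_num, ENNReal.rpow_one] at h3
  have e2 : wE ρ s x y = wE (2 * ρ) (s + 2) x y *
      (Real.exp (-(ρ * absK (x.2 - y.2))) * ((1 + |mode x.1 - mode y.1|) ^ 2)⁻¹) := by
    rw [wE, wE, Real.rpow_add hh, Real.rpow_two]
    have : Real.exp (ρ * absK (x.2 - y.2)) = Real.exp (2 * ρ * absK (x.2 - y.2)) *
        Real.exp (-(ρ * absK (x.2 - y.2))) := by rw [← Real.exp_add]; congr 1; ring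
    rw [this]
    field_simp
  rw [wP_eq, mul_comm (wE _ _ x y), ENNReal.ofReal_mul (bw_nonneg α x y), e2,
    ENNReal.ofReal_mul hw, ENNReal.ofReal_mul (Real.exp_pos _).le, ker, ← mul_assoc, ← mul_assoc]
  exact mul_le_mul' h3 le_rfl

end Bounds

end GenBound

end LipBlock

section Eta

variable {ν : ℕ} {V : (Fin ν → ℝ) → ℝ → ℝ} {mass : ℝ}

lemma wE_mono₂ {ρ ρ' s s' : ℝ} (hρ : ρ' ≤ ρ) (hs : s' ≤ s) (x y : Idx ν) :
    wE ρ' s' x y ≤ wE ρ s x y := by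
  have := absK_nonneg (x.2 - y.2)
  unfold wE
  gcongr
  exact one_le_one_add x y

lemma wP_mono₂ {ρ ρ' s s' α : ℝ} (hρ : ρ' ≤ ρ) (hs : s' ≤ s) (x y : Idx ν) :
    wP ρ' s' α x y ≤ wP ρ s α x y := by
  rw [wP_eq, wP_eq]
  exact ENNReal.ofReal_le_ofReal
    (mul_le_mul_of_nonneg_right (wE_mono₂ hρ hs x y) (bw_nonneg α x y))

lemma GenBound.mono {Ω : Set (Freq ν)} {κ t : ℝ≥0∞} {ρ ρ' s s' : ℝ} (h : GenBound Ω κ ρ s V t)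
    (hρ : ρ' ≤ ρ) (hs : s' ≤ s) : GenBound Ω κ ρ' s' V t :=
  (schur_mono_weight _ fun x y => ENNReal.ofReal_le_ofReal (wE_mono₂ hρ hs x y)).trans h

/-- Size of the perturbation, in the two norms that matter. -/
lemma exists_pOp_bounds (mass : ℝ) {ρ α s₀ τ₀ : ℝ} (hρ : 0 < ρ) (hV : IsDriving ρ V) (hα0 : 0 < α)
    (hα1 : α < 1) (hs₀ : 0 ≤ s₀) (hτ₀ : 0 ≤ τ₀) :
    ∃ C₁ > 0, ∃ C₂ > 0, ∀ γ γ₀ M : ℝ, 0 < γ → γ ≤ γ₀ → γ₀ ≤ 1 → 1 ≤ M →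
      (∃ t : ℝ≥0∞, t ≠ ∞ ∧
        GenBound (Omega0 ν γ₀ τ₀ M) (ENNReal.ofReal (γ / M ^ α)) (ρ / 16) (s₀ + 2) V t) ∧
      eta0 mass ρ V α s₀ γ₀ τ₀ γ M ≤ ENNReal.ofReal (C₁ / γ ^ 3 / M ^ (1 - α)) ∧
      famN (Omega0 ν γ₀ τ₀ M) (ENNReal.ofReal (γ / M ^ α)) (wP (ρ / 8) s₀ α) (pOp mass V) ≤
        ENNReal.ofReal (γ / M ^ α * (C₂ * Real.sqrt (eta0 mass ρ V α s₀ γ₀ τ₀ γ M).toReal *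
          Real.sqrt (1 / γ ^ 3 / M ^ (1 - α)))) := by
  have hV0 : ∀ m n, potEnt V 0 m n = 0 := hV.potEnt_zero
  obtain ⟨C, hC, hgen⟩ := exists_lipN_tEnt_le (ν := ν) (τ₀ := τ₀) hV (ρ' := ρ / 2)
    (s := 2 * s₀ + 4 + 2) (by positivity) (by linarith) hτ₀
  set C' := 2 * C * (1 + C) with hC'
  set E := expSum ν (ρ / 4) * sqSum ^ (1 / 2 : ℝ) with hE
  have hEt : E ≠ ∞ := ENNReal.mul_ne_top (expSum_ne_top (by positivity))
    (ENNReal.rpow_ne_top_of_nonneg (by norm_num) sqSum_ne_top)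
  set Q := kerSum ν (ρ / 8) with hQ
  have hQt : Q ≠ ∞ := kerSum_ne_top (by positivity)
  refine ⟨16 * C' * E.toReal + 1, by positivity, Real.sqrt C' * Q.toReal + 1, by positivity,
    fun γ γ₀ M hγ hγγ hγ₀ hM => ?_⟩
  have hM0 : 0 < M := by linarith
  have hMα : 1 ≤ M ^ α := Real.one_le_rpow hM hα0.le
  set κ := γ / M ^ α with hκ
  have hκ0 : 0 < κ := by positivity
  have hκγ : κ ≤ γ := div_le_self hγ.le hMα
  have hγ1 : γ ≤ 1 := hγγ.trans hγ₀
  set Ω := Omega0 ν γ₀ τ₀ M with hΩ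
  have hg : GenBound Ω (ENNReal.ofReal κ) (ρ / 2) (2 * s₀ + 4 + 2) V
      (ENNReal.ofReal (C / (γ * M))) := hgen γ γ₀ κ M hγ hγγ hγ₀ hκ0 hκγ hM
  have ht : ENNReal.ofReal (C / (γ * M)) ≠ ∞ := ENNReal.ofReal_ne_top
  have hρ2 : 0 ≤ ρ / 2 := by positivity
  have hs2 : 0 ≤ 2 * s₀ + 4 := by positivity
  set m := 1 / γ ^ 3 / M ^ (1 - α) with hm
  have hm0 : 0 < m := by positivity
  have eM : M ^ (1 - α) = M / M ^ α := by rw [Real.rpow_sub hM0, Real.rpow_one]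
  have hF : famN Ω (ENNReal.ofReal κ) (wP (ρ / 2) (2 * s₀ + 4) α) (pOp mass V) ≤
      ENNReal.ofReal (κ * (C' * m)) := by
    refine (hg.famN_pOp_le ht hρ2 hs2 hα1.le).trans ?_
    rw [← ENNReal.ofReal_mul (by positivity), ← ENNReal.ofReal_add (by positivity) (by positivity),
      ← ENNReal.ofReal_ofNat, ← ENNReal.ofReal_mul (by norm_num)]
    apply ENNReal.ofReal_le_ofReal
    have e : κ * (C' * m) = 2 * C * (1 + C) / (γ ^ 2 * M) := by
      rw [hκ, hm, eM, hC']; field_simp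
    rw [e]
    have h1 : C / (γ * M) ≤ C / (γ ^ 2 * M) := by
      gcongr; nlinarith
    have h2 : C / (γ * M) * (C / (γ * M)) ≤ C * C / (γ ^ 2 * M) := by
      rw [div_mul_div_comm]
      refine div_le_div_of_nonneg_left (by positivity) (by positivity) ?_
      have : γ ^ 2 * M * 1 ≤ γ ^ 2 * M * M := by gcongr
      linarith
    calc _ ≤ 2 * (C / (γ ^ 2 * M) + C * C / (γ ^ 2 * M)) := by gcongr
      _ = _ := by ring
  set L := lipBlockNorm (ρ / 4) s₀ α κ Ω (magnusVd mass V) (magnusVo mass V) with hL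
  have hF1 : famN Ω (ENNReal.ofReal κ) (wP (ρ / 4 + ρ / 4) (s₀ + 1) α) (pOp mass V) ≤
      ENNReal.ofReal (κ * (C' * m)) :=
    (schur_mono_weight _ fun x y => wP_mono₂ (by linarith) (by linarith) x y).trans hF
  have hLle : L ≤ ENNReal.ofReal (κ * (16 * C' * E.toReal * m)) := by
    refine (hg.lipBlockNorm_le (mass := mass) (δ := ρ / 4) ht hρ2 hs2 hV0 hs₀ hα0.le hκ0).trans ?_
    rw [← hE, ← ENNReal.ofReal_toReal hEt]
    refine (mul_le_mul' le_rfl (mul_le_mul' hF1 le_rfl)).trans (le_of_eq ?_)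
    rw [← ENNReal.ofReal_mul (by positivity), ← ENNReal.ofReal_ofNat,
      ← ENNReal.ofReal_mul (by norm_num), ENNReal.toReal_ofReal ENNReal.toReal_nonneg]
    congr 1; ring
  have heta : eta0 mass ρ V α s₀ γ₀ τ₀ γ M = ENNReal.ofReal (1 / κ) * L := by
    rw [eta0, hL, hκ, one_div_div]
  have heta_le : eta0 mass ρ V α s₀ γ₀ τ₀ γ M ≤ ENNReal.ofReal (16 * C' * E.toReal * m) := by
    rw [heta]
    refine (mul_le_mul' le_rfl hLle).trans (le_of_eq ?_)
    rw [← ENNReal.ofReal_mul (by positivity)]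
    congr 1
    field_simp
  have hLeta : L = ENNReal.ofReal κ * eta0 mass ρ V α s₀ γ₀ τ₀ γ M := by
    rw [heta, ← mul_assoc, ← ENNReal.ofReal_mul hκ0.le, mul_one_div_cancel hκ0.ne']
    simp
  refine ⟨⟨_, ht, hg.mono (by linarith) (by linarith)⟩, heta_le.trans ?_, ?_⟩
  · apply ENNReal.ofReal_le_ofReal
    have : (16 * C' * E.toReal + 1) / γ ^ 3 / M ^ (1 - α) = (16 * C' * E.toReal + 1) * m := by
      rw [hm]; ring
    rw [this]
    gcongr
    linarith
  · have hfin : eta0 mass ρ V α s₀ γ₀ τ₀ γ M ≠ ∞ := ne_top_of_le_ne_top ENNReal.ofReal_ne_top heta_le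
    set η := (eta0 mass ρ V α s₀ γ₀ τ₀ γ M).toReal with hη
    have hη0 : 0 ≤ η := ENNReal.toReal_nonneg
    rw [← ENNReal.ofReal_toReal hfin, ← hη] at hLeta
    have h1 := GenBound.famN_pOp_interpolate (mass := mass) (V := V) (κ := ENNReal.ofReal κ) (Ω := Ω)
      (ρ := ρ / 8) (s := s₀) (α := α) (ℓ := L)
      fun x y => hg.lipEnt_mul_bw_le ht hρ2 hs2 hV0 (by positivity) hs₀ x y
    rw [show 4 * (ρ / 8) = ρ / 2 by ring] at h1
    refine h1.trans ?_
    refine (mul_le_mul' (ENNReal.rpow_le_rpow (mul_le_mul' le_rfl hF) (by norm_num)) le_rfl).trans ?_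
    rw [hLeta, ← hQ, ← ENNReal.ofReal_toReal hQt, ← ENNReal.ofReal_mul hκ0.le,
      ← ENNReal.ofReal_mul (by positivity), ENNReal.ofReal_rpow_of_nonneg (by positivity)
      (by norm_num), ← ENNReal.ofReal_mul (by positivity)]
    apply ENNReal.ofReal_le_ofReal
    rw [ENNReal.toReal_ofReal ENNReal.toReal_nonneg, ← Real.sqrt_eq_rpow,
      show κ * η * (κ * (C' * m)) = κ ^ 2 * (C' * (η * m)) by ring,
      Real.sqrt_mul (by positivity), Real.sqrt_sq hκ0.le, Real.sqrt_mul (by positivity),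
      Real.sqrt_mul hη0]
    calc κ * (Real.sqrt C' * (Real.sqrt η * Real.sqrt m)) * Q.toReal =
        κ * ((Real.sqrt C' * Q.toReal) * Real.sqrt η * Real.sqrt m) := by ring
      _ ≤ _ := by
        gcongr
        linarith

end Eta

section Reduction

variable {ν : ℕ} {V : (Fin ν → ℝ) → ℝ → ℝ}

lemma exists_kam_constants {τ ρ : ℝ} (hτ : 0 ≤ τ) (hρ : 0 < ρ) : ∃ N θ A : ℝ, 1 ≤ N ∧ 0 < θ ∧
    θ ≤ 1 / 2 ∧ 0 < A ∧ Real.exp (-(ρ * N / 2)) ≤ θ / 2 ∧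
    ∀ n : ℕ, 13 * ((1 + N * 4 ^ n) ^ τ) ^ 2 * (1 + N * 4 ^ n) * θ ^ n ≤ A * (1 / 4) ^ n := by
  set θ : ℝ := 4 ^ (-(2 * τ + 2)) with hθ
  have hθ0 : 0 < θ := by positivity
  have hθ1 : θ ≤ 1 / 2 := by
    calc θ ≤ (4 : ℝ) ^ (-1 : ℝ) := Real.rpow_le_rpow_of_exponent_le (by norm_num) (by linarith)
      _ ≤ 1 / 2 := by rw [Real.rpow_neg_one]; norm_num
  set N := max 1 (2 / ρ * Real.log (2 / θ)) with hN
  have hN1 : 1 ≤ N := le_max_left _ _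
  refine ⟨N, θ, 13 * (2 * N) ^ (2 * τ + 1), hN1, hθ0, hθ1, by positivity, ?_, fun n => ?_⟩
  · rw [← Real.le_log_iff_exp_le (by positivity)]
    have h1 : 2 / ρ * Real.log (2 / θ) ≤ N := le_max_right _ _
    have h2 : Real.log (θ / 2) = -Real.log (2 / θ) := by rw [← Real.log_inv, inv_div]
    have h3 : Real.log (2 / θ) ≤ ρ * N / 2 := by
      calc Real.log (2 / θ) = ρ * (2 / ρ * Real.log (2 / θ)) / 2 := by field_simp
        _ ≤ _ := by gcongr
    linarith
  · have h4 : (1 : ℝ) ≤ 4 ^ n := one_le_pow₀ (by norm_num)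
    set u := 1 + N * 4 ^ n with hu
    have hu1 : 0 < u := by positivity
    have hle : u ≤ 2 * N * 4 ^ n := by nlinarith
    have e1 : (u ^ τ) ^ 2 * u = u ^ (2 * τ + 1) := by
      rw [Real.rpow_add_one hu1.ne', ← Real.rpow_natCast, ← Real.rpow_mul hu1.le, mul_comm τ]
      norm_num
    have e2 : ((4 : ℝ) ^ n) ^ (2 * τ + 1) * θ ^ n = (1 / 4) ^ n := by
      rw [hθ, ← Real.rpow_natCast, ← Real.rpow_natCast, ← Real.rpow_natCast, ← Real.rpow_mul
        (by norm_num), ← Real.rpow_mul (by norm_num), ← Real.rpow_add (by norm_num), one_div,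
        Real.inv_rpow (by norm_num), ← Real.rpow_neg (by norm_num)]
      congr 1
      ring
    calc 13 * (u ^ τ) ^ 2 * u * θ ^ n = 13 * u ^ (2 * τ + 1) * θ ^ n := by rw [← e1]; ring
      _ ≤ 13 * (2 * N * 4 ^ n) ^ (2 * τ + 1) * θ ^ n := by gcongr
      _ = 13 * (2 * N) ^ (2 * τ + 1) * (((4 : ℝ) ^ n) ^ (2 * τ + 1) * θ ^ n) := by
        rw [Real.mul_rpow (by positivity) (by positivity)]; ring
      _ = _ := by rw [e2]

lemma exp_neg_half_le_SigmaConst : Real.exp (-(1 / 2)) ≤ SigmaConst := by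
  have hs : Summable fun q : ℕ => Real.exp (-(1 / 2) * (3 / 2) ^ q) := by
    have h1 : Summable fun q : ℕ => Real.exp (-(1 / 4)) ^ q :=
      summable_geometric_of_lt_one (Real.exp_pos _).le (by rw [Real.exp_lt_one_iff]; norm_num)
    refine h1.of_nonneg_of_le (fun _ => (Real.exp_pos _).le) fun q => ?_
    rw [← Real.exp_nat_mul]
    apply Real.exp_le_exp.2
    have := one_add_mul_le_pow (a := (1 / 2 : ℝ)) (by norm_num) q
    norm_num at this ⊢
    linarith
  have := hs.le_tsum 0 fun _ _ => (Real.exp_pos _).le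
  simpa [SigmaConst] using this

lemma sqrt_le_bound {η : ℝ} : Real.sqrt η ≤ Real.sqrt (η * Real.exp 1) * SigmaConst *
    Real.exp (Real.sqrt (η * Real.exp 1) * SigmaConst) := by
  have hS := exp_neg_half_le_SigmaConst
  have hS0 : 0 < SigmaConst := (Real.exp_pos _).trans_le hS
  have h1 : Real.sqrt η = Real.sqrt (η * Real.exp 1) * Real.exp (-(1 / 2)) := by
    rw [Real.sqrt_mul' _ (Real.exp_pos _).le, ← Real.exp_half, mul_assoc, ← Real.exp_add]
    norm_num
  calc Real.sqrt η ≤ Real.sqrt (η * Real.exp 1) * SigmaConst * 1 := by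
        rw [mul_one, h1]; gcongr
    _ ≤ _ := by
      gcongr
      exact Real.one_le_exp (by positivity)

/-- Extension of a list of eigenvalues to the second component, with the opposite sign. -/
def sgE (f : ℕ+ → ℝ) : Pr → ℝ := Sum.elim f fun j => -f j

/-- The mode with a sign. -/
def sgMode : Pr → ℤ := Sum.elim (fun j => (j : ℤ)) fun j => -(j : ℤ)

lemma sgMode_injective : Function.Injective sgMode := by
  rintro (a | a) (b | b) h <;> simp only [sgMode, Sum.elim_inl, Sum.elim_inr] at h
  · congr 1; exact_mod_cast h
  · have := a.pos; have := b.pos; omega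
  · have := a.pos; have := b.pos; omega
  · congr 1; exact_mod_cast neg_injective h

lemma melnikov_iff {g t α M : ℝ} {f : ℕ+ → ℝ} {ω : Freq ν} : Melnikov g t α M f ω ↔
    ∀ (k : Fin ν → ℤ) (a b : Pr), ¬(k = 0 ∧ a = b) →
      g / bracket (absK k) ^ t * (bracket ((sgMode a - sgMode b : ℤ) : ℝ) ^ α / M ^ α) ≤
        |dotK k ω + (sgE f a - sgE f b)| := by
  constructor
  · intro h k a b hab
    rcases a with j | j <;> rcases b with l | l <;>
      simp only [sgMode, sgE, Sum.elim_inl, Sum.elim_inr] <;> push_cast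
    · rw [← add_sub_assoc]
      exact h.2 k j l fun hc => hab ⟨hc.1, by rw [hc.2]⟩
    · rw [sub_neg_eq_add, sub_neg_eq_add, ← add_assoc]
      exact h.1 k j l
    · have := h.1 (-k) j l
      rw [absK_neg, dotK_neg] at this
      rw [← abs_neg, show bracket (-(j : ℝ) - l) = bracket ((j : ℝ) + l) by
        unfold bracket; congr 1; ring]
      exact this.trans (le_of_eq (congrArg _ (by ring)))
    · have := h.2 (-k) j l fun hc => hab ⟨neg_eq_zero.1 hc.1, by rw [hc.2]⟩
      rw [absK_neg, dotK_neg] at this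
      rw [← abs_neg, show bracket (-(j : ℝ) - -(l : ℝ)) = bracket ((j : ℝ) - l) by
        unfold bracket; congr 1; ring]
      exact this.trans (le_of_eq (congrArg _ (by ring)))
  · intro h
    refine ⟨fun k j l => ?_, fun k j l hjl => ?_⟩
    · have := h k (Sum.inl j) (Sum.inr l) (by simp)
      simp only [sgMode, sgE, Sum.elim_inl, Sum.elim_inr] at this
      push_cast at this
      rwa [sub_neg_eq_add, sub_neg_eq_add, ← add_assoc] at this
    · have := h k (Sum.inl j) (Sum.inl l) (by simpa using hjl)
      simp only [sgMode, sgE, Sum.elim_inl] at this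
      push_cast at this
      rwa [← add_sub_assoc] at this

lemma bracket_modeGap (x y : Idx ν) :
    bracket (modeGap x y) = bracket ((sgMode x.1 - sgMode y.1 : ℤ) : ℝ) := by
  refine le_antisymm (bracket_mono (le_of_eq ?_)) (bracket_mono (le_of_eq ?_)) <;>
    obtain ⟨a, k⟩ := x <;> obtain ⟨b, l⟩ := y <;> rcases a with j | j <;> rcases b with n | n <;>
    simp [modeGap, sgMode, mode, neg_add_eq_sub, abs_sub_comm, ← abs_neg (-(j : ℝ) - n), add_comm]

lemma good_of_melnikov {S : KState ν} {γ τ α M N : ℝ} {ω : Freq ν} {lam : ℕ+ → ℝ}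
    (hl : ∀ j, KamData.muLim S (γ / M ^ α) τ α N (Sum.inl j) ω = lam j)
    (hr : ∀ j, KamData.muLim S (γ / M ^ α) τ α N (Sum.inr j) ω = -lam j)
    (h : Melnikov γ τ α M lam ω) : KamData.Good S (γ / M ^ α) τ α N ω := by
  intro x y hxy
  have e : ∀ a, KamData.muLim S (γ / M ^ α) τ α N a ω = sgE lam a := by
    rintro (j | j)
    · exact hl j
    · exact hr j
  rw [thr, bracket_modeGap, e, e, add_sub_assoc]
  refine le_trans (le_of_eq (by ring)) (melnikov_iff.1 h (x.2 - y.2) x.1 y.1 fun hc => hxy ?_)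
  exact Prod.ext hc.2 (sub_eq_zero.1 hc.1)

/-- Reducibility, with control of the final eigenvalues. -/
theorem exists_reduction (mass : ℝ) {ρ α s₀ τ₀ τ : ℝ} (hρ : 0 < ρ) (hV : IsDriving ρ V)
    (hα0 : 0 < α) (hα1 : α < 1) (hs₀ : 0 ≤ s₀) (hτ₀ : 0 ≤ τ₀) (hτ : 0 ≤ τ) {γ : ℝ} (hγ : 0 < γ) :
    ∃ M₀ ≥ 1, ∃ K > 0, ∀ γ₀ M : ℝ, γ ≤ γ₀ → γ₀ ≤ 1 → M₀ ≤ M →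
      eta0 mass ρ V α s₀ γ₀ τ₀ γ M ≤ ENNReal.ofReal (K / M ^ (1 - α)) ∧
      ∃ lam : ℕ+ → Freq ν → ℝ,
        (∀ j ω₁ ω₂, |lam j ω₁ - lam j ω₂| ≤ 1 / 8 * ‖ω₁ - ω₂‖) ∧
        (∀ j, ∀ ω ∈ Omega0 ν γ₀ τ₀ M,
          |lam j ω - freq0 mass j| ≤ 1 / 8 * (γ / M ^ α) / bracket j ^ α) ∧
        ∀ ω ∈ Omega0 ν γ₀ τ₀ M, Melnikov γ τ α M (fun j => lam j ω) ω →
          ∃ W : (Fin ν → ℝ) → State ≃L[ℂ] State,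
            IsCoordChange s₀ W ∧
            Conjugates ω W (magnusHam mass V ω) (diagSigma3 fun j => lam j ω) ∧
            ∀ r ∈ Set.Icc 0 s₀, ∀ θ : Fin ν → ℝ,
              OpBound r ((W θ : State →L[ℂ] State) - ContinuousLinearMap.id ℂ State)
                (Real.sqrt ((eta0 mass ρ V α s₀ γ₀ τ₀ γ M).toReal * Real.exp 1) * SigmaConst *
                  Real.exp (Real.sqrt ((eta0 mass ρ V α s₀ γ₀ τ₀ γ M).toReal * Real.exp 1)
                    * SigmaConst)) := by
  obtain ⟨C₁, hC₁, C₂, hC₂, hb⟩ := exists_pOp_bounds (ν := ν) mass hρ hV hα0 hα1 hs₀ hτ₀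
  obtain ⟨N, θ, A, hN, hθ0, hθ1, hA0, hexp, hA⟩ := exists_kam_constants hτ
    (show 0 < ρ / 16 by positivity)
  set c := max (16 * A * C₂) (48 * A * C₂ * Real.sqrt C₁ / θ + 1) with hc
  have hc0 : 0 < c := by positivity
  have hc1 : 1 ≤ c := le_max_of_le_right (le_add_of_nonneg_left (by positivity))
  set M₀ := max 1 ((c ^ 2 / γ ^ 3) ^ (1 / (1 - α))) with hM₀
  refine ⟨M₀, le_max_left _ _, C₁ / γ ^ 3, by positivity, fun γ₀ M hγγ hγ₀ hM => ?_⟩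
  have hM1 : 1 ≤ M := (le_max_left _ _).trans hM
  have hM0 : 0 < M := by linarith
  obtain ⟨⟨t, ht, hg⟩, heta, hfam⟩ := hb γ γ₀ M hγ hγγ hγ₀ hM1
  set m := 1 / γ ^ 3 / M ^ (1 - α) with hm
  have hm0 : 0 < m := by positivity
  have hmc : Real.sqrt m * c ≤ 1 := by
    have h1 : c ^ 2 / γ ^ 3 ≤ M ^ (1 - α) := by
      have h2 := Real.rpow_le_rpow (by positivity) ((le_max_right _ _).trans hM)
        (show 0 ≤ 1 - α by linarith)
      rwa [← Real.rpow_mul (by positivity), one_div_mul_cancel (by linarith), Real.rpow_one] at h2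
    have h3 : m * c ^ 2 ≤ 1 := by
      rw [hm, div_div, div_mul_eq_mul_div, one_mul, div_le_one (by positivity)]
      rw [div_le_iff₀ (by positivity)] at h1
      linarith
    have h4 : (Real.sqrt m * c) ^ 2 ≤ 1 := by rwa [mul_pow, Real.sq_sqrt hm0.le]
    exact le_of_sq_le_sq (by simpa using h4) zero_le_one |>.trans le_rfl
  set η := (eta0 mass ρ V α s₀ γ₀ τ₀ γ M).toReal with hη
  have hη0 : 0 ≤ η := ENNReal.toReal_nonneg
  have hηm : η ≤ C₁ * m := by
    refine ENNReal.toReal_le_of_le_ofReal (by positivity) (heta.trans (le_of_eq ?_))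
    congr 1; rw [hm]; ring
  set q := C₂ * Real.sqrt η * Real.sqrt m with hq
  have hq0 : 0 ≤ q := by positivity
  have hAq : 16 * A * q ≤ Real.sqrt η := by
    calc 16 * A * q = Real.sqrt η * (Real.sqrt m * (16 * A * C₂)) := by rw [hq]; ring
      _ ≤ Real.sqrt η * (Real.sqrt m * c) := by gcongr; exact le_max_left _ _
      _ ≤ Real.sqrt η * 1 := by gcongr
      _ = _ := mul_one _
  have hAqθ : 48 * A * q ≤ θ := by
    have h1 : Real.sqrt η ≤ Real.sqrt C₁ * Real.sqrt m := by
      rw [← Real.sqrt_mul hC₁.le]; exact Real.sqrt_le_sqrt hηm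
    have h2 : 48 * A * C₂ * Real.sqrt C₁ ≤ θ * c := by
      have : 48 * A * C₂ * Real.sqrt C₁ / θ ≤ c :=
        (le_add_of_nonneg_right zero_le_one).trans (le_max_right _ _)
      rw [div_le_iff₀ hθ0] at this
      linarith
    have h3 : Real.sqrt m ≤ 1 := by
      calc Real.sqrt m = Real.sqrt m * 1 := (mul_one _).symm
        _ ≤ Real.sqrt m * c := by gcongr
        _ ≤ 1 := hmc
    calc 48 * A * q ≤ 48 * A * (C₂ * (Real.sqrt C₁ * Real.sqrt m) * Real.sqrt m) := by
          rw [hq]; gcongr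
      _ = 48 * A * C₂ * Real.sqrt C₁ * (Real.sqrt m * Real.sqrt m) := by ring
      _ ≤ θ * c * (Real.sqrt m * 1) := by gcongr
      _ = θ * (Real.sqrt m * c) := by ring
      _ ≤ θ * 1 := by gcongr
      _ = θ := mul_one _
  set S : KState ν := ⟨fun a _ => mu0 mass a, pOp mass V⟩ with hS
  set κ := γ / M ^ α with hκ
  have hκ0 : 0 < κ := by positivity
  set Ω := Omega0 ν γ₀ τ₀ M with hΩ
  have hρ16 : 0 ≤ ρ / 16 := by positivity
  have hK : KamData Ω κ τ α s₀ (ρ / 16) N θ A q S :=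
    { hκ := hκ0, hτ := hτ, hα := hα0.le, hs := hs₀, hρ := by positivity, hN := hN, hθ0 := hθ0
      hθ := hθ1, hA := hA, hexp := hexp, hq0 := hq0, hq := hAqθ
      hP := by rw [show 2 * (ρ / 16) = ρ / 8 by ring]; exact hfam
      hμ := fun _ _ _ => rfl
      hsym := fun ω hω =>
        { op := hg.opSym ht hρ16 hs₀ hω
          odd := fun _ => rfl
          bdd := by
            have : ent (S.P ω) = pEnt mass V ω := by
              ext x y; exact hg.ent_pOp ht hρ16 hs₀ hω x y
            rw [this]
            exact hg.schurBdd_pEnt ht hρ16 hs₀ hω } }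
  have hq16 : 2 * q ≤ 1 / 8 := by
    have := hK.A_ge
    nlinarith
  have hlip : ∀ j : ℕ+, LipschitzOnWith (1 / 8) (KamData.muLim S κ τ α N (Sum.inl j)) Ω := fun j =>
    LipschitzOnWith.of_dist_le_mul fun ω₁ h₁ ω₂ h₂ => by
      rw [Real.dist_eq, dist_eq_norm]
      refine (hK.muLim_lip (Sum.inl j) h₁ h₂).trans ?_
      gcongr
      simpa using hq16
  choose lam hlam hlamE using fun j => (hlip j).extend_real
  refine ⟨heta, lam, fun j ω₁ ω₂ => ?_, fun j ω hω => ?_, fun ω hω hmel => ?_⟩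
  · have := (hlam j).dist_le_mul ω₁ ω₂
    rw [Real.dist_eq, dist_eq_norm] at this
    simpa using this
  · rw [← hlamE j hω]
    refine (hK.muLim_sub_le (Sum.inl j) hω).trans ?_
    have := bracket_pos (j : ℝ)
    change 2 * κ * q / bracket (j : ℝ) ^ α ≤ _
    rw [mul_right_comm]
    gcongr
  · have hl : ∀ j, KamData.muLim S κ τ α N (Sum.inl j) ω = lam j ω := fun j => hlamE j hω
    have hr : ∀ j, KamData.muLim S κ τ α N (Sum.inr j) ω = -lam j ω := fun j => by
      rw [hK.muLim_odd j hω, hl]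
    obtain ⟨W, hW, hWb⟩ := hK.exists_limit hω (good_of_melnikov hl hr hmel)
    have hbd : 16 * A * q ≤ Real.sqrt (η * Real.exp 1) * SigmaConst *
        Real.exp (Real.sqrt (η * Real.exp 1) * SigmaConst) := hAq.trans sqrt_le_bound
    exact exists_coordChange (ρ := ρ / 16) (s := s₀) (by positivity) hs₀ le_rfl
      ((by positivity : 0 ≤ 16 * A * q).trans hbd) hW
      (hg.nice_pOp ht hρ16 hs₀ hω) (hg.opSym ht hρ16 hs₀ hω).skew
      (hWb.trans (ENNReal.ofReal_le_ofReal hbd))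
      (fun θ i j => hg.magnusHam_eq ht hρ16 hs₀ hω hV.potEnt_zero θ i j) hl hr

end Reduction

section Slabs

open MeasureTheory

variable {ν : ℕ}

lemma volume_closedBall_le_annulus (hν : 1 ≤ ν) {M : ℝ} (hM : 0 < M) :
    volume (Metric.closedBall (0 : Freq ν) (3 * M)) ≤
      ENNReal.ofReal (3 ^ ν) * volume (annulus ν M) := by
  set v := volume (Metric.ball (0 : Freq ν) 1) with hv
  have hvt : v ≠ ∞ := measure_ball_lt_top.ne
  have e1 : volume (Metric.closedBall (0 : Freq ν) (3 * M)) = ENNReal.ofReal ((3 * M) ^ ν) * v := by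
    rw [Measure.addHaar_closedBall _ _ (by positivity)]; simp [hv]
  have e2 : volume (Metric.closedBall (0 : Freq ν) (2 * M)) = ENNReal.ofReal ((2 * M) ^ ν) * v := by
    rw [Measure.addHaar_closedBall _ _ (by positivity)]; simp [hv]
  have e3 : volume (Metric.ball (0 : Freq ν) M) = ENNReal.ofReal (M ^ ν) * v := by
    rw [Measure.addHaar_ball_of_pos _ _ hM]; simp [hv]
  have h1 : volume (Metric.closedBall (0 : Freq ν) (2 * M)) ≤
      volume (annulus ν M) + volume (Metric.ball (0 : Freq ν) M) := by
    refine (measure_mono ?_).trans (measure_union_le _ _)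
    intro x hx
    by_cases h : x ∈ Metric.ball (0 : Freq ν) M
    · exact Or.inr h
    · exact Or.inl ⟨hx, h⟩
  have h2 : ENNReal.ofReal (M ^ ν) * v ≤ volume (annulus ν M) := by
    refine ENNReal.le_of_add_le_add_right (a := ENNReal.ofReal (M ^ ν) * v)
      (ENNReal.mul_ne_top ENNReal.ofReal_ne_top hvt) ?_
    rw [e2, e3] at h1
    refine le_trans ?_ h1
    rw [← add_mul, ← ENNReal.ofReal_add (by positivity) (by positivity)]
    gcongr
    rw [mul_pow]
    have : (2 : ℝ) ^ 1 ≤ 2 ^ ν := pow_le_pow_right₀ (by norm_num) hν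
    have hp : 0 < M ^ ν := by positivity
    nlinarith
  rw [e1, mul_pow, ENNReal.ofReal_mul (by positivity), mul_assoc]
  gcongr

/-- A set that is thin in one direction has small volume. -/
lemma volume_le_of_thin {A : Set (Freq ν)} (hA : MeasurableSet A) {M η : ℝ} (hM : 0 < M)
    (hη : 0 < η) (hAM : A ⊆ Metric.closedBall 0 (2 * M)) {v : Freq ν} (hv : ‖v‖ = 1)
    (hthin : ∀ ω ∈ A, ∀ x : ℝ, ω + x • v ∈ A → |x| < η) :
    volume A ≤ ENNReal.ofReal (2 * η / M) * volume (Metric.closedBall (0 : Freq ν) (3 * M)) := by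
  set B := volume (Metric.closedBall (0 : Freq ν) (3 * M)) with hB
  set n := ⌊M / η⌋₊ with hn
  rcases Nat.eq_zero_or_pos n with h0 | hpos
  · have h1 : M / η < 1 := Nat.floor_eq_zero.1 h0
    rw [div_lt_one hη] at h1
    have h2 : volume A ≤ B := measure_mono (hAM.trans (Metric.closedBall_subset_closedBall
      (by linarith)))
    refine h2.trans ?_
    rw [← one_mul B, ← mul_assoc, mul_one]
    gcongr
    rw [ENNReal.one_le_ofReal, le_div_iff₀ hM]
    linarith
  · set T : Fin n → Set (Freq ν) := fun m => (fun ω => ω + (-((m : ℕ) * η)) • v) ⁻¹' A with hT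
    have hTm : ∀ m, MeasurableSet (T m) := fun m =>
      hA.preimage (measurable_id.add_const _)
    have hTv : ∀ m, volume (T m) = volume A := fun m => measure_preimage_add_right _ _ _
    have hdisj : Pairwise (Function.onFun Disjoint T) := by
      intro m m' hmm
      refine Set.disjoint_left.2 fun ω h1 h2 => ?_
      have h3 := hthin _ h1 (((m : ℕ) - (m' : ℕ) : ℝ) * η) (by
        have e : ω + (-((m : ℕ) * η)) • v + ((((m : ℕ) - (m' : ℕ) : ℝ)) * η) • v =
            ω + (-((m' : ℕ) * η)) • v := by
          rw [add_assoc, ← add_smul]; congr 2; ring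
        rw [e]; exact h2)
      rw [abs_mul, abs_of_pos hη] at h3
      have h4 : (1 : ℝ) ≤ |((m : ℕ) : ℝ) - (m' : ℕ)| := by
        have : ((m : ℕ) : ℤ) - ((m' : ℕ) : ℤ) ≠ 0 := by
          intro h; apply hmm; ext; omega
        have := Int.one_le_abs this
        exact_mod_cast this
      nlinarith
    have hsub : (⋃ m, T m) ⊆ Metric.closedBall 0 (3 * M) := by
      refine Set.iUnion_subset fun m ω hω => ?_
      have h1 := hAM hω
      rw [mem_closedBall_zero_iff] at h1 ⊢
      have h2 : ‖((m : ℕ) * η : ℝ) • v‖ ≤ M := by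
        rw [norm_smul, hv, mul_one, Real.norm_of_nonneg (by positivity)]
        have h3 : ((m : ℕ) : ℝ) ≤ n := by exact_mod_cast m.2.le
        have h4 : (n : ℝ) ≤ M / η := Nat.floor_le (by positivity)
        calc ((m : ℕ) : ℝ) * η ≤ M / η * η := by gcongr; exact h3.trans h4
          _ = M := div_mul_cancel₀ _ hη.ne'
      have e : ω = (ω + (-((m : ℕ) * η)) • v) + ((m : ℕ) * η : ℝ) • v := by
        rw [neg_smul]; abel
      rw [e]
      exact (norm_add_le _ _).trans (by linarith)
    have hsum : (n : ℝ≥0∞) * volume A ≤ B := by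
      have h1 := measure_iUnion (μ := volume) hdisj hTm
      rw [tsum_fintype, Finset.sum_congr rfl (fun m _ => hTv m), Finset.sum_const, Finset.card_univ,
        Fintype.card_fin, nsmul_eq_mul] at h1
      rw [← h1]
      exact measure_mono hsub
    have h5 : ENNReal.ofReal (M / (2 * η)) ≤ n := by
      rw [← ENNReal.ofReal_natCast]
      apply ENNReal.ofReal_le_ofReal
      have h6 := Nat.lt_floor_add_one (M / η)
      have h7 : (1 : ℝ) ≤ n := by exact_mod_cast hpos
      have h8 : M / (2 * η) = M / η / 2 := by field_simp
      rw [h8]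
      rw [← hn] at h6
      linarith
    have h9 : ENNReal.ofReal (M / (2 * η)) * volume A ≤ B := (mul_le_mul' h5 le_rfl).trans hsum
    calc volume A = ENNReal.ofReal (2 * η / M) * (ENNReal.ofReal (M / (2 * η)) * volume A) := by
          rw [← mul_assoc, ← ENNReal.ofReal_mul (by positivity)]
          have : 2 * η / M * (M / (2 * η)) = 1 := by field_simp
          rw [this]; simp
      _ ≤ _ := by gcongr

lemma relMeas_mono {M : ℝ} {A B : Set (Freq ν)} (h : A ⊆ B) : relMeas M A ≤ relMeas M B :=
  ENNReal.div_le_div_right (measure_mono h) _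

lemma relMeas_iUnion_le {ι : Type*} [Countable ι] {M : ℝ} (A : ι → Set (Freq ν)) :
    relMeas M (⋃ i, A i) ≤ ∑' i, relMeas M (A i) := by
  simp only [relMeas, div_eq_mul_inv]
  rw [ENNReal.tsum_mul_right]
  gcongr
  exact measure_iUnion_le A

lemma relMeas_union_le {M : ℝ} (A B : Set (Freq ν)) :
    relMeas M (A ∪ B) ≤ relMeas M A + relMeas M B := by
  simp only [relMeas, div_eq_mul_inv, ← add_mul]
  gcongr
  exact measure_union_le A B

/-- Measure of a resonant set. -/
lemma relMeas_resonance_le (hν : 1 ≤ ν) {M δ : ℝ} (hM : 0 < M) {k : Fin ν → ℤ} (hk : k ≠ 0)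
    {h : Freq ν → ℝ} (hL : ∀ ω₁ ω₂, |h ω₁ - h ω₂| ≤ 1 / 2 * ‖ω₁ - ω₂‖) :
    relMeas M {ω ∈ annulus ν M | |dotK k ω + h ω| < δ} ≤
      ENNReal.ofReal (10 * 3 ^ ν * δ / (absK k * M)) := by
  rcases le_or_gt δ 0 with hδ | hδ
  · have : {ω ∈ annulus ν M | |dotK k ω + h ω| < δ} = ∅ := by
      ext ω; simp only [Set.mem_ofPred_eq, Set.mem_empty_iff_false, iff_false, not_and, not_lt]
      exact fun _ => hδ.trans (abs_nonneg _)
    rw [this, relMeas]; simp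
  have hK := one_le_absK hk
  have hK0 : 0 < absK k := by linarith
  set A := {ω ∈ annulus ν M | |dotK k ω + h ω| < δ} with hA
  have hc : Continuous h := by
    have : LipschitzWith (1 / 2) h := LipschitzWith.of_dist_le_mul fun x y => by
      rw [Real.dist_eq, dist_eq_norm]; simpa using hL x y
    exact this.continuous
  have hd : Continuous fun ω : Freq ν => dotK k ω := by unfold dotK; fun_prop
  have hAm : MeasurableSet A := by
    refine MeasurableSet.inter ?_ (measurableSet_lt ((hd.add hc).abs.measurable) measurable_const)
    exact Metric.isClosed_closedBall.measurableSet.diff Metric.isOpen_ball.measurableSet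
  set v : Freq ν := WithLp.toLp 2 fun i => (k i : ℝ) / absK k with hv
  have hvn : ‖v‖ = 1 := by
    have e : ∑ i, (k i : ℝ) ^ 2 = absK k ^ 2 := by
      rw [absK, Real.sq_sqrt (Finset.sum_nonneg fun _ _ => sq_nonneg _)]
    rw [EuclideanSpace.norm_eq]
    simp only [hv, norm_div, Real.norm_eq_abs, div_pow, sq_abs]
    rw [← Finset.sum_div, e, div_self (by positivity), Real.sqrt_one]
  have hdv : ∀ (ω : Freq ν) (x : ℝ), dotK k (ω + x • v : Freq ν) = dotK k ω + x * absK k := by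
    intro ω x
    have e : ∑ i, (k i : ℝ) ^ 2 = absK k * absK k := by
      rw [absK, Real.mul_self_sqrt (Finset.sum_nonneg fun _ _ => sq_nonneg _)]
    have e2 : dotK k v = absK k := by
      have : dotK k v = (∑ i, (k i : ℝ) ^ 2) / absK k := by
        rw [Finset.sum_div, dotK]
        exact Finset.sum_congr rfl fun i _ => by simp only [hv]; ring
      rw [this, e, mul_div_cancel_right₀ _ hK0.ne']
    have : dotK k (ω + x • v : Freq ν) = dotK k ω + x * dotK k v := by
      simp only [dotK, PiLp.add_apply, PiLp.smul_apply, smul_eq_mul]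
      rw [Finset.mul_sum, ← Finset.sum_add_distrib]
      exact Finset.sum_congr rfl fun i _ => by ring
    rw [this, e2]
  have key := volume_le_of_thin hAm (η := 5 * δ / absK k) hM (by positivity)
    (fun ω hω => hω.1.1) hvn fun ω hω x hx => by
      have h1 := hω.2
      have h2 := hx.2
      rw [hdv] at h2
      have h3 := hL (ω + x • v) ω
      rw [add_sub_cancel_left, norm_smul, hvn, mul_one, Real.norm_eq_abs] at h3
      rw [lt_div_iff₀ hK0]
      have h4 : |x * absK k| < 2 * δ + 1 / 2 * |x| := by
        have e : x * absK k = (dotK k ω + x * absK k + h (ω + x • v)) - (dotK k ω + h ω) -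
          (h (ω + x • v) - h ω) := by ring
        rw [e]
        refine (abs_sub _ _).trans_lt ?_
        have := abs_sub (dotK k ω + x * absK k + h (ω + x • v)) (dotK k ω + h ω)
        linarith
      rw [abs_mul, abs_of_pos hK0] at h4
      nlinarith [abs_nonneg x]
  have hV := volume_closedBall_le_annulus hν hM
  rw [relMeas]
  refine ENNReal.div_le_of_le_mul ((key.trans (mul_le_mul' le_rfl hV)).trans (le_of_eq ?_))
  rw [← mul_assoc, ← ENNReal.ofReal_mul (by positivity)]
  congr 2
  field_simp
  ring

end Slabs

section Resonances

variable {ν : ℕ}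

lemma tsum_pnat_ite_le {J : ℝ} (hJ : 0 ≤ J) (x : ℝ≥0∞) :
    (∑' j : ℕ+, if (j : ℝ) ≤ J then x else 0) ≤ ENNReal.ofReal J * x := by
  have h1 := ENNReal.tsum_comp_le_tsum_of_injective (f := PNat.natPred) PNat.natPred_injective
    fun n : ℕ => if ((n + 1 : ℕ) : ℝ) ≤ J then x else 0
  have h2 : (∑' n : ℕ, if ((n + 1 : ℕ) : ℝ) ≤ J then x else 0) ≤ ENNReal.ofReal J * x := by
    rw [tsum_eq_sum (s := Finset.range ⌊J⌋₊)]
    · refine (Finset.sum_le_card_nsmul _ _ x fun n _ => by split_ifs <;> simp).trans ?_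
      rw [Finset.card_range, nsmul_eq_mul]
      gcongr
      rw [← ENNReal.ofReal_natCast]
      exact ENNReal.ofReal_le_ofReal (Nat.floor_le hJ)
    · intro n hn
      rw [if_neg]
      intro h
      exact hn (Finset.mem_range.2 (Nat.lt_of_succ_le (Nat.le_floor h)))
  refine le_trans (le_of_eq (tsum_congr fun j => ?_)) (h1.trans h2)
  rw [PNat.natPred_add_one]

lemma tsum_pr_ite_le {J : ℝ} (hJ : 0 ≤ J) (x : ℝ≥0∞) :
    (∑' a : Pr, if (idx a : ℝ) ≤ J then x else 0) ≤ ENNReal.ofReal (2 * J) * x := by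
  rw [ENNReal.summable.tsum_sum ENNReal.summable, two_mul, ENNReal.ofReal_add hJ hJ, add_mul]
  exact add_le_add (tsum_pnat_ite_le hJ x) (tsum_pnat_ite_le hJ x)

lemma tsum_int_ite_le {H : ℝ} (hH : 1 ≤ H) (x : ℝ≥0∞) :
    (∑' h : ℤ, if |(h : ℝ)| ≤ H then x else 0) ≤ ENNReal.ofReal (3 * H) * x := by
  have h0 : (0 : ℤ) ≤ ⌊H⌋ := Int.floor_nonneg.2 (by linarith)
  rw [tsum_eq_sum (s := Finset.Icc (-⌊H⌋) ⌊H⌋)]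
  · refine (Finset.sum_le_card_nsmul _ _ x fun n _ => by split_ifs <;> simp).trans ?_
    rw [Int.card_Icc, nsmul_eq_mul]
    gcongr
    rw [← ENNReal.ofReal_natCast]
    apply ENNReal.ofReal_le_ofReal
    have e : (((⌊H⌋ + 1 - -⌊H⌋).toNat : ℕ) : ℝ) = 2 * (⌊H⌋ : ℝ) + 1 := by
      have : (((⌊H⌋ + 1 - -⌊H⌋).toNat : ℕ) : ℤ) = 2 * ⌊H⌋ + 1 := by omega
      exact_mod_cast this
    rw [e]
    linarith [Int.floor_le H]
  · intro n hn
    rw [if_neg]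
    intro h
    refine hn (Finset.mem_Icc.2 ?_)
    have h1 := abs_le.1 h
    have h2 : n ≤ ⌊H⌋ := Int.le_floor.2 h1.2
    have h3 : -n ≤ ⌊H⌋ := Int.le_floor.2 (by push_cast; linarith)
    exact ⟨by linarith, h2⟩

lemma bracket_le_two_mul_absK {k : Fin ν → ℤ} (hk : k ≠ 0) :
    bracket (absK k) ≤ 2 * absK k := by
  have h1 := bracket_le_one_add (absK k)
  rw [abs_of_nonneg (absK_nonneg k)] at h1
  linarith [one_le_absK hk]

/-- Frequencies that are resonant for a pair of modes, one of which is small. -/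
def resonant (M c : ℝ) (Λ : Pr → Freq ν → ℝ) (J δ : (Fin ν → ℤ) → ℤ → ℝ) : Set (Freq ν) :=
  {ω ∈ annulus ν M | ∃ k : Fin ν → ℤ, k ≠ 0 ∧ ∃ a b : Pr,
    |((sgMode a - sgMode b : ℤ) : ℝ)| ≤ c * bracket (absK k) * M ∧
    (idx a : ℝ) ≤ J k (sgMode a - sgMode b) ∧
    |dotK k ω + (Λ a ω - Λ b ω)| < δ k (sgMode a - sgMode b)}

lemma exists_relMeas_resonant_le (hν : 1 ≤ ν) {r c : ℝ} (hr : (ν : ℝ) < r) (hc : 1 ≤ c) :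
    ∃ C > 0, ∀ (M B : ℝ) (Λ : Pr → Freq ν → ℝ) (J δ : (Fin ν → ℤ) → ℤ → ℝ), 1 ≤ M → 0 ≤ B →
      (∀ a ω₁ ω₂, |Λ a ω₁ - Λ a ω₂| ≤ 1 / 8 * ‖ω₁ - ω₂‖) → (∀ k h, 0 ≤ J k h) →
      (∀ k, k ≠ 0 → ∀ h : ℤ, |(h : ℝ)| ≤ c * bracket (absK k) * M →
        J k h * δ k h ≤ B * (bracket (absK k) ^ r)⁻¹) →
      relMeas M (resonant M c Λ J δ) ≤ ENNReal.ofReal (C * B) := by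
  have hsum := summable_bracket_rpow hr
  set S := ∑' k : Fin ν → ℤ, (bracket (absK k) ^ r)⁻¹ with hS
  have hS0 : 0 ≤ S := tsum_nonneg fun k => by
    have := bracket_pos (absK k); positivity
  set D : ℝ := 10 * 3 ^ ν with hD
  refine ⟨12 * c * D * S + 1, by positivity, fun M B Λ J δ hM hB hΛ hJ hJδ => ?_⟩
  have hM0 : 0 < M := by linarith
  set x : (Fin ν → ℤ) → ℤ → ℝ≥0∞ := fun k h => ENNReal.ofReal (D * δ k h / (absK k * M)) with hx
  set F : (Fin ν → ℤ) → Pr → ℤ → ℝ≥0∞ := fun k a h =>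
    if k ≠ 0 ∧ |(h : ℝ)| ≤ c * bracket (absK k) * M then
      (if (idx a : ℝ) ≤ J k h then x k h else 0) else 0 with hF
  set A : (Fin ν → ℤ) × Pr × Pr → Set (Freq ν) := fun p => {ω ∈ annulus ν M | (p.1 ≠ 0 ∧
    |((sgMode p.2.1 - sgMode p.2.2 : ℤ) : ℝ)| ≤ c * bracket (absK p.1) * M) ∧
    (idx p.2.1 : ℝ) ≤ J p.1 (sgMode p.2.1 - sgMode p.2.2) ∧
    |dotK p.1 ω + (Λ p.2.1 ω - Λ p.2.2 ω)| < δ p.1 (sgMode p.2.1 - sgMode p.2.2)} with hA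
  have hsub : resonant M c Λ J δ ⊆ ⋃ p, A p := by
    rintro ω ⟨h0, k, hk, a, b, h1, h2, h3⟩
    exact Set.mem_iUnion.2 ⟨(k, a, b), h0, ⟨hk, h1⟩, h2, h3⟩
  have hAle : ∀ p : (Fin ν → ℤ) × Pr × Pr,
      relMeas M (A p) ≤ F p.1 p.2.1 (sgMode p.2.1 - sgMode p.2.2) := by
    rintro ⟨k, a, b⟩
    simp only [hF]
    split_ifs with h1 h2
    · refine (relMeas_mono ?_).trans (relMeas_resonance_le hν hM0 h1.1
        (h := fun ω => Λ a ω - Λ b ω) fun ω₁ ω₂ => ?_)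
      · exact fun ω hω => ⟨hω.1, hω.2.2.2⟩
      · have h3 := hΛ a ω₁ ω₂
        have h4 := hΛ b ω₁ ω₂
        have e : Λ a ω₁ - Λ b ω₁ - (Λ a ω₂ - Λ b ω₂) = (Λ a ω₁ - Λ a ω₂) - (Λ b ω₁ - Λ b ω₂) := by
          ring
        rw [e]
        refine (abs_sub _ _).trans ?_
        linarith [norm_nonneg (ω₁ - ω₂)]
    · refine le_of_eq ?_
      have : A (k, a, b) = ∅ := by
        ext ω; exact ⟨fun h => h2 h.2.2.1, fun h => h.elim⟩
      rw [this, relMeas]; simp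
    · refine le_of_eq ?_
      have : A (k, a, b) = ∅ := by
        ext ω; exact ⟨fun h => h1 h.2.1, fun h => h.elim⟩
      rw [this, relMeas]; simp
  have hk : ∀ k : Fin ν → ℤ, ∑' a : Pr, ∑' b : Pr, F k a (sgMode a - sgMode b) ≤
      ENNReal.ofReal (12 * c * D * B * (bracket (absK k) ^ r)⁻¹) := by
    intro k
    have hb := one_le_bracket (absK k)
    have hb0 := bracket_pos (absK k)
    have h1 : ∑' a : Pr, ∑' b : Pr, F k a (sgMode a - sgMode b) ≤ ∑' a : Pr, ∑' h : ℤ, F k a h :=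
      ENNReal.tsum_le_tsum fun a => ENNReal.tsum_comp_le_tsum_of_injective
        (f := fun b => sgMode a - sgMode b)
        (fun b b' h => sgMode_injective (sub_right_injective h)) (F k a)
    refine h1.trans ?_
    rw [ENNReal.tsum_comm]
    by_cases hk0 : k = 0
    · simp [hF, hk0]
    have hK := one_le_absK hk0
    have hK0 : 0 < absK k := by linarith
    have h2 : ∀ h : ℤ, ∑' a : Pr, F k a h ≤ if |(h : ℝ)| ≤ c * bracket (absK k) * M then
        ENNReal.ofReal (2 * D * (B * (bracket (absK k) ^ r)⁻¹) / (absK k * M)) else 0 := by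
      intro h
      simp only [hF]
      split_ifs with h3 h4 h4
      · refine (tsum_pr_ite_le (hJ k h) _).trans ?_
        rw [hx, ← ENNReal.ofReal_mul (by have := hJ k h; positivity)]
        apply ENNReal.ofReal_le_ofReal
        calc 2 * J k h * (D * δ k h / (absK k * M)) = 2 * D * (J k h * δ k h) / (absK k * M) := by
              ring
          _ ≤ _ := div_le_div_of_nonneg_right
            (mul_le_mul_of_nonneg_left (hJδ k hk0 h h4) (by positivity)) (by positivity)
      · exact absurd h3.2 h4
      · exact absurd ⟨hk0, h4⟩ h3
      · simp
    refine (ENNReal.tsum_le_tsum h2).trans ?_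
    have hH : 1 ≤ c * bracket (absK k) * M := by
      calc (1 : ℝ) = 1 * 1 * 1 := by norm_num
        _ ≤ _ := by gcongr
    refine (tsum_int_ite_le hH _).trans ?_
    rw [← ENNReal.ofReal_mul (by positivity)]
    apply ENNReal.ofReal_le_ofReal
    have h5 := bracket_le_two_mul_absK hk0
    calc 3 * (c * bracket (absK k) * M) * (2 * D * (B * (bracket (absK k) ^ r)⁻¹) / (absK k * M)) =
          6 * c * D * B * (bracket (absK k) ^ r)⁻¹ * (bracket (absK k) / absK k) := by
          field_simp; ring
      _ ≤ 6 * c * D * B * (bracket (absK k) ^ r)⁻¹ * 2 := by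
        gcongr
        rwa [div_le_iff₀ hK0]
      _ = _ := by ring
  calc relMeas M (resonant M c Λ J δ) ≤ ∑' p, relMeas M (A p) :=
        (relMeas_mono hsub).trans (relMeas_iUnion_le A)
    _ ≤ ∑' p : (Fin ν → ℤ) × Pr × Pr, F p.1 p.2.1 (sgMode p.2.1 - sgMode p.2.2) :=
        ENNReal.tsum_le_tsum hAle
    _ = ∑' k, ∑' a : Pr, ∑' b : Pr, F k a (sgMode a - sgMode b) := by
        rw [ENNReal.tsum_prod']
        exact tsum_congr fun k => ENNReal.tsum_prod' (f := fun q : Pr × Pr => F k q.1 (sgMode q.1 - sgMode q.2))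
    _ ≤ ∑' k : Fin ν → ℤ, ENNReal.ofReal (12 * c * D * B * (bracket (absK k) ^ r)⁻¹) :=
        ENNReal.tsum_le_tsum hk
    _ = ENNReal.ofReal (12 * c * D * B * S) := by
        rw [← ENNReal.ofReal_tsum_of_nonneg (fun k => ?_) (hsum.mul_left _), tsum_mul_left]
        have := bracket_pos (absK k)
        positivity
    _ ≤ _ := by
        apply ENNReal.ofReal_le_ofReal
        calc 12 * c * D * B * S = 12 * c * D * S * B := by ring
          _ ≤ _ := by gcongr; linarith

end Resonances

section Spectrum

variable {ν : ℕ} {mass : ℝ}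

lemma exists_sgMode_eq {n : ℤ} (hn : n ≠ 0) : ∃ b : Pr, sgMode b = n := by
  rcases lt_or_gt_of_ne hn with h | h
  · refine ⟨Sum.inr ⟨n.natAbs, Int.natAbs_pos.2 hn⟩, ?_⟩
    change -((n.natAbs : ℕ) : ℤ) = n
    omega
  · refine ⟨Sum.inl ⟨n.natAbs, Int.natAbs_pos.2 hn⟩, ?_⟩
    change ((n.natAbs : ℕ) : ℤ) = n
    omega

lemma exists_sgMode_sub_eq (h : ℤ) : ∃ a b : Pr, idx a = 1 ∧ sgMode a - sgMode b = h := by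
  rcases eq_or_ne h 1 with rfl | hne
  · obtain ⟨b, hb⟩ := exists_sgMode_eq (n := -2) (by norm_num)
    refine ⟨Sum.inr 1, b, rfl, ?_⟩
    rw [hb]; simp [sgMode]
  · obtain ⟨b, hb⟩ := exists_sgMode_eq (n := 1 - h) (by omega)
    refine ⟨Sum.inl 1, b, rfl, ?_⟩
    rw [hb]; simp [sgMode]

lemma abs_sgE_sub_le {f g : ℕ+ → ℝ} (a : Pr) : |sgE f a - sgE g a| ≤ |f (idx a) - g (idx a)| := by
  rcases a with j | j
  · exact le_rfl
  · simp only [sgE, idx, Sum.elim_inr, id]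
    rw [neg_sub_neg, abs_sub_comm]

lemma freq0_le (hm : 0 ≤ mass) (j : ℕ+) : freq0 mass j ≤ (1 + mass) * j := by
  have hj := one_le_coe j
  rw [freq0]
  refine Real.sqrt_le_iff.2 ⟨by positivity, ?_⟩
  nlinarith [mul_nonneg hm (sub_nonneg.2 hj), mul_nonneg hm hm, mul_nonneg (mul_nonneg hm hm)
    (sub_nonneg.2 (one_le_pow₀ (n := 2) hj)), mul_nonneg hm (sq_nonneg (j : ℝ))]

lemma abs_sgMode_sub_le (hm : 0 ≤ mass) (a b : Pr) : |((sgMode a - sgMode b : ℤ) : ℝ)| ≤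
    (1 + mass) * |sgE (freq0 mass) a - sgE (freq0 mass) b| := by
  have key : ∀ j l : ℕ+, |(j : ℝ) - l| ≤ (1 + mass) * |freq0 mass j - freq0 mass l| := by
    intro j l
    have ej : freq0 mass j ^ 2 = (j : ℝ) ^ 2 + mass ^ 2 := Real.sq_sqrt (by positivity)
    have el : freq0 mass l ^ 2 = (l : ℝ) ^ 2 + mass ^ 2 := Real.sq_sqrt (by positivity)
    have h1 := freq0_le hm j
    have h2 := freq0_le hm l
    have hjl : (0 : ℝ) < j + l := by linarith [one_le_coe j, one_le_coe l]
    have h3 : |freq0 mass j - freq0 mass l| * (freq0 mass j + freq0 mass l) =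
        |(j : ℝ) - l| * (j + l) := by
      have e : (freq0 mass j - freq0 mass l) * (freq0 mass j + freq0 mass l) =
          ((j : ℝ) - l) * (j + l) := by nlinarith
      have e' := congrArg abs e
      rwa [abs_mul, abs_mul, abs_of_pos hjl, abs_of_pos (show 0 < freq0 mass j + freq0 mass l by
        linarith [one_le_freq0 mass j, one_le_freq0 mass l])] at e'
    have h4 : |freq0 mass j - freq0 mass l| * (freq0 mass j + freq0 mass l) ≤
        |freq0 mass j - freq0 mass l| * ((1 + mass) * (j + l)) :=
      mul_le_mul_of_nonneg_left (by linarith) (abs_nonneg _)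
    refine le_of_mul_le_mul_right ?_ hjl
    linarith
  have key' : ∀ j l : ℕ+, |(j : ℝ) + l| ≤ (1 + mass) * |freq0 mass j + freq0 mass l| := by
    intro j l
    have h1 := freq0_ge mass j
    have h2 := freq0_ge mass l
    have h3 := one_le_coe j
    have h4 := one_le_coe l
    rw [abs_of_pos (by linarith), abs_of_pos (by linarith)]
    nlinarith
  rcases a with j | j <;> rcases b with l | l <;>
    simp only [sgMode, sgE, Sum.elim_inl, Sum.elim_inr] <;> push_cast
  · exact key j l
  · simpa using key' j l
  · rw [← abs_neg, ← abs_neg (-_ - _), neg_sub, neg_sub, sub_neg_eq_add, sub_neg_eq_add, add_comm,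
      add_comm (freq0 mass l)]
    exact key' j l
  · rw [neg_sub_neg, neg_sub_neg]
    exact key l j

lemma abs_sgE_sub_sgMode_le (a : Pr) :
    |sgE (freq0 mass) a - sgMode a| ≤ mass ^ 2 / (2 * idx a) := by
  have key : ∀ j : ℕ+, |freq0 mass j - j| ≤ mass ^ 2 / (2 * j) := by
    intro j
    have h1 := freq0_ge mass j
    have h2 := one_le_coe j
    have ej : freq0 mass j ^ 2 = (j : ℝ) ^ 2 + mass ^ 2 := Real.sq_sqrt (by positivity)
    rw [abs_of_nonneg (by linarith), le_div_iff₀ (by positivity)]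
    nlinarith
  rcases a with j | j
  · simpa [sgE, sgMode, idx] using key j
  · have := key j
    rw [abs_sub_comm] at this
    simpa [sgE, sgMode, idx, neg_add_eq_sub] using this

/-- The right hand side of the Melnikov conditions. -/
def melThr (g t α M : ℝ) (k : Fin ν → ℤ) (h : ℤ) : ℝ :=
  g / bracket (absK k) ^ t * (bracket (h : ℝ) ^ α / M ^ α)

lemma melThr_neg (g t α M : ℝ) (k : Fin ν → ℤ) (h : ℤ) :
    melThr g t α M (-k) (-h) = melThr g t α M k h := by
  simp [melThr, absK_neg, bracket]

lemma melnikov_of_not_resonant {M μ α g t : ℝ} {f : ℕ+ → ℝ} {ω : Freq ν} {Λ : Pr → Freq ν → ℝ}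
    {J : (Fin ν → ℤ) → ℤ → ℝ} (hM : 0 < M) (hμ : 1 ≤ μ) (hα0 : 0 ≤ α) (hα1 : α ≤ 1) (hg0 : 0 ≤ g)
    (hg : g ≤ 1) (ht : 0 ≤ t) (hMμ : 8 * μ ≤ M ^ α) (hω : ω ∈ annulus ν M)
    (hgap : ∀ a b, |((sgMode a - sgMode b : ℤ) : ℝ)| ≤ 2 * μ * |sgE f a - sgE f b|)
    (hΛ : ∀ a, Λ a ω = sgE f a) (hJ : ∀ k h, J (-k) (-h) = J k h)
    (hres : ω ∉ resonant M (8 * μ) Λ J (melThr g t α M))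
    (hrest : ∀ k, k ≠ 0 → ∀ a b : Pr, J k (sgMode a - sgMode b) < idx a →
      J k (sgMode a - sgMode b) < idx b →
      |((sgMode a - sgMode b : ℤ) : ℝ)| ≤ 8 * μ * bracket (absK k) * M →
      melThr g t α M k (sgMode a - sgMode b) ≤ |dotK k ω + (sgE f a - sgE f b)|) :
    Melnikov g t α M f ω := by
  rw [melnikov_iff]
  intro k a b hab
  change melThr g t α M k (sgMode a - sgMode b) ≤ _
  set h := sgMode a - sgMode b with hh
  have hb := one_le_bracket (absK k)
  by_cases hfar : k = 0 ∨ 8 * μ * bracket (absK k) * M < |(h : ℝ)|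
  · have hh1 : (1 : ℝ) ≤ |(h : ℝ)| := by
      have : h ≠ 0 := by
        rintro h0
        rcases hfar with hk | hfar
        · exact hab ⟨hk, sgMode_injective (sub_eq_zero.1 h0)⟩
        · rw [h0, Int.cast_zero, abs_zero] at hfar
          exact absurd hfar (not_lt.2 (by positivity))
      exact_mod_cast Int.one_le_abs this
    have h1 : melThr g t α M k h ≤ |(h : ℝ)| / (4 * μ) := by
      have h2 : g / bracket (absK k) ^ t ≤ 1 := by
        rw [div_le_one (by positivity)]
        exact hg.trans (Real.one_le_rpow hb ht)
      have h3 : bracket (h : ℝ) ^ α ≤ 2 * |(h : ℝ)| := by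
        calc bracket (h : ℝ) ^ α ≤ bracket (h : ℝ) ^ (1 : ℝ) :=
              Real.rpow_le_rpow_of_exponent_le (one_le_bracket _) hα1
          _ ≤ 2 * |(h : ℝ)| := by
              rw [Real.rpow_one]; linarith [bracket_le_one_add (h : ℝ)]
      have hb2 := bracket_pos (h : ℝ)
      calc melThr g t α M k h ≤ 1 * (2 * |(h : ℝ)| / (8 * μ)) := by
            unfold melThr; gcongr
        _ = _ := by field_simp; norm_num
    have h4 : |dotK k ω| ≤ |(h : ℝ)| / (4 * μ) := by
      rcases hfar with hk | hfar
      · rw [hk, dotK_zero, abs_zero]; positivity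
      · have h5 := abs_dotK_le k ω
        have h6 : ‖ω‖ ≤ 2 * M := mem_closedBall_zero_iff.1 hω.1
        have h7 := (le_abs_self _).trans (abs_le_bracket (absK k))
        rw [le_div_iff₀ (by positivity)]
        calc |dotK k ω| * (4 * μ) ≤ absK k * ‖ω‖ * (4 * μ) := by gcongr
          _ ≤ bracket (absK k) * (2 * M) * (4 * μ) := by gcongr
          _ = 8 * μ * bracket (absK k) * M := by ring
          _ ≤ _ := hfar.le
    have h8 : |(h : ℝ)| / (2 * μ) ≤ |sgE f a - sgE f b| := by
      rw [div_le_iff₀ (by positivity), mul_comm]; exact hgap a b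
    have h9 : |(h : ℝ)| / (2 * μ) = |(h : ℝ)| / (4 * μ) + |(h : ℝ)| / (4 * μ) := by
      field_simp; norm_num
    have h10 := abs_sub_abs_le_abs_sub (sgE f a - sgE f b) (-dotK k ω)
    rw [abs_neg, sub_neg_eq_add, add_comm _ (dotK k ω)] at h10
    linarith
  · push Not at hfar
    obtain ⟨hk, hle⟩ := hfar
    by_cases ha : (idx a : ℝ) ≤ J k h
    · by_contra hcon
      push Not at hcon
      exact hres ⟨hω, k, hk, a, b, hle, ha, by rw [hΛ, hΛ]; exact hcon⟩
    by_cases hb' : (idx b : ℝ) ≤ J k h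
    · by_contra hcon
      push Not at hcon
      have e : sgMode b - sgMode a = -h := by rw [hh]; ring
      refine hres ⟨hω, -k, neg_ne_zero.2 hk, b, a, ?_, ?_, ?_⟩
      · rw [e, absK_neg]; push_cast; rw [abs_neg]; exact hle
      · rw [e, hJ]; exact hb'
      · rw [e, melThr_neg, hΛ, hΛ, dotK_neg, ← abs_neg]
        refine lt_of_eq_of_lt (congrArg _ (by ring)) hcon
    · exact hrest k hk a b (not_le.1 ha) (not_le.1 hb') hle

/-- The Melnikov conditions for the unperturbed eigenvalues, off two resonant sets. -/
lemma melnikov_freq0 {M α g t : ℝ} {ω : Freq ν} (hm : 0 ≤ mass) (hM : 0 < M) (hα0 : 0 ≤ α)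
    (hα1 : α ≤ 1) (hg0 : 0 < g) (hg : g ≤ 1 / 2) (ht : (ν : ℝ) + 1 ≤ t)
    (hMμ : 8 * (1 + mass) ≤ M ^ α) (hω : ω ∈ annulus ν M)
    (h1 : ω ∉ resonant M (8 * (1 + mass)) (fun a _ => (sgMode a : ℝ)) (fun _ _ => 1)
      (melThr g (ν + 1) α M))
    (h2 : ω ∉ resonant M (8 * (1 + mass)) (fun a _ => sgE (freq0 mass) a)
      (fun k h => 2 * mass ^ 2 / melThr g (ν + 1) α M k h) (melThr (g ^ 2) t α M)) :
    Melnikov (g ^ 2) t α M (freq0 mass) ω := by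
  have hthr : ∀ (k : Fin ν → ℤ) (h : ℤ), 0 < melThr g (ν + 1) α M k h := fun k h => by
    have := bracket_pos (absK k); have := bracket_pos (h : ℝ)
    unfold melThr; positivity
  refine melnikov_of_not_resonant hM (by linarith) hα0 hα1 (by positivity) (by nlinarith)
    (by have : (0 : ℝ) ≤ ν := by positivity
        linarith) hMμ hω (fun a b => ?_) (fun _ => rfl)
    (fun k h => by rw [melThr_neg]) h2 fun k hk a b ha hb hle => ?_
  · refine (abs_sgMode_sub_le hm a b).trans ?_
    have := abs_nonneg (sgE (freq0 mass) a - sgE (freq0 mass) b)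
    nlinarith
  set h := sgMode a - sgMode b with hh
  set δ := melThr g (ν + 1) α M k h with hδ
  have hδ0 : 0 < δ := hthr k h
  have h3 : δ ≤ |dotK k ω + h| := by
    obtain ⟨a', b', ha', hab'⟩ := exists_sgMode_sub_eq h
    by_contra hcon
    push Not at hcon
    refine h1 ⟨hω, k, hk, a', b', ?_, ?_, ?_⟩
    · rw [hab']; exact hle
    · rw [ha']; simp
    · rw [hab']
      refine lt_of_eq_of_lt (congrArg _ ?_) hcon
      rw [← hab']; push_cast; ring
  have hsmall : ∀ c : Pr, 2 * mass ^ 2 / δ < idx c → mass ^ 2 / (2 * idx c) ≤ δ / 4 := by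
    intro c hc
    have := one_le_coe (idx c)
    rw [div_lt_iff₀ hδ0] at hc
    rw [div_le_div_iff₀ (by positivity) (by norm_num)]
    linarith
  have h4 := (abs_sgE_sub_sgMode_le (mass := mass) a).trans (hsmall a ha)
  have h5 := (abs_sgE_sub_sgMode_le (mass := mass) b).trans (hsmall b hb)
  have h6 : melThr (g ^ 2) t α M k h ≤ δ / 2 := by
    have hb1 := one_le_bracket (absK k)
    have hb2 := bracket_pos (h : ℝ)
    have e : δ / 2 = g / 2 / bracket (absK k) ^ ((ν : ℝ) + 1) * (bracket (h : ℝ) ^ α / M ^ α) := by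
      rw [hδ, melThr]; ring
    rw [e, melThr]
    gcongr
    nlinarith
  have h7 : |dotK k ω + h| ≤ |dotK k ω + (sgE (freq0 mass) a - sgE (freq0 mass) b)| +
      (|sgE (freq0 mass) a - sgMode a| + |sgE (freq0 mass) b - sgMode b|) := by
    have e : dotK k ω + (h : ℝ) = dotK k ω + (sgE (freq0 mass) a - sgE (freq0 mass) b) -
        ((sgE (freq0 mass) a - sgMode a) - (sgE (freq0 mass) b - sgMode b)) := by
      rw [hh]; push_cast; ring
    rw [e]
    refine (abs_sub _ _).trans ?_
    gcongr
    exact abs_sub _ _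
  linarith

/-- The Melnikov conditions for the final eigenvalues, off a resonant set. -/
lemma melnikov_perturbed {M α g g' t t' : ℝ} {ω : Freq ν} {f : ℕ+ → ℝ} {Λ : Pr → Freq ν → ℝ}
    (hm : 0 ≤ mass) (hM : 0 < M) (hα0 : 0 < α) (hα1 : α ≤ 1) (hg0 : 0 < g) (hgg : g ≤ g')
    (hg : g ≤ 1) (ht0 : 0 ≤ t') (ht : t' + 1 ≤ t)
    (hMμ : 8 * (1 + mass) ≤ M ^ α) (hω : ω ∈ annulus ν M)
    (hf : ∀ j, |f j - freq0 mass j| ≤ 1 / 8 * (g / M ^ α) / bracket j ^ α)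
    (h0 : Melnikov g' t' α M (freq0 mass) ω) (hΛ : ∀ a, Λ a ω = sgE f a)
    (h1 : ω ∉ resonant M (8 * (1 + mass)) Λ (fun k _ => bracket (absK k) ^ (t' / α))
      (melThr g t α M)) :
    Melnikov g t α M f ω := by
  have hMα : 0 < M ^ α := by positivity
  set κ := g / M ^ α with hκ
  have hκ0 : 0 < κ := by positivity
  have hκμ : κ * (8 * (1 + mass)) ≤ 1 := by
    calc κ * (8 * (1 + mass)) ≤ κ * M ^ α := by gcongr
      _ = g := div_mul_cancel₀ _ hMα.ne'
      _ ≤ 1 := hg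
  have hd : ∀ a, |sgE f a - sgE (freq0 mass) a| ≤ 1 / 8 * κ / bracket (idx a : ℝ) ^ α := fun a =>
    (abs_sgE_sub_le a).trans (hf _)
  have htri : ∀ (z : ℝ) (a b : Pr), |z + (sgE (freq0 mass) a - sgE (freq0 mass) b)| ≤
      |z + (sgE f a - sgE f b)| +
      (|sgE f a - sgE (freq0 mass) a| + |sgE f b - sgE (freq0 mass) b|) := fun z a b => by
    have e : z + (sgE (freq0 mass) a - sgE (freq0 mass) b) = z + (sgE f a - sgE f b) -
        ((sgE f a - sgE (freq0 mass) a) - (sgE f b - sgE (freq0 mass) b)) := by ring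
    rw [e]
    refine (abs_sub _ _).trans ?_
    gcongr
    exact abs_sub _ _
  refine melnikov_of_not_resonant hM (by linarith) hα0.le hα1 hg0.le hg (by linarith) hMμ hω
    (fun a b => ?_) hΛ (fun k h => by rw [absK_neg]) h1 fun k hk a b ha hb hle => ?_
  · have h2 := abs_sgMode_sub_le hm a b
    have h3 := htri 0 a b
    rw [zero_add, zero_add] at h3
    have h4 : ∀ c, |sgE f c - sgE (freq0 mass) c| ≤ 1 / 8 * κ := fun c =>
      (hd c).trans (div_le_self (by positivity) (Real.one_le_rpow (one_le_bracket _) hα0.le))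
    rcases eq_or_ne (sgMode a - sgMode b) 0 with hz | hz
    · rw [hz]; simp only [Int.cast_zero, abs_zero]; positivity
    · have h5 : (1 : ℝ) ≤ |((sgMode a - sgMode b : ℤ) : ℝ)| := by
        exact_mod_cast Int.one_le_abs hz
      have h6 : |sgE (freq0 mass) a - sgE (freq0 mass) b| ≤ |sgE f a - sgE f b| + κ / 4 := by
        linarith [h4 a, h4 b]
      have h7 : (1 + mass) * |sgE (freq0 mass) a - sgE (freq0 mass) b| ≤
          (1 + mass) * (|sgE f a - sgE f b| + κ / 4) := by gcongr
      nlinarith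
  · set h := sgMode a - sgMode b with hh
    have hb1 := one_le_bracket (absK k)
    have hb0 := bracket_pos (absK k)
    have hh1 := one_le_bracket (h : ℝ)
    have hbig : ∀ c : Pr, bracket (absK k) ^ (t' / α) < idx c →
        |sgE f c - sgE (freq0 mass) c| ≤ 1 / 8 * (κ / bracket (absK k) ^ t') := by
      intro c hc
      refine (hd c).trans ?_
      rw [mul_div_assoc]
      have h2 : bracket (absK k) ^ t' ≤ bracket (idx c : ℝ) ^ α := by
        calc bracket (absK k) ^ t' = (bracket (absK k) ^ (t' / α)) ^ α := by
              rw [← Real.rpow_mul hb0.le, div_mul_cancel₀ _ hα0.ne']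
          _ ≤ bracket (idx c : ℝ) ^ α := by
              gcongr
              exact hc.le.trans ((le_abs_self _).trans (abs_le_bracket _))
      gcongr
    have h3 := melnikov_iff.1 h0 k a b fun hc => hk hc.1
    have h4 := htri (dotK k ω) a b
    have h5 := hbig a ha
    have h6 := hbig b hb
    set u := κ / bracket (absK k) ^ t' with hu
    have hu0 : 0 < u := by positivity
    set w := bracket (h : ℝ) ^ α with hw
    have hw1 : 1 ≤ w := Real.one_le_rpow hh1 hα0.le
    have h7 : u * w ≤ g' / bracket (absK k) ^ t' * (w / M ^ α) := by
      calc u * w = g / bracket (absK k) ^ t' * (w / M ^ α) := by rw [hu, hκ]; ring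
        _ ≤ _ := by gcongr
    have h8 : melThr g t α M k h ≤ 3 / 4 * (u * w) := by
      have hK : 4 / 3 ≤ bracket (absK k) := by
        have := one_le_absK hk
        rw [bracket]
        exact Real.le_sqrt_of_sq_le (by nlinarith)
      have h9 : bracket (absK k) ^ t' * (4 / 3) ≤ bracket (absK k) ^ t := by
        calc bracket (absK k) ^ t' * (4 / 3) ≤ bracket (absK k) ^ t' * bracket (absK k) := by gcongr
          _ = bracket (absK k) ^ (t' + 1) := by rw [Real.rpow_add_one hb0.ne']
          _ ≤ _ := Real.rpow_le_rpow_of_exponent_le hb1 ht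
      calc melThr g t α M k h = g / bracket (absK k) ^ t * (w / M ^ α) := rfl
        _ ≤ g / (bracket (absK k) ^ t' * (4 / 3)) * (w / M ^ α) := by gcongr
        _ = _ := by rw [hu, hκ]; field_simp
    have h10 : u ≤ u * w := le_mul_of_one_le_right hu0.le hw1
    linarith

end Spectrum

section MeasureEstimate

variable {ν : ℕ}

lemma exists_relMeas_compl_Omega0_le (hν : 1 ≤ ν) {τ₀ : ℝ} (hτ₀ : (ν : ℝ) - 1 < τ₀) :
    ∃ C > 0, ∀ γ₀ M : ℝ, 0 ≤ γ₀ → 0 < M →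
      relMeas M (annulus ν M \ Omega0 ν γ₀ τ₀ M) ≤ ENNReal.ofReal (C * γ₀) := by
  have hsum := summable_bracket_rpow (ν := ν) (r := τ₀ + 1) (by linarith)
  set S := ∑' k : Fin ν → ℤ, (bracket (absK k) ^ (τ₀ + 1))⁻¹ with hS
  have hS0 : 0 ≤ S := tsum_nonneg fun k => by
    have := bracket_pos (absK k); positivity
  refine ⟨20 * 3 ^ ν * S + 1, by positivity, fun γ₀ M hγ₀ hM => ?_⟩
  have hsub : annulus ν M \ Omega0 ν γ₀ τ₀ M ⊆ ⋃ k : Fin ν → ℤ, {ω ∈ annulus ν M | k ≠ 0 ∧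
      |dotK k ω + 0| < γ₀ / bracket (absK k) ^ τ₀ * M} := by
    rintro ω ⟨h1, h2⟩
    by_contra hcon
    refine h2 ⟨h1, fun k hk => ?_⟩
    by_contra h3
    exact hcon (Set.mem_iUnion.2 ⟨k, h1, hk, by rw [add_zero]; exact not_le.1 h3⟩)
  refine (relMeas_mono hsub).trans ((relMeas_iUnion_le _).trans ?_)
  have hk : ∀ k : Fin ν → ℤ, relMeas M {ω ∈ annulus ν M | k ≠ 0 ∧
      |dotK k ω + 0| < γ₀ / bracket (absK k) ^ τ₀ * M} ≤
      ENNReal.ofReal (20 * 3 ^ ν * γ₀ * (bracket (absK k) ^ (τ₀ + 1))⁻¹) := by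
    intro k
    by_cases hk0 : k = 0
    · have : {ω ∈ annulus ν M | k ≠ 0 ∧
          |dotK k ω + 0| < γ₀ / bracket (absK k) ^ τ₀ * M} = ∅ := by
        ext ω; exact ⟨fun h => h.2.1 hk0, fun h => h.elim⟩
      rw [this, relMeas]; simp
    have hb := bracket_pos (absK k)
    have hK0 : 0 < absK k := by linarith [one_le_absK hk0]
    have h5 := bracket_le_two_mul_absK hk0
    refine (relMeas_mono ?_).trans ((relMeas_resonance_le hν hM hk0 (h := fun _ => 0)
      (δ := γ₀ / bracket (absK k) ^ τ₀ * M) fun ω₁ ω₂ => ?_).trans ?_)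
    · exact fun ω hω => ⟨hω.1, hω.2.2⟩
    · simp
    · apply ENNReal.ofReal_le_ofReal
      rw [Real.rpow_add_one hb.ne']
      calc 10 * 3 ^ ν * (γ₀ / bracket (absK k) ^ τ₀ * M) / (absK k * M) =
            20 * 3 ^ ν * γ₀ * (bracket (absK k) ^ τ₀ * (2 * absK k))⁻¹ := by field_simp; ring
        _ ≤ _ := by gcongr
  refine (ENNReal.tsum_le_tsum hk).trans ?_
  rw [← ENNReal.ofReal_tsum_of_nonneg (fun k => ?_) (hsum.mul_left _), tsum_mul_left]
  · apply ENNReal.ofReal_le_ofReal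
    calc 20 * 3 ^ ν * γ₀ * S = 20 * 3 ^ ν * S * γ₀ := by ring
      _ ≤ _ := by gcongr; linarith
  · have := bracket_pos (absK k)
    positivity

lemma bracket_rpow_div_le_of_le {M c α : ℝ} (hM : 1 ≤ M) (hc : 1 ≤ c) (hα0 : 0 ≤ α) (hα1 : α ≤ 1)
    {k : Fin ν → ℤ} {h : ℤ} (hh : |(h : ℝ)| ≤ c * bracket (absK k) * M) :
    bracket (h : ℝ) ^ α / M ^ α ≤ 2 * c * bracket (absK k) ^ α := by
  have hb := one_le_bracket (absK k)
  have hb0 := bracket_pos (absK k)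
  have hM0 : 0 < M := by linarith
  have h1 : bracket (h : ℝ) ≤ 2 * c * bracket (absK k) * M := by
    have h2 : 1 ≤ c * bracket (absK k) * M := by
      calc (1 : ℝ) = 1 * 1 * 1 := by norm_num
        _ ≤ _ := by gcongr
    linarith [bracket_le_one_add (h : ℝ)]
  have hp := bracket_pos (h : ℝ)
  rw [div_le_iff₀ (by positivity)]
  calc bracket (h : ℝ) ^ α ≤ (2 * c * bracket (absK k) * M) ^ α := by gcongr
    _ = (2 * c) ^ α * bracket (absK k) ^ α * M ^ α := by
      rw [Real.mul_rpow (by positivity) hM0.le, Real.mul_rpow (by positivity) hb0.le]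
    _ ≤ (2 * c) ^ (1 : ℝ) * bracket (absK k) ^ α * M ^ α := by
      gcongr
      linarith
    _ = _ := by rw [Real.rpow_one]

/-- Measure of the set of frequencies removed. -/
theorem exists_relMeas_compl_OmegaInf_le (hν : 1 ≤ ν) {mass α τ₀ τt τ : ℝ} (hm : 0 ≤ mass)
    (hα0 : 0 < α) (hα1 : α < 1) (hτ₀ : (ν : ℝ) - 1 < τ₀) (hτt : 2 * (ν : ℝ) + 3 ≤ τt)
    (hτ : (ν : ℝ) + 1 + α + τt / α < τ) :
    ∃ C > 0, ∀ (γ γ₀ γt M : ℝ) (lam : ℕ+ → Freq ν → ℝ), 0 < γ → γ < γt → γt ≤ 1 / 8 → 0 < γ₀ →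
      1 ≤ M → 8 * (1 + mass) ≤ M ^ α →
      (∀ j ω₁ ω₂, |lam j ω₁ - lam j ω₂| ≤ 1 / 8 * ‖ω₁ - ω₂‖) →
      (∀ j, ∀ ω ∈ Omega0 ν γ₀ τ₀ M,
        |lam j ω - freq0 mass j| ≤ 1 / 8 * (γ / M ^ α) / bracket j ^ α) →
      relMeas M (annulus ν M \ OmegaInf ν mass γ₀ τ₀ γt τt γ τ α M lam) ≤
        ENNReal.ofReal (C * (γ + γt ^ (1 / 3 : ℝ) + γ₀)) := by
  set c := 8 * (1 + mass) with hc
  have hc1 : 1 ≤ c := by rw [hc]; linarith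
  have hν0 : (0 : ℝ) ≤ ν := by positivity
  have hτα : τt ≤ τt / α := by
    rw [le_div_iff₀ hα0]; nlinarith
  obtain ⟨C₀, hC₀, h₀⟩ := exists_relMeas_compl_Omega0_le hν hτ₀
  obtain ⟨C₁, hC₁, h₁⟩ := exists_relMeas_resonant_le hν
    (show (ν : ℝ) < ν + 1 - α by linarith) hc1
  obtain ⟨C₂, hC₂, h₂⟩ := exists_relMeas_resonant_le hν
    (show (ν : ℝ) < τt - (ν + 1) by linarith) hc1
  obtain ⟨C₃, hC₃, h₃⟩ := exists_relMeas_resonant_le hν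
    (show (ν : ℝ) < τ - (α + τt / α) by linarith) hc1
  refine ⟨C₀ + C₁ * (2 * c) + C₂ * (2 * mass ^ 2) + C₃ * (2 * c), by positivity,
    fun γ γ₀ γt M lam hγ hγγ hγt hγ₀ hM hMμ hlip hf => ?_⟩
  have hM0 : 0 < M := by linarith
  have hγt0 : 0 < γt := hγ.trans hγγ
  set g := Real.sqrt γt with hg
  have hg0 : 0 < g := Real.sqrt_pos.2 hγt0
  have hg2 : g ^ 2 = γt := Real.sq_sqrt hγt0.le
  have hg1 : g ≤ 1 / 2 := by
    by_contra hcon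
    push Not at hcon
    nlinarith
  have hg3 : g ≤ γt ^ (1 / 3 : ℝ) := by
    rw [hg, Real.sqrt_eq_rpow]
    exact Real.rpow_le_rpow_of_exponent_ge hγt0 (by linarith) (by norm_num)
  set Λ : Pr → Freq ν → ℝ := fun a ω => sgE (fun j => lam j ω) a with hΛ
  set R₁ := resonant M c (fun a (_ : Freq ν) => (sgMode a : ℝ)) (fun _ _ => 1)
    (melThr g (ν + 1) α M) with hR₁
  set R₂ := resonant M c (fun a (_ : Freq ν) => sgE (freq0 mass) a)
    (fun k h => 2 * mass ^ 2 / melThr g (ν + 1) α M k h) (melThr (g ^ 2) τt α M) with hR₂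
  set R₃ := resonant M c Λ (fun k _ => bracket (absK k) ^ (τt / α)) (melThr γ τ α M) with hR₃
  have hsub : annulus ν M \ OmegaInf ν mass γ₀ τ₀ γt τt γ τ α M lam ⊆
      (annulus ν M \ Omega0 ν γ₀ τ₀ M) ∪ (R₁ ∪ (R₂ ∪ R₃)) := by
    rintro ω ⟨hω, hn⟩
    by_contra hcon
    simp only [Set.mem_union, not_or] at hcon
    obtain ⟨n0, n1, n2, n3⟩ := hcon
    have hω0 : ω ∈ Omega0 ν γ₀ τ₀ M := by
      by_contra h; exact n0 ⟨hω, h⟩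
    have hmel := melnikov_freq0 hm hM0 hα0.le hα1.le hg0 hg1 (by linarith) hMμ hω n1 n2
    rw [hg2] at hmel
    exact hn ⟨⟨hω0, hmel⟩, melnikov_perturbed hm hM0 hα0 hα1.le hγ hγγ.le (by linarith)
      (by linarith) (by linarith) hMμ hω (fun j => hf j ω hω0) hmel (fun _ => rfl) n3⟩
  have b₁ : relMeas M R₁ ≤ ENNReal.ofReal (C₁ * (2 * c * g)) := by
    refine h₁ M _ _ _ _ hM (by positivity) (fun a ω₁ ω₂ => by simp) (fun _ _ => zero_le_one)
      fun k hk h hh => ?_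
    have hb := bracket_pos (absK k)
    have := bracket_rpow_div_le_of_le hM hc1 hα0.le hα1.le hh
    rw [one_mul, melThr]
    calc g / bracket (absK k) ^ ((ν : ℝ) + 1) * (bracket (h : ℝ) ^ α / M ^ α) ≤
          g / bracket (absK k) ^ ((ν : ℝ) + 1) * (2 * c * bracket (absK k) ^ α) := by gcongr
      _ = _ := by rw [Real.rpow_sub hb _ α]; field_simp
  have b₂ : relMeas M R₂ ≤ ENNReal.ofReal (C₂ * (2 * mass ^ 2 * g)) := by
    have hp : ∀ (k : Fin ν → ℤ) (h : ℤ), 0 < melThr g (ν + 1) α M k h := fun k h => by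
      have := bracket_pos (absK k); have := bracket_pos (h : ℝ)
      unfold melThr; positivity
    refine h₂ M _ _ _ _ hM (by positivity) (fun a ω₁ ω₂ => by simp)
      (fun k h => by have := hp k h; positivity) fun k hk h hh => le_of_eq ?_
    have hb := bracket_pos (absK k)
    have hb' := bracket_pos (h : ℝ)
    rw [melThr, melThr, Real.rpow_sub hb τt]
    field_simp
  have b₃ : relMeas M R₃ ≤ ENNReal.ofReal (C₃ * (2 * c * γ)) := by
    refine h₃ M _ _ _ _ hM (by positivity) (fun a ω₁ ω₂ => ?_)
      (fun k _ => by have := bracket_pos (absK k); positivity) fun k hk h hh => ?_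
    · exact (abs_sgE_sub_le a).trans (hlip _ ω₁ ω₂)
    · have hb := bracket_pos (absK k)
      have := bracket_rpow_div_le_of_le hM hc1 hα0.le hα1.le hh
      rw [melThr]
      calc bracket (absK k) ^ (τt / α) * (γ / bracket (absK k) ^ τ *
            (bracket (h : ℝ) ^ α / M ^ α)) ≤ bracket (absK k) ^ (τt / α) *
            (γ / bracket (absK k) ^ τ * (2 * c * bracket (absK k) ^ α)) := by gcongr
        _ = _ := by rw [Real.rpow_sub hb τ, Real.rpow_add hb]; field_simp
  have b₀ := h₀ γ₀ M hγ₀.le hM0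
  refine (relMeas_mono hsub).trans ((relMeas_union_le _ _).trans ((add_le_add b₀
    ((relMeas_union_le _ _).trans (add_le_add b₁ ((relMeas_union_le _ _).trans
      (add_le_add b₂ b₃))))).trans ?_))
  rw [← ENNReal.ofReal_add (by positivity) (by positivity),
    ← ENNReal.ofReal_add (by positivity) (by positivity),
    ← ENNReal.ofReal_add (by positivity) (by positivity)]
  apply ENNReal.ofReal_le_ofReal
  set w := γ + γt ^ (1 / 3 : ℝ) + γ₀ with hw
  have hp : 0 ≤ γt ^ (1 / 3 : ℝ) := by positivity
  have w1 : γ₀ ≤ w := by linarith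
  have w2 : g ≤ w := by linarith
  have w3 : γ ≤ w := by linarith
  calc _ ≤ C₀ * w + (C₁ * (2 * c * w) + (C₂ * (2 * mass ^ 2 * w) + C₃ * (2 * c * w))) := by gcongr
    _ = _ := by ring

end MeasureEstimate

end FastKG

end

theorem theorem5p9 {ν : ℕ} (hν : 1 ≤ ν) (mass : ℝ) (hmass : 0 ≤ mass)
    (ρ : ℝ) (hρ : 0 < ρ) (V : (Fin ν → ℝ) → ℝ → ℝ) (hV : FastKG.IsDriving ρ V)
    (α : ℝ) (hα0 : 0 < α) (hα1 : α < 1) (s₀ : ℝ) (hs₀ : 1 / 2 < s₀)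
    (τ₀ : ℝ) (hτ₀ : (ν : ℝ) - 1 < τ₀) (τt : ℝ) (hτt : 2 * (ν : ℝ) + 3 ≤ τt)
    (τ : ℝ) (hτ : (ν : ℝ) + 1 + α + τt / α < τ) :
    ∃ C > 0, ∀ γ : ℝ, 0 < γ → ∃ Mstar > 0, ∃ K > 0,
      ∀ γ₀ γt : ℝ, 0 < γ₀ → γ₀ < 1 → γt ≤ min (γ₀ ^ (3 / 2 : ℝ)) (1 / 8) → γ < γt →
      ∀ M : ℝ, Mstar ≤ M →
        FastKG.eta0 mass ρ V α s₀ γ₀ τ₀ γ M ≤ ENNReal.ofReal (K / M ^ (1 - α)) ∧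
        ∃ lam : ℕ+ → FastKG.Freq ν → ℝ,
          (∀ j, ∃ L : NNReal, LipschitzOnWith L (lam j) (FastKG.annulus ν M)) ∧
          FastKG.relMeas M
              (FastKG.annulus ν M \ FastKG.OmegaInf ν mass γ₀ τ₀ γt τt γ τ α M lam)
            ≤ ENNReal.ofReal (C * (γ + γt ^ (1 / 3 : ℝ) + γ₀)) ∧
          ∀ ω ∈ FastKG.OmegaInf ν mass γ₀ τ₀ γt τt γ τ α M lam,
            ∃ W : (Fin ν → ℝ) → FastKG.State ≃L[ℂ] FastKG.State,
              FastKG.IsCoordChange s₀ W ∧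
              FastKG.Conjugates ω W (FastKG.magnusHam mass V ω)
                (FastKG.diagSigma3 fun j => lam j ω) ∧
              ∀ r ∈ Set.Icc 0 s₀, ∀ θ : Fin ν → ℝ,
                FastKG.OpBound r
                  ((W θ : FastKG.State →L[ℂ] FastKG.State) - ContinuousLinearMap.id ℂ FastKG.State)
                  (Real.sqrt ((FastKG.eta0 mass ρ V α s₀ γ₀ τ₀ γ M).toReal * Real.exp 1)
                    * FastKG.SigmaConst *
                    Real.exp (Real.sqrt
                      ((FastKG.eta0 mass ρ V α s₀ γ₀ τ₀ γ M).toReal * Real.exp 1)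
                      * FastKG.SigmaConst)) := by
  have hν0 : (1 : ℝ) ≤ ν := by exact_mod_cast hν
  have hτ' : 0 ≤ τ := by
    have : 0 ≤ τt / α := div_nonneg (by linarith) hα0.le
    linarith
  obtain ⟨C, hC, hmeas⟩ := FastKG.exists_relMeas_compl_OmegaInf_le hν hmass hα0 hα1 hτ₀ hτt hτ
  refine ⟨C, hC, fun γ hγ => ?_⟩
  obtain ⟨M₀, hM₀, K, hK, hred⟩ := FastKG.exists_reduction mass hρ hV hα0 hα1
    (show 0 ≤ s₀ by linarith) (show 0 ≤ τ₀ by linarith) hτ' hγ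
  refine ⟨max M₀ ((8 * (1 + mass)) ^ (1 / α)), lt_max_of_lt_left (by linarith), K, hK,
    fun γ₀ γt hγ₀ hγ₀1 hγt hγγ M hM => ?_⟩
  have hM1 : M₀ ≤ M := (le_max_left _ _).trans hM
  have hMα : 8 * (1 + mass) ≤ M ^ α := by
    have h := Real.rpow_le_rpow (by positivity) ((le_max_right _ _).trans hM) hα0.le
    rwa [← Real.rpow_mul (by positivity), one_div_mul_cancel hα0.ne', Real.rpow_one] at h
  have hγγ₀ : γ ≤ γ₀ := by
    refine hγγ.le.trans ((hγt.trans (min_le_left _ _)).trans ?_)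
    have := Real.rpow_le_rpow_of_exponent_ge hγ₀ hγ₀1.le (show (1 : ℝ) ≤ 3 / 2 by norm_num)
    rwa [Real.rpow_one] at this
  obtain ⟨heta, lam, hlip, hf, hconj⟩ := hred γ₀ M hγγ₀ hγ₀1.le hM1
  refine ⟨heta, lam, fun j => ⟨1 / 8, LipschitzOnWith.of_dist_le_mul fun x _ y _ => ?_⟩,
    hmeas γ γ₀ γt M lam hγ hγγ (hγt.trans (min_le_right _ _)) hγ₀ (hM₀.trans hM1) hMα hlip hf,
    fun ω hω => hconj ω hω.1.1 hω.2⟩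
  rw [Real.dist_eq, dist_eq_norm]
  simpa using hlip j x y
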